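/- **Setting.** Let $d\ge1$, $m>0$, and for $n\in\mathbb Z^d$ let $|n|$ be the Euclidean norm and $\langle n\rangle=(1+|n|^2)^{1/2}$. Let $0<\rho<\beta<\frac1{10}$, $\theta>0$, and let $\mathbb Z^d=\bigcup_{\alpha\in\mathcal A}\Omega_\alpha$ be a partition into non-empty blocks with $|n-n'|+\big||n|^2-|n'|^2\big|<\theta+|n|^\beta$ for $n,n'$ in one block and $|n-n'|+\big||n|^2-|n'|^2\big|>|n|^\rho$ for $n,n'$ in different blocks. Fix $n(\alpha)\in\Omega_\alpha$ for every $\alpha$, such that $|n(\alpha)|=|n(\alpha')|$ whenever $n\in\Omega_\alpha$, $-n\in\Omega_{\alpha'}$. Let $\Pi_n$ be the projection on the space frequency $n$, $\widetilde\Pi_\alpha=\sum_{n\in\Omega_\alpha}\Pi_n$, $\rho'=1+\rho/2$, and fix $K_0>0$. For $\sigma\in\mathbb R$ let $\mathcal H^\sigma_{\mathbb C}$ be the space of $u$ on $\mathbb T\times\mathbb T^d$ with $\|u\|^2_{\mathcal H^\sigma}=\sum_{j,n}(1+j^2+|n|^4)^\sigma|\hat u(j,n)|^2<\infty$ and $\hat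 u(j,n)=0$ unless $K_0^{-1}\langle n(\alpha)\rangle^2\le|j|\le K_0\langle n(\alpha)\rangle^2$ (where $n\in\Omega_\alpha$); let $\mathcal H^\sigma$ be its real-valued elements and $B_q$ the open ball of radius $q$ about $0$. Let $L_\omega=\omega^2\partial_{tt}+\Delta^2+m$. **Classes of operators.** Fix $\sigma_0>\frac d2+1$, $q>0$, $\gamma\in(0,1]$. All families below depend on $u\in B_q(\mathcal H^\sigma_{\mathbb C})$ and $(\omega,\epsilon)\in[1,2]\times[0,\gamma]$, map real functions to real functions when $u$ is real, and are $C^1$ in $(\omega,\epsilon)$, which means that $\Pi_nA\Pi_{n'}$ (in the first class) or $R$ (in the second) is $C^1$ in $(\omega,\epsilon)$ in the operator norm and that the family and its derivatives $\partial_\omega$, $\partial_\epsilon$ satisfy the following conditions, uniformly in $(\omega,\epsilon)$. * $A\in\Sigma^\chi(N,\sigma,q)$: each $u\mapsto\Pi_nA(u)\Pi_{n'}\in\mathcal L(\mathcal H^0_{\mathbb C})$ is smooth, and for all $j\ge0$ and all $M\in\frac12\mathbb N$ with $\frac{d+1}2\le M\le\sigma-\sigma_0-2N$ there is $C$ with $$\|\Pi_n(D_u^jA(u)\cdot(w_1,\dots,w_j))\Pi_{n'}\|_{\mathcal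 L(\mathcal H^0_{\mathbb C})}\le C(1+|n|+|n'|)^{2\chi}\langle n-n'\rangle^{-2M}\mathbf 1_{|n-n'|\le\frac1{10}(|n|+|n'|)}\prod_{l=1}^j\|w_l\|_{\mathcal H^{\sigma_0+2N+M}}.$$ * $R\in\mathcal R^r_\nu(N,\sigma,q)$ (with $\sigma\ge\sigma_0+2N+\frac{d+1}2$): for all $\tau\ge\sigma_0+\nu$, $u\mapsto R(u)\in\mathcal L(\mathcal H^\tau_{\mathbb C},\mathcal H^{\tau+r}_{\mathbb C})$ is smooth, and for all $j\ge0$ there is $C$ with $\|D_u^jR(u)\cdot(w_1,\dots,w_j)\|_{\mathcal L(\mathcal H^\tau_{\mathbb C},\mathcal H^{\tau+r}_{\mathbb C})}\le C\prod_l\|w_l\|_{\mathcal H^\sigma}$. **Data.** Let $\zeta>0$, $N\in\mathbb N$, $\sigma,s\in\mathbb R$ with $\sigma\ge\sigma_0+2(N+1)+\frac{d+1}2+\zeta$, $(N+1)\rho'\ge\zeta+2$, $s\ge\sigma+\zeta+2$, and let $f\in\mathcal H^{s+\zeta}$. Let $V\in\Sigma^0(0,\sigma,q)$ be self-adjoint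 for real $u$ and $\tilde R\in\mathcal R^\zeta_0(0,\sigma,q)$; these are the potential and the remainder of the equation $L_\omega u+\epsilon V(u,\omega,\epsilon)u=\epsilon\tilde R(u,\omega,\epsilon)u+\epsilon f$. Let $Q=\sum_{j=0}^NQ_j$ and $V_{\rm D}=\sum_{j=0}^NV_{{\rm D},j}$ with $Q_j\in\Sigma^{-j\rho'}(j,\sigma,q)\cap\Sigma^{-(j+1)\rho'}(j,\sigma,q)$, with $V_{{\rm D},j}\in\Sigma^{-j\rho'}(j,\sigma,q)$ block diagonal ($\widetilde\Pi_\alpha V_{{\rm D},j}\widetilde\Pi_{\alpha'}=0$ for $\alpha\ne\alpha'$) and self-adjoint for real $u$, and let $R_1\in\mathcal R^\zeta_2(N+1,\sigma,q)$, such that for all $u\in B_q(\mathcal H^\sigma)$ $$({\rm Id}+\epsilon Q)^*(L_\omega+\epsilon V)({\rm Id}+\epsilon Q)=L_\omega+\epsilon V_{\rm D}-\epsilon R_1 .$$ Let $\lambda^\alpha_l(\omega;u,\epsilon)$ be the eigenvalues of $A_\alpha(\omega;u,\epsilon)=\widetilde\Pi_\alpha(L_\omega+\epsilon V_{\rm D}(u,\omega,\epsilon))\widetilde\Pi_\alpha$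 on the finite-dimensional range of $\widetilde\Pi_\alpha$ in $\mathcal H^0_{\mathbb C}$, and let $\tilde S_k=\sum_{\langle n(\alpha)\rangle<2^{k+1}}\widetilde\Pi_\alpha$. **Proposition.** There are $\gamma_0\in(0,\gamma]$ and $C_0>0$ such that * for $\epsilon\in(0,\gamma_0]$, $\omega\in[1,2]$, $u,u'\in B_q(\mathcal H^\sigma)$, every eigenvalue of $A_\alpha(\omega;u,\epsilon)$ is within $C_0\epsilon\|u-u'\|_{\mathcal H^\sigma}$ of an eigenvalue of $A_\alpha(\omega;u',\epsilon)$; * for $\epsilon\in(0,\gamma_0]$ and every curve $\omega\mapsto u(\omega)\in\mathcal H^\sigma$ on $[1,2]$, continuous in $\mathcal H^\sigma$ and $C^1$ in $\mathcal H^{\sigma-\zeta-2}$, with $\sup\|u\|_{\mathcal H^\sigma}+\sup\|\partial_\omega u\|_{\mathcal H^{\sigma-\zeta-2}}<q$, every $C^1$ branch $\lambda(\omega)$ of eigenvalues of $A_\alpha(\omega;u(\omega),\epsilon)$ satisfies $-4C_0\langle n(\alpha)\rangle^4\le\lambda'(\omega)\le-2C_0^{-1}\langle n(\alpha)\rangle^4$;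 and there are $\delta_0\in(0,\sqrt{\gamma_0}]$ and $C_1,B_1,B_2>0$ such that for every $\delta\in(0,\delta_0]$ there is a sequence $(G_k,\mathcal O_k,\psi_k,u_k,w_k)_{k\ge0}$ with the following properties for all $k\ge0$, where $u_{-1}=w_{-1}=0$ and where $\mathcal O_{k,\epsilon}$ is the $\epsilon$-section of $\mathcal O_k$. 1. $\mathcal O_k$ is the set of $(\omega,\epsilon)\in[1,2]\times[0,\delta^2]$ for which some $\alpha$ with $2^k\le\langle n(\alpha)\rangle<2^{k+1}$ and some $l$ satisfy $|\lambda^\alpha_l(\omega;u_{k-1},\epsilon)|<2\delta2^{-2k\zeta}$; and $G_k=\{(\omega,\epsilon)\in[1,2]\times[0,\delta^2]:\ {\rm dist}(\omega,\mathbb R\setminus\mathcal O_{k,\epsilon})\ge\frac{\delta}{128C_0}2^{-2k(\zeta+2)}\}$. 2. $\psi_k:[1,2]\times[0,\delta^2]\to[0,1]$ is supported in $\mathcal O_k$ (for each $\epsilon$, the closed support in $\omega$ lies in $\mathcal O_{k,\epsilon}$), equals $1$ on $G_k$, is $C^1$ in $\omega$, and $|\partial_\omega\psi_k|\le\frac{C_1}\delta2^{2k(\zeta+2)}$.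 3. For each $\epsilon\in[0,\delta^2]$, $w_k$ and $u_k$ are real valued, continuous in $\omega\in[1,2]$ with values in $\mathcal H^s$ and $C^1$ in $\omega$ with values in $\mathcal H^{s-\zeta-2}$; $\|u_k\|_{\mathcal H^\sigma}<q$; and for all $\omega\in[1,2]$, $\epsilon\in[0,\delta^2]$ $$\|w_k\|_{\mathcal H^s}+\delta\|\partial_\omega w_k\|_{\mathcal H^{s-\zeta-2}}\le B_1\frac\epsilon\delta,\qquad\|u_k\|_{\mathcal H^s}+\delta\|\partial_\omega u_k\|_{\mathcal H^{s-\zeta-2}}\le B_2\frac\epsilon\delta,$$ $$\|w_k-w_{k-1}\|_{\mathcal H^\sigma}\le B_2\frac\epsilon\delta2^{-2k\zeta},\qquad\|u_k-u_{k-1}\|_{\mathcal H^\sigma}\le2B_2\frac\epsilon\delta2^{-2k\zeta}.$$ 4. $u_k=({\rm Id}+\epsilon Q(u_{k-1},\omega,\epsilon))w_k$ on $[1,2]\times[0,\delta^2]$. 5. For all $(\omega,\epsilon)\in[1,2]\times[0,\delta^2]\setminus\bigcup_{k'=0}^k\mathcal O_{k'}$, $$(L_\omega+\epsilon V_{\rm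 D}(u_{k-1},\omega,\epsilon))w_k=\epsilon\tilde S_k({\rm Id}+\epsilon Q(u_{k-1},\omega,\epsilon))^*\tilde R(u_{k-1},\omega,\epsilon)u_{k-1}+\epsilon\tilde S_kR_1(u_{k-1},\omega,\epsilon)w_{k-1}+\epsilon\tilde S_k({\rm Id}+\epsilon Q(u_{k-1},\omega,\epsilon))^*f .$$ -/

import Mathlib

open Set Filter Topology

noncomputable section

namespace Beam

/-! Lattice points and the block partition -/

/-- Euclidean length of a lattice point. -/
def len {d : ℕ} (n : Fin d → ℤ) : ℝ := Real.sqrt (∑ i, (n i : ℝ) ^ 2)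

/-- The Japanese bracket of a lattice point. -/
def jap {d : ℕ} (n : Fin d → ℤ) : ℝ := Real.sqrt (1 + len n ^ 2)

/-- A partition of the lattice into blocks `{n | cls n = α}` (one for every index `α`), with a
chosen point `center α` in every block; points of one block are close, points of different blocks
are separated. The last field says that the size of the chosen point is the same for the blocks of
`n` and of `-n`, so that the spectral cut-offs below map real functions to real functions. -/
structure BlockPartition (d : ℕ) (ι : Type*) (β ρ θ : ℝ) where
  cls : (Fin d → ℤ) → ι
  center : ι → (Fin d → ℤ)
  cls_center : ∀ α, cls (center α) = α
  near : ∀ n n', cls n = cls n' →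
    len (n - n') + |len n ^ 2 - len n' ^ 2| < θ + len n ^ β
  far : ∀ n n', cls n ≠ cls n' →
    len n ^ ρ < len (n - n') + |len n ^ 2 - len n' ^ 2|
  even : ∀ n, len (center (cls (-n))) = len (center (cls n))

variable {d : ℕ} {ι : Type*} {β ρ θ : ℝ}

/-- The bracket of the chosen point of the block that contains `n`. -/
def BlockPartition.size (P : BlockPartition d ι β ρ θ) (n : Fin d → ℤ) : ℝ :=
  jap (P.center (P.cls n))

/-- The space-time modes `(j, n)` whose Fourier coefficient may be non-zero. -/
def ActiveMode (P : BlockPartition d ι β ρ θ) (K₀ : ℝ) : Type :=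
  {p : ℤ × (Fin d → ℤ) // K₀⁻¹ * P.size p.2 ^ 2 ≤ |(p.1 : ℝ)| ∧ |(p.1 : ℝ)| ≤ K₀ * P.size p.2 ^ 2}

theorem BlockPartition.size_neg (P : BlockPartition d ι β ρ θ) (n : Fin d → ℤ) :
    P.size (-n) = P.size n := by
  simp [BlockPartition.size, jap, P.even n]

variable {P : BlockPartition d ι β ρ θ} {K₀ : ℝ}

namespace ActiveMode

/-- Time frequency. -/
def time (p : ActiveMode P K₀) : ℤ := p.1.1

/-- Space frequency. -/
def space (p : ActiveMode P K₀) : Fin d → ℤ := p.1.2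

/-- The index of the block of a mode. -/
def block (p : ActiveMode P K₀) : ι := P.cls p.space

/-- The Sobolev weight of a mode. -/
def weight (p : ActiveMode P K₀) : ℝ := 1 + (p.time : ℝ) ^ 2 + len p.space ^ 4

theorem one_le_weight (p : ActiveMode P K₀) : 1 ≤ p.weight := by
  have h1 : 0 ≤ (p.time : ℝ) ^ 2 := by positivity
  have h2 : 0 ≤ len p.space ^ 4 := by positivity
  unfold weight
  linarith

instance : Neg (ActiveMode P K₀) :=
  ⟨fun p => ⟨(-p.1.1, -p.1.2), by
    have h := p.2
    simpa [BlockPartition.size_neg] using h⟩⟩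

end ActiveMode

/-! Sobolev spaces -/

/-- The sequences of Fourier coefficients with finite Sobolev norm. -/
def HsSubmodule (P : BlockPartition d ι β ρ θ) (K₀ σ : ℝ) :
    Submodule ℂ (ActiveMode P K₀ → ℂ) where
  carrier := {u | Summable fun p => p.weight ^ σ * ‖u p‖ ^ 2}
  zero_mem' := by simp
  add_mem' := by
    intro u v hu hv
    refine Summable.of_nonneg_of_le (fun p => ?_) (fun p => ?_) ((hu.add hv).mul_left 2)
    · have := p.one_le_weight
      positivity
    · have hw : 0 ≤ p.weight ^ σ := Real.rpow_nonneg (by linarith [p.one_le_weight]) _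
      have h1 : ‖u p + v p‖ ≤ ‖u p‖ + ‖v p‖ := norm_add_le _ _
      have h2 : ‖u p + v p‖ ^ 2 ≤ 2 * (‖u p‖ ^ 2 + ‖v p‖ ^ 2) := by
        nlinarith [norm_nonneg (u p + v p), norm_nonneg (u p), norm_nonneg (v p),
          sq_nonneg (‖u p‖ - ‖v p‖)]
      calc p.weight ^ σ * ‖u p + v p‖ ^ 2
          ≤ p.weight ^ σ * (2 * (‖u p‖ ^ 2 + ‖v p‖ ^ 2)) := mul_le_mul_of_nonneg_left h2 hw
        _ = 2 * (p.weight ^ σ * ‖u p‖ ^ 2 + p.weight ^ σ * ‖v p‖ ^ 2) := by ring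
  smul_mem' := by
    intro c u hu
    have h : (fun p : ActiveMode P K₀ => p.weight ^ σ * ‖(c • u) p‖ ^ 2) =
        fun p => ‖c‖ ^ 2 * (p.weight ^ σ * ‖u p‖ ^ 2) := by
      funext p
      simp only [Pi.smul_apply, smul_eq_mul, norm_mul]
      ring
    show Summable _
    rw [h]
    exact Summable.mul_left _ hu

/-- The space of complex functions of Sobolev order `σ` with Fourier coefficients supported by the
active modes; a function is identified with its Fourier coefficients on the active modes. -/
def Hs (P : BlockPartition d ι β ρ θ) (K₀ σ : ℝ) : Type := ↥(HsSubmodule P K₀ σ)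

variable {σ s s' : ℝ}

instance : AddCommGroup (Hs P K₀ σ) := inferInstanceAs (AddCommGroup ↥(HsSubmodule P K₀ σ))

instance : Module ℂ (Hs P K₀ σ) := inferInstanceAs (Module ℂ ↥(HsSubmodule P K₀ σ))

/-- Fourier coefficients. -/
def Hs.coeff (u : Hs P K₀ σ) : ActiveMode P K₀ → ℂ := u.1

/-- The Sobolev norm of order `τ` of a coefficient sequence. -/
def sobNorm (τ : ℝ) (u : ActiveMode P K₀ → ℂ) : ℝ :=
  Real.sqrt (∑' p, p.weight ^ τ * ‖u p‖ ^ 2)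

/-- The weighted coefficients, an element of `ℓ²`; its norm is the Sobolev norm. -/
def Hs.toL2 : Hs P K₀ σ →ₗ[ℂ] lp (fun _ : ActiveMode P K₀ => ℂ) 2 where
  toFun u := ⟨fun p => ((p.weight ^ (σ / 2) : ℝ) : ℂ) * u.coeff p, by
    have hu : Summable fun p => p.weight ^ σ * ‖u.coeff p‖ ^ 2 := u.2
    refine memℓp_gen ?_
    refine hu.congr (fun p => ?_)
    have hw : 0 < p.weight := by linarith [p.one_le_weight]
    have h2 : p.weight ^ σ = (p.weight ^ (σ / 2)) ^ 2 := by
      rw [← Real.rpow_natCast, ← Real.rpow_mul hw.le]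
      norm_num
    rw [norm_mul, Complex.norm_real, Real.norm_eq_abs, abs_of_pos (Real.rpow_pos_of_pos hw _), h2]
    norm_num
    ring⟩
  map_add' u v := by
    ext p
    exact mul_add _ _ _
  map_smul' c u := by
    ext p
    exact mul_left_comm _ _ _

theorem Hs.toL2_injective : Function.Injective (Hs.toL2 : Hs P K₀ σ →ₗ[ℂ] _) := by
  intro u v h
  apply Subtype.ext
  funext p
  have hp : ((p.weight ^ (σ / 2) : ℝ) : ℂ) * u.coeff p =
      ((p.weight ^ (σ / 2) : ℝ) : ℂ) * v.coeff p := congrFun (congrArg Subtype.val h) p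
  have hw : 0 < p.weight := by linarith [p.one_le_weight]
  have hne : ((p.weight ^ (σ / 2) : ℝ) : ℂ) ≠ 0 := by
    exact_mod_cast (Real.rpow_pos_of_pos hw _).ne'
  exact mul_left_cancel₀ hne hp

instance : NormedAddCommGroup (Hs P K₀ σ) :=
  NormedAddCommGroup.induced _ _ (Hs.toL2 : Hs P K₀ σ →ₗ[ℂ] _) Hs.toL2_injective

instance : NormedSpace ℂ (Hs P K₀ σ) :=
  NormedSpace.induced ℂ (Hs P K₀ σ) _ (Hs.toL2 : Hs P K₀ σ →ₗ[ℂ] _)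

theorem Hs.norm_eq (u : Hs P K₀ σ) : ‖u‖ = sobNorm σ u.coeff := by
  have h0 : ‖u‖ = ‖Hs.toL2 u‖ := rfl
  have h1 : ‖Hs.toL2 u‖ ^ 2 = ∑' p, p.weight ^ σ * ‖u.coeff p‖ ^ 2 := by
    have h := lp.norm_rpow_eq_tsum (p := 2) (by norm_num) (Hs.toL2 u)
    norm_num at h
    rw [h]
    refine tsum_congr (fun p => ?_)
    have hw : 0 < p.weight := by linarith [p.one_le_weight]
    have h2 : p.weight ^ σ = (p.weight ^ (σ / 2)) ^ 2 := by
      rw [← Real.rpow_natCast, ← Real.rpow_mul hw.le]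
      norm_num
    have h3 : ‖(Hs.toL2 u) p‖ = p.weight ^ (σ / 2) * ‖u.coeff p‖ := by
      show ‖((p.weight ^ (σ / 2) : ℝ) : ℂ) * u.coeff p‖ = _
      rw [norm_mul, Complex.norm_real, Real.norm_eq_abs,
        abs_of_pos (Real.rpow_pos_of_pos hw _)]
    rw [h3, h2]
    ring
  rw [h0, sobNorm, ← h1, Real.sqrt_sq (norm_nonneg _)]

/-- The inclusion of a Sobolev space in one of lower order. -/
def Hs.incl (h : s' ≤ s) (u : Hs P K₀ s) : Hs P K₀ s' :=
  ⟨u.coeff, by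
    have hu : Summable fun p => p.weight ^ s * ‖u.coeff p‖ ^ 2 := u.2
    refine Summable.of_nonneg_of_le (fun p => ?_) (fun p => ?_) hu
    · have := p.one_le_weight
      positivity
    · exact mul_le_mul_of_nonneg_right
        (Real.rpow_le_rpow_of_exponent_le p.one_le_weight h) (by positivity)⟩

/-- The function with these coefficients is real valued. -/
def IsRealSeq (u : ActiveMode P K₀ → ℂ) : Prop := ∀ p, u (-p) = (starRingEnd ℂ) (u p)

/-- Real valued elements of the Sobolev space. -/
def Hs.IsReal (u : Hs P K₀ σ) : Prop := IsRealSeq u.coeff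

/-! Operators -/

/-- An operator, given by its matrix in the Fourier basis: `a p p'` is the `p`-th coefficient of
the image of the `p'`-th exponential. -/
abbrev FOp (P : BlockPartition d ι β ρ θ) (K₀ : ℝ) : Type :=
  ActiveMode P K₀ → ActiveMode P K₀ → ℂ

namespace FOp

/-- The action of an operator on a function. -/
def act (a : FOp P K₀) (w : ActiveMode P K₀ → ℂ) : ActiveMode P K₀ → ℂ :=
  fun p => ∑' p', a p p' * w p'

/-- The continuous linear map `T` is given by the operator `a`. -/
def Rep (a : FOp P K₀) (T : Hs P K₀ s →L[ℂ] Hs P K₀ s') : Prop :=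
  ∀ w p, HasSum (fun p' => a p p' * w.coeff p') ((T w).coeff p)

/-- The operator is bounded from order `s` to order `s'`. -/
def Bdd (a : FOp P K₀) (s s' : ℝ) : Prop := ∃ T : Hs P K₀ s →L[ℂ] Hs P K₀ s', a.Rep T

open Classical in
/-- A bounded operator as a continuous linear map from order `s` to order `s'`. -/
def clm (a : FOp P K₀) (s s' : ℝ) : Hs P K₀ s →L[ℂ] Hs P K₀ s' :=
  if h : a.Bdd s s' then h.choose else 0

/-- The adjoint for the complex `L²` scalar product. -/
def adj (a : FOp P K₀) : FOp P K₀ := fun p p' => (starRingEnd ℂ) (a p' p)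

open Classical in
/-- The operator between the spectral projectors on the space frequencies `n` and `n'`. -/
def between (a : FOp P K₀) (n n' : Fin d → ℤ) : FOp P K₀ :=
  fun p p' => if p.space = n ∧ p'.space = n' then a p p' else 0

/-- The operator maps real functions to real functions. -/
def IsReal (a : FOp P K₀) : Prop := ∀ p p', a (-p) (-p') = (starRingEnd ℂ) (a p p')

/-- The function `(Id + ε a) w`. -/
def idAdd (ε : ℝ) (a : FOp P K₀) (w : ActiveMode P K₀ → ℂ) : ActiveMode P K₀ → ℂ :=
  fun p => w p + (ε : ℂ) * a.act w p

end FOp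

/-- The eigenvalue of `ω² ∂_tt + Δ² + m` at a mode. -/
def waveSymbol (m ω : ℝ) (p : ActiveMode P K₀) : ℝ :=
  -ω ^ 2 * (p.time : ℝ) ^ 2 + len p.space ^ 4 + m

/-- The function `(L_ω + ε a) w`, where `L_ω = ω² ∂_tt + Δ² + m`. -/
def waveAct (m ω ε : ℝ) (a : FOp P K₀) (w : ActiveMode P K₀ → ℂ) : ActiveMode P K₀ → ℂ :=
  fun p => (waveSymbol m ω p : ℂ) * w p + (ε : ℂ) * a.act w p

/-! Classes of operators depending on a function `u` and on `z = (ω, ε)` -/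

/-- Families of operators. -/
abbrev Fam (P : BlockPartition d ι β ρ θ) (K₀ σ : ℝ) : Type := Hs P K₀ σ → ℝ × ℝ → FOp P K₀

/-- The domain of the parameters `(ω, ε)`. -/
def paramBox (γ : ℝ) : Set (ℝ × ℝ) := Icc 1 2 ×ˢ Icc 0 γ

/-- Partial derivative in `ω`. -/
def Fam.dOmega (A : Fam P K₀ σ) : Fam P K₀ σ :=
  fun u z p p' => derivWithin (fun x => A u (x, z.2) p p') (Icc 1 2) z.1

/-- Partial derivative in `ε`. -/
def Fam.dEps (γ : ℝ) (A : Fam P K₀ σ) : Fam P K₀ σ :=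
  fun u z p p' => derivWithin (fun x => A u (z.1, x) p p') (Icc 0 γ) z.2

open Classical in
/-- The symbol-type bounds of order `χ` on the ball of radius `q`, uniform in `(ω, ε)`: smoothness
in `u` of all the pieces between two space frequencies, decay away from the diagonal (`k = 2 M`),
and support near the diagonal, for all the derivatives in `u`. -/
structure SigmaBounds (σ₀ χ : ℝ) (N : ℕ) (q γ : ℝ) (A : Fam P K₀ σ) : Prop where
  bdd : ∀ z ∈ paramBox γ, ∀ u ∈ Metric.ball (0 : Hs P K₀ σ) q, ∀ n n',
    ((A u z).between n n').Bdd 0 0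
  smooth : ∀ z ∈ paramBox γ, ∀ n n',
    ContDiffOn ℝ ((⊤ : ℕ∞) : WithTop ℕ∞) (fun u => ((A u z).between n n').clm 0 0) (Metric.ball (0 : Hs P K₀ σ) q)
  bound : ∀ k j : ℕ, ((d : ℝ) + 1) / 2 ≤ (k : ℝ) / 2 → (k : ℝ) / 2 ≤ σ - σ₀ - 2 * N →
    ∃ C > 0, ∀ z ∈ paramBox γ, ∀ u ∈ Metric.ball (0 : Hs P K₀ σ) q,
      ∀ (w : Fin j → Hs P K₀ σ) (n n' : Fin d → ℤ),
      ‖iteratedFDeriv ℝ j (fun v => ((A v z).between n n').clm 0 0) u w‖ ≤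
        C * (1 + len n + len n') ^ (2 * χ) * jap (n - n') ^ (-(k : ℝ)) *
          (if len (n - n') ≤ (len n + len n') / 10 then 1 else 0) *
          ∏ l, sobNorm (σ₀ + 2 * N + (k : ℝ) / 2) (w l).coeff

/-- The class `Σ^χ(N, σ, q)` of families which are `C¹` in `(ω, ε)` and preserve reality. -/
structure MemSigma (σ₀ χ : ℝ) (N : ℕ) (q γ : ℝ) (A : Fam P K₀ σ) : Prop where
  bounds : SigmaBounds σ₀ χ N q γ A
  c1 : ∀ u ∈ Metric.ball (0 : Hs P K₀ σ) q, ∀ n n',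
    ContDiffOn ℝ 1 (fun z => ((A u z).between n n').clm 0 0) (paramBox γ)
  bounds_dOmega : SigmaBounds σ₀ χ N q γ A.dOmega
  bounds_dEps : SigmaBounds σ₀ χ N q γ (A.dEps γ)
  real : ∀ z ∈ paramBox γ, ∀ u ∈ Metric.ball (0 : Hs P K₀ σ) q, u.IsReal → (A u z).IsReal

/-- The block diagonal families in `Σ^χ(N, σ, q)`. -/
structure MemSigmaD (σ₀ χ : ℝ) (N : ℕ) (q γ : ℝ) (A : Fam P K₀ σ) : Prop where
  mem : MemSigma σ₀ χ N q γ A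
  diag : ∀ z ∈ paramBox γ, ∀ u ∈ Metric.ball (0 : Hs P K₀ σ) q, ∀ p p',
    p.block ≠ p'.block → A u z p p' = 0

/-- The families in `Σ^χ(N, σ, q)` which gain `ρ' = 1 + ρ / 2` orders more. -/
def MemL (σ₀ χ : ℝ) (N : ℕ) (q γ : ℝ) (A : Fam P K₀ σ) : Prop :=
  MemSigma σ₀ χ N q γ A ∧ MemSigma σ₀ (χ - (1 + ρ / 2)) N q γ A

/-- The bounds of a family of smoothing operators, which gain `r` orders on the Sobolev spaces of
order at least `σ₀ + ν`, uniform in `(ω, ε)`. -/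
structure SmoothingBounds (σ₀ r : ℝ) (ν : ℕ) (q γ : ℝ) (R : Fam P K₀ σ) : Prop where
  bdd : ∀ τ, σ₀ + ν ≤ τ → ∀ z ∈ paramBox γ, ∀ u ∈ Metric.ball (0 : Hs P K₀ σ) q,
    (R u z).Bdd τ (τ + r)
  smooth : ∀ τ, σ₀ + ν ≤ τ → ∀ z ∈ paramBox γ,
    ContDiffOn ℝ ((⊤ : ℕ∞) : WithTop ℕ∞) (fun u => (R u z).clm τ (τ + r)) (Metric.ball (0 : Hs P K₀ σ) q)
  bound : ∀ τ, σ₀ + ν ≤ τ → ∀ j : ℕ, ∃ C > 0, ∀ z ∈ paramBox γ,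
    ∀ u ∈ Metric.ball (0 : Hs P K₀ σ) q, ∀ w : Fin j → Hs P K₀ σ,
      ‖iteratedFDeriv ℝ j (fun v => (R v z).clm τ (τ + r)) u w‖ ≤ C * ∏ l, ‖w l‖

/-- The class `R^r_ν(N, σ, q)` of smoothing families which are `C¹` in `(ω, ε)` and preserve
reality; `N` enters only through the lower bound on `σ`. -/
structure MemR (σ₀ r : ℝ) (ν N : ℕ) (q γ : ℝ) (R : Fam P K₀ σ) : Prop where
  index : σ₀ + 2 * N + ((d : ℝ) + 1) / 2 ≤ σ
  bounds : SmoothingBounds σ₀ r ν q γ R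
  c1 : ∀ τ, σ₀ + ν ≤ τ → ∀ u ∈ Metric.ball (0 : Hs P K₀ σ) q,
    ContDiffOn ℝ 1 (fun z => (R u z).clm τ (τ + r)) (paramBox γ)
  bounds_dOmega : SmoothingBounds σ₀ r ν q γ R.dOmega
  bounds_dEps : SmoothingBounds σ₀ r ν q γ (R.dEps γ)
  real : ∀ z ∈ paramBox γ, ∀ u ∈ Metric.ball (0 : Hs P K₀ σ) q, u.IsReal → (R u z).IsReal

/-- The family is self-adjoint at real functions. -/
def Fam.SelfAdj (q γ : ℝ) (A : Fam P K₀ σ) : Prop :=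
  ∀ z ∈ paramBox γ, ∀ u ∈ Metric.ball (0 : Hs P K₀ σ) q, u.IsReal → (A u z).adj = A u z

/-- The sum of the families with index `0, …, N`. -/
def Fam.total (N : ℕ) (A : ℕ → Fam P K₀ σ) : Fam P K₀ σ :=
  fun u z => ∑ j ∈ Finset.range (N + 1), A j u z

/-- `Q = ∑ Q_j`, `V_D = ∑ V_{D,j}` and `R₁` diagonalize `L_ω + ε V` up to a smoothing error:
`(Id + ε Q)^* (L_ω + ε V) (Id + ε Q) = L_ω + ε V_D - ε R₁`. -/
structure IsDiagonalization (m σ₀ r : ℝ) (N : ℕ) (q γ : ℝ) (V : Fam P K₀ σ)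
    (Q VD : ℕ → Fam P K₀ σ) (R₁ : Fam P K₀ σ) : Prop where
  memQ : ∀ j ≤ N, MemL σ₀ (-(j : ℝ) * (1 + ρ / 2)) j q γ (Q j)
  memVD : ∀ j ≤ N, MemSigmaD σ₀ (-(j : ℝ) * (1 + ρ / 2)) j q γ (VD j)
  selfAdjVD : ∀ j ≤ N, (VD j).SelfAdj q γ
  memR : MemR σ₀ r 2 (N + 1) q γ R₁
  conj : ∀ z ∈ paramBox γ, ∀ u ∈ Metric.ball (0 : Hs P K₀ σ) q, u.IsReal →
    ∀ τ, σ₀ + 2 ≤ τ → ∀ w : Hs P K₀ τ,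
      FOp.idAdd z.2 (Fam.total N Q u z).adj
          (waveAct m z.1 z.2 (V u z) (FOp.idAdd z.2 (Fam.total N Q u z) w.coeff)) =
        fun p => waveAct m z.1 z.2 (Fam.total N VD u z) w.coeff p -
          (z.2 : ℂ) * (R₁ u z).act w.coeff p

/-! Eigenvalues of the blocks -/

/-- `μ` is an eigenvalue of the operator induced by `L_ω + ε V_D(u, ω, ε)` on the (finite
dimensional) range of the spectral projector on the block `α`. -/
def IsEig (m : ℝ) (VD : Fam P K₀ σ) (α : ι) (ω : ℝ) (u : Hs P K₀ σ) (ε μ : ℝ) : Prop :=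
  ∃ v : Hs P K₀ 0, v ≠ 0 ∧ (∀ p, p.block ≠ α → v.coeff p = 0) ∧
    ∀ p, p.block = α → waveAct m ω ε (VD u (ω, ε)) v.coeff p = (μ : ℂ) * v.coeff p

/-- On `[1, 2]` the curve `v` is continuous in order `s` and it has the continuous derivative `v'`
in the lower order `s'`. -/
def HasC1Deriv (h : s' ≤ s) (v : ℝ → Hs P K₀ s) (v' : ℝ → Hs P K₀ s') : Prop :=
  ContinuousOn v (Icc 1 2) ∧ ContinuousOn v' (Icc 1 2) ∧
    ∀ ω ∈ Icc (1 : ℝ) 2, HasDerivWithinAt (fun x => Hs.incl h (v x)) (v' ω) (Icc 1 2) ω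

theorem index_drop {ζ σ : ℝ} (hζ : 0 < ζ) : σ - ζ - 2 ≤ σ := by linarith

theorem index_base {ζ σ s : ℝ} (hζ : 0 < ζ) (hs : σ + ζ + 2 ≤ s) : σ ≤ s := by linarith

/-- The constant `C₀` controls the eigenvalues: they are Lipschitz in `u`, and the derivative in
`ω` of every `C¹` branch of eigenvalues along a curve `v` with
`sup ‖v‖ + sup ‖v'‖ < q` lies between `-4 C₀ ⟨n(α)⟩⁴` and `-2 C₀⁻¹ ⟨n(α)⟩⁴`. -/
structure EigenvalueConstant (m q γ₀ C₀ : ℝ) {ζ : ℝ} (hζ : 0 < ζ) (VD : Fam P K₀ σ) : Prop where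
  lipschitz : ∀ (α : ι), ∀ ε ∈ Ioc 0 γ₀, ∀ ω ∈ Icc (1 : ℝ) 2, ∀ u v : Hs P K₀ σ,
    u.IsReal → v.IsReal → ‖u‖ < q → ‖v‖ < q → ∀ μ, IsEig m VD α ω u ε μ →
      ∃ μ', IsEig m VD α ω v ε μ' ∧ |μ - μ'| ≤ C₀ * ε * ‖u - v‖
  deriv : ∀ (α : ι), ∀ ε ∈ Ioc 0 γ₀, ∀ (v : ℝ → Hs P K₀ σ) (v' : ℝ → Hs P K₀ (σ - ζ - 2)),
    (∀ ω ∈ Icc (1 : ℝ) 2, (v ω).IsReal) → HasC1Deriv (index_drop hζ) v v' →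
    (∃ a b : ℝ, a + b < q ∧ ∀ ω ∈ Icc (1 : ℝ) 2, ‖v ω‖ ≤ a ∧ ‖v' ω‖ ≤ b) →
    ∀ lam : ℝ → ℝ, ContDiffOn ℝ 1 lam (Icc 1 2) →
      (∀ ω ∈ Icc (1 : ℝ) 2, IsEig m VD α ω (v ω) ε (lam ω)) →
      ∀ ω ∈ Icc (1 : ℝ) 2,
        -4 * C₀ * jap (P.center α) ^ 4 ≤ derivWithin lam (Icc 1 2) ω ∧
          derivWithin lam (Icc 1 2) ω ≤ -2 * C₀⁻¹ * jap (P.center α) ^ 4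

/-! The iterative scheme -/

/-- The previous term of a sequence, with the convention that the term of index `-1` is `0`. -/
def prev {X : Type*} [Zero X] (x : ℕ → X) : ℕ → X
  | 0 => 0
  | k + 1 => x k

/-- The resonant parameters at step `k` for the function `u = u_{k-1}`. -/
def resonantSet (m ζ δ : ℝ) (VD : Fam P K₀ σ) (k : ℕ) (u : ℝ → ℝ → Hs P K₀ σ) : Set (ℝ × ℝ) :=
  {z | z.1 ∈ Icc (1 : ℝ) 2 ∧ z.2 ∈ Icc (0 : ℝ) (δ ^ 2) ∧
    ∃ α : ι, 2 ^ k ≤ jap (P.center α) ∧ jap (P.center α) < 2 ^ (k + 1) ∧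
      ∃ μ : ℝ, IsEig m VD α z.1 (u z.1 z.2) z.2 μ ∧ |μ| < 2 * δ * (2 : ℝ) ^ (-2 * k * ζ)}

/-- The part of the set `O` which is far, in the variable `ω`, from the complement of `O`. -/
def innerSet (ζ δ C₀ : ℝ) (k : ℕ) (O : Set (ℝ × ℝ)) : Set (ℝ × ℝ) :=
  {z | z.1 ∈ Icc (1 : ℝ) 2 ∧ z.2 ∈ Icc (0 : ℝ) (δ ^ 2) ∧
    δ / (128 * C₀) * (2 : ℝ) ^ (-2 * k * (ζ + 2)) ≤ Metric.infDist z.1 {x | (x, z.2) ∈ O}ᶜ}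

open Classical in
/-- The spectral cut-off to the blocks with `⟨n(α)⟩ < 2 ^ (k + 1)`. -/
def lowBlocks (k : ℕ) (w : ActiveMode P K₀ → ℂ) : ActiveMode P K₀ → ℂ :=
  fun p => if P.size p.space < 2 ^ (k + 1) then w p else 0

end Beam

end

open Beam

open Set Filter Topology

noncomputable section

namespace Beam

variable {d : ℕ} {ι : Type*} {β ρ θ : ℝ} {P : BlockPartition d ι β ρ θ} {K₀ : ℝ} {σ s s' : ℝ}

/-! Truncated Sobolev norms -/

/-! Why the theorem is true. For fixed `ε` the function `w` must solve a system whose left side `L_ω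
+ ε V_D` is block diagonal and Hermitian, so on a union of blocks its inverse is as large as the
reciprocal of the smallest eigenvalue in modulus (`exists_isEig_near`, `lowerBdd_of_isEig`). The
modes split into finite dyadic shells, unions of blocks on which the Sobolev weight is comparable to
`2 ^ (4 κ)`. Outside the resonant set of step `κ` the eigenvalues on shell `κ` are at least `2 δ 2 ^
(-2 κ ζ)`, so inversion loses `ζ` orders and a factor `δ`. The remainders in the right hand side
gain exactly `ζ` orders. Hence nothing is lost at each step, and a Picard iteration converges
without any Newton scheme.

On each shell `κ ≤ k` the new `w` is the cut-off `1 - ψ_κ` times the exact solution of the finite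
linear system with coefficients frozen at the previous `u` (`shellInv`, `CutSol`). The cut-off of
shell `κ` is fixed once and for all by the function known at step `κ`. Its use at later steps is
legitimate because the lower bound survives (`Scheme.lower`): moving `ω` within the layer of width
`gap` costs a quarter of the small divisor, and replacing the function of step `κ` by the current
one costs another quarter, since the increments sum to `O((ε / δ) 2 ^ (-2 κ ζ))` and enter with a
factor `ε`.

Three estimates close the induction. In order `s`, the induction bounds are below `1` because `ε / δ
≤ δ`, so the bound of the new `w` does not depend on them. Between two values of `ω`, two inverses
and the variation of `ω² ∂_tt`, or one inverse and the variation of the cut-off, cost `2 ζ + 2`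
orders in all; starting from a source of order `s + ζ` this leaves a Lipschitz bound in order `s - ζ
- 2` (`CutSol.pnorm_sub_le`, `Scheme.lipW_succ`). The increments in order `σ` consist of the new
shell, small because the order `s` exceeds `σ + ζ` (`exists_tail_le`), and of the old shells, where
the cut-offs agree and the map contracts with a factor `ε / δ` (`Scheme.low_succ`). All iterates are
trigonometric polynomials, so they are `C¹` in every space and their derivative is bounded by the
Lipschitz constant.

For the eigenvalues, an eigenvector for one function is an approximate eigenvector for another,
which gives the Lipschitz dependence. The derivative of a branch follows from a Feynman–Hellmann
computation with limits of normalized eigenvectors (`BlockFam.abs_deriv_add_le`): the main term is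
`-2 ω` times an average of the squared time frequencies, comparable to `⟨n(α)⟩⁴` by the support
condition, and `V_D`, only Lipschitz along the curve, contributes `O(ε)`. -/

theorem ActiveMode.weight_pos (p : ActiveMode P K₀) : 0 < p.weight := by
  linarith [p.one_le_weight]

/-- The Sobolev norm of order `τ` of the part of a sequence supported by `T`. -/
def pnorm (τ : ℝ) (T : Finset (ActiveMode P K₀)) (c : ActiveMode P K₀ → ℂ) : ℝ :=
  Real.sqrt (∑ p ∈ T, p.weight ^ τ * ‖c p‖ ^ 2)

theorem weight_rpow_nonneg (p : ActiveMode P K₀) (τ : ℝ) : 0 ≤ p.weight ^ τ :=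
  Real.rpow_nonneg p.weight_pos.le _

theorem pnorm_term_nonneg (τ : ℝ) (c : ActiveMode P K₀ → ℂ) (p : ActiveMode P K₀) :
    0 ≤ p.weight ^ τ * ‖c p‖ ^ 2 :=
  mul_nonneg (weight_rpow_nonneg p τ) (sq_nonneg _)

theorem pnorm_nonneg (τ : ℝ) (T : Finset (ActiveMode P K₀)) (c : ActiveMode P K₀ → ℂ) :
    0 ≤ pnorm τ T c := Real.sqrt_nonneg _

theorem pnorm_sq (τ : ℝ) (T : Finset (ActiveMode P K₀)) (c : ActiveMode P K₀ → ℂ) :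
    pnorm τ T c ^ 2 = ∑ p ∈ T, p.weight ^ τ * ‖c p‖ ^ 2 :=
  Real.sq_sqrt (Finset.sum_nonneg fun p _ => pnorm_term_nonneg τ c p)

theorem weight_rpow_half_sq (p : ActiveMode P K₀) (τ : ℝ) :
    (p.weight ^ (τ / 2)) ^ 2 = p.weight ^ τ := by
  rw [← Real.rpow_natCast, ← Real.rpow_mul p.weight_pos.le]
  norm_num

/-- Imports the triangle inequality and homogeneity from a finite-dimensional Hilbert space. -/
theorem pnorm_eq_norm (τ : ℝ) (T : Finset (ActiveMode P K₀)) (c : ActiveMode P K₀ → ℂ) :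
    pnorm τ T c =
      ‖(WithLp.toLp 2 fun p : T => ((p.1.weight ^ (τ / 2) : ℝ) : ℂ) * c p.1 : EuclideanSpace ℂ T)‖ := by
  rw [EuclideanSpace.norm_eq, pnorm, ← Finset.sum_coe_sort T]
  congr 1
  refine Finset.sum_congr rfl fun p _ => ?_
  simp only [norm_mul, Complex.norm_real, Real.norm_eq_abs, mul_pow, sq_abs]
  rw [weight_rpow_half_sq]

theorem pnorm_add_le (τ : ℝ) (T : Finset (ActiveMode P K₀)) (c c' : ActiveMode P K₀ → ℂ) :
    pnorm τ T (fun p => c p + c' p) ≤ pnorm τ T c + pnorm τ T c' := by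
  simp only [pnorm_eq_norm]
  refine le_trans (le_of_eq ?_) (norm_add_le _ _)
  congr 1
  ext p
  simp [mul_add]

theorem pnorm_smul (τ : ℝ) (T : Finset (ActiveMode P K₀)) (z : ℂ) (c : ActiveMode P K₀ → ℂ) :
    pnorm τ T (fun p => z * c p) = ‖z‖ * pnorm τ T c := by
  simp only [pnorm_eq_norm]
  rw [← norm_smul]
  congr 1
  ext p
  simp only [PiLp.smul_apply, smul_eq_mul]
  ring

theorem pnorm_neg (τ : ℝ) (T : Finset (ActiveMode P K₀)) (c : ActiveMode P K₀ → ℂ) :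
    pnorm τ T (fun p => -c p) = pnorm τ T c := by
  simp [pnorm]

theorem pnorm_sub_le (τ : ℝ) (T : Finset (ActiveMode P K₀)) (c c' : ActiveMode P K₀ → ℂ) :
    pnorm τ T (fun p => c p - c' p) ≤ pnorm τ T c + pnorm τ T c' := by
  have h := pnorm_add_le τ T c (fun p => -c' p)
  rw [pnorm_neg] at h
  simpa [sub_eq_add_neg] using h

theorem pnorm_congr {τ : ℝ} {T : Finset (ActiveMode P K₀)} {c c' : ActiveMode P K₀ → ℂ}
    (h : ∀ p ∈ T, c p = c' p) : pnorm τ T c = pnorm τ T c' := by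
  unfold pnorm
  congr 1
  exact Finset.sum_congr rfl fun p hp => by rw [h p hp]

theorem pnorm_le_of_norm_le {τ : ℝ} {T : Finset (ActiveMode P K₀)} {c c' : ActiveMode P K₀ → ℂ}
    (h : ∀ p ∈ T, ‖c p‖ ≤ ‖c' p‖) : pnorm τ T c ≤ pnorm τ T c' := by
  refine Real.sqrt_le_sqrt (Finset.sum_le_sum fun p hp => ?_)
  exact mul_le_mul_of_nonneg_left (pow_le_pow_left₀ (norm_nonneg _) (h p hp) 2)
    (weight_rpow_nonneg p τ)

theorem pnorm_mono_order {τ τ' : ℝ} (h : τ ≤ τ') (T : Finset (ActiveMode P K₀))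
    (c : ActiveMode P K₀ → ℂ) : pnorm τ T c ≤ pnorm τ' T c :=
  Real.sqrt_le_sqrt (Finset.sum_le_sum fun p _ => mul_le_mul_of_nonneg_right
    (Real.rpow_le_rpow_of_exponent_le p.one_le_weight h) (sq_nonneg _))

theorem pnorm_le_sq {τ B : ℝ} (hB : 0 ≤ B) {T : Finset (ActiveMode P K₀)}
    {c : ActiveMode P K₀ → ℂ} (h : ∑ p ∈ T, p.weight ^ τ * ‖c p‖ ^ 2 ≤ B ^ 2) :
    pnorm τ T c ≤ B := by
  rw [pnorm]
  exact Real.sqrt_le_iff.mpr ⟨hB, h⟩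

/-- Cauchy–Schwarz after splitting the weights as `1 = weight ^ (-τ / 2) * weight ^ (τ / 2)`. The
pairing is bilinear, without conjugation, which suits matrices. -/
theorem norm_sum_mul_le (τ : ℝ) (T : Finset (ActiveMode P K₀)) (x y : ActiveMode P K₀ → ℂ) :
    ‖∑ p ∈ T, x p * y p‖ ≤ pnorm (-τ) T x * pnorm τ T y := by
  refine (norm_sum_le _ _).trans ?_
  have h := Real.sum_mul_le_sqrt_mul_sqrt T (fun p => p.weight ^ (-τ / 2) * ‖x p‖)
    (fun p => p.weight ^ (τ / 2) * ‖y p‖)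
  simp only [mul_pow, weight_rpow_half_sq] at h
  refine le_trans (le_of_eq (Finset.sum_congr rfl fun p _ => ?_)) h
  have h1 : p.weight ^ (-τ / 2) * p.weight ^ (τ / 2) = 1 := by
    rw [← Real.rpow_add p.weight_pos, show -τ / 2 + τ / 2 = 0 by ring, Real.rpow_zero]
  rw [norm_mul]
  linear_combination (-‖x p‖ * ‖y p‖) * h1

/-- The converse of the duality bound: testing against `weight ^ τ` times the conjugate of `y` gives
the square of the norm on the left and the norm itself on the right. -/
theorem pnorm_le_of_dual {τ B : ℝ} {T : Finset (ActiveMode P K₀)} {y : ActiveMode P K₀ → ℂ}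
    (hB : 0 ≤ B)
    (h : ∀ x : ActiveMode P K₀ → ℂ, ‖∑ p ∈ T, x p * y p‖ ≤ B * pnorm (-τ) T x) :
    pnorm τ T y ≤ B := by
  have h1 := h fun p => ((p.weight ^ τ : ℝ) : ℂ) * (starRingEnd ℂ) (y p)
  have h2 : (∑ p ∈ T, ((p.weight ^ τ : ℝ) : ℂ) * (starRingEnd ℂ) (y p) * y p) =
      ((pnorm τ T y ^ 2 : ℝ) : ℂ) := by
    rw [pnorm_sq, Complex.ofReal_sum]
    refine Finset.sum_congr rfl fun p _ => ?_
    rw [mul_assoc, mul_comm ((starRingEnd ℂ) (y p)), Complex.mul_conj, Complex.normSq_eq_norm_sq]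
    push_cast
    ring
  have h3 : pnorm (-τ) T (fun p => ((p.weight ^ τ : ℝ) : ℂ) * (starRingEnd ℂ) (y p)) =
      pnorm τ T y := by
    unfold pnorm
    congr 1
    refine Finset.sum_congr rfl fun p _ => ?_
    rw [norm_mul, Complex.norm_real, Real.norm_eq_abs, abs_of_nonneg (weight_rpow_nonneg p τ),
      mul_pow, RCLike.norm_conj, Real.rpow_neg p.weight_pos.le]
    have := (Real.rpow_pos_of_pos p.weight_pos τ).ne'
    field_simp
  rw [h2, h3, Complex.norm_real, Real.norm_eq_abs, abs_of_nonneg (sq_nonneg _)] at h1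
  by_contra hlt
  push Not at hlt
  have h5 : 0 < pnorm τ T y := lt_of_le_of_lt hB hlt
  nlinarith

/-- The sequence has Sobolev norm at most `B`. -/
def SobBdd (τ : ℝ) (c : ActiveMode P K₀ → ℂ) (B : ℝ) : Prop := ∀ T, pnorm τ T c ≤ B

theorem SobBdd.nonneg {τ : ℝ} {c : ActiveMode P K₀ → ℂ} {B : ℝ} (h : SobBdd τ c B) : 0 ≤ B :=
  (pnorm_nonneg _ _ _).trans (h ∅)

theorem SobBdd.mono {τ : ℝ} {c : ActiveMode P K₀ → ℂ} {B B' : ℝ} (h : SobBdd τ c B) (hB : B ≤ B') :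
    SobBdd τ c B' := fun T => (h T).trans hB

theorem SobBdd.lower {τ τ' : ℝ} {c : ActiveMode P K₀ → ℂ} {B : ℝ} (h : SobBdd τ' c B)
    (hτ : τ ≤ τ') : SobBdd τ c B := fun T => (pnorm_mono_order hτ T c).trans (h T)

theorem SobBdd.add {τ : ℝ} {c c' : ActiveMode P K₀ → ℂ} {B B' : ℝ} (h : SobBdd τ c B)
    (h' : SobBdd τ c' B') : SobBdd τ (fun p => c p + c' p) (B + B') :=
  fun T => (pnorm_add_le τ T c c').trans (add_le_add (h T) (h' T))

theorem SobBdd.smul {τ : ℝ} {c : ActiveMode P K₀ → ℂ} {B : ℝ} (h : SobBdd τ c B) (z : ℂ) :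
    SobBdd τ (fun p => z * c p) (‖z‖ * B) := fun T => by
  rw [pnorm_smul]
  exact mul_le_mul_of_nonneg_left (h T) (norm_nonneg _)

theorem sobBdd_zero (τ : ℝ) : SobBdd τ (0 : ActiveMode P K₀ → ℂ) 0 := fun T => by
  simp [pnorm]

theorem SobBdd.summable {τ : ℝ} {c : ActiveMode P K₀ → ℂ} {B : ℝ} (h : SobBdd τ c B) :
    Summable fun p => p.weight ^ τ * ‖c p‖ ^ 2 := by
  refine summable_of_sum_le (c := B ^ 2) (fun p => pnorm_term_nonneg τ c p) fun T => ?_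
  rw [← pnorm_sq]
  exact pow_le_pow_left₀ (pnorm_nonneg _ _ _) (h T) 2

/-- Summability has to be assumed on the side of `sobNorm`, whose infinite sum would take the value
`0` on a divergent series; `SobBdd` needs no such proviso. -/
theorem sobBdd_iff {τ : ℝ} {c : ActiveMode P K₀ → ℂ} {B : ℝ} (hB : 0 ≤ B)
    (hc : Summable fun p => p.weight ^ τ * ‖c p‖ ^ 2) :
    SobBdd τ c B ↔ sobNorm τ c ≤ B := by
  constructor
  · intro h
    refine Real.sqrt_le_iff.mpr ⟨hB, ?_⟩
    refine hc.tsum_le_of_sum_le fun T => ?_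
    rw [← pnorm_sq]
    exact pow_le_pow_left₀ (pnorm_nonneg _ _ _) (h T) 2
  · intro h T
    refine le_trans (Real.sqrt_le_sqrt ?_) h
    exact hc.sum_le_tsum T fun p _ => pnorm_term_nonneg τ c p

/-! Elements of the Sobolev spaces -/

theorem Hs.summable (u : Hs P K₀ s) : Summable fun p => p.weight ^ s * ‖u.coeff p‖ ^ 2 := u.2

/-- The element of the Sobolev space with given coefficients. -/
def Hs.ofMem (c : ActiveMode P K₀ → ℂ) (h : c ∈ HsSubmodule P K₀ s) : Hs P K₀ s := ⟨c, h⟩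

theorem Hs.coeff_ofMem (c : ActiveMode P K₀ → ℂ) (h : c ∈ HsSubmodule P K₀ s) :
    (Hs.ofMem c h).coeff = c := rfl

theorem Hs.incl_coeff (h : s' ≤ s) (u : Hs P K₀ s) : (Hs.incl h u).coeff = u.coeff :=
  Hs.coeff_ofMem _ _

theorem Hs.summable_of_le (h : s' ≤ s) (u : Hs P K₀ s) :
    Summable fun p => p.weight ^ s' * ‖u.coeff p‖ ^ 2 := by
  have h1 := (Hs.incl h u).summable
  rwa [Hs.incl_coeff] at h1

theorem Hs.ext {u v : Hs P K₀ s} (h : ∀ p, u.coeff p = v.coeff p) : u = v :=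
  Subtype.ext (funext h)

@[simp] theorem Hs.coeff_add (u v : Hs P K₀ s) (p : ActiveMode P K₀) :
    (u + v).coeff p = u.coeff p + v.coeff p := rfl

@[simp] theorem Hs.coeff_sub (u v : Hs P K₀ s) (p : ActiveMode P K₀) :
    (u - v).coeff p = u.coeff p - v.coeff p := rfl

@[simp] theorem Hs.coeff_zero (p : ActiveMode P K₀) : (0 : Hs P K₀ s).coeff p = 0 := rfl

@[simp] theorem Hs.coeff_smul (z : ℂ) (u : Hs P K₀ s) (p : ActiveMode P K₀) :
    (z • u).coeff p = z * u.coeff p := rfl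

@[simp] theorem Hs.coeff_incl (h : s' ≤ s) (u : Hs P K₀ s) (p : ActiveMode P K₀) :
    (Hs.incl h u).coeff p = u.coeff p := by rw [Hs.incl_coeff]

theorem Hs.norm_le_iff {u : Hs P K₀ s} {B : ℝ} (hB : 0 ≤ B) : ‖u‖ ≤ B ↔ SobBdd s u.coeff B := by
  rw [Hs.norm_eq, sobBdd_iff hB u.summable]

theorem Hs.sobBdd (u : Hs P K₀ s) : SobBdd s u.coeff ‖u‖ :=
  (Hs.norm_le_iff (norm_nonneg _)).1 le_rfl

open Classical in
/-- The element of the Sobolev space with given coefficients, or `0` if there is none. -/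
def Hs.ofSeq (s : ℝ) (c : ActiveMode P K₀ → ℂ) : Hs P K₀ s :=
  if h : c ∈ HsSubmodule P K₀ s then Hs.ofMem c h else 0

theorem Hs.coeff_ofSeq {c : ActiveMode P K₀ → ℂ} {B : ℝ} (h : SobBdd s c B) :
    (Hs.ofSeq s c).coeff = c := by
  have h' : c ∈ HsSubmodule P K₀ s := h.summable
  rw [Hs.ofSeq, dif_pos h', Hs.coeff_ofMem]

theorem SobBdd.norm_coeff_le {τ : ℝ} {c : ActiveMode P K₀ → ℂ} {B : ℝ} (h : SobBdd τ c B)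
    (p : ActiveMode P K₀) : ‖c p‖ ≤ p.weight ^ (-τ / 2) * B := by
  have h1 := h {p}
  rw [pnorm, Finset.sum_singleton, ← weight_rpow_half_sq, ← mul_pow,
    Real.sqrt_sq (by have := weight_rpow_nonneg p (τ / 2); positivity)] at h1
  have h2 := mul_le_mul_of_nonneg_left h1 (weight_rpow_nonneg p (-τ / 2))
  rwa [← mul_assoc, ← Real.rpow_add p.weight_pos, show -τ / 2 + τ / 2 = 0 by ring, Real.rpow_zero,
    one_mul] at h2

/-- A Fourier coefficient as a continuous linear form. -/
def Hs.coeffL (p : ActiveMode P K₀) : Hs P K₀ s →L[ℂ] ℂ :=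
  LinearMap.mkContinuous
    { toFun := fun u => u.coeff p
      map_add' := fun _ _ => Hs.coeff_add _ _ _
      map_smul' := fun _ _ => Hs.coeff_smul _ _ _ } (p.weight ^ (-s / 2)) fun u => u.sobBdd.norm_coeff_le p

@[simp] theorem Hs.coeffL_apply (p : ActiveMode P K₀) (u : Hs P K₀ s) :
    Hs.coeffL p u = u.coeff p := rfl

open Classical in
theorem single_mem_HsSubmodule (s : ℝ) (p : ActiveMode P K₀) :
    Pi.single p 1 ∈ HsSubmodule P K₀ s := by
  have h : Summable fun p' => p'.weight ^ s * ‖(Pi.single p 1 : ActiveMode P K₀ → ℂ) p'‖ ^ 2 := by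
    refine summable_of_ne_finset_zero (s := {p}) fun p' hp' => ?_
    rw [Finset.mem_singleton] at hp'
    simp [Pi.single_eq_of_ne hp']
  exact h

open Classical in
/-- The exponentials. -/
def Hs.exp (s : ℝ) (p : ActiveMode P K₀) : Hs P K₀ s :=
  Hs.ofMem (Pi.single p 1) (single_mem_HsSubmodule s p)

open Classical in
theorem Hs.coeff_exp (s : ℝ) (p p' : ActiveMode P K₀) :
    (Hs.exp s p).coeff p' = if p' = p then 1 else 0 := by
  rw [Hs.exp, Hs.coeff_ofMem, Pi.single_apply]

theorem Hs.isInducing_toL2 : IsInducing (Hs.toL2 : Hs P K₀ s → _) := ⟨rfl⟩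

-- The corresponding expansion in `ℓ²`, pulled back along the inducing map `toL2`. It is what makes
-- a bounded operator determined by its matrix.
open Classical in
theorem Hs.hasSum_exp (u : Hs P K₀ s) : HasSum (fun p => u.coeff p • Hs.exp s p) u := by
  have h := lp.hasSum_single (p := 2) (by norm_num) (Hs.toL2 u)
  have h2 : (fun p => lp.single 2 p ((Hs.toL2 u : ∀ _, ℂ) p)) =
      fun p => Hs.toL2 (u.coeff p • Hs.exp s p) := by
    funext p
    ext p'
    change _ = ((p'.weight ^ (s / 2) : ℝ) : ℂ) * (u.coeff p * (Hs.exp s p).coeff p')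
    rw [Hs.coeff_exp, lp.single_apply, Pi.single_apply]
    split_ifs with hp
    · subst hp
      rw [mul_one]
      rfl
    · simp
  rw [h2] at h
  exact (Hs.isInducing_toL2.hasSum_iff (g := (Hs.toL2 : Hs P K₀ s →ₗ[ℂ] _)) _ _).1 h

/-! Operators as continuous linear maps -/

theorem FOp.Rep.apply {a : FOp P K₀} {T : Hs P K₀ s →L[ℂ] Hs P K₀ s'} (h : a.Rep T)
    (w : Hs P K₀ s) : (T w).coeff = a.act w.coeff := by
  funext p
  exact ((h w p).tsum_eq).symm

theorem FOp.Rep.apply_exp {a : FOp P K₀} {T : Hs P K₀ s →L[ℂ] Hs P K₀ s'} (h : a.Rep T)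
    (p p' : ActiveMode P K₀) : (T (Hs.exp s p')).coeff p = a p p' := by
  have h1 := h (Hs.exp s p') p
  refine h1.unique ?_
  convert hasSum_single p' ?_ using 1
  · simp [Hs.coeff_exp]
  · intro p'' hp
    simp [Hs.coeff_exp, hp]

/-- Apply the continuous map, then the continuous coefficient form, to the expansion in
exponentials. -/
theorem FOp.rep_of_apply_exp {a : FOp P K₀} {T : Hs P K₀ s →L[ℂ] Hs P K₀ s'}
    (h : ∀ p p', (T (Hs.exp s p')).coeff p = a p p') : a.Rep T := by
  intro w p
  have h1 := (w.hasSum_exp.mapL T).mapL (Hs.coeffL p)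
  simp only [map_smul, Hs.coeffL_apply, h, smul_eq_mul] at h1
  simpa only [mul_comm] using h1

theorem FOp.Rep.unique {a : FOp P K₀} {T T' : Hs P K₀ s →L[ℂ] Hs P K₀ s'} (h : a.Rep T)
    (h' : a.Rep T') : T = T' := by
  ext1 w
  refine Hs.ext fun p => ?_
  rw [h.apply, h'.apply]

theorem FOp.Bdd.rep_clm {a : FOp P K₀} (h : a.Bdd s s') : a.Rep (a.clm s s') := by
  rw [FOp.clm, dif_pos h]
  exact h.choose_spec

/-- By uniqueness the arbitrary choice in the definition of `clm` is harmless: any map with the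
right matrix is the chosen one. -/
theorem FOp.Rep.clm_eq {a : FOp P K₀} {T : Hs P K₀ s →L[ℂ] Hs P K₀ s'} (h : a.Rep T) :
    a.clm s s' = T :=
  (FOp.Bdd.rep_clm ⟨T, h⟩).unique h

/-! Lengths of lattice points, block sizes and weights -/

theorem len_eq_norm (n : Fin d → ℤ) :
    len n = ‖(WithLp.toLp 2 fun i => (n i : ℝ) : EuclideanSpace ℝ (Fin d))‖ := by
  rw [EuclideanSpace.norm_eq, len]
  simp

theorem len_nonneg (n : Fin d → ℤ) : 0 ≤ len n := Real.sqrt_nonneg _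

theorem len_add_le (n n' : Fin d → ℤ) : len (n + n') ≤ len n + len n' := by
  simp only [len_eq_norm]
  refine le_trans (le_of_eq ?_) (norm_add_le _ _)
  congr 1
  ext i
  simp

theorem len_neg (n : Fin d → ℤ) : len (-n) = len n := by
  simp [len]

theorem len_sub_comm (n n' : Fin d → ℤ) : len (n - n') = len (n' - n) := by
  rw [← len_neg, neg_sub]

theorem len_le_add_sub (n n' : Fin d → ℤ) : len n ≤ len n' + len (n - n') := by
  have h := len_add_le n' (n - n')
  rwa [add_sub_cancel] at h

theorem abs_le_len (n : Fin d → ℤ) (i : Fin d) : |(n i : ℝ)| ≤ len n := by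
  refine Real.le_sqrt_of_sq_le ?_
  rw [sq_abs]
  exact Finset.single_le_sum (f := fun i => (n i : ℝ) ^ 2) (fun _ _ => sq_nonneg _)
    (Finset.mem_univ i)

theorem jap_sq (n : Fin d → ℤ) : jap n ^ 2 = 1 + len n ^ 2 := Real.sq_sqrt (by positivity)

theorem one_le_jap (n : Fin d → ℤ) : 1 ≤ jap n := by
  refine Real.le_sqrt_of_sq_le ?_
  nlinarith [sq_nonneg (len n)]

theorem jap_pos (n : Fin d → ℤ) : 0 < jap n := by linarith [one_le_jap n]

theorem len_le_jap (n : Fin d → ℤ) : len n ≤ jap n :=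
  Real.le_sqrt_of_sq_le (by linarith)

theorem jap_le_one_add (n : Fin d → ℤ) : jap n ≤ 1 + len n :=
  Real.sqrt_le_iff.mpr ⟨by linarith [len_nonneg n], by nlinarith [len_nonneg n]⟩

theorem jap_sub_comm (n n' : Fin d → ℤ) : jap (n - n') = jap (n' - n) := by
  rw [jap, jap, len_sub_comm]

/-- The conditions on the parameters of the partition and of the spectral zone. -/
structure Admissible (β θ K₀ : ℝ) : Prop where
  β_nonneg : 0 ≤ β
  β_le_one : β ≤ 1
  θ_nonneg : 0 ≤ θ
  K_pos : 0 < K₀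

theorem len_rpow_le (h : Admissible β θ K₀) (n : Fin d → ℤ) : len n ^ β ≤ 1 + len n := by
  rcases le_total (len n) 1 with h1 | h1
  · have := Real.rpow_le_one (len_nonneg n) h1 h.β_nonneg
    linarith [len_nonneg n]
  · have := Real.rpow_le_rpow_of_exponent_le h1 h.β_le_one
    rw [Real.rpow_one] at this
    linarith

/-- From the nearness condition and `len n ^ β ≤ 1 + len n`, which uses only `0 ≤ β ≤ 1`. The
brackets of the points of a block are thus all comparable to that of its centre. -/
theorem jap_le_of_cls_eq (h : Admissible β θ K₀) (P : BlockPartition d ι β ρ θ)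
    {n n' : Fin d → ℤ} (hn : P.cls n = P.cls n') : jap n' ≤ (θ + 4) * jap n := by
  have h1 := P.near n n' hn
  have h2 := len_rpow_le h n
  have h3 := len_le_add_sub n' n
  rw [len_sub_comm] at h3
  have h4 := abs_nonneg (len n ^ 2 - len n' ^ 2)
  have h5 := jap_le_one_add n'
  have h6 := len_le_jap n
  have h7 := one_le_jap n
  nlinarith [h.θ_nonneg]

theorem size_le (h : Admissible β θ K₀) (P : BlockPartition d ι β ρ θ) (n : Fin d → ℤ) :
    P.size n ≤ (θ + 4) * jap n :=
  jap_le_of_cls_eq h P (P.cls_center _).symm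

theorem jap_le_size (h : Admissible β θ K₀) (P : BlockPartition d ι β ρ θ) (n : Fin d → ℤ) :
    jap n ≤ (θ + 4) * P.size n :=
  jap_le_of_cls_eq h P (P.cls_center _)

theorem one_le_size (P : BlockPartition d ι β ρ θ) (n : Fin d → ℤ) : 1 ≤ P.size n := one_le_jap _

theorem finite_len_le (R : ℝ) : {n : Fin d → ℤ | len n ≤ R}.Finite := by
  refine (Set.finite_Icc (fun _ => -⌈R⌉) (fun _ => ⌈R⌉)).subset fun n hn => ?_
  have h1 : ∀ i, |n i| ≤ ⌈R⌉ := fun i => by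
    have := ((abs_le_len n i).trans hn).trans (Int.le_ceil R)
    exact_mod_cast this
  exact ⟨fun i => (abs_le.1 (h1 i)).1, fun i => (abs_le.1 (h1 i)).2⟩

theorem ActiveMode.ext {p p' : ActiveMode P K₀} (h : p.time = p'.time) (h' : p.space = p'.space) :
    p = p' := Subtype.ext (Prod.ext h h')

theorem ActiveMode.abs_time_le (p : ActiveMode P K₀) :
    |(p.time : ℝ)| ≤ K₀ * P.size p.space ^ 2 := p.2.2

theorem ActiveMode.le_abs_time (p : ActiveMode P K₀) :
    K₀⁻¹ * P.size p.space ^ 2 ≤ |(p.time : ℝ)| := p.2.1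

/-- The support condition bounds the time frequency by the square of the block size, so a bound on
the space frequency alone leaves finitely many modes. -/
theorem finite_len_space_le (h : Admissible β θ K₀) (R : ℝ) :
    {p : ActiveMode P K₀ | len p.space ≤ R}.Finite := by
  set B : ℝ := K₀ * ((θ + 4) * (1 + R)) ^ 2
  refine Set.Finite.of_finite_image (f := fun p : ActiveMode P K₀ => (p.time, p.space)) ?_ ?_
  · refine ((Set.finite_Icc (-⌈B⌉) ⌈B⌉).prod (finite_len_le (d := d) R)).subset ?_
    rintro _ ⟨p, hp, rfl⟩
    refine ⟨?_, hp⟩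
    have h1 : P.size p.space ≤ (θ + 4) * (1 + R) :=
      (size_le h P _).trans (mul_le_mul_of_nonneg_left
        ((jap_le_one_add _).trans (by have : len p.space ≤ R := hp; linarith))
        (by linarith [h.θ_nonneg]))
    have h2 : |(p.time : ℝ)| ≤ B := p.abs_time_le.trans (mul_le_mul_of_nonneg_left
      (pow_le_pow_left₀ (by linarith [one_le_size P p.space]) h1 2) h.K_pos.le)
    have h3 : |p.time| ≤ ⌈B⌉ := by
      have := h2.trans (Int.le_ceil B)
      exact_mod_cast this
    exact ⟨(abs_le.1 h3).1, (abs_le.1 h3).2⟩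
  · intro p _ p' _ hpp
    have h1 := Prod.mk.inj hpp
    exact ActiveMode.ext h1.1 h1.2

theorem finite_size_le (h : Admissible β θ K₀) (R : ℝ) :
    {p : ActiveMode P K₀ | P.size p.space ≤ R}.Finite := by
  refine (finite_len_space_le h ((θ + 4) * R)).subset fun p hp => ?_
  exact (len_le_jap _).trans ((jap_le_size h P _).trans
    (mul_le_mul_of_nonneg_left hp (by linarith [h.θ_nonneg])))

/-! ### Dyadic levels, shells and their comparison with the Sobolev weights -/

/-- The dyadic level of the block of a mode. -/
def ActiveMode.lev (p : ActiveMode P K₀) : ℕ := Nat.log 2 ⌊P.size p.space⌋₊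

theorem two_pow_lev_le (p : ActiveMode P K₀) : (2 : ℝ) ^ p.lev ≤ P.size p.space := by
  have h1 := one_le_size P p.space
  have h0 : ⌊P.size p.space⌋₊ ≠ 0 := (Nat.floor_pos.2 h1).ne'
  have h2 : (2 ^ p.lev : ℕ) ≤ ⌊P.size p.space⌋₊ := Nat.pow_log_le_self 2 h0
  have h3 := (Nat.le_floor_iff (by linarith)).1 h2
  exact_mod_cast h3

theorem size_lt_two_pow (p : ActiveMode P K₀) : P.size p.space < (2 : ℝ) ^ (p.lev + 1) := by
  have h2 : ⌊P.size p.space⌋₊ < (2 ^ (p.lev + 1) : ℕ) := Nat.lt_pow_succ_log_self (by norm_num) _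
  have h3 := (Nat.floor_lt (by linarith [one_le_size P p.space])).1 h2
  exact_mod_cast h3

/-- The strict inequality with `k + 1` is the condition in `lowBlocks`, so the spectral cut-off
keeps exactly the levels at most `k`. -/
theorem lev_le_iff (p : ActiveMode P K₀) (k : ℕ) :
    p.lev ≤ k ↔ P.size p.space < (2 : ℝ) ^ (k + 1) := by
  constructor
  · intro h
    exact (size_lt_two_pow p).trans_le (pow_le_pow_right₀ (by norm_num) (by omega))
  · intro h
    have h1 := (two_pow_lev_le p).trans_lt h
    have := (pow_lt_pow_iff_right₀ (by norm_num : (1 : ℝ) < 2)).1 h1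
    omega

/-- The level is defined through the chosen point of the block, so a shell is a union of whole
blocks and block diagonal operators preserve it. -/
theorem lev_eq_of_block_eq {p p' : ActiveMode P K₀} (h : p.block = p'.block) : p.lev = p'.lev := by
  have h1 : P.cls p.space = P.cls p'.space := h
  simp only [ActiveMode.lev, BlockPartition.size, h1]

theorem ActiveMode.space_neg (p : ActiveMode P K₀) : (-p).space = -p.space := rfl

theorem ActiveMode.time_neg (p : ActiveMode P K₀) : (-p).time = -p.time := rfl

instance : InvolutiveNeg (ActiveMode P K₀) where
  neg_neg p := ActiveMode.ext (neg_neg p.time) (neg_neg p.space)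

-- This is where the field `even` of the partition enters; without it the shells and the cut-offs
-- would not respect real functions.
@[simp] theorem lev_neg (p : ActiveMode P K₀) : (-p).lev = p.lev := by
  simp only [ActiveMode.lev, ActiveMode.space_neg, P.size_neg]

theorem finite_lev_le (h : Admissible β θ K₀) (k : ℕ) : {p : ActiveMode P K₀ | p.lev ≤ k}.Finite :=
  (finite_size_le h ((2 : ℝ) ^ (k + 1))).subset fun p hp => ((lev_le_iff p k).1 hp).le

/-- The modes of level at most `k`. -/
def low (h : Admissible β θ K₀) (P : BlockPartition d ι β ρ θ) (k : ℕ) : Finset (ActiveMode P K₀) :=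
  (finite_lev_le h k).toFinset

@[simp] theorem mem_low {h : Admissible β θ K₀} {k : ℕ} {p : ActiveMode P K₀} :
    p ∈ low h P k ↔ p.lev ≤ k := by
  simp [low]

/-- The modes of level `κ`. -/
def shell (h : Admissible β θ K₀) (P : BlockPartition d ι β ρ θ) (κ : ℕ) :
    Finset (ActiveMode P K₀) :=
  (low h P κ).filter fun p => p.lev = κ

@[simp] theorem mem_shell {h : Admissible β θ K₀} {κ : ℕ} {p : ActiveMode P K₀} :
    p ∈ shell h P κ ↔ p.lev = κ := by
  simp only [shell, Finset.mem_filter, mem_low]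
  omega

theorem sum_low (h : Admissible β θ K₀) (k : ℕ) (g : ActiveMode P K₀ → ℝ) :
    ∑ p ∈ low h P k, g p = ∑ κ ∈ Finset.range (k + 1), ∑ p ∈ shell h P κ, g p := by
  rw [← Finset.sum_fiberwise_of_maps_to (s := low h P k) (t := Finset.range (k + 1))
    (g := fun p => p.lev) (fun p hp => by
      rw [mem_low] at hp
      exact Finset.mem_range.2 (by omega))]
  refine Finset.sum_congr rfl fun κ hκ => Finset.sum_congr ?_ fun _ _ => rfl
  ext p
  have := Finset.mem_range.1 hκ
  simp only [Finset.mem_filter, mem_low, mem_shell]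
  omega

theorem weight_le_size (h : Admissible β θ K₀) (p : ActiveMode P K₀) :
    p.weight ≤ (1 + K₀ ^ 2 + (θ + 4) ^ 4) * P.size p.space ^ 4 := by
  have h1 : (p.time : ℝ) ^ 2 ≤ (K₀ * P.size p.space ^ 2) ^ 2 := by
    rw [← sq_abs]
    exact pow_le_pow_left₀ (abs_nonneg _) p.abs_time_le 2
  have h2 : len p.space ^ 4 ≤ ((θ + 4) * P.size p.space) ^ 4 :=
    pow_le_pow_left₀ (len_nonneg _) ((len_le_jap _).trans (jap_le_size h P _)) 4
  have h3 : 1 ≤ P.size p.space ^ 4 := one_le_pow₀ (one_le_size P _)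
  unfold ActiveMode.weight
  rw [mul_pow] at h1 h2
  nlinarith

/-- The space frequency alone suffices here; the support condition in time is needed only for the
opposite inequality. -/
theorem size_le_weight (h : Admissible β θ K₀) (p : ActiveMode P K₀) :
    P.size p.space ^ 4 ≤ 2 * (θ + 4) ^ 4 * p.weight := by
  have h1 : P.size p.space ^ 4 ≤ ((θ + 4) * jap p.space) ^ 4 :=
    pow_le_pow_left₀ (by linarith [one_le_size P p.space]) (size_le h P _) 4
  have h2 : jap p.space ^ 4 ≤ 2 * p.weight := by
    have h3 : jap p.space ^ 4 = (jap p.space ^ 2) ^ 2 := by ring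
    rw [h3, jap_sq]
    unfold ActiveMode.weight
    nlinarith [sq_nonneg (p.time : ℝ), sq_nonneg (1 - len p.space ^ 2)]
  rw [mul_pow] at h1
  have h4 : 0 ≤ (θ + 4) ^ 4 := by positivity
  nlinarith

/-- With a two-sided comparison the sign of the exponent does not matter: for negative `τ` use the
other inequality and take inverses. -/
theorem rpow_le_of_comparable {C x y τ : ℝ} (hC : 1 ≤ C) (hx : 0 < x) (hy : 0 < y)
    (h : x ≤ C * y) (h' : y ≤ C * x) : x ^ τ ≤ C ^ |τ| * y ^ τ := by
  have hC0 : 0 < C := by linarith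
  rcases le_total 0 τ with hτ | hτ
  · rw [abs_of_nonneg hτ, ← Real.mul_rpow hC0.le hy.le]
    exact Real.rpow_le_rpow hx.le h hτ
  · rw [abs_of_nonpos hτ]
    have h1 : y ^ (-τ) ≤ C ^ (-τ) * x ^ (-τ) := by
      rw [← Real.mul_rpow hC0.le hx.le]
      exact Real.rpow_le_rpow hy.le h' (by linarith)
    have hx1 := Real.rpow_pos_of_pos hx τ
    have hy1 := Real.rpow_pos_of_pos hy τ
    rw [Real.rpow_neg hy.le, Real.rpow_neg hx.le] at h1
    have h2 := mul_le_mul_of_nonneg_right h1 (mul_pos hx1 hy1).le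
    have e1 : (y ^ τ)⁻¹ * (x ^ τ * y ^ τ) = x ^ τ := by field_simp
    have e2 : C ^ (-τ) * (x ^ τ)⁻¹ * (x ^ τ * y ^ τ) = C ^ (-τ) * y ^ τ := by field_simp
    rwa [e1, e2] at h2

/-- The constant which compares the weights with the powers of the dyadic levels. -/
def levConst (θ K₀ : ℝ) : ℝ := 16 * (1 + K₀ ^ 2 + 2 * (θ + 4) ^ 4)

theorem one_le_levConst (h : Admissible β θ K₀) : 1 ≤ levConst θ K₀ := by
  have := h.θ_nonneg
  unfold levConst
  have : 0 ≤ (θ + 4) ^ 4 := by positivity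
  nlinarith [sq_nonneg K₀]

theorem weight_le_lev (h : Admissible β θ K₀) (p : ActiveMode P K₀) :
    p.weight ≤ levConst θ K₀ * ((2 : ℝ) ^ p.lev) ^ 4 := by
  have h1 : P.size p.space ^ 4 ≤ 16 * ((2 : ℝ) ^ p.lev) ^ 4 := by
    have := pow_le_pow_left₀ (by linarith [one_le_size P p.space]) (size_lt_two_pow p).le 4
    rw [pow_succ (2 : ℝ), mul_pow] at this
    linarith
  have h2 := weight_le_size h p
  have h3 : 0 ≤ (θ + 4) ^ 4 := by positivity
  have h4 := mul_le_mul_of_nonneg_left h1 (by positivity : 0 ≤ 1 + K₀ ^ 2 + (θ + 4) ^ 4)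
  have h5 : 0 ≤ (θ + 4) ^ 4 * ((2 : ℝ) ^ p.lev) ^ 4 := by positivity
  unfold levConst
  linarith

theorem lev_le_weight (h : Admissible β θ K₀) (p : ActiveMode P K₀) :
    ((2 : ℝ) ^ p.lev) ^ 4 ≤ levConst θ K₀ * p.weight := by
  have h1 := pow_le_pow_left₀ (by positivity) (two_pow_lev_le p) 4
  have h2 := size_le_weight h p
  have h3 : 0 ≤ (θ + 4) ^ 4 * p.weight := mul_nonneg (by positivity) p.weight_pos.le
  have h4 : 0 ≤ K₀ ^ 2 * p.weight := mul_nonneg (by positivity) p.weight_pos.le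
  have := p.weight_pos
  unfold levConst
  linarith

theorem two_pow_rpow (κ : ℕ) (τ : ℝ) : (((2 : ℝ) ^ κ) ^ 4) ^ τ = (2 : ℝ) ^ (4 * κ * τ) := by
  rw [← pow_mul, ← Real.rpow_natCast, ← Real.rpow_mul (by norm_num)]
  congr 1
  push_cast
  ring

theorem weight_rpow_le_lev (h : Admissible β θ K₀) (τ : ℝ) (p : ActiveMode P K₀) :
    p.weight ^ τ ≤ levConst θ K₀ ^ |τ| * (2 : ℝ) ^ (4 * p.lev * τ) := by
  rw [← two_pow_rpow]
  exact rpow_le_of_comparable (one_le_levConst h) p.weight_pos (by positivity)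
    (weight_le_lev h p) (lev_le_weight h p)

theorem lev_rpow_le_weight (h : Admissible β θ K₀) (τ : ℝ) (p : ActiveMode P K₀) :
    (2 : ℝ) ^ (4 * p.lev * τ) ≤ levConst θ K₀ ^ |τ| * p.weight ^ τ := by
  rw [← two_pow_rpow]
  exact rpow_le_of_comparable (one_le_levConst h) (by positivity) p.weight_pos
    (lev_le_weight h p) (weight_le_lev h p)

/-- Two modes whose space frequencies are close have comparable weights. -/
theorem weight_rpow_le_of_near (h : Admissible β θ K₀) (τ : ℝ) :
    ∃ C > 0, ∀ p p' : ActiveMode P K₀,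
      len (p.space - p'.space) ≤ (len p.space + len p'.space) / 10 →
        p.weight ^ τ ≤ C * p'.weight ^ τ := by
  have key : ∀ p p' : ActiveMode P K₀,
      len (p.space - p'.space) ≤ (len p.space + len p'.space) / 10 →
      p.weight ≤ (1 + K₀ ^ 2 + (θ + 4) ^ 4) * (2 * (θ + 4)) ^ 4 * (2 * (θ + 4) ^ 4) * p'.weight := by
    intro p p' hp
    have h0 := h.θ_nonneg
    have h1 := len_le_add_sub p.space p'.space
    have h2 : len p.space ≤ 2 * len p'.space := by linarith [len_nonneg p'.space]
    have h3 : jap p.space ≤ 2 * jap p'.space := by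
      refine abs_le_of_sq_le_sq' ?_ (by linarith [one_le_jap p'.space]) |>.2
      rw [mul_pow, jap_sq, jap_sq]
      nlinarith [len_nonneg p.space]
    have h4 : P.size p.space ≤ 2 * (θ + 4) * jap p'.space := by
      refine (size_le h P _).trans ?_
      nlinarith
    have h5 : jap p'.space ^ 4 ≤ 2 * p'.weight := by
      have h3 : jap p'.space ^ 4 = (jap p'.space ^ 2) ^ 2 := by ring
      rw [h3, jap_sq]
      unfold ActiveMode.weight
      nlinarith [sq_nonneg (p'.time : ℝ), sq_nonneg (1 - len p'.space ^ 2)]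
    have h6 := pow_le_pow_left₀ (by linarith [one_le_size P p.space]) h4 4
    rw [mul_pow] at h6
    have h7 := p'.weight_pos
    have h8 : (1 : ℝ) ≤ (θ + 4) ^ 4 := one_le_pow₀ (by linarith)
    calc p.weight ≤ (1 + K₀ ^ 2 + (θ + 4) ^ 4) * P.size p.space ^ 4 := weight_le_size h p
      _ ≤ (1 + K₀ ^ 2 + (θ + 4) ^ 4) * ((2 * (θ + 4)) ^ 4 * ((2 * (θ + 4) ^ 4) * p'.weight)) := by
          refine mul_le_mul_of_nonneg_left (h6.trans ?_) (by positivity)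
          refine mul_le_mul_of_nonneg_left (h5.trans ?_) (by positivity)
          nlinarith
      _ = _ := by ring
  set C := (1 + K₀ ^ 2 + (θ + 4) ^ 4) * (2 * (θ + 4)) ^ 4 * (2 * (θ + 4) ^ 4) with hC
  have h0 := h.θ_nonneg
  have hC1 : 1 ≤ C := by
    have h8 : (1 : ℝ) ≤ (θ + 4) ^ 4 := one_le_pow₀ (by linarith)
    have h9 : (1 : ℝ) ≤ (2 * (θ + 4)) ^ 4 := one_le_pow₀ (by linarith)
    have h10 : 1 ≤ 1 + K₀ ^ 2 + (θ + 4) ^ 4 := by nlinarith [sq_nonneg K₀]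
    have h11 := one_le_mul_of_one_le_of_one_le h10 h9
    exact one_le_mul_of_one_le_of_one_le h11 (by linarith)
  refine ⟨C ^ |τ|, Real.rpow_pos_of_pos (by linarith) _, fun p p' hp => ?_⟩
  refine rpow_le_of_comparable hC1 p.weight_pos p'.weight_pos (key p p' hp) (key p' p ?_)
  rw [len_sub_comm, add_comm]
  exact hp

/-! Comparison of norms on the shells -/

theorem pnorm_shell_le (h : Admissible β θ K₀) (τ : ℝ) (κ : ℕ) (c : ActiveMode P K₀ → ℂ) :
    pnorm τ (shell h P κ) c ^ 2 ≤
      levConst θ K₀ ^ |τ| * (2 : ℝ) ^ (4 * κ * τ) * pnorm 0 (shell h P κ) c ^ 2 := by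
  rw [pnorm_sq, pnorm_sq, Finset.mul_sum]
  refine Finset.sum_le_sum fun p hp => ?_
  rw [mem_shell] at hp
  have := weight_rpow_le_lev h τ p
  rw [hp] at this
  rw [Real.rpow_zero, one_mul]
  exact mul_le_mul_of_nonneg_right this (sq_nonneg _)

theorem pnorm_zero_shell_le (h : Admissible β θ K₀) (τ : ℝ) (κ : ℕ) (c : ActiveMode P K₀ → ℂ) :
    (2 : ℝ) ^ (4 * κ * τ) * pnorm 0 (shell h P κ) c ^ 2 ≤
      levConst θ K₀ ^ |τ| * pnorm τ (shell h P κ) c ^ 2 := by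
  rw [pnorm_sq, pnorm_sq, Finset.mul_sum, Finset.mul_sum]
  refine Finset.sum_le_sum fun p hp => ?_
  rw [mem_shell] at hp
  have := lev_rpow_le_weight h τ p
  rw [hp] at this
  rw [Real.rpow_zero, one_mul, ← mul_assoc]
  exact mul_le_mul_of_nonneg_right this (sq_nonneg _)

/-- A bound on every shell which loses a power of the frequency gives a bound in Sobolev norms. -/
theorem pnorm_low_le (h : Admissible β θ K₀) (τ a₁ a₂ a₃ : ℝ) : ∃ C > 0, ∀ (k : ℕ)
    (x y₁ y₂ y₃ : ActiveMode P K₀ → ℂ) (K₁ K₂ K₃ : ℝ), 0 ≤ K₁ → 0 ≤ K₂ → 0 ≤ K₃ →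
    (∀ κ ≤ k, pnorm 0 (shell h P κ) x ≤
      K₁ * (2 : ℝ) ^ (2 * κ * a₁) * pnorm 0 (shell h P κ) y₁ +
      K₂ * (2 : ℝ) ^ (2 * κ * a₂) * pnorm 0 (shell h P κ) y₂ +
      K₃ * (2 : ℝ) ^ (2 * κ * a₃) * pnorm 0 (shell h P κ) y₃) →
    pnorm τ (low h P k) x ≤ C * (K₁ * pnorm (τ + a₁) (low h P k) y₁ +
      K₂ * pnorm (τ + a₂) (low h P k) y₂ + K₃ * pnorm (τ + a₃) (low h P k) y₃) := by
  have hL := one_le_levConst h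
  set L := levConst θ K₀
  have hLp : ∀ t : ℝ, 0 < L ^ t := fun t => Real.rpow_pos_of_pos (by linarith) t
  have hL1 : ∀ t : ℝ, 1 ≤ L ^ |t| := fun t => Real.one_le_rpow hL (abs_nonneg t)
  set D := 3 * L ^ |τ| * (L ^ |τ + a₁| + L ^ |τ + a₂| + L ^ |τ + a₃|) with hD
  have hDpos : 0 < D := by
    have := hLp |τ|; have := hLp |τ + a₁|; have := hLp |τ + a₂|; have := hLp |τ + a₃|
    positivity
  refine ⟨Real.sqrt D, Real.sqrt_pos.2 hDpos, fun k x y₁ y₂ y₃ K₁ K₂ K₃ h1 h2 h3 hx => ?_⟩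
  have n1 := pnorm_nonneg (τ + a₁) (low h P k) y₁
  have n2 := pnorm_nonneg (τ + a₂) (low h P k) y₂
  have n3 := pnorm_nonneg (τ + a₃) (low h P k) y₃
  have shell_sum : ∀ (t : ℝ) (c : ActiveMode P K₀ → ℂ), pnorm t (low h P k) c ^ 2 =
      ∑ κ ∈ Finset.range (k + 1), pnorm t (shell h P κ) c ^ 2 := by
    intro t c
    rw [pnorm_sq, sum_low]
    exact Finset.sum_congr rfl fun κ _ => (pnorm_sq _ _ _).symm
  have hsq : pnorm τ (low h P k) x ^ 2 ≤ D * (K₁ ^ 2 * pnorm (τ + a₁) (low h P k) y₁ ^ 2 +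
      K₂ ^ 2 * pnorm (τ + a₂) (low h P k) y₂ ^ 2 + K₃ ^ 2 * pnorm (τ + a₃) (low h P k) y₃ ^ 2) := by
    simp only [shell_sum, Finset.mul_sum, ← Finset.sum_add_distrib]
    refine Finset.sum_le_sum fun κ hκ => ?_
    have hκ' : κ ≤ k := by have := Finset.mem_range.1 hκ; omega
    have e1 := pnorm_shell_le h τ κ x
    have e2 := hx κ hκ'
    have term : ∀ (a K : ℝ) (y : ActiveMode P K₀ → ℂ), (2 : ℝ) ^ (4 * κ * τ) *
        (K * (2 : ℝ) ^ (2 * κ * a) * pnorm 0 (shell h P κ) y) ^ 2 ≤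
        L ^ |τ + a| * (K ^ 2 * pnorm (τ + a) (shell h P κ) y ^ 2) := by
      intro a K y
      have e3 := mul_le_mul_of_nonneg_left (pnorm_zero_shell_le h (τ + a) κ y) (sq_nonneg K)
      -- The norms are square roots of sums with weights near `2 ^ (4 κ τ)`, so a factor `2 ^ (2 κ
      -- a)` on a shell amounts to exactly `a` orders.
      have e4 : (2 : ℝ) ^ (4 * κ * (τ + a)) = (2 : ℝ) ^ (4 * κ * τ) * ((2 : ℝ) ^ (2 * κ * a)) ^ 2 := by
        rw [← Real.rpow_natCast, ← Real.rpow_mul (by norm_num), ← Real.rpow_add (by norm_num)]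
        congr 1
        push_cast
        ring
      rw [e4] at e3
      calc _ = K ^ 2 * ((2 : ℝ) ^ (4 * κ * τ) * ((2 : ℝ) ^ (2 * κ * a)) ^ 2 *
            pnorm 0 (shell h P κ) y ^ 2) := by ring
        _ ≤ _ := e3
        _ = _ := by ring
    have t1 := term a₁ K₁ y₁
    have t2 := term a₂ K₂ y₂
    have t3 := term a₃ K₃ y₃
    have e5 := pow_le_pow_left₀ (pnorm_nonneg _ _ _) e2 2
    set z₁ := K₁ * (2 : ℝ) ^ (2 * κ * a₁) * pnorm 0 (shell h P κ) y₁
    set z₂ := K₂ * (2 : ℝ) ^ (2 * κ * a₂) * pnorm 0 (shell h P κ) y₂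
    set z₃ := K₃ * (2 : ℝ) ^ (2 * κ * a₃) * pnorm 0 (shell h P κ) y₃
    have e6 : (z₁ + z₂ + z₃) ^ 2 ≤ 3 * (z₁ ^ 2 + z₂ ^ 2 + z₃ ^ 2) := by
      nlinarith [sq_nonneg (z₁ - z₂), sq_nonneg (z₁ - z₃), sq_nonneg (z₂ - z₃)]
    have hp : 0 < (2 : ℝ) ^ (4 * κ * τ) := Real.rpow_pos_of_pos (by norm_num) _
    have e7 := mul_le_mul_of_nonneg_left (e5.trans e6) hp.le
    have s1 : 0 ≤ K₁ ^ 2 * pnorm (τ + a₁) (shell h P κ) y₁ ^ 2 := by positivity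
    have s2 : 0 ≤ K₂ ^ 2 * pnorm (τ + a₂) (shell h P κ) y₂ ^ 2 := by positivity
    have s3 : 0 ≤ K₃ ^ 2 * pnorm (τ + a₃) (shell h P κ) y₃ ^ 2 := by positivity
    have l1 := hLp |τ + a₁|
    have l2 := hLp |τ + a₂|
    have l3 := hLp |τ + a₃|
    have e8 : (2 : ℝ) ^ (4 * κ * τ) * pnorm 0 (shell h P κ) x ^ 2 ≤
        3 * (L ^ |τ + a₁| + L ^ |τ + a₂| + L ^ |τ + a₃|) *
        (K₁ ^ 2 * pnorm (τ + a₁) (shell h P κ) y₁ ^ 2 + K₂ ^ 2 * pnorm (τ + a₂) (shell h P κ) y₂ ^ 2 +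
          K₃ ^ 2 * pnorm (τ + a₃) (shell h P κ) y₃ ^ 2) := by
      have := mul_nonneg l1.le s2; have := mul_nonneg l1.le s3
      have := mul_nonneg l2.le s1; have := mul_nonneg l2.le s3
      have := mul_nonneg l3.le s1; have := mul_nonneg l3.le s2
      linarith
    have e9 := mul_le_mul_of_nonneg_left e8 (hLp |τ|).le
    rw [hD]
    linarith
  refine abs_le_of_sq_le_sq' (hsq.trans ?_) (by positivity) |>.2
  rw [mul_pow, Real.sq_sqrt hDpos.le]
  refine mul_le_mul_of_nonneg_left ?_ hDpos.le
  have p1 := mul_nonneg h1 n1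
  have p2 := mul_nonneg h2 n2
  have p3 := mul_nonneg h3 n3
  nlinarith [mul_nonneg p1 p2, mul_nonneg p1 p3, mul_nonneg p2 p3]

/-! Operators with off-diagonal decay -/

/-- The lattice has rank `d` and the exponent is `d + 1 > d`, so the general summability of negative
powers of the norm over a lattice applies. -/
theorem summable_jap_rpow (d : ℕ) :
    Summable fun n : Fin d → ℤ => jap n ^ (-((d + 1 : ℕ) : ℝ)) := by
  let b := (EuclideanSpace.basisFun (Fin d) ℝ).toBasis
  let L : Submodule ℤ (EuclideanSpace ℝ (Fin d)) := Submodule.span ℤ (Set.range b)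
  have hrank : Module.finrank ℤ L = d := by
    rw [ZLattice.rank ℝ L]
    simp
  have hmem : ∀ n : Fin d → ℤ,
      (WithLp.toLp 2 fun i => (n i : ℝ) : EuclideanSpace ℝ (Fin d)) ∈ L := by
    intro n
    refine (Module.Basis.mem_span_iff_repr_mem ℤ b _).2 fun i => ⟨n i, ?_⟩
    simp [b]
  have h1 := ZLattice.summable_norm_rpow L (-((d + 1 : ℕ) : ℝ)) (by rw [hrank]; push_cast; linarith)
  have hinj : Function.Injective fun n : Fin d → ℤ => (⟨_, hmem n⟩ : L) := by
    intro n n' hn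
    funext i
    have := congrArg (fun z : L => (z : EuclideanSpace ℝ (Fin d)) i) hn
    simpa using this
  have h2 := h1.comp_injective hinj
  refine Summable.of_norm_bounded_eventually h2 ?_
  -- The origin is set apart: there the negative power of the norm takes the default value `0` and
  -- cannot dominate.
  have hfin : ({0} : Set (Fin d → ℤ)).Finite := Set.finite_singleton 0
  filter_upwards [hfin.compl_mem_cofinite] with n hn
  have hn0 : n ≠ 0 := hn
  have hlen : 0 < len n := by
    rcases (len_nonneg n).lt_or_eq with h | h
    · exact h
    · exfalso
      refine hn0 (funext fun i => ?_)
      have := abs_le_len n i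
      rw [← h] at this
      exact_mod_cast abs_nonpos_iff.1 this
  rw [Real.norm_of_nonneg (Real.rpow_nonneg (jap_pos n).le _)]
  refine (Real.rpow_le_rpow_of_nonpos hlen (len_le_jap n) ?_).trans (le_of_eq ?_)
  · have : (0 : ℝ) ≤ ((d + 1 : ℕ) : ℝ) := Nat.cast_nonneg _
    linarith
  · simp [len_eq_norm]

open Classical in
/-- The decay away from the diagonal. -/
def decay (n n' : Fin d → ℤ) : ℝ :=
  jap (n - n') ^ (-((d + 1 : ℕ) : ℝ)) * (if len (n - n') ≤ (len n + len n') / 10 then 1 else 0)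

theorem decay_nonneg (n n' : Fin d → ℤ) : 0 ≤ decay n n' := by
  unfold decay
  have := Real.rpow_nonneg (jap_pos (n - n')).le (-((d + 1 : ℕ) : ℝ))
  split_ifs <;> simp only [mul_one, mul_zero, le_refl, this]

theorem decay_comm (n n' : Fin d → ℤ) : decay n n' = decay n' n := by
  unfold decay
  rw [jap_sub_comm, len_sub_comm, add_comm (len n)]

theorem decay_le (n n' : Fin d → ℤ) : decay n n' ≤ jap (n - n') ^ (-((d + 1 : ℕ) : ℝ)) := by
  unfold decay
  have := Real.rpow_nonneg (jap_pos (n - n')).le (-((d + 1 : ℕ) : ℝ))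
  split_ifs <;> simp only [mul_one, mul_zero, le_refl, this]

theorem decay_eq_zero {n n' : Fin d → ℤ} (h : ¬ len (n - n') ≤ (len n + len n') / 10) :
    decay n n' = 0 := by
  simp [decay, h]

/-- The `L²` bounds with constant `K` and decay away from the diagonal for an operator. -/
def DecayBdd (K : ℝ) (a : FOp P K₀) : Prop :=
  ∀ (n n' : Fin d → ℤ) (S S' : Finset (ActiveMode P K₀)), (∀ p ∈ S, p.space = n) →
    (∀ p ∈ S', p.space = n') → ∀ x y : ActiveMode P K₀ → ℂ,
      ‖∑ p ∈ S, ∑ p' ∈ S', x p * a p p' * y p'‖ ≤ K * decay n n' * pnorm 0 S x * pnorm 0 S' y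

theorem DecayBdd.mono {K K' : ℝ} {a : FOp P K₀} (h : DecayBdd K a) (hK : K ≤ K') :
    DecayBdd K' a := by
  intro n n' S S' hS hS' x y
  refine (h n n' S S' hS hS' x y).trans ?_
  have h1 := decay_nonneg n n'
  have h2 := pnorm_nonneg 0 S x
  have h3 := pnorm_nonneg 0 S' y
  gcongr

theorem DecayBdd.add {K K' : ℝ} {a a' : FOp P K₀} (h : DecayBdd K a) (h' : DecayBdd K' a') :
    DecayBdd (K + K') (a + a') := by
  intro n n' S S' hS hS' x y
  have e : ∑ p ∈ S, ∑ p' ∈ S', x p * (a + a') p p' * y p' =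
      ∑ p ∈ S, ∑ p' ∈ S', x p * a p p' * y p' + ∑ p ∈ S, ∑ p' ∈ S', x p * a' p p' * y p' := by
    simp only [← Finset.sum_add_distrib]
    refine Finset.sum_congr rfl fun p _ => Finset.sum_congr rfl fun p' _ => ?_
    simp only [Pi.add_apply]
    ring
  rw [e]
  refine (norm_add_le _ _).trans ?_
  linarith [h n n' S S' hS hS' x y, h' n n' S S' hS hS' x y]

theorem decayBdd_zero : DecayBdd 0 (0 : FOp P K₀) := by
  intro n n' S S' hS hS' x y
  simp

theorem decayBdd_sum {K : ℕ → ℝ} {a : ℕ → FOp P K₀} (T : Finset ℕ)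
    (h : ∀ j ∈ T, DecayBdd (K j) (a j)) : DecayBdd (∑ j ∈ T, K j) (∑ j ∈ T, a j) := by
  classical
  induction T using Finset.induction_on with
  | empty => simpa using decayBdd_zero
  | insert j T hj ih =>
    rw [Finset.sum_insert hj, Finset.sum_insert hj]
    exact (h j (Finset.mem_insert_self _ _)).add
      (ih fun i hi => h i (Finset.mem_insert_of_mem hi))

theorem pnorm_conj (τ : ℝ) (T : Finset (ActiveMode P K₀)) (c : ActiveMode P K₀ → ℂ) :
    pnorm τ T (fun p => (starRingEnd ℂ) (c p)) = pnorm τ T c := by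
  simp [pnorm]

theorem DecayBdd.adj {K : ℝ} {a : FOp P K₀} (h : DecayBdd K a) : DecayBdd K a.adj := by
  intro n n' S S' hS hS' x y
  have h1 := h n' n S' S hS' hS (fun p => (starRingEnd ℂ) (y p)) (fun p => (starRingEnd ℂ) (x p))
  rw [pnorm_conj, pnorm_conj, decay_comm] at h1
  have e : ∑ p ∈ S, ∑ p' ∈ S', x p * a.adj p p' * y p' = (starRingEnd ℂ) (∑ p ∈ S', ∑ p' ∈ S,
      (starRingEnd ℂ) (y p) * a p p' * (starRingEnd ℂ) (x p')) := by
    rw [Finset.sum_comm]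
    simp only [map_sum, map_mul, Complex.conj_conj, FOp.adj]
    refine Finset.sum_congr rfl fun p _ => Finset.sum_congr rfl fun p' _ => ?_
    ring
  rw [e, RCLike.norm_conj]
  linarith

/-- The support condition near the diagonal makes every row finite, so the infinite sums in `act`
are finite and need no convergence argument. -/
theorem DecayBdd.entry_eq_zero {K : ℝ} {a : FOp P K₀} (h : DecayBdd K a) {p p' : ActiveMode P K₀}
    (hp : ¬ len (p.space - p'.space) ≤ (len p.space + len p'.space) / 10) : a p p' = 0 := by
  have h1 := h p.space p'.space {p} {p'} (by simp) (by simp) (fun _ => 1) (fun _ => 1)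
  rw [decay_eq_zero hp] at h1
  simpa using h1

theorem len_le_two_mul {n n' : Fin d → ℤ} (h : len (n - n') ≤ (len n + len n') / 10) :
    len n' ≤ 2 * len n := by
  have h1 := len_le_add_sub n' n
  rw [len_sub_comm] at h1
  linarith [len_nonneg n]

/-- The modes which may interact with a given mode. -/
def nearModes (h : Admissible β θ K₀) (P : BlockPartition d ι β ρ θ) (p : ActiveMode P K₀) :
    Finset (ActiveMode P K₀) := (finite_len_space_le h (2 * len p.space)).toFinset

theorem DecayBdd.entry_eq_zero_of_notMem (ha : Admissible β θ K₀) {K : ℝ} {a : FOp P K₀}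
    (h : DecayBdd K a) {p p' : ActiveMode P K₀} (hp : p' ∉ nearModes ha P p) : a p p' = 0 := by
  refine h.entry_eq_zero fun h1 => hp ?_
  simpa [nearModes] using len_le_two_mul h1

theorem act_eq_sum {a : FOp P K₀} {p : ActiveMode P K₀} {T : Finset (ActiveMode P K₀)}
    (h : ∀ p' ∉ T, a p p' = 0) (w : ActiveMode P K₀ → ℂ) :
    a.act w p = ∑ p' ∈ T, a p p' * w p' :=
  tsum_eq_sum fun p' hp' => by rw [h p' hp', zero_mul]

/-- The Schur test for the decay away from the diagonal. -/
theorem sum_decay_mul_le (S : Finset (Fin d → ℤ)) (x y : (Fin d → ℤ) → ℝ) :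
    ∑ n ∈ S, ∑ n' ∈ S, decay n n' * x n * y n' ≤
      (∑' n : Fin d → ℤ, jap n ^ (-((d + 1 : ℕ) : ℝ))) *
        (Real.sqrt (∑ n ∈ S, x n ^ 2) * Real.sqrt (∑ n ∈ S, y n ^ 2)) := by
  set J := ∑' n : Fin d → ℤ, jap n ^ (-((d + 1 : ℕ) : ℝ)) with hJ
  have hJ0 : 0 ≤ J := tsum_nonneg fun n => Real.rpow_nonneg (jap_pos n).le _
  have hrow : ∀ n, ∑ n' ∈ S, decay n n' ≤ J := by
    intro n
    have hs : Summable fun n' : Fin d → ℤ => jap (n - n') ^ (-((d + 1 : ℕ) : ℝ)) :=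
      (Equiv.subLeft n).summable_iff.2 (summable_jap_rpow d)
    have he : ∑' n' : Fin d → ℤ, jap (n - n') ^ (-((d + 1 : ℕ) : ℝ)) = J :=
      (Equiv.subLeft n).tsum_eq fun n : Fin d → ℤ => jap n ^ (-((d + 1 : ℕ) : ℝ))
    rw [← he]
    exact (Finset.sum_le_sum fun n' _ => decay_le n n').trans
      (hs.sum_le_tsum S fun n' _ => Real.rpow_nonneg (jap_pos _).le _)
  have hsq : ∀ z : (Fin d → ℤ) → ℝ, ∑ q ∈ S ×ˢ S, (Real.sqrt (decay q.1 q.2) * z q.1) ^ 2 ≤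
      J * ∑ n ∈ S, z n ^ 2 := by
    intro z
    rw [Finset.sum_product, Finset.mul_sum]
    refine Finset.sum_le_sum fun n _ => ?_
    simp only [mul_pow, Real.sq_sqrt (decay_nonneg _ _)]
    rw [← Finset.sum_mul]
    exact mul_le_mul_of_nonneg_right (hrow n) (sq_nonneg _)
  have hsq' : ∑ q ∈ S ×ˢ S, (Real.sqrt (decay q.1 q.2) * y q.2) ^ 2 ≤ J * ∑ n ∈ S, y n ^ 2 := by
    refine le_trans (le_of_eq ?_) (hsq y)
    rw [Finset.sum_product, Finset.sum_product_right]
    refine Finset.sum_congr rfl fun n _ => Finset.sum_congr rfl fun n' _ => ?_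
    dsimp only
    rw [decay_comm]
  have h1 := Real.sum_mul_le_sqrt_mul_sqrt (S ×ˢ S)
    (fun q => Real.sqrt (decay q.1 q.2) * x q.1) (fun q => Real.sqrt (decay q.1 q.2) * y q.2)
  have h2 : ∑ n ∈ S, ∑ n' ∈ S, decay n n' * x n * y n' = ∑ q ∈ S ×ˢ S,
      Real.sqrt (decay q.1 q.2) * x q.1 * (Real.sqrt (decay q.1 q.2) * y q.2) := by
    rw [Finset.sum_product]
    refine Finset.sum_congr rfl fun n _ => Finset.sum_congr rfl fun n' _ => ?_
    have := Real.mul_self_sqrt (decay_nonneg n n')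
    linear_combination (-x n * y n') * this
  rw [h2]
  refine h1.trans ?_
  refine (mul_le_mul (Real.sqrt_le_sqrt (hsq x)) (Real.sqrt_le_sqrt hsq') (Real.sqrt_nonneg _)
    (Real.sqrt_nonneg _)).trans (le_of_eq ?_)
  rw [Real.sqrt_mul hJ0, Real.sqrt_mul hJ0]
  have := Real.mul_self_sqrt hJ0
  linear_combination (Real.sqrt (∑ n ∈ S, x n ^ 2) * Real.sqrt (∑ n ∈ S, y n ^ 2)) * this

open Classical in
/-- Operators with off-diagonal decay are bounded on all the Sobolev spaces. -/
theorem DecayBdd.exists_bilin_le (h : Admissible β θ K₀) (P : BlockPartition d ι β ρ θ) (τ : ℝ) :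
    ∃ C > 0, ∀ (K : ℝ) (a : FOp P K₀), 0 ≤ K → DecayBdd K a →
      ∀ (T T' : Finset (ActiveMode P K₀)) (x y : ActiveMode P K₀ → ℂ),
        ‖∑ p ∈ T, ∑ p' ∈ T', x p * a p p' * y p'‖ ≤
          C * K * pnorm (-τ) T x * pnorm τ T' y := by
  obtain ⟨C, hC, hw⟩ := weight_rpow_le_of_near (P := P) h τ
  set J := ∑' n : Fin d → ℤ, jap n ^ (-((d + 1 : ℕ) : ℝ)) with hJ
  have hJ0 : 0 ≤ J := tsum_nonneg fun n => Real.rpow_nonneg (jap_pos n).le _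
  -- The `1` is there because only `0 ≤ J` is known and the constant has to be positive.
  refine ⟨Real.sqrt C * J + 1, by positivity, fun K a hK ha T T' x y => ?_⟩
  set S := (T ∪ T').image ActiveMode.space with hS
  have hT : ∀ p ∈ T, p.space ∈ S := fun p hp =>
    Finset.mem_image_of_mem _ (Finset.mem_union_left _ hp)
  have hT' : ∀ p ∈ T', p.space ∈ S := fun p hp =>
    Finset.mem_image_of_mem _ (Finset.mem_union_right _ hp)
  let X : (Fin d → ℤ) → ℝ := fun n => pnorm (-τ) (T.filter fun p => p.space = n) x
  let Y : (Fin d → ℤ) → ℝ := fun n => pnorm τ (T'.filter fun p => p.space = n) y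
  have hX : ∑ n ∈ S, X n ^ 2 = pnorm (-τ) T x ^ 2 := by
    rw [pnorm_sq, ← Finset.sum_fiberwise_of_maps_to hT]
    exact Finset.sum_congr rfl fun n _ => pnorm_sq _ _ _
  have hY : ∑ n ∈ S, Y n ^ 2 = pnorm τ T' y ^ 2 := by
    rw [pnorm_sq, ← Finset.sum_fiberwise_of_maps_to hT']
    exact Finset.sum_congr rfl fun n _ => pnorm_sq _ _ _
  have hsplit : ∑ p ∈ T, ∑ p' ∈ T', x p * a p p' * y p' = ∑ n ∈ S, ∑ n' ∈ S,
      ∑ p ∈ T.filter (fun p => p.space = n), ∑ p' ∈ T'.filter (fun p => p.space = n'),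
        x p * a p p' * y p' := by
    rw [← Finset.sum_fiberwise_of_maps_to hT]
    refine Finset.sum_congr rfl fun n _ => ?_
    refine Eq.trans ?_ Finset.sum_comm
    exact Finset.sum_congr rfl fun p _ =>
      (Finset.sum_fiberwise_of_maps_to hT' fun p' => x p * a p p' * y p').symm
  -- Where the decay does not vanish the two space frequencies are close, hence the weights
  -- comparable, and the `L²` bound can be reweighted to orders `-τ` and `τ` at the cost of `√C`.
  -- Elsewhere both sides are `0`.
  have hprod : ∀ n n', decay n n' * (pnorm 0 (T.filter fun p => p.space = n) x *
      pnorm 0 (T'.filter fun p => p.space = n') y) ≤ decay n n' * (Real.sqrt C * (X n * Y n')) := by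
    intro n n'
    by_cases hn : len (n - n') ≤ (len n + len n') / 10
    · refine mul_le_mul_of_nonneg_left ?_ (decay_nonneg n n')
      have hXY : 0 ≤ X n * Y n' := mul_nonneg (pnorm_nonneg _ _ _) (pnorm_nonneg _ _ _)
      refine abs_le_of_sq_le_sq' ?_ (mul_nonneg (Real.sqrt_nonneg _) hXY) |>.2
      rw [mul_pow, mul_pow, mul_pow, Real.sq_sqrt hC.le, pnorm_sq, pnorm_sq, pnorm_sq, pnorm_sq,
        Finset.sum_mul_sum, Finset.sum_mul_sum, Finset.mul_sum]
      refine Finset.sum_le_sum fun p hp => ?_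
      rw [Finset.mul_sum]
      refine Finset.sum_le_sum fun p' hp' => ?_
      have e1 := (Finset.mem_filter.1 hp).2
      have e2 := (Finset.mem_filter.1 hp').2
      have e3 := hw p p' (by rw [e1, e2]; exact hn)
      have e4 := Real.rpow_pos_of_pos p.weight_pos τ
      have e5 : 1 ≤ C * (p.weight ^ (-τ) * p'.weight ^ τ) := by
        rw [Real.rpow_neg p.weight_pos.le]
        have := mul_le_mul_of_nonneg_left e3 (inv_nonneg.2 e4.le)
        rw [inv_mul_cancel₀ e4.ne'] at this
        linarith
      have e6 := mul_le_mul_of_nonneg_right e5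
        (by positivity : 0 ≤ ‖x p‖ ^ 2 * ‖y p'‖ ^ 2)
      rw [Real.rpow_zero, Real.rpow_zero]
      linarith
    · rw [decay_eq_zero hn]
      simp
  have hschur := sum_decay_mul_le S X Y
  rw [hX, hY, Real.sqrt_sq (pnorm_nonneg _ _ _), Real.sqrt_sq (pnorm_nonneg _ _ _), ← hJ] at hschur
  have n1 := pnorm_nonneg (-τ) T x
  have n2 := pnorm_nonneg τ T' y
  rw [hsplit]
  calc _ ≤ ∑ n ∈ S, ∑ n' ∈ S, K * Real.sqrt C * (decay n n' * X n * Y n') := by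
        refine (norm_sum_le _ _).trans (Finset.sum_le_sum fun n _ => ?_)
        refine (norm_sum_le _ _).trans (Finset.sum_le_sum fun n' _ => ?_)
        refine (ha n n' _ _ (fun p hp => (Finset.mem_filter.1 hp).2)
          (fun p hp => (Finset.mem_filter.1 hp).2) x y).trans ?_
        have := mul_le_mul_of_nonneg_left (hprod n n') hK
        linarith
    _ = K * Real.sqrt C * ∑ n ∈ S, ∑ n' ∈ S, decay n n' * X n * Y n' := by
        simp only [Finset.mul_sum]
    _ ≤ K * Real.sqrt C * (J * (pnorm (-τ) T x * pnorm τ T' y)) :=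
        mul_le_mul_of_nonneg_left hschur (by positivity)
    _ ≤ _ := by
        have : 0 ≤ K * (pnorm (-τ) T x * pnorm τ T' y) := by positivity
        linarith

/-- Operators with off-diagonal decay are bounded on all the Sobolev spaces. -/
theorem DecayBdd.exists_act_le (h : Admissible β θ K₀) (P : BlockPartition d ι β ρ θ) (τ : ℝ) :
    ∃ C > 0, ∀ (K : ℝ) (a : FOp P K₀), 0 ≤ K → DecayBdd K a →
      ∀ (c : ActiveMode P K₀ → ℂ) (B : ℝ), SobBdd τ c B → SobBdd τ (a.act c) (C * K * B) := by
  classical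
  obtain ⟨C, hC, hb⟩ := DecayBdd.exists_bilin_le h P τ
  refine ⟨C, hC, fun K a hK ha c B hc T => ?_⟩
  have hB := hc.nonneg
  refine pnorm_le_of_dual (by positivity) fun x => ?_
  set T' := T.biUnion (nearModes h P)
  have e : ∑ p ∈ T, x p * a.act c p = ∑ p ∈ T, ∑ p' ∈ T', x p * a p p' * c p' := by
    refine Finset.sum_congr rfl fun p hp => ?_
    rw [act_eq_sum (T := T') fun p' hp' => ha.entry_eq_zero_of_notMem h fun h1 =>
      hp' (Finset.mem_biUnion.2 ⟨p, hp, h1⟩), Finset.mul_sum]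
    exact Finset.sum_congr rfl fun p' _ => by ring
  rw [e]
  refine (hb K a hK ha T T' x c).trans ?_
  have n1 := pnorm_nonneg (-τ) T x
  calc C * K * pnorm (-τ) T x * pnorm τ T' c ≤ C * K * pnorm (-τ) T x * B :=
        mul_le_mul_of_nonneg_left (hc T') (by positivity)
    _ = _ := by ring

/-- Valid for arbitrary sequences `c`, since both rows are supported in one finite set of modes. -/
theorem act_sub_of_decayBdd (h : Admissible β θ K₀) {K K' : ℝ} {a a' : FOp P K₀}
    (ha : DecayBdd K a) (ha' : DecayBdd K' a') (c : ActiveMode P K₀ → ℂ) (p : ActiveMode P K₀) :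
    (a - a').act c p = a.act c p - a'.act c p := by
  rw [act_eq_sum fun p' hp' => ha.entry_eq_zero_of_notMem h hp',
    act_eq_sum fun p' hp' => ha'.entry_eq_zero_of_notMem h hp',
    act_eq_sum (a := a - a') (T := nearModes h P p) fun p' hp' => ?_, ← Finset.sum_sub_distrib]
  · exact Finset.sum_congr rfl fun p' _ => by simp [sub_mul]
  · simp [ha.entry_eq_zero_of_notMem h hp', ha'.entry_eq_zero_of_notMem h hp']

theorem act_fun_sub_of_decayBdd (h : Admissible β θ K₀) {K : ℝ} {a : FOp P K₀}
    (ha : DecayBdd K a) (c c' : ActiveMode P K₀ → ℂ) (p : ActiveMode P K₀) :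
    a.act (fun p => c p - c' p) p = a.act c p - a.act c' p := by
  simp only [act_eq_sum fun p' hp' => ha.entry_eq_zero_of_notMem h hp', ← Finset.sum_sub_distrib,
    mul_sub]

/-! Reality -/

/-- Conjugate the sum and reindex it by `p' ↦ -p'`. -/
theorem FOp.IsReal.act {a : FOp P K₀} (ha : a.IsReal) {c : ActiveMode P K₀ → ℂ}
    (hc : IsRealSeq c) : IsRealSeq (a.act c) := by
  intro p
  unfold FOp.act
  rw [Complex.conj_tsum, ← (Equiv.neg (ActiveMode P K₀)).tsum_eq]
  refine tsum_congr fun p' => ?_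
  rw [map_mul, Equiv.neg_apply, ha p p', hc p']

theorem FOp.IsReal.adj {a : FOp P K₀} (ha : a.IsReal) : a.adj.IsReal := by
  intro p p'
  simp only [FOp.adj, ha p' p]

theorem IsRealSeq.idAdd {ε : ℝ} {a : FOp P K₀} (ha : a.IsReal) {c : ActiveMode P K₀ → ℂ}
    (hc : IsRealSeq c) : IsRealSeq (FOp.idAdd ε a c) := by
  intro p
  simp only [FOp.idAdd, map_add, map_mul, Complex.conj_ofReal, hc p, ha.act hc p]

theorem FOp.IsReal.sum {a : ℕ → FOp P K₀} (T : Finset ℕ) (h : ∀ j ∈ T, (a j).IsReal) :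
    (∑ j ∈ T, a j).IsReal := by
  intro p p'
  simp only [Finset.sum_apply, map_sum]
  exact Finset.sum_congr rfl fun j hj => h j hj p p'

/-! Calculus along curves -/

theorem uniqueDiffOn_interval : UniqueDiffOn ℝ (Icc (1 : ℝ) 2) := uniqueDiffOn_Icc (by norm_num)

section Calculus

variable {X Y : Type*} [NormedAddCommGroup X] [NormedSpace ℝ X] [NormedAddCommGroup Y]
  [NormedSpace ℝ Y]

theorem contDiffOn_one_of_hasDerivWithinAt {f f' : ℝ → Y}
    (h : ∀ ω ∈ Icc (1 : ℝ) 2, HasDerivWithinAt f (f' ω) (Icc 1 2) ω)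
    (hc : ContinuousOn f' (Icc 1 2)) : ContDiffOn ℝ 1 f (Icc 1 2) := by
  rw [contDiffOn_one_iff_derivWithin uniqueDiffOn_interval]
  refine ⟨fun ω hω => (h ω hω).differentiableWithinAt, hc.congr fun ω hω => ?_⟩
  exact (h ω hω).derivWithin (uniqueDiffOn_interval ω hω)

theorem hasDerivWithinAt_of_contDiffOn_one {f : ℝ → Y} (h : ContDiffOn ℝ 1 f (Icc 1 2)) {ω : ℝ}
    (hω : ω ∈ Icc (1 : ℝ) 2) :
    HasDerivWithinAt f (derivWithin f (Icc 1 2) ω) (Icc 1 2) ω :=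
  ((contDiffOn_one_iff_derivWithin uniqueDiffOn_interval).1 h).1 ω hω |>.hasDerivWithinAt

theorem continuousOn_derivWithin_of_contDiffOn_one {f : ℝ → Y} (h : ContDiffOn ℝ 1 f (Icc 1 2)) :
    ContinuousOn (derivWithin f (Icc 1 2)) (Icc 1 2) :=
  ((contDiffOn_one_iff_derivWithin uniqueDiffOn_interval).1 h).2

/-- The derivative of a Lipschitz curve is bounded by the Lipschitz constant. -/
theorem norm_le_of_hasDerivWithinAt_of_lip {f : ℝ → Y} {f' : Y} {ω L : ℝ}
    (hω : ω ∈ Icc (1 : ℝ) 2) (h : HasDerivWithinAt f f' (Icc 1 2) ω)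
    (hL : ∀ x ∈ Icc (1 : ℝ) 2, ‖f x - f ω‖ ≤ L * |x - ω|) : ‖f'‖ ≤ L := by
  have h1 := (hasDerivWithinAt_iff_tendsto_slope.1 h).norm
  have hne : (𝓝[Icc 1 2 \ {ω}] ω).NeBot := by
    rw [← accPt_principal_iff_nhdsWithin]
    exact uniqueDiffWithinAt_iff_accPt.1 (uniqueDiffOn_interval ω hω)
  refine le_of_tendsto h1 ?_
  filter_upwards [self_mem_nhdsWithin] with x hx
  have hx0 : 0 < |x - ω| := abs_pos.2 (sub_ne_zero.2 hx.2)
  rw [slope_def_module, norm_smul, norm_inv, Real.norm_eq_abs, inv_mul_le_iff₀ hx0, mul_comm]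
  exact hL x hx.1

/-- The mean value inequality for the difference `g v - g u`, whose `ω`-derivative is at most `L *
‖v - u‖`. -/
theorem lip_sub_of_hasDerivWithinAt {g gω : X → ℝ → Y} {u v : X} {L : ℝ}
    (h2 : ∀ w ∈ ({u, v} : Set X), ∀ ω ∈ Icc (1 : ℝ) 2,
      HasDerivWithinAt (g w) (gω w ω) (Icc 1 2) ω)
    (h4 : ∀ ω ∈ Icc (1 : ℝ) 2, ‖gω v ω - gω u ω‖ ≤ L * ‖v - u‖) {ω x : ℝ}
    (hω : ω ∈ Icc (1 : ℝ) 2) (hx : x ∈ Icc (1 : ℝ) 2) :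
    ‖(g v x - g v ω) - (g u x - g u ω)‖ ≤ L * ‖v - u‖ * |x - ω| := by
  have h := (convex_Icc (1 : ℝ) 2).norm_image_sub_le_of_norm_hasDerivWithin_le
    (f := fun y => g v y - g u y) (f' := fun y => gω v y - gω u y)
    (fun y hy => (h2 v (by simp) y hy).sub (h2 u (by simp) y hy)) h4 hω hx
  rw [Real.norm_eq_abs] at h
  refine le_trans (le_of_eq ?_) h
  congr 1
  abel

/-- The composition of a family which is `C¹` in each of its two variables with a curve. -/
theorem contDiffOn_comp_curve {B : Set X} (hB : IsOpen B) {g gω : X → ℝ → Y} {L : ℝ}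
    (h1 : ∀ ω ∈ Icc (1 : ℝ) 2, ContDiffOn ℝ 1 (fun u => g u ω) B)
    (h2 : ∀ u ∈ B, ∀ ω ∈ Icc (1 : ℝ) 2, HasDerivWithinAt (g u) (gω u ω) (Icc 1 2) ω)
    (h3 : ∀ u ∈ B, ContinuousOn (gω u) (Icc 1 2))
    (hL : 0 ≤ L)
    (h4 : ∀ u ∈ B, ∀ v ∈ B, ∀ ω ∈ Icc (1 : ℝ) 2, ‖gω v ω - gω u ω‖ ≤ L * ‖v - u‖)
    {c : ℝ → X} (hc : ContDiffOn ℝ 1 c (Icc 1 2)) (hcB : ∀ ω ∈ Icc (1 : ℝ) 2, c ω ∈ B) :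
    ContDiffOn ℝ 1 (fun ω => g (c ω) ω) (Icc 1 2) := by
  have hlip : ∀ u ∈ B, ∀ v ∈ B, ∀ ω ∈ Icc (1 : ℝ) 2, ∀ x ∈ Icc (1 : ℝ) 2,
      ‖(g v x - g v ω) - (g u x - g u ω)‖ ≤ L * ‖v - u‖ * |x - ω| := by
    intro u hu v hv ω hω x hx
    refine lip_sub_of_hasDerivWithinAt (fun w hw => ?_) (h4 u hu v hv) hω hx
    rcases hw with rfl | hw
    · exact h2 w hu
    · rw [Set.mem_singleton_iff] at hw
      subst hw
      exact h2 w hv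
  have hcc := hc.continuousOn
  have hcn : ∀ ω ∈ Icc (1 : ℝ) 2, Tendsto (fun x => L * ‖c x - c ω‖) (𝓝[Icc 1 2] ω) (𝓝 0) := by
    intro ω hω
    have := ((hcc ω hω).sub_const (c ω)).norm.const_mul L
    simpa using this
  have hdiff : ∀ ω ∈ Icc (1 : ℝ) 2, ∀ u ∈ B, DifferentiableAt ℝ (fun u => g u ω) u :=
    fun ω hω u hu => ((h1 ω hω).differentiableOn (by norm_num)).differentiableAt (hB.mem_nhds hu)
  refine contDiffOn_one_of_hasDerivWithinAt (f' := fun ω =>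
    fderiv ℝ (fun u => g u ω) (c ω) (derivWithin c (Icc 1 2) ω) + gω (c ω) ω) ?_ ?_
  · intro ω hω
    have e1 : HasDerivWithinAt (fun x => g (c x) ω)
        (fderiv ℝ (fun u => g u ω) (c ω) (derivWithin c (Icc 1 2) ω)) (Icc 1 2) ω :=
      (hdiff ω hω (c ω) (hcB ω hω)).hasFDerivAt.comp_hasDerivWithinAt ω
        (hasDerivWithinAt_of_contDiffOn_one hc hω)
    have e2 := h2 (c ω) (hcB ω hω) ω hω
    -- The mixed second difference is at most `L ‖c x - c ω‖ |x - ω|`, hence `o(|x - ω|)` by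
    -- continuity of the curve. This replaces joint differentiability of the family.
    have e3 : HasDerivWithinAt (fun x => (g (c x) x - g (c x) ω) - (g (c ω) x - g (c ω) ω)) 0
        (Icc 1 2) ω := by
      rw [hasDerivWithinAt_iff_isLittleO]
      simp only [sub_self, smul_zero, sub_zero]
      refine Asymptotics.isLittleO_iff.2 fun η hη => ?_
      filter_upwards [self_mem_nhdsWithin, (hcn ω hω).eventually (gt_mem_nhds hη)] with x hx hx'
      refine (hlip _ (hcB ω hω) _ (hcB x hx) ω hω x hx).trans ?_
      exact mul_le_mul_of_nonneg_right hx'.le (abs_nonneg _)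
    have e4 := ((e1.add e2).add e3).sub_const (g (c ω) ω)
    rw [add_zero] at e4
    refine e4.congr_of_eventuallyEq (Eventually.of_forall fun x => ?_) ?_
    · simp only [Pi.add_apply]
      abel
    · simp
  · refine ContinuousOn.add ?_ ?_
    · refine ContinuousOn.clm_apply ?_ (continuousOn_derivWithin_of_contDiffOn_one hc)
      intro ω hω
      have e1 : Tendsto (fun x => fderiv ℝ (fun u => g u ω) (c x)) (𝓝[Icc 1 2] ω)
          (𝓝 (fderiv ℝ (fun u => g u ω) (c ω))) := by
        have e0 := ((h1 ω hω).continuousOn_fderiv_of_isOpen hB (by norm_num))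
        exact (e0.comp hcc hcB) ω hω
      have e2 : Tendsto (fun x => L * |x - ω|) (𝓝[Icc 1 2] ω) (𝓝 0) := by
        have : Tendsto (fun x : ℝ => L * |x - ω|) (𝓝 ω) (𝓝 (L * |ω - ω|)) := by
          apply Continuous.tendsto
          fun_prop
        rw [sub_self, abs_zero, mul_zero] at this
        exact this.mono_left nhdsWithin_le_nhds
      -- The map `v ↦ g v x - g v ω` is Lipschitz with constant `L |x - ω|`, so its derivative is no
      -- larger. Continuity of the derivative in `u` at fixed `ω` is then enough.
      have e3 : Tendsto (fun x => fderiv ℝ (fun u => g u x) (c x) - fderiv ℝ (fun u => g u ω) (c x))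
          (𝓝[Icc 1 2] ω) (𝓝 0) := by
        refine squeeze_zero_norm' ?_ e2
        filter_upwards [self_mem_nhdsWithin] with x hx
        have d1 := ((hdiff x hx _ (hcB x hx)).hasFDerivAt).sub
          ((hdiff ω hω _ (hcB x hx)).hasFDerivAt)
        refine d1.le_of_lip' (by positivity) ?_
        filter_upwards [hB.mem_nhds (hcB x hx)] with v hv
        refine le_trans (le_of_eq ?_) ((hlip _ (hcB x hx) v hv ω hω x hx).trans
          (le_of_eq (by ring)))
        congr 1
      have e4 := e3.add e1
      rw [zero_add] at e4
      exact e4.congr fun x => by abel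
    · intro ω hω
      have e1 := h3 (c ω) (hcB ω hω) ω hω
      have e3 : Tendsto (fun x => gω (c x) x - gω (c ω) x) (𝓝[Icc 1 2] ω) (𝓝 0) := by
        refine squeeze_zero_norm' ?_ (hcn ω hω)
        filter_upwards [self_mem_nhdsWithin] with x hx
        exact h4 _ (hcB ω hω) _ (hcB x hx) x hx
      have e4 := e3.add e1
      rw [zero_add] at e4
      exact e4.congr fun x => by abel

/-- Only the derivative in the direction `u - v` is bounded: in the classes of operators this bound
involves a Sobolev norm of the direction weaker than that of the space. -/
theorem norm_sub_le_of_fderiv_le {B : Set X} (hB : IsOpen B) (hBc : Convex ℝ B) {f : X → Y}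
    (hf : ContDiffOn ℝ 1 f B) {u v : X} (hu : u ∈ B) (hv : v ∈ B) {C : ℝ}
    (hC : ∀ x ∈ B, ‖fderiv ℝ f x (u - v)‖ ≤ C) : ‖f u - f v‖ ≤ C := by
  have hseg : ∀ t ∈ Icc (0 : ℝ) 1, v + t • (u - v) ∈ B := by
    intro t ht
    have := hBc hv hu (sub_nonneg.2 ht.2) ht.1 (by ring)
    convert this using 1
    module
  have hder : ∀ t ∈ Icc (0 : ℝ) 1, HasDerivWithinAt (fun t : ℝ => f (v + t • (u - v)))
      (fderiv ℝ f (v + t • (u - v)) (u - v)) (Icc 0 1) t := by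
    intro t ht
    have e1 := ((hf.differentiableOn (by norm_num)).differentiableAt
      (hB.mem_nhds (hseg t ht))).hasFDerivAt
    have e2 : HasDerivWithinAt (fun t : ℝ => v + t • (u - v)) (u - v) (Icc 0 1) t := by
      have := ((hasDerivWithinAt_id t (Icc 0 1)).smul_const (u - v)).const_add v
      simpa using this
    exact e1.comp_hasDerivWithinAt t e2
  have h := (convex_Icc (0 : ℝ) 1).norm_image_sub_le_of_norm_hasDerivWithin_le hder
    (fun t ht => hC _ (hseg t ht)) (left_mem_Icc.2 zero_le_one) (right_mem_Icc.2 zero_le_one)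
  simpa using h

end Calculus

/-! Derivatives of operators -/

theorem FOp.Bdd.clm_apply_exp {a : FOp P K₀} (h : a.Bdd s s') (p p' : ActiveMode P K₀) :
    ((a.clm s s') (Hs.exp s p')).coeff p = a p p' := h.rep_clm.apply_exp p p'

/-- A matrix entry as a continuous linear form on the bounded operators. -/
def entryL (s s' : ℝ) (p p' : ActiveMode P K₀) : (Hs P K₀ s →L[ℂ] Hs P K₀ s') →L[ℝ] ℂ :=
  ((Hs.coeffL p).comp (ContinuousLinearMap.apply ℂ (Hs P K₀ s') (Hs.exp s p'))).restrictScalars ℝ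

theorem entryL_apply (p p' : ActiveMode P K₀) (T : Hs P K₀ s →L[ℂ] Hs P K₀ s') :
    entryL s s' p p' T = (T (Hs.exp s p')).coeff p := rfl

theorem FOp.Bdd.entryL_clm {a : FOp P K₀} (h : a.Bdd s s') (p p' : ActiveMode P K₀) :
    entryL s s' p p' (a.clm s s') = a p p' := h.clm_apply_exp p p'

/-- The entries are continuous linear forms on bounded operators, so the derivative in operator norm
has the entrywise derivatives as its matrix. This connects `c1` with the bounds assumed for
`dOmega`. -/
theorem derivWithin_clm_eq {a : ℝ → FOp P K₀} {a' : FOp P K₀} {ω : ℝ} (hω : ω ∈ Icc (1 : ℝ) 2)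
    (hd : DifferentiableWithinAt ℝ (fun x => (a x).clm s s') (Icc 1 2) ω)
    (hb : ∀ x ∈ Icc (1 : ℝ) 2, (a x).Bdd s s')
    (he : ∀ p p', a' p p' = derivWithin (fun x => a x p p') (Icc 1 2) ω) :
    derivWithin (fun x => (a x).clm s s') (Icc 1 2) ω = a'.clm s s' := by
  refine (FOp.Rep.clm_eq (FOp.rep_of_apply_exp fun p p' => ?_)).symm
  have h1 := (entryL s s' p p').hasFDerivAt.comp_hasDerivWithinAt ω hd.hasDerivWithinAt
  have h2 : HasDerivWithinAt (fun x => a x p p')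
      (entryL s s' p p' (derivWithin (fun x => (a x).clm s s') (Icc 1 2) ω)) (Icc 1 2) ω :=
    h1.congr (fun x hx => ((hb x hx).entryL_clm p p').symm) ((hb ω hω).entryL_clm p p').symm
  rw [he p p', h2.derivWithin (uniqueDiffOn_interval ω hω), entryL_apply]

theorem contDiffOn_slice {Y : Type*} [NormedAddCommGroup Y] [NormedSpace ℝ Y] {γ ε : ℝ}
    (hε : ε ∈ Icc 0 γ) {f : ℝ × ℝ → Y} (hf : ContDiffOn ℝ 1 f (paramBox γ)) :
    ContDiffOn ℝ 1 (fun ω => f (ω, ε)) (Icc 1 2) :=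
  hf.comp (contDiff_id.prodMk contDiff_const).contDiffOn fun _ hω => ⟨hω, hε⟩

/-! Families of operators -/

theorem sobNorm_nonneg (τ : ℝ) (c : ActiveMode P K₀ → ℂ) : 0 ≤ sobNorm τ c := Real.sqrt_nonneg _

theorem Hs.sobNorm_le (u : Hs P K₀ s) (h : s' ≤ s) : sobNorm s' u.coeff ≤ ‖u‖ :=
  (sobBdd_iff (norm_nonneg _) (u.summable_of_le h)).1 (u.sobBdd.lower h)

theorem Hs.norm_incl (h : s' ≤ s) (u : Hs P K₀ s) : ‖Hs.incl h u‖ = sobNorm s' u.coeff := by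
  rw [Hs.norm_eq, Hs.incl_coeff]

theorem Hs.sobNorm_mono (u : Hs P K₀ s) {τ τ' : ℝ} (h : τ ≤ τ') (h' : τ' ≤ s) :
    sobNorm τ u.coeff ≤ sobNorm τ' u.coeff := by
  rw [← Hs.norm_incl h', ← Hs.incl_coeff h']
  exact Hs.sobNorm_le _ h

open Classical in
/-- The restriction of a sequence to a set of modes. -/
def restr (T : Finset (ActiveMode P K₀)) (c : ActiveMode P K₀ → ℂ) : ActiveMode P K₀ → ℂ :=
  fun p => if p ∈ T then c p else 0

theorem restr_of_mem {T : Finset (ActiveMode P K₀)} {p : ActiveMode P K₀} (hp : p ∈ T)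
    (c : ActiveMode P K₀ → ℂ) : restr T c p = c p := by
  simp [restr, hp]

theorem restr_of_notMem {T : Finset (ActiveMode P K₀)} {p : ActiveMode P K₀} (hp : p ∉ T)
    (c : ActiveMode P K₀ → ℂ) : restr T c p = 0 := by
  simp [restr, hp]

theorem sobBdd_of_support {τ : ℝ} {T : Finset (ActiveMode P K₀)} {c : ActiveMode P K₀ → ℂ}
    (h : ∀ p ∉ T, c p = 0) : SobBdd τ c (pnorm τ T c) := by
  classical
  intro S
  refine Real.sqrt_le_sqrt ?_
  have h1 : ∑ p ∈ S ∩ T, p.weight ^ τ * ‖c p‖ ^ 2 = ∑ p ∈ S, p.weight ^ τ * ‖c p‖ ^ 2 := by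
    refine Finset.sum_subset Finset.inter_subset_left fun p hp hp' => ?_
    rw [h p fun h2 => hp' (Finset.mem_inter.2 ⟨hp, h2⟩)]
    simp
  rw [← h1]
  exact Finset.sum_le_sum_of_subset_of_nonneg Finset.inter_subset_right
    fun p _ _ => pnorm_term_nonneg τ c p

theorem sobBdd_restr (τ : ℝ) (T : Finset (ActiveMode P K₀)) (c : ActiveMode P K₀ → ℂ) :
    SobBdd τ (restr T c) (pnorm τ T c) := by
  have h := sobBdd_of_support (τ := τ) (T := T) (c := restr T c) fun p hp => restr_of_notMem hp c
  rwa [pnorm_congr (c' := c) fun p hp => restr_of_mem hp c] at h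

open Classical in
theorem FOp.between_apply (a : FOp P K₀) (p p' : ActiveMode P K₀) :
    a.between p.space p'.space p p' = a p p' := by
  simp [FOp.between]

/-- Norm bounds between the space frequencies give the bilinear bounds. -/
theorem decayBdd_of_clm {K : ℝ} {a : FOp P K₀}
    (h : ∀ n n', ∃ T : Hs P K₀ 0 →L[ℂ] Hs P K₀ 0,
      (∀ p p', p.space = n → p'.space = n' → (T (Hs.exp 0 p')).coeff p = a p p') ∧
        ‖T‖ ≤ K * decay n n') : DecayBdd K a := by
  classical
  intro n n' S S' hS hS' x y
  obtain ⟨T, hT, hTn⟩ := h n n'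
  set yy : Hs P K₀ 0 := ∑ p' ∈ S', y p' • Hs.exp 0 p' with hyy
  have hcoeff : yy.coeff = restr S' y := by
    funext p
    have : Hs.coeffL p yy = ∑ p' ∈ S', y p' * (Hs.exp 0 p').coeff p := by
      simp [hyy, map_sum]
    rw [Hs.coeffL_apply] at this
    rw [this]
    simp [Hs.coeff_exp, restr]
  have hnorm : ‖yy‖ ≤ pnorm 0 S' y := by
    rw [Hs.norm_le_iff (pnorm_nonneg _ _ _), hcoeff]
    exact sobBdd_restr 0 S' y
  have hTy : ∀ p ∈ S, (T yy).coeff p = ∑ p' ∈ S', a p p' * y p' := by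
    intro p hp
    have : Hs.coeffL p (T yy) = ∑ p' ∈ S', y p' * (T (Hs.exp 0 p')).coeff p := by
      simp [hyy, map_sum]
    rw [Hs.coeffL_apply] at this
    rw [this]
    refine Finset.sum_congr rfl fun p' hp' => ?_
    rw [hT p p' (hS p hp) (hS' p' hp'), mul_comm]
  have e : ∑ p ∈ S, ∑ p' ∈ S', x p * a p p' * y p' = ∑ p ∈ S, x p * (T yy).coeff p := by
    refine Finset.sum_congr rfl fun p hp => ?_
    rw [hTy p hp, Finset.mul_sum]
    exact Finset.sum_congr rfl fun p' _ => by ring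
  rw [e]
  refine (norm_sum_mul_le 0 S x _).trans ?_
  rw [neg_zero]
  have h1 : pnorm 0 S (T yy).coeff ≤ K * decay n n' * pnorm 0 S' y := by
    refine ((T yy).sobBdd S).trans ((T.le_opNorm yy).trans ?_)
    exact mul_le_mul hTn hnorm (norm_nonneg _) ((norm_nonneg _).trans hTn)
  calc _ ≤ pnorm 0 S x * (K * decay n n' * pnorm 0 S' y) :=
        mul_le_mul_of_nonneg_left h1 (pnorm_nonneg _ _ _)
    _ = _ := by ring

/-! ### From symbol classes to operators with off-diagonal decay -/

/-- The properties of the families of order at most `0` which are used in the sequel. -/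
structure DecayFam (q γ K τ₀ : ℝ) (A : Fam P K₀ σ) : Prop where
  bdd : ∀ z ∈ paramBox γ, ∀ u ∈ Metric.ball (0 : Hs P K₀ σ) q, DecayBdd K (A u z)
  lip : ∀ ε ∈ Icc 0 γ, ∀ ω ∈ Icc (1 : ℝ) 2, ∀ ω' ∈ Icc (1 : ℝ) 2,
    ∀ u ∈ Metric.ball (0 : Hs P K₀ σ) q, ∀ v ∈ Metric.ball (0 : Hs P K₀ σ) q,
      DecayBdd (K * (sobNorm τ₀ (u - v).coeff + |ω - ω'|)) (A u (ω, ε) - A v (ω', ε))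
  c1 : ∀ ε ∈ Icc 0 γ, ∀ c : ℝ → Hs P K₀ σ, ContDiffOn ℝ 1 c (Icc 1 2) →
    (∀ ω ∈ Icc (1 : ℝ) 2, c ω ∈ Metric.ball (0 : Hs P K₀ σ) q) → ∀ p p',
      ContDiffOn ℝ 1 (fun ω => A (c ω) (ω, ε) p p') (Icc 1 2)
  real : ∀ z ∈ paramBox γ, ∀ u ∈ Metric.ball (0 : Hs P K₀ σ) q, u.IsReal → (A u z).IsReal

/-- Only `j = 0, 1` and the smallest admissible decay `k = d + 1` are used: it makes the kernel
summable and asks for the weakest norm of the direction. Since `χ ≤ 0`, the factor with the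
frequencies is at most `1`. -/
theorem SigmaBounds.exists_bound {σ₀ χ q γ : ℝ} {N : ℕ} {A : Fam P K₀ σ}
    (h : SigmaBounds σ₀ χ N q γ A) (hχ : χ ≤ 0) (hσ : σ₀ + 2 * N + ((d : ℝ) + 1) / 2 ≤ σ) :
    ∃ C > 0, ∀ z ∈ paramBox γ, ∀ u ∈ Metric.ball (0 : Hs P K₀ σ) q, ∀ n n',
      ‖((A u z).between n n').clm 0 0‖ ≤ C * decay n n' ∧
      ∀ w, ‖fderiv ℝ (fun v => ((A v z).between n n').clm 0 0) u w‖ ≤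
        C * decay n n' * sobNorm (σ₀ + 2 * N + ((d : ℝ) + 1) / 2) w.coeff := by
  have hk : (((d + 1 : ℕ) : ℝ)) / 2 = ((d : ℝ) + 1) / 2 := by push_cast; ring
  obtain ⟨C₀, hC₀, h0⟩ := h.bound (d + 1) 0 hk.ge (by rw [hk]; linarith)
  obtain ⟨C₁, hC₁, h1⟩ := h.bound (d + 1) 1 hk.ge (by rw [hk]; linarith)
  have key : ∀ (C M : ℝ) (n n' : Fin d → ℤ), 0 ≤ C → 0 ≤ M →
      C * (1 + len n + len n') ^ (2 * χ) * jap (n - n') ^ (-((d + 1 : ℕ) : ℝ)) *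
        (open Classical in if len (n - n') ≤ (len n + len n') / 10 then 1 else 0) * M ≤
        C * decay n n' * M := by
    intro C M n n' hC hM
    have e1 : (1 + len n + len n') ^ (2 * χ) ≤ 1 :=
      Real.rpow_le_one_of_one_le_of_nonpos (by linarith [len_nonneg n, len_nonneg n'])
        (by linarith)
    have e2 := decay_nonneg n n'
    have e3 : C * (1 + len n + len n') ^ (2 * χ) * jap (n - n') ^ (-((d + 1 : ℕ) : ℝ)) *
        (open Classical in if len (n - n') ≤ (len n + len n') / 10 then 1 else 0) * M =
        (C * decay n n' * M) * (1 + len n + len n') ^ (2 * χ) := by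
      unfold decay
      ring
    rw [e3]
    exact mul_le_of_le_one_right (by positivity) e1
  refine ⟨C₀ + C₁, by positivity, fun z hz u hu n n' => ⟨?_, fun w => ?_⟩⟩
  · have := h0 z hz u hu (fun i => i.elim0) n n'
    rw [iteratedFDeriv_zero_apply] at this
    simp only [Finset.univ_eq_empty, Finset.prod_empty] at this
    have e := this.trans (key C₀ 1 n n' hC₀.le zero_le_one)
    have e2 := mul_nonneg hC₁.le (decay_nonneg n n')
    linarith
  · have := h1 z hz u hu (fun _ => w) n n'
    rw [iteratedFDeriv_one_apply] at this
    simp only [Finset.univ_unique, Finset.prod_singleton, hk] at this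
    have e := this.trans (key C₁ _ n n' hC₁.le (sobNorm_nonneg _ _))
    have e2 := mul_nonneg (mul_nonneg hC₀.le (decay_nonneg n n'))
      (sobNorm_nonneg (σ₀ + 2 * N + ((d : ℝ) + 1) / 2) w.coeff)
    linarith

theorem ball_contDiffOn_one {q : ℝ} {Y : Type*} [NormedAddCommGroup Y] [NormedSpace ℝ Y]
    {f : Hs P K₀ σ → Y}
    (h : ContDiffOn ℝ ((⊤ : ℕ∞) : WithTop ℕ∞) f (Metric.ball (0 : Hs P K₀ σ) q)) :
    ContDiffOn ℝ 1 f (Metric.ball (0 : Hs P K₀ σ) q) :=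
  h.of_le (by exact_mod_cast le_top)

open Classical in
theorem FOp.between_of_eq (a : FOp P K₀) {n n' : Fin d → ℤ} {p p' : ActiveMode P K₀}
    (hp : p.space = n) (hp' : p'.space = n') : a.between n n' p p' = a p p' := by
  simp [FOp.between, hp, hp']

/-- The `ω`-derivative of the part of a family between two space frequencies. -/
theorem derivWithin_between {A : Fam P K₀ σ} (u : Hs P K₀ σ) (ω ε : ℝ) (n n' : Fin d → ℤ)
    (p p' : ActiveMode P K₀) : (A.dOmega u (ω, ε)).between n n' p p' =
      derivWithin (fun x => (A u (x, ε)).between n n' p p') (Icc 1 2) ω := by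
  unfold FOp.between
  split_ifs
  · rfl
  · simp

/-- Curves of operators whose entries have the derivatives `a'`. -/
theorem hasDerivWithinAt_clm {a a' : ℝ → FOp P K₀}
    (hc : ContDiffOn ℝ 1 (fun x => (a x).clm s s') (Icc 1 2))
    (hb : ∀ x ∈ Icc (1 : ℝ) 2, (a x).Bdd s s')
    (he : ∀ ω ∈ Icc (1 : ℝ) 2, ∀ p p', a' ω p p' = derivWithin (fun x => a x p p') (Icc 1 2) ω) :
    ∀ ω ∈ Icc (1 : ℝ) 2,
      HasDerivWithinAt (fun x => (a x).clm s s') ((a' ω).clm s s') (Icc 1 2) ω := by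
  intro ω hω
  have h1 := hasDerivWithinAt_of_contDiffOn_one hc hω
  rwa [derivWithin_clm_eq hω h1.differentiableWithinAt hb (he ω hω)] at h1

theorem continuousOn_deriv_clm {a a' : ℝ → FOp P K₀}
    (hc : ContDiffOn ℝ 1 (fun x => (a x).clm s s') (Icc 1 2))
    (hb : ∀ x ∈ Icc (1 : ℝ) 2, (a x).Bdd s s')
    (he : ∀ ω ∈ Icc (1 : ℝ) 2, ∀ p p', a' ω p p' = derivWithin (fun x => a x p p') (Icc 1 2) ω) :
    ContinuousOn (fun ω => (a' ω).clm s s') (Icc 1 2) :=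
  (continuousOn_derivWithin_of_contDiffOn_one hc).congr fun ω hω =>
    ((hasDerivWithinAt_clm hc hb he ω hω).derivWithin (uniqueDiffOn_interval ω hω)).symm

theorem norm_clm_sub_le {a a' : ℝ → FOp P K₀} {C : ℝ}
    (hc : ContDiffOn ℝ 1 (fun x => (a x).clm s s') (Icc 1 2))
    (hb : ∀ x ∈ Icc (1 : ℝ) 2, (a x).Bdd s s')
    (he : ∀ ω ∈ Icc (1 : ℝ) 2, ∀ p p', a' ω p p' = derivWithin (fun x => a x p p') (Icc 1 2) ω)
    (hC : ∀ ω ∈ Icc (1 : ℝ) 2, ‖(a' ω).clm s s'‖ ≤ C) {ω ω' : ℝ} (hω : ω ∈ Icc (1 : ℝ) 2)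
    (hω' : ω' ∈ Icc (1 : ℝ) 2) : ‖(a ω).clm s s' - (a ω').clm s s'‖ ≤ C * |ω - ω'| :=
  (convex_Icc (1 : ℝ) 2).norm_image_sub_le_of_norm_hasDerivWithin_le
    (f := fun x => (a x).clm s s') (hasDerivWithinAt_clm hc hb he) hC hω' hω

section

variable {σ₀ χ q γ : ℝ} {N : ℕ} {A : Fam P K₀ σ}

theorem MemSigma.contDiffOn_between (h : MemSigma σ₀ χ N q γ A) {ε : ℝ} (hε : ε ∈ Icc 0 γ)
    {u : Hs P K₀ σ} (hu : u ∈ Metric.ball (0 : Hs P K₀ σ) q) (n n' : Fin d → ℤ) :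
    ContDiffOn ℝ 1 (fun ω => ((A u (ω, ε)).between n n').clm 0 0) (Icc 1 2) :=
  contDiffOn_slice (f := fun z => ((A u z).between n n').clm 0 0) hε (h.c1 u hu n n')

theorem SigmaBounds.lip_between (h : SigmaBounds σ₀ χ N q γ A) {C : ℝ} {z : ℝ × ℝ}
    (hz : z ∈ paramBox γ) {n n' : Fin d → ℤ} {τ₀ : ℝ}
    (hC : ∀ u ∈ Metric.ball (0 : Hs P K₀ σ) q, ∀ w,
      ‖fderiv ℝ (fun v => ((A v z).between n n').clm 0 0) u w‖ ≤ C * sobNorm τ₀ w.coeff)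
    {u v : Hs P K₀ σ} (hu : u ∈ Metric.ball (0 : Hs P K₀ σ) q)
    (hv : v ∈ Metric.ball (0 : Hs P K₀ σ) q) :
    ‖((A u z).between n n').clm 0 0 - ((A v z).between n n').clm 0 0‖ ≤
      C * sobNorm τ₀ (u - v).coeff :=
  norm_sub_le_of_fderiv_le (f := fun v => ((A v z).between n n').clm 0 0) Metric.isOpen_ball
    (convex_ball 0 q) (ball_contDiffOn_one (h.smooth z hz n n')) hu hv fun x hx => hC x hx _

/-- Composition with a curve in operator norm, followed by the continuous entry form. The Lipschitz
condition on the `ω`-derivative comes from the first derivative bound for `dOmega`. -/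
theorem MemSigma.contDiffOn_entry (h : MemSigma σ₀ χ N q γ A) (hχ : χ ≤ 0)
    (hσ : σ₀ + 2 * N + ((d : ℝ) + 1) / 2 ≤ σ) {ε : ℝ} (hε : ε ∈ Icc 0 γ) {c : ℝ → Hs P K₀ σ}
    (hc : ContDiffOn ℝ 1 c (Icc 1 2))
    (hcB : ∀ ω ∈ Icc (1 : ℝ) 2, c ω ∈ Metric.ball (0 : Hs P K₀ σ) q) (p p' : ActiveMode P K₀) :
    ContDiffOn ℝ 1 (fun ω => A (c ω) (ω, ε) p p') (Icc 1 2) := by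
  obtain ⟨C', hC', hA'⟩ := h.bounds_dOmega.exists_bound hχ hσ
  have hb : ∀ u ∈ Metric.ball (0 : Hs P K₀ σ) q, ∀ x ∈ Icc (1 : ℝ) 2,
      ((A u (x, ε)).between p.space p'.space).Bdd 0 0 :=
    fun u hu x hx => h.bounds.bdd (x, ε) ⟨hx, hε⟩ u hu _ _
  have e := contDiffOn_comp_curve Metric.isOpen_ball
    (g := fun u ω => ((A u (ω, ε)).between p.space p'.space).clm 0 0)
    (gω := fun u ω => ((A.dOmega u (ω, ε)).between p.space p'.space).clm 0 0)
    (L := C' * decay p.space p'.space)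
    (fun ω hω => ball_contDiffOn_one (h.bounds.smooth (ω, ε) ⟨hω, hε⟩ p.space p'.space))
    (fun u hu => hasDerivWithinAt_clm (h.contDiffOn_between hε hu _ _) (hb u hu)
      fun ω _ => derivWithin_between u ω ε _ _)
    (fun u hu => continuousOn_deriv_clm (h.contDiffOn_between hε hu _ _) (hb u hu)
      fun ω _ => derivWithin_between u ω ε _ _)
    (mul_nonneg hC'.le (decay_nonneg _ _))
    (fun u hu v hv ω hω => (h.bounds_dOmega.lip_between ⟨hω, hε⟩
      (fun x hx => (hA' (ω, ε) ⟨hω, hε⟩ x hx p.space p'.space).2) hv hu).trans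
        (mul_le_mul_of_nonneg_left (Hs.sobNorm_le _ hσ) (mul_nonneg hC'.le (decay_nonneg _ _))))
    hc hcB
  have e2 := (entryL 0 0 p p').contDiff.comp_contDiffOn e
  refine e2.congr fun ω hω => ?_
  rw [Function.comp_apply, (hb (c ω) (hcB ω hω) ω hω).entryL_clm, FOp.between_apply]

/-- The Lipschitz bound changes `ω` first, using `dOmega`, and then `u`, using the first derivative.
It keeps the weak norm of `u - v`, which is what later allows curves that are `C¹` only in a lower
order. -/
theorem MemSigma.exists_decayFam (h : MemSigma σ₀ χ N q γ A) (hχ : χ ≤ 0)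
    (hσ : σ₀ + 2 * N + ((d : ℝ) + 1) / 2 ≤ σ) :
    ∃ K > 0, DecayFam q γ K (σ₀ + 2 * N + ((d : ℝ) + 1) / 2) A := by
  obtain ⟨C, hC, hA⟩ := h.bounds.exists_bound hχ hσ
  obtain ⟨C', hC', hA'⟩ := h.bounds_dOmega.exists_bound hχ hσ
  refine ⟨C + C', by positivity, ?_, ?_,
    fun ε hε c hc hcB p p' => h.contDiffOn_entry hχ hσ hε hc hcB p p', h.real⟩
  · intro z hz u hu
    refine DecayBdd.mono (decayBdd_of_clm (K := C) fun n n' =>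
      ⟨((A u z).between n n').clm 0 0, fun p p' hp hp' => ?_, (hA z hz u hu n n').1⟩) (by linarith)
    rw [(h.bounds.bdd z hz u hu n n').clm_apply_exp, FOp.between_of_eq _ hp hp']
  · intro ε hε ω hω ω' hω' u hu v hv
    refine decayBdd_of_clm fun n n' => ⟨((A u (ω, ε)).between n n').clm 0 0 -
      ((A v (ω', ε)).between n n').clm 0 0, fun p p' hp hp' => ?_, ?_⟩
    · rw [sub_apply, Hs.coeff_sub,
        (h.bounds.bdd (ω, ε) ⟨hω, hε⟩ u hu n n').clm_apply_exp,
        (h.bounds.bdd (ω', ε) ⟨hω', hε⟩ v hv n n').clm_apply_exp,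
        FOp.between_of_eq _ hp hp', FOp.between_of_eq _ hp hp']
      rfl
    · have e1 := norm_clm_sub_le (h.contDiffOn_between hε hu n n')
        (fun x hx => h.bounds.bdd (x, ε) ⟨hx, hε⟩ u hu n n')
        (fun ω _ => derivWithin_between u ω ε n n')
        (fun x hx => (hA' (x, ε) ⟨hx, hε⟩ u hu n n').1) hω hω'
      have e2 := h.bounds.lip_between (z := (ω', ε)) ⟨hω', hε⟩
        (fun x hx => (hA (ω', ε) ⟨hω', hε⟩ x hx n n').2) hu hv
      have e3 := norm_sub_le_norm_sub_add_norm_sub (((A u (ω, ε)).between n n').clm 0 0)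
        (((A u (ω', ε)).between n n').clm 0 0) (((A v (ω', ε)).between n n').clm 0 0)
      have e4 := mul_nonneg (mul_nonneg hC.le (decay_nonneg n n')) (abs_nonneg (ω - ω'))
      have e5 := mul_nonneg (mul_nonneg hC'.le (decay_nonneg n n'))
        (sobNorm_nonneg (σ₀ + 2 * N + ((d : ℝ) + 1) / 2) (u - v).coeff)
      refine e3.trans ((add_le_add e1 e2).trans ?_)
      linarith

end

theorem DecayFam.mono {q γ K K' τ₀ τ₀' : ℝ} {A : Fam P K₀ σ} (h : DecayFam q γ K τ₀ A)
    (hK : K ≤ K') (hK0 : 0 ≤ K) (hτ : τ₀ ≤ τ₀') (hσ : τ₀' ≤ σ) : DecayFam q γ K' τ₀' A := by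
  refine ⟨fun z hz u hu => (h.bdd z hz u hu).mono hK, ?_, h.c1, h.real⟩
  intro ε hε ω hω ω' hω' u hu v hv
  refine (h.lip ε hε ω hω ω' hω' u hu v hv).mono ?_
  have e1 := (u - v).sobNorm_mono hτ hσ
  have e2 := sobNorm_nonneg τ₀ (u - v).coeff
  have e3 := abs_nonneg (ω - ω')
  exact mul_le_mul hK (by linarith) (by linarith) (by linarith)

theorem DecayFam.total {q γ τ₀ : ℝ} {N : ℕ} {K : ℕ → ℝ} {A : ℕ → Fam P K₀ σ}
    (h : ∀ j ≤ N, DecayFam q γ (K j) τ₀ (A j)) :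
    DecayFam q γ (∑ j ∈ Finset.range (N + 1), K j) τ₀ (Fam.total N A) := by
  have hj : ∀ j ∈ Finset.range (N + 1), j ≤ N := fun j hj => by
    have := Finset.mem_range.1 hj
    omega
  refine ⟨?_, ?_, ?_, ?_⟩
  · intro z hz u hu
    exact decayBdd_sum _ fun j hj' => (h j (hj j hj')).bdd z hz u hu
  · intro ε hε ω hω ω' hω' u hu v hv
    have := decayBdd_sum (Finset.range (N + 1)) fun j hj' =>
      (h j (hj j hj')).lip ε hε ω hω ω' hω' u hu v hv
    rw [← Finset.sum_mul, Finset.sum_sub_distrib] at this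
    exact this
  · intro ε hε c hc hcB p p'
    have e : (fun ω => Fam.total N A (c ω) (ω, ε) p p') =
        fun ω => ∑ j ∈ Finset.range (N + 1), A j (c ω) (ω, ε) p p' := by
      funext ω
      simp [Fam.total, Finset.sum_apply]
    rw [e]
    exact ContDiffOn.sum fun j hj' => (h j (hj j hj')).c1 ε hε c hc hcB p p'
  · intro z hz u hu hr
    exact FOp.IsReal.sum _ fun j hj' => (h j (hj j hj')).real z hz u hu hr

/-! ### Smoothing families -/

/-- The properties of the smoothing families which are used in the sequel. -/
structure SmoothFam (q γ r τ K : ℝ) (R : Fam P K₀ σ) : Prop where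
  bdd : ∀ z ∈ paramBox γ, ∀ u ∈ Metric.ball (0 : Hs P K₀ σ) q, (R u z).Bdd τ (τ + r)
  norm_le : ∀ z ∈ paramBox γ, ∀ u ∈ Metric.ball (0 : Hs P K₀ σ) q,
    ‖(R u z).clm τ (τ + r)‖ ≤ K
  lip : ∀ ε ∈ Icc 0 γ, ∀ ω ∈ Icc (1 : ℝ) 2, ∀ ω' ∈ Icc (1 : ℝ) 2,
    ∀ u ∈ Metric.ball (0 : Hs P K₀ σ) q, ∀ v ∈ Metric.ball (0 : Hs P K₀ σ) q,
      ‖(R u (ω, ε)).clm τ (τ + r) - (R v (ω', ε)).clm τ (τ + r)‖ ≤ K * (‖u - v‖ + |ω - ω'|)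
  c1 : ∀ ε ∈ Icc 0 γ, ∀ c : ℝ → Hs P K₀ σ, ContDiffOn ℝ 1 c (Icc 1 2) →
    (∀ ω ∈ Icc (1 : ℝ) 2, c ω ∈ Metric.ball (0 : Hs P K₀ σ) q) →
      ContDiffOn ℝ 1 (fun ω => (R (c ω) (ω, ε)).clm τ (τ + r)) (Icc 1 2)
  real : ∀ z ∈ paramBox γ, ∀ u ∈ Metric.ball (0 : Hs P K₀ σ) q, u.IsReal → (R u z).IsReal

theorem SmoothingBounds.exists_bound {σ₀ r q γ τ : ℝ} {ν : ℕ} {R : Fam P K₀ σ}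
    (h : SmoothingBounds σ₀ r ν q γ R) (hτ : σ₀ + ν ≤ τ) :
    ∃ C > 0, ∀ z ∈ paramBox γ, ∀ u ∈ Metric.ball (0 : Hs P K₀ σ) q,
      ‖(R u z).clm τ (τ + r)‖ ≤ C ∧
      ∀ w, ‖fderiv ℝ (fun v => (R v z).clm τ (τ + r)) u w‖ ≤ C * ‖w‖ := by
  obtain ⟨C₀, hC₀, h0⟩ := h.bound τ hτ 0
  obtain ⟨C₁, hC₁, h1⟩ := h.bound τ hτ 1
  refine ⟨C₀ + C₁, by positivity, fun z hz u hu => ⟨?_, fun w => ?_⟩⟩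
  · have := h0 z hz u hu (fun i => i.elim0)
    rw [iteratedFDeriv_zero_apply] at this
    simp only [Finset.univ_eq_empty, Finset.prod_empty] at this
    linarith
  · have := h1 z hz u hu (fun _ => w)
    rw [iteratedFDeriv_one_apply] at this
    simp only [Finset.univ_unique, Finset.prod_singleton] at this
    have := mul_nonneg hC₀.le (norm_nonneg w)
    linarith

/-- As for the symbol classes, now in the norm of operators from order `τ` to order `τ + r`; the
direction is measured in the full norm of order `σ`. -/
theorem MemR.exists_smoothFam {σ₀ r q γ τ : ℝ} {ν N : ℕ} {R : Fam P K₀ σ}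
    (h : MemR σ₀ r ν N q γ R) (hτ : σ₀ + ν ≤ τ) : ∃ K > 0, SmoothFam q γ r τ K R := by
  obtain ⟨C, hC, hA⟩ := h.bounds.exists_bound hτ
  obtain ⟨C', hC', hA'⟩ := h.bounds_dOmega.exists_bound hτ
  have hball : IsOpen (Metric.ball (0 : Hs P K₀ σ) q) := Metric.isOpen_ball
  have hconv : Convex ℝ (Metric.ball (0 : Hs P K₀ σ) q) := convex_ball 0 q
  have hslice : ∀ ε ∈ Icc 0 γ, ∀ u ∈ Metric.ball (0 : Hs P K₀ σ) q,
      ContDiffOn ℝ 1 (fun ω => (R u (ω, ε)).clm τ (τ + r)) (Icc 1 2) :=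
    fun ε hε u hu => contDiffOn_slice hε (h.c1 τ hτ u hu)
  have hderiv : ∀ ε ∈ Icc 0 γ, ∀ u ∈ Metric.ball (0 : Hs P K₀ σ) q,
      ∀ ω ∈ Icc (1 : ℝ) 2, derivWithin (fun ω => (R u (ω, ε)).clm τ (τ + r)) (Icc 1 2) ω =
        (R.dOmega u (ω, ε)).clm τ (τ + r) := by
    intro ε hε u hu ω hω
    exact derivWithin_clm_eq hω
      (hasDerivWithinAt_of_contDiffOn_one (hslice ε hε u hu) hω).differentiableWithinAt
      (fun x hx => h.bounds.bdd τ hτ (x, ε) ⟨hx, hε⟩ u hu) fun p p' => rfl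
  refine ⟨C + C', by positivity, h.bounds.bdd τ hτ, ?_, ?_, ?_, h.real⟩
  · intro z hz u hu
    linarith [(hA z hz u hu).1]
  · intro ε hε ω hω ω' hω' u hu v hv
    have e1 : ‖(R u (ω, ε)).clm τ (τ + r) - (R u (ω', ε)).clm τ (τ + r)‖ ≤ C' * |ω - ω'| := by
      refine (convex_Icc (1 : ℝ) 2).norm_image_sub_le_of_norm_hasDerivWithin_le
        (fun x hx => hasDerivWithinAt_of_contDiffOn_one (hslice ε hε u hu) hx)
        (fun x hx => ?_) hω' hω
      rw [hderiv ε hε u hu x hx]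
      exact (hA' (x, ε) ⟨hx, hε⟩ u hu).1
    have e2 : ‖(R u (ω', ε)).clm τ (τ + r) - (R v (ω', ε)).clm τ (τ + r)‖ ≤ C * ‖u - v‖ :=
      norm_sub_le_of_fderiv_le hball hconv (ball_contDiffOn_one
        (h.bounds.smooth τ hτ (ω', ε) ⟨hω', hε⟩)) hu hv
        fun x hx => (hA (ω', ε) ⟨hω', hε⟩ x hx).2 _
    have e3 := norm_sub_le_norm_sub_add_norm_sub ((R u (ω, ε)).clm τ (τ + r))
      ((R u (ω', ε)).clm τ (τ + r)) ((R v (ω', ε)).clm τ (τ + r))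
    have e4 := mul_nonneg hC.le (abs_nonneg (ω - ω'))
    have e5 := mul_nonneg hC'.le (norm_nonneg (u - v))
    linarith
  · intro ε hε c hc hcB
    refine contDiffOn_comp_curve hball
      (g := fun u ω => (R u (ω, ε)).clm τ (τ + r))
      (gω := fun u ω => (R.dOmega u (ω, ε)).clm τ (τ + r)) (L := C')
      (fun ω hω => ball_contDiffOn_one (h.bounds.smooth τ hτ (ω, ε) ⟨hω, hε⟩))
      (fun u hu ω hω => ?_) (fun u hu => ?_) hC'.le (fun u hu v hv ω hω => ?_) hc hcB
    · rw [← hderiv ε hε u hu ω hω]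
      exact hasDerivWithinAt_of_contDiffOn_one (hslice ε hε u hu) hω
    · exact (continuousOn_derivWithin_of_contDiffOn_one (hslice ε hε u hu)).congr
        fun ω hω => (hderiv ε hε u hu ω hω).symm
    · exact norm_sub_le_of_fderiv_le hball hconv (ball_contDiffOn_one
        (h.bounds_dOmega.smooth τ hτ (ω, ε) ⟨hω, hε⟩)) hv hu
        fun x hx => (hA' (ω, ε) ⟨hω, hε⟩ x hx).2 _

/-! The spectrum of the blocks -/

theorem pnorm_zero_eq_norm (T : Finset (ActiveMode P K₀)) (c : ActiveMode P K₀ → ℂ) :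
    pnorm 0 T c = ‖(WithLp.toLp 2 fun p : T => c p.1 : EuclideanSpace ℂ T)‖ := by
  rw [pnorm_eq_norm]
  congr 1
  ext p
  simp

theorem pnorm_pos {τ : ℝ} {T : Finset (ActiveMode P K₀)} {c : ActiveMode P K₀ → ℂ}
    {p : ActiveMode P K₀} (hp : p ∈ T) (hc : c p ≠ 0) : 0 < pnorm τ T c := by
  refine Real.sqrt_pos.2 (Finset.sum_pos' (fun p _ => pnorm_term_nonneg τ c p) ⟨p, hp, ?_⟩)
  have := Real.rpow_pos_of_pos p.weight_pos τ
  have := norm_pos_iff.2 hc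
  positivity

theorem waveAct_eq_sum {m ω ε : ℝ} {a : FOp P K₀} {T : Finset (ActiveMode P K₀)}
    {p : ActiveMode P K₀} (h : ∀ p' ∉ T, a p p' = 0) (v : ActiveMode P K₀ → ℂ) :
    waveAct m ω ε a v p =
      (waveSymbol m ω p : ℂ) * v p + (ε : ℂ) * ∑ p' ∈ T, a p p' * v p' := by
  rw [waveAct, act_eq_sum h]

/-- A Hermitian matrix has an eigenvalue near any approximate eigenvalue. -/
theorem exists_eigenvalue_near {n : Type*} [Fintype n] [DecidableEq n] {A : Matrix n n ℂ}
    (hA : A.IsHermitian) (μ₀ : ℝ) {x : n → ℂ} (hx : x ≠ 0) :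
    ∃ (μ : ℝ) (e : n → ℂ), e ≠ 0 ∧ A.mulVec e = (μ : ℂ) • e ∧
      |μ - μ₀| * ‖(WithLp.toLp 2 x : EuclideanSpace ℂ n)‖ ≤
        ‖(WithLp.toLp 2 (A.mulVec x - (μ₀ : ℂ) • x) : EuclideanSpace ℂ n)‖ := by
  set b := hA.eigenvectorBasis
  have hne : Nonempty n := by
    by_contra h
    rw [not_nonempty_iff] at h
    exact hx (Subsingleton.elim _ _)
  -- The eigenvalue closest to `μ₀`. In the orthonormal eigenbasis `A - μ₀` multiplies each
  -- coordinate of `x` by a number of modulus at least this distance.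
  obtain ⟨i, -, hi⟩ := Finset.exists_min_image Finset.univ (fun i => |hA.eigenvalues i - μ₀|)
    Finset.univ_nonempty
  refine ⟨hA.eigenvalues i, b i, ?_, ?_, ?_⟩
  · intro h
    have h1 : b i = 0 := by
      ext p
      exact congrFun h p
    have h2 := b.orthonormal.1 i
    rw [h1, norm_zero] at h2
    exact zero_ne_one h2
  · rw [hA.mulVec_eigenvectorBasis i]
    ext p
    simp [b]
  · set X : EuclideanSpace ℂ n := WithLp.toLp 2 x
    set Y : EuclideanSpace ℂ n := WithLp.toLp 2 (A.mulVec x - (μ₀ : ℂ) • x)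
    have hinner : ∀ j, inner ℂ (b j) Y = ((hA.eigenvalues j - μ₀ : ℝ) : ℂ) * inner ℂ (b j) X := by
      intro j
      rw [EuclideanSpace.inner_eq_star_dotProduct, EuclideanSpace.inner_eq_star_dotProduct]
      change (A.mulVec x - (μ₀ : ℂ) • x) ⬝ᵥ star (b j).ofLp = _ * (x ⬝ᵥ star (b j).ofLp)
      have h1 : A.mulVec x ⬝ᵥ star (b j).ofLp = (hA.eigenvalues j : ℂ) * (x ⬝ᵥ star (b j).ofLp) := by
        rw [dotProduct_comm, Matrix.dotProduct_mulVec]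
        have h2 : Matrix.vecMul (star (b j).ofLp) A = star (A.mulVec (b j).ofLp) := by
          rw [Matrix.star_mulVec, hA.eq]
        rw [h2, hA.mulVec_eigenvectorBasis j, dotProduct_comm]
        have h3 : star (hA.eigenvalues j • (hA.eigenvectorBasis j).ofLp) =
            (hA.eigenvalues j : ℂ) • star (b j).ofLp := by
          ext p
          simp [b]
        rw [h3, dotProduct_smul, smul_eq_mul]
      rw [sub_dotProduct, h1, smul_dotProduct, smul_eq_mul]
      push_cast
      ring
    refine abs_le_of_sq_le_sq' ?_ (norm_nonneg _) |>.2
    rw [mul_pow, ← b.sum_sq_norm_inner_right X, ← b.sum_sq_norm_inner_right Y, Finset.mul_sum]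
    refine Finset.sum_le_sum fun j _ => ?_
    rw [hinner j, norm_mul, Complex.norm_real, Real.norm_eq_abs, mul_pow]
    exact mul_le_mul_of_nonneg_right (pow_le_pow_left₀ (abs_nonneg _) (hi j (Finset.mem_univ j)) 2)
      (sq_nonneg _)

/-- The operator does not couple different blocks. -/
def BlockDiag (a : FOp P K₀) : Prop := ∀ p p', p.block ≠ p'.block → a p p' = 0

/-- The set of modes is a union of blocks. -/
def BlockClosed (T : Finset (ActiveMode P K₀)) : Prop :=
  ∀ p ∈ T, ∀ p', p'.block = p.block → p' ∈ T

theorem BlockDiag.entry_eq_zero {a : FOp P K₀} (ha : BlockDiag a) {T : Finset (ActiveMode P K₀)}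
    (hT : BlockClosed T) {p p' : ActiveMode P K₀} (hp : p ∈ T) (hp' : p' ∉ T) : a p p' = 0 :=
  ha p p' fun h => hp' (hT p hp p' h.symm)

theorem blockClosed_shell (h : Admissible β θ K₀) (κ : ℕ) : BlockClosed (shell h P κ) := by
  intro p hp p' hpp
  rw [mem_shell] at hp ⊢
  rw [lev_eq_of_block_eq hpp, hp]

theorem finite_block (h : Admissible β θ K₀) (α : ι) :
    {p : ActiveMode P K₀ | p.block = α}.Finite := by
  refine (finite_size_le h (jap (P.center α))).subset fun p hp => ?_
  have : P.cls p.space = α := hp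
  simp [BlockPartition.size, this]

/-- The modes of a block. -/
def blockModes (h : Admissible β θ K₀) (P : BlockPartition d ι β ρ θ) (α : ι) :
    Finset (ActiveMode P K₀) := (finite_block h α).toFinset

@[simp] theorem mem_blockModes {h : Admissible β θ K₀} {α : ι} {p : ActiveMode P K₀} :
    p ∈ blockModes h P α ↔ p.block = α := by
  simp [blockModes]

theorem blockClosed_blockModes (h : Admissible β θ K₀) (α : ι) :
    BlockClosed (blockModes h P α : Finset (ActiveMode P K₀)) := by
  intro p hp p' hpp
  rw [mem_blockModes] at hp ⊢
  rw [hpp, hp]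

open Classical in
/-- The matrix of `L_ω + ε a` on a finite set of modes. -/
def waveMatrix (m ω ε : ℝ) (a : FOp P K₀) (T : Finset (ActiveMode P K₀)) : Matrix T T ℂ :=
  Matrix.of fun p p' => (if p = p' then (waveSymbol m ω p.1 : ℂ) else 0) + (ε : ℂ) * a p.1 p'.1

theorem waveMatrix_mulVec {m ω ε : ℝ} {a : FOp P K₀} {T : Finset (ActiveMode P K₀)} {p : T}
    (h : ∀ p' ∉ T, a p.1 p' = 0) (v : ActiveMode P K₀ → ℂ) :
    (waveMatrix m ω ε a T).mulVec (fun p => v p.1) p = waveAct m ω ε a v p.1 := by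
  rw [waveAct_eq_sum h, Matrix.mulVec, dotProduct, ← Finset.sum_coe_sort T, Finset.mul_sum]
  simp only [waveMatrix, Matrix.of_apply, add_mul, Finset.sum_add_distrib, ite_mul, zero_mul,
    Finset.sum_ite_eq, Finset.mem_univ, if_true, mul_assoc]

theorem isHermitian_waveMatrix {m ω ε : ℝ} {a : FOp P K₀} (ha : a.adj = a)
    (T : Finset (ActiveMode P K₀)) : (waveMatrix m ω ε a T).IsHermitian := by
  ext p p'
  have h1 : (starRingEnd ℂ) (a p'.1 p.1) = a p.1 p'.1 := congrFun (congrFun ha p.1) p'.1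
  simp only [waveMatrix, Matrix.conjTranspose_apply, Matrix.of_apply, star_add, star_mul',
    RCLike.star_def, Complex.conj_ofReal, h1]
  congr 1
  by_cases h : p = p'
  · subst h
    simp
  · rw [if_neg h, if_neg (Ne.symm h), map_zero]

/-- The matrix on `T` is Hermitian and has an eigenvalue close to `μ₀`. Since `a` does not couple
blocks, the part of its eigenvector on any block where it does not vanish is again an eigenvector,
so the eigenvalue belongs to a single block. -/
theorem exists_isEig_near {m ω ε μ₀ : ℝ} {VD : Fam P K₀ σ} {u : Hs P K₀ σ}
    {T : Finset (ActiveMode P K₀)} (hT : BlockClosed T) (hdiag : BlockDiag (VD u (ω, ε)))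
    (hsa : (VD u (ω, ε)).adj = VD u (ω, ε)) {v : ActiveMode P K₀ → ℂ} {p₀ : ActiveMode P K₀}
    (hp₀ : p₀ ∈ T) (hv : v p₀ ≠ 0) :
    ∃ (α : ι) (μ : ℝ), (∃ p ∈ T, p.block = α) ∧ IsEig m VD α ω u ε μ ∧
      |μ - μ₀| * pnorm 0 T v ≤
        pnorm 0 T (fun p => waveAct m ω ε (VD u (ω, ε)) v p - (μ₀ : ℂ) * v p) := by
  classical
  set a := VD u (ω, ε) with ha
  have hx : (fun p : T => v p.1) ≠ 0 := fun h => hv (congrFun h ⟨p₀, hp₀⟩)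
  obtain ⟨μ, e, he0, he, hle⟩ := exists_eigenvalue_near (isHermitian_waveMatrix (m := m) (ω := ω)
    (ε := ε) hsa T) μ₀ hx
  obtain ⟨p₁, hp₁⟩ := Function.ne_iff.1 he0
  set α := p₁.1.block
  let ee : ActiveMode P K₀ → ℂ := fun p => if h : p ∈ T then e ⟨p, h⟩ else 0
  have hee : ∀ p : T, ee p.1 = e p := fun p => by simp [ee]
  -- The eigenvector restricted to the block of a mode `p₁` at which it is non-zero.
  let c : ActiveMode P K₀ → ℂ := fun p => if p.block = α then ee p else 0
  have hcT : ∀ p ∉ T, c p = 0 := by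
    intro p hp
    simp [c, ee, hp]
  have hc := sobBdd_of_support (τ := 0) hcT
  refine ⟨α, μ, ⟨p₁.1, p₁.2, rfl⟩, ⟨Hs.ofSeq 0 c, ?_, ?_, ?_⟩, ?_⟩
  · intro h
    have h1 : (Hs.ofSeq 0 c).coeff p₁.1 = 0 := by rw [h, Hs.coeff_zero]
    rw [Hs.coeff_ofSeq hc] at h1
    have h2 : c p₁.1 = e p₁ := by simp [c, α, hee]
    rw [h2] at h1
    exact hp₁ h1
  · intro p hp
    rw [Hs.coeff_ofSeq hc]
    simp [c, hp]
  · intro p hp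
    have hpT : p ∈ T := hT p₁.1 p₁.2 p hp
    rw [Hs.coeff_ofSeq hc]
    have h1 : waveAct m ω ε a c p = waveAct m ω ε a ee p := by
      rw [waveAct, waveAct]
      congr 2
      · simp [c, hp]
      · refine tsum_congr fun p' => ?_
        by_cases hpp : p.block = p'.block
        · have : p'.block = α := by rw [← hpp, hp]
          simp [c, this]
        · rw [hdiag p p' hpp, zero_mul, zero_mul]
    have h2 := waveMatrix_mulVec (m := m) (ω := ω) (ε := ε) (a := a) (T := T) (p := ⟨p, hpT⟩)
      (fun p' hp' => hdiag.entry_eq_zero hT hpT hp') ee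
    have h3 : (fun p : T => ee p.1) = e := funext hee
    rw [h3, he] at h2
    rw [h1, ← h2]
    simp [c, hp, ee, hpT]
  · rw [pnorm_zero_eq_norm, pnorm_zero_eq_norm]
    refine hle.trans (le_of_eq ?_)
    congr 1
    ext p
    simp only [Pi.sub_apply, Pi.smul_apply, smul_eq_mul]
    rw [waveMatrix_mulVec fun p' hp' => hdiag.entry_eq_zero hT p.2 hp']

/-- A lower bound for `|L_ω + ε a|` on a set of modes. -/
def LowerBdd (m ω ε : ℝ) (a : FOp P K₀) (T : Finset (ActiveMode P K₀)) (c : ℝ) : Prop :=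
  ∀ v : ActiveMode P K₀ → ℂ, c * pnorm 0 T v ≤ pnorm 0 T (waveAct m ω ε a v)

/-- The case `μ₀ = 0`: the image of `v` is at least as large as the smallest eigenvalue in modulus
times `v`. -/
theorem lowerBdd_of_isEig {m ω ε c : ℝ} {VD : Fam P K₀ σ} {u : Hs P K₀ σ}
    {T : Finset (ActiveMode P K₀)} (hT : BlockClosed T) (hdiag : BlockDiag (VD u (ω, ε)))
    (hsa : (VD u (ω, ε)).adj = VD u (ω, ε))
    (h : ∀ (α : ι) (μ : ℝ), (∃ p ∈ T, p.block = α) → IsEig m VD α ω u ε μ → c ≤ |μ|) :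
    LowerBdd m ω ε (VD u (ω, ε)) T c := by
  intro v
  by_cases hv : ∃ p ∈ T, v p ≠ 0
  · obtain ⟨p, hp, hvp⟩ := hv
    obtain ⟨α, μ, hα, hμ, hle⟩ := exists_isEig_near (m := m) (μ₀ := 0) hT hdiag hsa hp hvp
    have h1 := h α μ hα hμ
    simp only [sub_zero, Complex.ofReal_zero, zero_mul] at hle
    exact (mul_le_mul_of_nonneg_right h1 (pnorm_nonneg _ _ _)).trans hle
  · push Not at hv
    have : pnorm 0 T v = 0 := by
      rw [pnorm_congr (c' := 0) fun p hp => hv p hp]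
      simp [pnorm]
    rw [this, mul_zero]
    exact pnorm_nonneg _ _ _

theorem LowerBdd.mono {m ω ε c c' : ℝ} {a : FOp P K₀} {T : Finset (ActiveMode P K₀)}
    (h : LowerBdd m ω ε a T c) (hc : c' ≤ c) : LowerBdd m ω ε a T c' := fun v =>
  (mul_le_mul_of_nonneg_right hc (pnorm_nonneg _ _ _)).trans (h v)

/-- Stability of the lower bounds. -/
theorem LowerBdd.perturb {m ω ω' ε c η : ℝ} {a a' : FOp P K₀} {T : Finset (ActiveMode P K₀)}
    (h : LowerBdd m ω ε a T c)
    (hη : ∀ v, pnorm 0 T (fun p => waveAct m ω' ε a' v p - waveAct m ω ε a v p) ≤ η * pnorm 0 T v) :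
    LowerBdd m ω' ε a' T (c - η) := by
  intro v
  have h1 := h v
  have h2 := hη v
  have h3 := pnorm_sub_le 0 T (waveAct m ω' ε a' v)
    (fun p => waveAct m ω' ε a' v p - waveAct m ω ε a v p)
  have h4 : (fun p => waveAct m ω' ε a' v p -
      (waveAct m ω' ε a' v p - waveAct m ω ε a v p)) = waveAct m ω ε a v := by
    funext p
    ring
  rw [h4] at h3
  linarith

theorem sq_time_le (p : ActiveMode P K₀) :
    (p.time : ℝ) ^ 2 ≤ K₀ ^ 2 * P.size p.space ^ 4 := by
  have := pow_le_pow_left₀ (abs_nonneg _) p.abs_time_le 2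
  rw [sq_abs] at this
  linarith

theorem le_sq_time (h : Admissible β θ K₀) (p : ActiveMode P K₀) :
    (K₀ ^ 2)⁻¹ * P.size p.space ^ 4 ≤ (p.time : ℝ) ^ 2 := by
  have hK := h.K_pos
  have := pow_le_pow_left₀ (by positivity) p.le_abs_time 2
  rw [sq_abs, mul_pow, inv_pow] at this
  linarith

/-- The rows in `T` see only `T`, so `v` may be replaced by its restriction. Thus no global bound on
`v` is needed. -/
theorem pnorm_act_le_of_closed {C K : ℝ} {a : FOp P K₀} {T : Finset (ActiveMode P K₀)}
    (hC : ∀ (c : ActiveMode P K₀ → ℂ) (B : ℝ), SobBdd 0 c B → SobBdd 0 (a.act c) (C * K * B))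
    (ha : ∀ p ∈ T, ∀ p' ∉ T, a p p' = 0) (v : ActiveMode P K₀ → ℂ) :
    pnorm 0 T (a.act v) ≤ C * K * pnorm 0 T v := by
  have h1 := hC _ _ (sobBdd_restr 0 T v) T
  rwa [pnorm_congr (c' := a.act v) fun p hp => ?_] at h1
  rw [act_eq_sum (ha p hp), act_eq_sum (ha p hp)]
  exact Finset.sum_congr rfl fun p' hp' => by rw [restr_of_mem hp']

/-! Dependence of the spectrum on the parameters -/

theorem act_sub_of_closed {a a' : FOp P K₀} {T : Finset (ActiveMode P K₀)}
    {p : ActiveMode P K₀} (ha : ∀ p' ∉ T, a p p' = 0) (ha' : ∀ p' ∉ T, a' p p' = 0)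
    (v : ActiveMode P K₀ → ℂ) : (a' - a).act v p = a'.act v p - a.act v p := by
  rw [act_eq_sum ha, act_eq_sum ha', act_eq_sum (a := a' - a) (T := T) fun p' hp' => by
    simp [ha p' hp', ha' p' hp'], ← Finset.sum_sub_distrib]
  exact Finset.sum_congr rfl fun p' _ => by simp [sub_mul]

theorem BlockDiag.sub {a a' : FOp P K₀} (h : BlockDiag a) (h' : BlockDiag a') :
    BlockDiag (a' - a) := by
  intro p p' hp
  simp [h p p' hp, h' p p' hp]

theorem abs_sq_sub_sq_le {ω ω' : ℝ} (hω : ω ∈ Icc (1 : ℝ) 2) (hω' : ω' ∈ Icc (1 : ℝ) 2) :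
    |ω ^ 2 - ω' ^ 2| ≤ 4 * |ω - ω'| := by
  have e : ω ^ 2 - ω' ^ 2 = (ω + ω') * (ω - ω') := by ring
  rw [e, abs_mul]
  refine mul_le_mul_of_nonneg_right ?_ (abs_nonneg _)
  rw [abs_of_nonneg (by linarith [hω.1, hω'.1])]
  linarith [hω.2, hω'.2]

/-- The `L²` constant of the operators with off-diagonal decay. -/
def schurConst (h : Admissible β θ K₀) (P : BlockPartition d ι β ρ θ) : ℝ :=
  (DecayBdd.exists_act_le h P 0).choose

theorem schurConst_pos (h : Admissible β θ K₀) (P : BlockPartition d ι β ρ θ) :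
    0 < schurConst h P := (DecayBdd.exists_act_le h P 0).choose_spec.1

theorem DecayBdd.pnorm_act_le (h : Admissible β θ K₀) {K : ℝ} (hK : 0 ≤ K) {a : FOp P K₀}
    (ha : DecayBdd K a) {T : Finset (ActiveMode P K₀)} (hT : ∀ p ∈ T, ∀ p' ∉ T, a p p' = 0)
    (v : ActiveMode P K₀ → ℂ) : pnorm 0 T (a.act v) ≤ schurConst h P * K * pnorm 0 T v :=
  pnorm_act_le_of_closed ((DecayBdd.exists_act_le h P 0).choose_spec.2 K a hK ha) hT v

/-- Besides `a`, only `-ω² j²` changes, and `j² ≤ K₀² R` by the support condition while `|ω'² - ω²|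
≤ 4 |ω' - ω|` on the interval. -/
theorem pnorm_waveAct_sub_le (h : Admissible β θ K₀) {m ω ω' ε η R : ℝ} {a a' : FOp P K₀}
    {T : Finset (ActiveMode P K₀)} (hT : BlockClosed T) (ha : BlockDiag a) (ha' : BlockDiag a')
    (hη : 0 ≤ η) (haa : DecayBdd η (a' - a)) (hε : 0 ≤ ε) (hω : ω ∈ Icc (1 : ℝ) 2)
    (hω' : ω' ∈ Icc (1 : ℝ) 2) (hR : ∀ p ∈ T, P.size p.space ^ 4 ≤ R) (hR0 : 0 ≤ R)
    (v : ActiveMode P K₀ → ℂ) :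
    pnorm 0 T (fun p => waveAct m ω' ε a' v p - waveAct m ω ε a v p) ≤
      (4 * K₀ ^ 2 * R * |ω' - ω| + ε * (schurConst h P * η)) * pnorm 0 T v := by
  have e : pnorm 0 T (fun p => waveAct m ω' ε a' v p - waveAct m ω ε a v p) =
      pnorm 0 T (fun p => ((-(ω' ^ 2 - ω ^ 2) * (p.time : ℝ) ^ 2 : ℝ) : ℂ) * v p +
        (ε : ℂ) * (a' - a).act v p) := by
    refine pnorm_congr fun p hp => ?_
    rw [act_sub_of_closed (fun p' hp' => ha.entry_eq_zero hT hp hp')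
      (fun p' hp' => ha'.entry_eq_zero hT hp hp')]
    simp only [waveAct, waveSymbol]
    push_cast
    ring
  rw [e]
  refine (pnorm_add_le _ _ _ _).trans ?_
  rw [add_mul]
  refine add_le_add ?_ ?_
  · rw [← abs_of_nonneg (show 0 ≤ 4 * K₀ ^ 2 * R * |ω' - ω| by positivity), ← Real.norm_eq_abs,
      ← Complex.norm_real, ← pnorm_smul]
    refine pnorm_le_of_norm_le fun p hp => ?_
    rw [norm_mul, norm_mul, Complex.norm_real, Complex.norm_real]
    refine mul_le_mul_of_nonneg_right ?_ (norm_nonneg _)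
    rw [Real.norm_eq_abs, Real.norm_eq_abs, abs_mul, abs_neg, abs_of_nonneg (sq_nonneg (p.time : ℝ)),
      abs_of_nonneg (show 0 ≤ 4 * K₀ ^ 2 * R * |ω' - ω| by positivity)]
    have h1 := abs_sq_sub_sq_le hω' hω
    have h2 : (p.time : ℝ) ^ 2 ≤ K₀ ^ 2 * R :=
      (sq_time_le p).trans (mul_le_mul_of_nonneg_left (hR p hp) (sq_nonneg _))
    calc _ ≤ 4 * |ω' - ω| * (K₀ ^ 2 * R) := mul_le_mul h1 h2 (sq_nonneg _) (by positivity)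
      _ = _ := by ring
  · rw [pnorm_smul, Complex.norm_real, Real.norm_of_nonneg hε, mul_assoc]
    exact mul_le_mul_of_nonneg_left (haa.pnorm_act_le h hη
      (fun p hp p' hp' => (ha.sub ha').entry_eq_zero hT hp hp') v) hε

theorem DecayBdd.norm_entry_le {K : ℝ} (hK : 0 ≤ K) {a : FOp P K₀} (ha : DecayBdd K a)
    (p p' : ActiveMode P K₀) : ‖a p p'‖ ≤ K := by
  have h1 := ha p.space p'.space {p} {p'} (by simp) (by simp) (fun _ => 1) (fun _ => 1)
  have h2 : decay p.space p'.space ≤ 1 := (decay_le _ _).trans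
    (Real.rpow_le_one_of_one_le_of_nonpos (one_le_jap _) (by simp; linarith))
  have h3 : ∀ p : ActiveMode P K₀, pnorm 0 {p} (fun _ => (1 : ℂ)) = 1 := by
    intro p
    simp [pnorm]
  rw [h3, h3] at h1
  simp only [Finset.sum_singleton, one_mul, mul_one] at h1
  exact h1.trans (mul_le_of_le_one_right hK h2)

/-- The hypotheses on the block diagonal part of the operator. -/
structure BlockFam (q γ K τ₀ : ℝ) (VD : Fam P K₀ σ) : Prop where
  decay : DecayFam q γ K τ₀ VD
  selfAdj : VD.SelfAdj q γ
  diag : ∀ z ∈ paramBox γ, ∀ u ∈ Metric.ball (0 : Hs P K₀ σ) q, BlockDiag (VD u z)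

theorem mem_ball_of_norm_lt {q : ℝ} {u : Hs P K₀ s} (h : ‖u‖ < q) :
    u ∈ Metric.ball (0 : Hs P K₀ s) q := mem_ball_zero_iff.2 h

theorem size_of_block {p : ActiveMode P K₀} {α : ι} (h : p.block = α) :
    P.size p.space = jap (P.center α) := by
  have : P.cls p.space = α := h
  rw [BlockPartition.size, this]

/-- An eigenvector for `u` is an approximate eigenvector for `v`, with an error given by the
difference of the two operators. Reality of `v` makes the operator at `v` Hermitian, which yields a
true eigenvalue nearby. -/
theorem BlockFam.exists_isEig_near_of_isEig (h : Admissible β θ K₀) {q γ K τ₀ m : ℝ}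
    {VD : Fam P K₀ σ} (hVD : BlockFam q γ K τ₀ VD) (hK : 0 ≤ K) (hτ : τ₀ ≤ σ) {α : ι} {ε ω : ℝ}
    (hε : ε ∈ Icc 0 γ) (hω : ω ∈ Icc (1 : ℝ) 2) {u v : Hs P K₀ σ} (hvr : v.IsReal)
    (hu : ‖u‖ < q) (hv : ‖v‖ < q) {μ : ℝ} (hμ : IsEig m VD α ω u ε μ) :
    ∃ μ', IsEig m VD α ω v ε μ' ∧ |μ - μ'| ≤ schurConst h P * K * ε * ‖u - v‖ := by
  obtain ⟨x, hx0, hxs, hx⟩ := hμ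
  have hex : ∃ p, x.coeff p ≠ 0 := by
    by_contra hne
    push Not at hne
    exact hx0 (Hs.ext hne)
  obtain ⟨p₀, hp₀⟩ := hex
  set T : Finset (ActiveMode P K₀) := blockModes h P α
  have hT := blockClosed_blockModes (P := P) h α
  have hp₀T : p₀ ∈ T := by
    rw [mem_blockModes]
    by_contra hne
    exact hp₀ (hxs p₀ hne)
  have hz : (ω, ε) ∈ paramBox γ := ⟨hω, hε⟩
  have hub := mem_ball_of_norm_lt hu
  have hvb := mem_ball_of_norm_lt hv
  obtain ⟨α', μ', ⟨p₁, hp₁, hα'⟩, hμ', hle⟩ := exists_isEig_near (m := m) (μ₀ := μ) hT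
    (hVD.diag _ hz v hvb) (hVD.selfAdj _ hz v hvb hvr) hp₀T hp₀
  rw [mem_blockModes] at hp₁
  rw [hp₁] at hα'
  subst hα'
  refine ⟨μ', hμ', ?_⟩
  have hlip := hVD.decay.lip ε hε ω hω ω hω v hvb u hub
  rw [sub_self, abs_zero, add_zero] at hlip
  have hs : sobNorm τ₀ (v - u).coeff ≤ ‖u - v‖ := by
    rw [norm_sub_rev]
    exact Hs.sobNorm_le _ hτ
  have h1 := pnorm_waveAct_sub_le h (m := m) (R := jap (P.center α) ^ 4) hT (hVD.diag _ hz u hub)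
    (hVD.diag _ hz v hvb)
    (by have := sobNorm_nonneg τ₀ (v - u).coeff; positivity) hlip hε.1 hω hω
    (fun p hp => by rw [mem_blockModes] at hp; rw [size_of_block hp])
    (by have := jap_pos (P.center α); positivity) x.coeff
  rw [sub_self, abs_zero, mul_zero, zero_add] at h1
  rw [pnorm_congr (c' := fun p => waveAct m ω ε (VD v (ω, ε)) x.coeff p -
    (μ : ℂ) * x.coeff p) fun p hp => by rw [hx p (mem_blockModes.1 hp)]] at h1
  have hpos := pnorm_pos (τ := 0) hp₀T hp₀
  have h2 := le_of_mul_le_mul_right (hle.trans h1) hpos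
  rw [abs_sub_comm]
  have hsc := schurConst_pos h P
  calc |μ' - μ| ≤ ε * (schurConst h P * (K * sobNorm τ₀ (v - u).coeff)) := h2
    _ ≤ ε * (schurConst h P * (K * ‖u - v‖)) := by
        have := hε.1
        gcongr
    _ = _ := by ring

theorem Hs.incl_sub (h : s' ≤ s) (u v : Hs P K₀ s) :
    Hs.incl h (u - v) = Hs.incl h u - Hs.incl h v := by
  refine Hs.ext fun p => ?_
  rw [Hs.coeff_sub, Hs.coeff_incl, Hs.coeff_incl, Hs.coeff_incl, Hs.coeff_sub]

/-- A curve is Lipschitz in the weak norm when its derivative is bounded. -/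
theorem HasC1Deriv.norm_sub_le {h : s' ≤ s} {v : ℝ → Hs P K₀ s} {v' : ℝ → Hs P K₀ s'}
    (hv : HasC1Deriv h v v') {b : ℝ} (hb : ∀ ω ∈ Icc (1 : ℝ) 2, ‖v' ω‖ ≤ b) {ω ω' : ℝ}
    (hω : ω ∈ Icc (1 : ℝ) 2) (hω' : ω' ∈ Icc (1 : ℝ) 2) :
    ‖Hs.incl h (v ω) - Hs.incl h (v ω')‖ ≤ b * |ω - ω'| :=
  (convex_Icc (1 : ℝ) 2).norm_image_sub_le_of_norm_hasDerivWithin_le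
    (f := fun x => Hs.incl h (v x)) hv.2.2 hb hω' hω

/-- Normalized eigenvectors of a block. -/
theorem exists_normalized (h : Admissible β θ K₀) {m ω ε μ : ℝ} {VD : Fam P K₀ σ} {α : ι}
    {u : Hs P K₀ σ} (hμ : IsEig m VD α ω u ε μ) :
    ∃ x : EuclideanSpace ℂ (blockModes h P α : Finset (ActiveMode P K₀)), ‖x‖ = 1 ∧
      ∃ c : ActiveMode P K₀ → ℂ, (∀ p, c p.1 = x p) ∧
        ∀ p ∈ (blockModes h P α : Finset (ActiveMode P K₀)),
          waveAct m ω ε (VD u (ω, ε)) c p = (μ : ℂ) * c p := by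
  obtain ⟨x, hx0, hxs, hx⟩ := hμ
  have hex : ∃ p, x.coeff p ≠ 0 := by
    by_contra hne
    push Not at hne
    exact hx0 (Hs.ext hne)
  obtain ⟨p₀, hp₀⟩ := hex
  set T : Finset (ActiveMode P K₀) := blockModes h P α
  have hp₀T : p₀ ∈ T := by
    rw [mem_blockModes]
    by_contra hne
    exact hp₀ (hxs p₀ hne)
  have hpos := pnorm_pos (τ := 0) hp₀T hp₀
  set r := pnorm 0 T x.coeff
  let c : ActiveMode P K₀ → ℂ := fun p => ((r⁻¹ : ℝ) : ℂ) * x.coeff p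
  have hc : ∀ p ∈ T, waveAct m ω ε (VD u (ω, ε)) c p = (μ : ℂ) * c p := by
    intro p hp
    have h1 := hx p (mem_blockModes.1 hp)
    have h2 : waveAct m ω ε (VD u (ω, ε)) c p =
        ((r⁻¹ : ℝ) : ℂ) * waveAct m ω ε (VD u (ω, ε)) x.coeff p := by
      simp only [waveAct, FOp.act, c]
      have : ∀ p', VD u (ω, ε) p p' * (((r⁻¹ : ℝ) : ℂ) * x.coeff p') =
          ((r⁻¹ : ℝ) : ℂ) * (VD u (ω, ε) p p' * x.coeff p') := fun p' => by ring
      simp only [this, tsum_mul_left]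
      ring
    rw [h2, h1]
    simp only [c]
    ring
  refine ⟨WithLp.toLp 2 fun p => c p.1, ?_, c, fun p => rfl, hc⟩
  rw [← pnorm_zero_eq_norm, pnorm_smul, Complex.norm_real, Real.norm_of_nonneg (by positivity)]
  exact inv_mul_cancel₀ hpos.ne'

/-- The derivative of a branch of eigenvalues. -/
theorem BlockFam.abs_deriv_add_le (h : Admissible β θ K₀) {q γ K τ₀ m b : ℝ}
    {VD : Fam P K₀ σ} (hVD : BlockFam q γ K τ₀ VD) (hK : 0 ≤ K) {α : ι} {ε : ℝ}
    (hε : ε ∈ Icc 0 γ) (hb0 : 0 ≤ b) {v : ℝ → Hs P K₀ σ}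
    (hvr : ∀ ω ∈ Icc (1 : ℝ) 2, (v ω).IsReal) (hvq : ∀ ω ∈ Icc (1 : ℝ) 2, ‖v ω‖ < q)
    (hb : ∀ ω ∈ Icc (1 : ℝ) 2, ∀ ω' ∈ Icc (1 : ℝ) 2,
      sobNorm τ₀ (v ω - v ω').coeff ≤ b * |ω - ω'|)
    {lam : ℝ → ℝ} (hlam : ContDiffOn ℝ 1 lam (Icc 1 2))
    (heig : ∀ ω ∈ Icc (1 : ℝ) 2, IsEig m VD α ω (v ω) ε (lam ω)) {ω : ℝ}
    (hω : ω ∈ Icc (1 : ℝ) 2) :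
    ∃ J : ℝ, (K₀ ^ 2)⁻¹ * jap (P.center α) ^ 4 ≤ J ∧ J ≤ K₀ ^ 2 * jap (P.center α) ^ 4 ∧
      |derivWithin lam (Icc 1 2) ω + 2 * ω * J| ≤ ε * (schurConst h P * (K * (b + 1))) := by
  set T : Finset (ActiveMode P K₀) := blockModes h P α with hTdef
  have hT : BlockClosed T := blockClosed_blockModes h α
  set a : ℝ → FOp P K₀ := fun x => VD (v x) (x, ε) with ha
  have hvb : ∀ x ∈ Icc (1 : ℝ) 2, v x ∈ Metric.ball (0 : Hs P K₀ σ) q :=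
    fun x hx => mem_ball_of_norm_lt (hvq x hx)
  have hlip : ∀ x ∈ Icc (1 : ℝ) 2, DecayBdd (K * ((b + 1) * |x - ω|)) (a x - a ω) := by
    intro x hx
    refine (hVD.decay.lip ε hε x hx ω hω _ (hvb x hx) _ (hvb ω hω)).mono ?_
    refine mul_le_mul_of_nonneg_left ?_ hK
    linarith [hb x hx ω hω]
  have hdiag : ∀ x ∈ Icc (1 : ℝ) 2, ∀ p ∈ T, ∀ p' ∉ T, a x p p' = 0 := fun x hx p hp p' hp' =>
    (hVD.diag (x, ε) ⟨hx, hε⟩ _ (hvb x hx)).entry_eq_zero hT hp hp'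
  have hsa : ∀ p p', (starRingEnd ℂ) (a ω p p') = a ω p' p := fun p p' =>
    congrFun (congrFun (hVD.selfAdj (ω, ε) ⟨hω, hε⟩ _ (hvb ω hω) (hvr ω hω)) p') p
  have hex : ∀ x, ∃ (X : EuclideanSpace ℂ T) (c : ActiveMode P K₀ → ℂ), x ∈ Icc (1 : ℝ) 2 →
      ‖X‖ = 1 ∧ (∀ p : T, c p.1 = X p) ∧
        ∀ p ∈ T, waveAct m x ε (a x) c p = ((lam x : ℝ) : ℂ) * c p := by
    intro x
    by_cases hx : x ∈ Icc (1 : ℝ) 2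
    · obtain ⟨X, hX, c, hc, hcc⟩ := exists_normalized h (heig x hx)
      exact ⟨X, c, fun _ => ⟨hX, hc, hcc⟩⟩
    · exact ⟨0, 0, fun hx' => absurd hx' hx⟩
  choose X c hXc using hex
  have hne : (𝓝[Icc 1 2 \ {ω}] ω).NeBot := by
    rw [← accPt_principal_iff_nhdsWithin]
    exact uniqueDiffWithinAt_iff_accPt.1 (uniqueDiffOn_interval ω hω)
  -- No regularity of eigenvectors is available, in particular at crossings. An ultrafilter together
  -- with compactness of the unit sphere gives a limit `e` of normalized eigenvectors, which is an
  -- eigenvector at `ω` because the equation passes to the limit.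
  set U : Ultrafilter ℝ := Ultrafilter.of (𝓝[Icc 1 2 \ {ω}] ω)
  have hU : (U : Filter ℝ) ≤ 𝓝[Icc 1 2 \ {ω}] ω := Ultrafilter.of_le _
  have hUI : ∀ᶠ x in (U : Filter ℝ), x ∈ Icc (1 : ℝ) 2 \ {ω} := hU self_mem_nhdsWithin
  have hUω : Tendsto (fun x : ℝ => x) U (𝓝 ω) := hU.trans nhdsWithin_le_nhds
  obtain ⟨e, heS, he⟩ := isCompact_iff_ultrafilter_le_nhds.1
    (isCompact_sphere (0 : EuclideanSpace ℂ T) 1) (U.map X) (by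
      rw [le_principal_iff]
      change ∀ᶠ x in (U : Filter ℝ), X x ∈ Metric.sphere 0 1
      filter_upwards [hUI] with x hx
      rw [mem_sphere_zero_iff_norm]
      exact (hXc x hx.1).1)
  have heX : Tendsto X U (𝓝 e) := he
  classical
  let ee : ActiveMode P K₀ → ℂ := fun p => if hp : p ∈ T then e ⟨p, hp⟩ else 0
  have hee : ∀ p : T, ee p.1 = e p := fun p => by simp [ee]
  have hc : ∀ p ∈ T, Tendsto (fun x => c x p) U (𝓝 (ee p)) := by
    intro p hp
    have h1 : Tendsto (fun x => X x ⟨p, hp⟩) U (𝓝 (e ⟨p, hp⟩)) :=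
      ((EuclideanSpace.proj (𝕜 := ℂ) (⟨p, hp⟩ : T)).continuous.tendsto e).comp heX
    rw [← hee ⟨p, hp⟩] at h1
    refine h1.congr' ?_
    filter_upwards [hUI] with x hx
    exact ((hXc x hx.1).2.1 ⟨p, hp⟩).symm
  have hnc : ∀ x ∈ Icc (1 : ℝ) 2, pnorm 0 T (c x) = 1 := by
    intro x hx
    rw [pnorm_zero_eq_norm, ← (hXc x hx).1]
    congr 1
    ext p
    exact (hXc x hx).2.1 p
  have hne1 : pnorm 0 T ee = 1 := by
    rw [pnorm_zero_eq_norm, ← mem_sphere_zero_iff_norm.1 heS]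
    congr 1
    ext p
    exact hee p
  have hnsum : ∑ p ∈ T, ‖ee p‖ ^ 2 = 1 := by
    have := pnorm_sq 0 T ee
    rw [hne1] at this
    simp only [Real.rpow_zero, one_mul, one_pow] at this
    exact this.symm
  have heq : ∀ x ∈ Icc (1 : ℝ) 2, ∀ p ∈ T, (waveSymbol m x p : ℂ) * c x p +
      (ε : ℂ) * ∑ p' ∈ T, a x p p' * c x p' = ((lam x : ℝ) : ℂ) * c x p := by
    intro x hx p hp
    rw [← waveAct_eq_sum (hdiag x hx p hp)]
    exact (hXc x hx).2.2 p hp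
  have hlam0 : Tendsto lam U (𝓝 (lam ω)) :=
    ((hlam.continuousOn ω hω).mono_left (nhdsWithin_mono _ sdiff_subset)).mono_left hU
  have ha0 : ∀ p p', Tendsto (fun x => a x p p') U (𝓝 (a ω p p')) := by
    intro p p'
    rw [tendsto_iff_norm_sub_tendsto_zero]
    have h1 : Tendsto (fun x => K * ((b + 1) * |x - ω|)) U (𝓝 (K * ((b + 1) * |ω - ω|))) :=
      ((hUω.sub_const ω).abs.const_mul _).const_mul _
    rw [sub_self, abs_zero, mul_zero, mul_zero] at h1
    refine squeeze_zero' (Eventually.of_forall fun x => norm_nonneg _) ?_ h1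
    filter_upwards [hUI] with x hx
    exact (hlip x hx.1).norm_entry_le (by positivity) p p'
  have hsym : ∀ p : ActiveMode P K₀, Continuous fun x => (waveSymbol m x p : ℂ) := by
    intro p
    unfold waveSymbol
    fun_prop
  have heq0 : ∀ p ∈ T, (waveSymbol m ω p : ℂ) * ee p +
      (ε : ℂ) * ∑ p' ∈ T, a ω p p' * ee p' = ((lam ω : ℝ) : ℂ) * ee p := by
    intro p hp
    have h1 : Tendsto (fun x => (waveSymbol m x p : ℂ) * c x p +
        (ε : ℂ) * ∑ p' ∈ T, a x p p' * c x p') U (𝓝 ((waveSymbol m ω p : ℂ) * ee p +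
        (ε : ℂ) * ∑ p' ∈ T, a ω p p' * ee p')) :=
      ((((hsym p).tendsto ω).comp hUω).mul (hc p hp)).add
        ((tendsto_finsetSum T fun p' hp' => (ha0 p p').mul (hc p' hp')).const_mul _)
    have h2 : Tendsto (fun x => ((lam x : ℝ) : ℂ) * c x p) U (𝓝 (((lam ω : ℝ) : ℂ) * ee p)) :=
      ((Complex.continuous_ofReal.tendsto _).comp hlam0).mul (hc p hp)
    refine tendsto_nhds_unique (h1.congr' ?_) h2
    filter_upwards [hUI] with x hx
    exact heq x hx.1 p hp
  have hconj : ∀ p ∈ T, (waveSymbol m ω p : ℂ) * (starRingEnd ℂ) (ee p) +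
      (ε : ℂ) * ∑ p' ∈ T, a ω p' p * (starRingEnd ℂ) (ee p') =
        ((lam ω : ℝ) : ℂ) * (starRingEnd ℂ) (ee p) := by
    intro p hp
    have h1 := congrArg (starRingEnd ℂ) (heq0 p hp)
    simpa only [map_add, map_mul, map_sum, Complex.conj_ofReal, hsa] using h1
  set G : ℝ → ℂ := fun x => ∑ p ∈ T, (starRingEnd ℂ) (ee p) * c x p with hG
  set Jx : ℝ → ℂ := fun x => ∑ p ∈ T, (starRingEnd ℂ) (ee p) * ((p.time : ℂ) ^ 2 * c x p) with hJx
  set D : ℝ → ℂ := fun x => ∑ p ∈ T, (starRingEnd ℂ) (ee p) * (a x - a ω).act (c x) p with hD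
  -- Pair the equation at `x` with `e`, and the conjugate equation at `ω` with `c x`; by
  -- self-adjointness the terms with `a ω` match. After division by `x - ω` the limits are `G → 1`
  -- and `Jx → J`, and `D` is controlled by the Lipschitz bound only.
  have hident : ∀ x ∈ Icc (1 : ℝ) 2, ((lam x : ℂ) - lam ω) * G x + ((x : ℂ) ^ 2 - (ω : ℂ) ^ 2) * Jx x =
      (ε : ℂ) * D x := by
    intro x hx
    have h1 : ∑ p ∈ T, (starRingEnd ℂ) (ee p) * ((waveSymbol m x p : ℂ) * c x p +
        (ε : ℂ) * ∑ p' ∈ T, a x p p' * c x p') = (lam x : ℂ) * G x := by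
      rw [hG, Finset.mul_sum]
      refine Finset.sum_congr rfl fun p hp => ?_
      rw [heq x hx p hp]
      ring
    have h2 : ∑ p ∈ T, c x p * ((waveSymbol m ω p : ℂ) * (starRingEnd ℂ) (ee p) +
        (ε : ℂ) * ∑ p' ∈ T, a ω p' p * (starRingEnd ℂ) (ee p')) = (lam ω : ℂ) * G x := by
      rw [hG, Finset.mul_sum]
      refine Finset.sum_congr rfl fun p hp => ?_
      rw [hconj p hp]
      ring
    have h3 : ∑ p ∈ T, c x p * ∑ p' ∈ T, a ω p' p * (starRingEnd ℂ) (ee p') =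
        ∑ p ∈ T, (starRingEnd ℂ) (ee p) * ∑ p' ∈ T, a ω p p' * c x p' := by
      simp only [Finset.mul_sum]
      rw [Finset.sum_comm]
      exact Finset.sum_congr rfl fun p _ => Finset.sum_congr rfl fun p' _ => by ring
    have h4 : D x = ∑ p ∈ T, (starRingEnd ℂ) (ee p) * ∑ p' ∈ T, a x p p' * c x p' -
        ∑ p ∈ T, (starRingEnd ℂ) (ee p) * ∑ p' ∈ T, a ω p p' * c x p' := by
      rw [hD, ← Finset.sum_sub_distrib]
      refine Finset.sum_congr rfl fun p hp => ?_
      rw [act_sub_of_closed (hdiag ω hω p hp) (hdiag x hx p hp), act_eq_sum (hdiag ω hω p hp),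
        act_eq_sum (hdiag x hx p hp), mul_sub]
    rw [sub_mul, ← h1, ← h2, h4]
    simp only [mul_add, Finset.sum_add_distrib]
    have h5 : ∑ p ∈ T, c x p * ((ε : ℂ) * ∑ p' ∈ T, a ω p' p * (starRingEnd ℂ) (ee p')) =
        (ε : ℂ) * ∑ p ∈ T, (starRingEnd ℂ) (ee p) * ∑ p' ∈ T, a ω p p' * c x p' := by
      rw [← h3, Finset.mul_sum]
      exact Finset.sum_congr rfl fun p _ => by ring
    have h6 : ∑ p ∈ T, (starRingEnd ℂ) (ee p) * ((ε : ℂ) * ∑ p' ∈ T, a x p p' * c x p') =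
        (ε : ℂ) * ∑ p ∈ T, (starRingEnd ℂ) (ee p) * ∑ p' ∈ T, a x p p' * c x p' := by
      rw [Finset.mul_sum]
      exact Finset.sum_congr rfl fun p _ => by ring
    have h7 : ∑ p ∈ T, (starRingEnd ℂ) (ee p) * ((waveSymbol m x p : ℂ) * c x p) -
        ∑ p ∈ T, c x p * ((waveSymbol m ω p : ℂ) * (starRingEnd ℂ) (ee p)) +
        ((x : ℂ) ^ 2 - (ω : ℂ) ^ 2) * Jx x = 0 := by
      rw [hJx, Finset.mul_sum, ← Finset.sum_sub_distrib, ← Finset.sum_add_distrib]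
      refine Finset.sum_eq_zero fun p _ => ?_
      simp only [waveSymbol]
      push_cast
      ring
    rw [h5, h6]
    linear_combination h7
  have hDle : ∀ x ∈ Icc (1 : ℝ) 2, ‖D x‖ ≤ schurConst h P * (K * (b + 1)) * |x - ω| := by
    intro x hx
    refine (norm_sum_mul_le 0 T _ _).trans ?_
    rw [neg_zero, pnorm_conj, hne1, one_mul]
    have h1 := (hlip x hx).pnorm_act_le h (by positivity) (T := T) (fun p hp p' hp' => by
      simp [hdiag x hx p hp p' hp', hdiag ω hω p hp p' hp']) (c x)
    rw [hnc x hx] at h1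
    linarith
  have hcG : Tendsto G U (𝓝 1) := by
    have h1 : Tendsto G U (𝓝 (∑ p ∈ T, (starRingEnd ℂ) (ee p) * ee p)) :=
      tendsto_finsetSum T fun p hp => (hc p hp).const_mul _
    have h2 : ∑ p ∈ T, (starRingEnd ℂ) (ee p) * ee p = 1 := by
      have := congrArg (fun r : ℝ => (r : ℂ)) hnsum
      simp only [Complex.ofReal_sum, Complex.ofReal_one] at this
      rw [← this]
      refine Finset.sum_congr rfl fun p _ => ?_
      rw [mul_comm, Complex.mul_conj, Complex.normSq_eq_norm_sq]
    rwa [h2] at h1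
  set J : ℝ := ∑ p ∈ T, (p.time : ℝ) ^ 2 * ‖ee p‖ ^ 2 with hJ
  have hcJ : Tendsto Jx U (𝓝 (J : ℂ)) := by
    have h1 : Tendsto Jx U (𝓝 (∑ p ∈ T, (starRingEnd ℂ) (ee p) * ((p.time : ℂ) ^ 2 * ee p))) :=
      tendsto_finsetSum T fun p hp => ((hc p hp).const_mul _).const_mul _
    have h2 : ∑ p ∈ T, (starRingEnd ℂ) (ee p) * ((p.time : ℂ) ^ 2 * ee p) = (J : ℂ) := by
      rw [hJ, Complex.ofReal_sum]
      refine Finset.sum_congr rfl fun p _ => ?_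
      rw [mul_comm, mul_assoc, Complex.mul_conj, Complex.normSq_eq_norm_sq]
      push_cast
      ring
    rwa [h2] at h1
  have hslope : Tendsto (slope lam ω) U (𝓝 (derivWithin lam (Icc 1 2) ω)) :=
    (hasDerivWithinAt_iff_tendsto_slope.1 (hasDerivWithinAt_of_contDiffOn_one hlam hω)).mono_left hU
  refine ⟨J, ?_, ?_, ?_⟩
  · rw [hJ, ← mul_one ((K₀ ^ 2)⁻¹ * jap (P.center α) ^ 4), ← hnsum, Finset.mul_sum]
    refine Finset.sum_le_sum fun p hp => mul_le_mul_of_nonneg_right ?_ (sq_nonneg _)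
    rw [← size_of_block (mem_blockModes.1 hp)]
    exact le_sq_time h p
  · rw [hJ, ← mul_one (K₀ ^ 2 * jap (P.center α) ^ 4), ← hnsum, Finset.mul_sum]
    refine Finset.sum_le_sum fun p hp => mul_le_mul_of_nonneg_right ?_ (sq_nonneg _)
    rw [← size_of_block (mem_blockModes.1 hp)]
    exact sq_time_le p
  · have h1 : Tendsto (fun x => ((slope lam ω x : ℝ) : ℂ) * G x + ((x + ω : ℝ) : ℂ) * Jx x) U
        (𝓝 (((derivWithin lam (Icc 1 2) ω : ℝ) : ℂ) * 1 + ((ω + ω : ℝ) : ℂ) * (J : ℂ))) :=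
      (((Complex.continuous_ofReal.tendsto _).comp hslope).mul hcG).add
        (((Complex.continuous_ofReal.tendsto _).comp (hUω.add_const ω)).mul hcJ)
    have h2 := le_of_tendsto h1.norm (b := ε * (schurConst h P * (K * (b + 1)))) (by
      filter_upwards [hUI] with x hx
      have hxω : x - ω ≠ 0 := sub_ne_zero.2 hx.2
      have hxc : ((x : ℂ) - ω) ≠ 0 := by exact_mod_cast hxω
      have h3 : ((slope lam ω x : ℝ) : ℂ) * G x + ((x + ω : ℝ) : ℂ) * Jx x =
          ((x : ℂ) - ω)⁻¹ * ((ε : ℂ) * D x) := by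
        rw [← hident x hx.1, slope_def_field]
        push_cast
        field_simp
        ring
      have hpos : 0 < |x - ω| := abs_pos.2 hxω
      rw [h3, norm_mul, norm_mul, norm_inv, Complex.norm_real, Real.norm_of_nonneg hε.1,
        ← Complex.ofReal_sub, Complex.norm_real, Real.norm_eq_abs, inv_mul_le_iff₀ hpos]
      have := mul_le_mul_of_nonneg_left (hDle x hx.1) hε.1
      linarith)
    rw [← Complex.ofReal_one, ← Complex.ofReal_mul, ← Complex.ofReal_mul, ← Complex.ofReal_add,
      Complex.norm_real, Real.norm_eq_abs] at h2
    rwa [mul_one, ← two_mul] at h2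

/-- The constants of the eigenvalues. -/
theorem BlockFam.eigenvalueConstant (h : Admissible β θ K₀) {q γ K τ₀ m γ₀ C₀ ζ : ℝ} (hζ : 0 < ζ)
    {VD : Fam P K₀ σ} (hVD : BlockFam q γ K τ₀ VD) (hK : 0 ≤ K) (hτ : τ₀ ≤ σ - ζ - 2)
    (hγ₀ : γ₀ ≤ γ) (hγ1 : γ₀ ≤ 1) (hq : 0 < q)
    (h1 : γ₀ * (schurConst h P * (K * (q + 1))) ≤ (K₀ ^ 2)⁻¹)
    (h2 : 2 * K₀ ^ 2 + schurConst h P * (K * (q + 1)) ≤ C₀) :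
    EigenvalueConstant m q γ₀ C₀ hζ VD := by
  have hsc := schurConst_pos h P
  have hK0 := h.K_pos
  have hM0 : 0 ≤ schurConst h P * (K * (q + 1)) := by positivity
  refine ⟨?_, ?_⟩
  · intro α ε hε ω hω u v _ hvr hu hv μ hμ
    obtain ⟨μ', hμ', hle⟩ := hVD.exists_isEig_near_of_isEig h hK (by linarith)
      ⟨hε.1.le, hε.2.trans hγ₀⟩ hω hvr hu hv hμ
    refine ⟨μ', hμ', hle.trans ?_⟩
    have h3 : schurConst h P * K ≤ C₀ := by
      have : 0 ≤ schurConst h P * K * q := by positivity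
      nlinarith [sq_nonneg K₀]
    have := hε.1
    gcongr
  · rintro α ε hε v v' hvr hv ⟨A, b, hAb, hbd⟩ lam hlam heig ω hω
    have hA0 : 0 ≤ A := (norm_nonneg _).trans (hbd ω hω).1
    have hb0 : 0 ≤ b := (norm_nonneg _).trans (hbd ω hω).2
    obtain ⟨J, hJ1, hJ2, hJ3⟩ := hVD.abs_deriv_add_le h hK (ε := ε) ⟨hε.1.le, hε.2.trans hγ₀⟩ hb0
      hvr (fun x hx => by linarith [(hbd x hx).1]) (fun x hx y hy => by
        have e1 := hv.norm_sub_le (fun x hx => (hbd x hx).2) hx hy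
        rw [← Hs.incl_sub, Hs.norm_incl] at e1
        exact ((v x - v y).sobNorm_mono hτ (index_drop hζ)).trans e1) hlam heig hω
    have hM : ε * (schurConst h P * (K * (b + 1))) ≤ γ₀ * (schurConst h P * (K * (q + 1))) := by
      have : b ≤ q := by linarith
      have := hε.1
      have := hε.2
      have : 0 ≤ γ₀ := by linarith
      gcongr
    have hz : 1 ≤ jap (P.center α) ^ 4 := one_le_pow₀ (one_le_jap _)
    have hM2 : ε * (schurConst h P * (K * (b + 1))) ≤ schurConst h P * (K * (q + 1)) :=
      hM.trans (mul_le_of_le_one_left hM0 hγ1)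
    obtain ⟨h5, h6⟩ := abs_le.1 hJ3
    set z := jap (P.center α) ^ 4
    have hinv : 0 < (K₀ ^ 2)⁻¹ := by positivity
    -- The main term is at most `-2 (K₀²)⁻¹ z` and the perturbation takes back at most `(K₀²)⁻¹`.
    -- What is left, `-(K₀²)⁻¹ z`, is below `-2 C₀⁻¹ z` since `C₀ ≥ 2 K₀²`.
    have hC₀ : C₀⁻¹ ≤ (K₀ ^ 2)⁻¹ / 2 := by
      rw [← one_div, ← one_div, div_div]
      refine one_div_le_one_div_of_le (by positivity) (by linarith)
    have hJ0 : 0 ≤ J := le_trans (by positivity) hJ1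
    constructor
    · have e1 : 2 * ω * J ≤ 4 * (K₀ ^ 2 * z) := by nlinarith [hω.2]
      have e2 : (2 * K₀ ^ 2 + schurConst h P * (K * (q + 1))) * z ≤ C₀ * z :=
        mul_le_mul_of_nonneg_right h2 (by linarith)
      have e3 : schurConst h P * (K * (q + 1)) ≤ schurConst h P * (K * (q + 1)) * z :=
        le_mul_of_one_le_right hM0 hz
      have e4 : 0 ≤ K₀ ^ 2 * z := by positivity
      linarith
    · have e1 : 2 * ((K₀ ^ 2)⁻¹ * z) ≤ 2 * ω * J := by nlinarith [hω.1]
      have e2 : C₀⁻¹ * z ≤ (K₀ ^ 2)⁻¹ / 2 * z := mul_le_mul_of_nonneg_right hC₀ (by linarith)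
      have e3 : (K₀ ^ 2)⁻¹ ≤ (K₀ ^ 2)⁻¹ * z := le_mul_of_one_le_right hinv.le hz
      linarith

/-! Cut-off functions on the interval -/

/-- The point `x` is at distance less than `r` of the part of `[1, 2]` outside `O`. -/
def NearCompl (O : Set ℝ) (r x : ℝ) : Prop := ∃ y ∈ Icc (1 : ℝ) 2, y ∉ O ∧ |x - y| < r

/-- A function which vanishes near the part of `[1, 2]` outside `O` and is `1` far from it. -/
def cutProfile (O : Set ℝ) (D x : ℝ) : ℝ :=
  open Classical in
  if (Icc (1 : ℝ) 2 \ O).Nonempty then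
    -- The profile rises from `0` at distance `5 D / 8` to `1` at distance `3 D / 4`. Averaging over
    -- a length `D / 8` turns these thresholds into `D / 2` and `7 D / 8`, leaving room on both
    -- sides.
    min 1 (max 0 (8 / D * Metric.infDist x (Icc 1 2 \ O) - 5))
  -- A separate case, because the distance to the empty set has the default value `0`.
  else 1

/-- The average of `cutProfile` on a short interval, a `C¹` cut-off function. -/
def cutoff (O : Set ℝ) (D x : ℝ) : ℝ := 8 / D * ∫ t in x..(x + D / 8), cutProfile O D t

theorem cutProfile_mem (O : Set ℝ) (D x : ℝ) : cutProfile O D x ∈ Icc (0 : ℝ) 1 := by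
  unfold cutProfile
  split_ifs
  · exact ⟨le_min zero_le_one (le_max_left _ _), min_le_left _ _⟩
  · exact ⟨zero_le_one, le_rfl⟩

theorem continuous_cutProfile (O : Set ℝ) (D : ℝ) : Continuous (cutProfile O D) := by
  unfold cutProfile
  split_ifs
  · have := Metric.continuous_infDist_pt (Icc (1 : ℝ) 2 \ O)
    fun_prop
  · exact continuous_const

theorem abs_cutProfile_sub_le (O : Set ℝ) {D : ℝ} (hD : 0 < D) (x y : ℝ) :
    |cutProfile O D x - cutProfile O D y| ≤ 8 / D * |x - y| := by
  unfold cutProfile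
  split_ifs
  · refine (abs_min_sub_min_le_max _ _ _ _).trans ?_
    rw [sub_self, abs_zero]
    refine max_le (by positivity) ((abs_max_sub_max_le_max _ _ _ _).trans ?_)
    rw [sub_self, abs_zero]
    refine max_le (by positivity) ?_
    have h1 : |Metric.infDist x (Icc 1 2 \ O) - Metric.infDist y (Icc 1 2 \ O)| ≤ |x - y| := by
      have := (Metric.lipschitz_infDist_pt (Icc (1 : ℝ) 2 \ O)).dist_le_mul x y
      rwa [NNReal.coe_one, one_mul, Real.dist_eq, Real.dist_eq] at this
    have e : 8 / D * Metric.infDist x (Icc 1 2 \ O) - 5 -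
        (8 / D * Metric.infDist y (Icc 1 2 \ O) - 5) =
        8 / D * (Metric.infDist x (Icc 1 2 \ O) - Metric.infDist y (Icc 1 2 \ O)) := by ring
    rw [e, abs_mul, abs_of_pos (by positivity : 0 < 8 / D)]
    exact mul_le_mul_of_nonneg_left h1 (by positivity)
  · rw [sub_self, abs_zero]
    positivity

theorem hasDerivAt_cutoff (O : Set ℝ) (D x : ℝ) :
    HasDerivAt (cutoff O D) (8 / D * (cutProfile O D (x + D / 8) - cutProfile O D x)) x := by
  have hc := continuous_cutProfile O D
  have h1 : ∀ y, HasDerivAt (fun y => ∫ t in (0 : ℝ)..y, cutProfile O D t) (cutProfile O D y) y :=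
    fun y => intervalIntegral.integral_hasDerivAt_right (hc.intervalIntegrable _ _)
      hc.stronglyMeasurable.stronglyMeasurableAtFilter hc.continuousAt
  have h2 : HasDerivAt (fun y => ∫ t in (0 : ℝ)..(y + D / 8), cutProfile O D t)
      (cutProfile O D (x + D / 8)) x := by
    have := (h1 (x + D / 8)).comp_add_const x (D / 8)
    simpa using this
  have h3 := (h2.sub (h1 x)).const_mul (8 / D)
  refine h3.congr_of_eventuallyEq (Eventually.of_forall fun y => ?_)
  rw [cutoff, ← intervalIntegral.integral_interval_sub_left (a := 0)
    (hc.intervalIntegrable _ _) (hc.intervalIntegrable _ _)]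
  rfl

theorem contDiff_cutoff (O : Set ℝ) (D : ℝ) : ContDiff ℝ 1 (cutoff O D) := by
  rw [contDiff_one_iff_deriv]
  refine ⟨fun x => (hasDerivAt_cutoff O D x).differentiableAt, ?_⟩
  have : deriv (cutoff O D) = fun x => 8 / D * (cutProfile O D (x + D / 8) - cutProfile O D x) :=
    funext fun x => (hasDerivAt_cutoff O D x).deriv
  rw [this]
  have := continuous_cutProfile O D
  fun_prop

theorem abs_deriv_cutoff_le (O : Set ℝ) {D : ℝ} (hD : 0 < D) (x : ℝ) :
    |8 / D * (cutProfile O D (x + D / 8) - cutProfile O D x)| ≤ 8 / D := by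
  rw [abs_mul, abs_of_pos (by positivity : 0 < 8 / D)]
  refine mul_le_of_le_one_right (by positivity) ?_
  refine (abs_cutProfile_sub_le O hD _ _).trans (le_of_eq ?_)
  rw [add_sub_cancel_left, abs_of_pos (by positivity)]
  field_simp

theorem abs_cutoff_sub_le (O : Set ℝ) {D : ℝ} (hD : 0 < D) (x y : ℝ) :
    |cutoff O D x - cutoff O D y| ≤ 8 / D * |x - y| :=
  convex_univ.norm_image_sub_le_of_norm_hasDerivWithin_le
    (fun x _ => (hasDerivAt_cutoff O D x).hasDerivWithinAt)
    (fun x _ => abs_deriv_cutoff_le O hD x) (mem_univ y) (mem_univ x)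

theorem cutoff_const {O : Set ℝ} {D x c : ℝ} (hD : 0 < D)
    (h : ∀ t ∈ Icc x (x + D / 8), cutProfile O D t = c) : cutoff O D x = c := by
  rw [cutoff, intervalIntegral.integral_congr (g := fun _ => c) fun t ht => by
    rw [uIcc_of_le (by linarith)] at ht
    exact h t ht, intervalIntegral.integral_const]
  simp only [add_sub_cancel_left, smul_eq_mul]
  field_simp

theorem cutoff_mem (O : Set ℝ) {D : ℝ} (hD : 0 < D) (x : ℝ) : cutoff O D x ∈ Icc (0 : ℝ) 1 := by
  have hc := continuous_cutProfile O D
  have hle : x ≤ x + D / 8 := by linarith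
  constructor
  · refine mul_nonneg (by positivity) (intervalIntegral.integral_nonneg hle fun t _ => ?_)
    exact (cutProfile_mem O D t).1
  · have h1 := intervalIntegral.integral_mono_on hle (hc.intervalIntegrable _ _)
      (continuous_const.intervalIntegrable (μ := MeasureTheory.volume) x (x + D / 8))
      fun t _ => (cutProfile_mem O D t).2
    rw [intervalIntegral.integral_const] at h1
    simp only [add_sub_cancel_left, smul_eq_mul, mul_one] at h1
    have h2 := mul_le_mul_of_nonneg_left h1 (by positivity : 0 ≤ 8 / D)
    refine h2.trans (le_of_eq ?_)
    field_simp

theorem infDist_lt_of_nearCompl {O : Set ℝ} {r x : ℝ} (h : NearCompl O r x) :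
    Metric.infDist x (Icc 1 2 \ O) < r := by
  obtain ⟨y, hy, hyO, hxy⟩ := h
  have hm : y ∈ Icc (1 : ℝ) 2 \ O := ⟨hy, hyO⟩
  exact (Metric.infDist_le_dist_of_mem hm).trans_lt hxy

/-- The cut-off function vanishes near the complement of `O`. -/
theorem cutoff_eq_zero {O : Set ℝ} {D x : ℝ} (hD : 0 < D) (h : NearCompl O (D / 2) x) :
    cutoff O D x = 0 := by
  refine cutoff_const hD fun t ht => ?_
  obtain ⟨y, hy, hyO, hxy⟩ := h
  have hn : NearCompl O (5 * D / 8) t := by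
    refine ⟨y, hy, hyO, ?_⟩
    rw [abs_lt] at hxy ⊢
    constructor <;> linarith [ht.1, ht.2, hxy.1, hxy.2]
  have h1 := infDist_lt_of_nearCompl hn
  have hm : (Icc (1 : ℝ) 2 \ O).Nonempty := ⟨y, hy, hyO⟩
  rw [cutProfile, if_pos hm]
  have h2 : 8 / D * Metric.infDist t (Icc 1 2 \ O) - 5 ≤ 0 := by
    have := mul_le_mul_of_nonneg_left h1.le (by positivity : 0 ≤ 8 / D)
    have e : 8 / D * (5 * D / 8) = 5 := by field_simp
    linarith
  rw [max_eq_left h2]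
  exact min_eq_right zero_le_one

/-- The cut-off function is `1` far from the complement of `O`. -/
theorem cutoff_eq_one {O : Set ℝ} {D x : ℝ} (hD : 0 < D) (h : ¬ NearCompl O (7 * D / 8) x) :
    cutoff O D x = 1 := by
  refine cutoff_const hD fun t ht => ?_
  rw [cutProfile]
  split_ifs with hne
  · have h1 : 3 * D / 4 ≤ Metric.infDist t (Icc 1 2 \ O) := by
      refine (Metric.le_infDist hne).2 fun y hy => ?_
      by_contra hlt
      push Not at hlt
      refine h ⟨y, hy.1, hy.2, ?_⟩
      rw [Real.dist_eq, abs_lt] at hlt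
      rw [abs_lt]
      constructor <;> linarith [ht.1, ht.2, hlt.1, hlt.2]
    have h2 := mul_le_mul_of_nonneg_left h1 (by positivity : 0 ≤ 8 / D)
    have e : 8 / D * (3 * D / 4) = 6 := by
      field_simp
      norm_num
    rw [max_eq_right (by linarith)]
    exact min_eq_left (by linarith)
  · rfl

theorem closure_support_cutoff_subset {O : Set ℝ} {D : ℝ} (hD : 0 < D) :
    closure {x | x ∈ Icc (1 : ℝ) 2 ∧ cutoff O D x ≠ 0} ⊆ O := by
  intro x hx
  by_contra hxO
  have hxI : x ∈ Icc (1 : ℝ) 2 := closure_minimal (fun y hy => hy.1) isClosed_Icc hx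
  obtain ⟨y, hy, hyx⟩ := Metric.mem_closure_iff.1 hx (D / 2) (by positivity)
  refine hy.2 (cutoff_eq_zero hD ⟨x, hxI, hxO, ?_⟩)
  rwa [dist_comm, Real.dist_eq] at hyx

/-- A function which is `C¹` near the complement of `O` becomes `C¹` after multiplication by
`1 - cutoff`. -/
theorem contDiffOn_cutoff_mul {O : Set ℝ} {D : ℝ} (hD : 0 < D) {f : ℝ → ℂ}
    (hf : ∀ x ∈ Icc (1 : ℝ) 2, NearCompl O D x → ContDiffWithinAt ℝ 1 f (Icc 1 2) x) :
    ContDiffOn ℝ 1 (fun x => ((1 - cutoff O D x : ℝ) : ℂ) * f x) (Icc 1 2) := by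
  intro x hx
  by_cases h : NearCompl O D x
  · have h1 : ContDiff ℝ 1 fun x => ((1 - cutoff O D x : ℝ) : ℂ) :=
      Complex.ofRealCLM.contDiff.comp (contDiff_const.sub (contDiff_cutoff O D))
    exact h1.contDiffWithinAt.mul (hf x hx h)
  -- Here no point outside `O` is within `D`, hence none is within `7 D / 8` of any point of the
  -- ball of radius `D / 8`. The product vanishes near `x`, whatever `f` is.
  · have h1 : ∀ᶠ y in 𝓝 x, ((1 - cutoff O D y : ℝ) : ℂ) * f y = 0 := by
      filter_upwards [Metric.ball_mem_nhds x (by positivity : 0 < D / 8)] with y hy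
      rw [cutoff_eq_one hD, sub_self, Complex.ofReal_zero, zero_mul]
      rintro ⟨z, hz, hzO, hyz⟩
      refine h ⟨z, hz, hzO, ?_⟩
      rw [Metric.mem_ball, dist_comm, Real.dist_eq] at hy
      have : |x - z| ≤ |x - y| + |y - z| := abs_sub_le x y z
      linarith
    have h2 : ContDiffWithinAt ℝ 1 (fun _ : ℝ => (0 : ℂ)) (Icc 1 2) x := contDiffWithinAt_const
    exact h2.congr_of_eventuallyEq (nhdsWithin_le_nhds h1) h1.self_of_nhds

/-! Estimates of the right hand side -/

theorem FOp.Bdd.sobBdd_act {a : FOp P K₀} (h : a.Bdd s s') {c : ActiveMode P K₀ → ℂ} {B K : ℝ}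
    (hc : SobBdd s c B) (hK : ‖a.clm s s'‖ ≤ K) : SobBdd s' (a.act c) (K * B) := by
  have h1 : (Hs.ofSeq s c).coeff = c := Hs.coeff_ofSeq hc
  have h2 : ‖Hs.ofSeq s c‖ ≤ B := by
    rw [Hs.norm_le_iff hc.nonneg, h1]
    exact hc
  have h3 := ((a.clm s s') (Hs.ofSeq s c)).sobBdd
  rw [h.rep_clm.apply, h1] at h3
  exact h3.mono (((a.clm s s').le_opNorm _).trans
    (mul_le_mul hK h2 (norm_nonneg _) ((norm_nonneg _).trans hK)))

theorem FOp.Bdd.sobBdd_act_sub {a a' : FOp P K₀} (h : a.Bdd s s') (h' : a'.Bdd s s')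
    {c : ActiveMode P K₀ → ℂ} {B K : ℝ} (hc : SobBdd s c B)
    (hK : ‖a.clm s s' - a'.clm s s'‖ ≤ K) :
    SobBdd s' (fun p => a.act c p - a'.act c p) (K * B) := by
  have h1 : (Hs.ofSeq s c).coeff = c := Hs.coeff_ofSeq hc
  have h2 : ‖Hs.ofSeq s c‖ ≤ B := by
    rw [Hs.norm_le_iff hc.nonneg, h1]
    exact hc
  have h3 := ((a.clm s s' - a'.clm s s') (Hs.ofSeq s c)).sobBdd
  have h4 : ((a.clm s s' - a'.clm s s') (Hs.ofSeq s c)).coeff =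
      fun p => a.act c p - a'.act c p := by
    funext p
    rw [sub_apply, Hs.coeff_sub, h.rep_clm.apply, h'.rep_clm.apply, h1]
  rw [h4] at h3
  exact h3.mono (((a.clm s s' - a'.clm s s').le_opNorm _).trans
    (mul_le_mul hK h2 (norm_nonneg _) ((norm_nonneg _).trans hK)))

/-- The rows of a smoothing operator may be infinite, so the two sequences must have finite norms
for the sums to be split. -/
theorem FOp.Bdd.act_sub {a : FOp P K₀} (h : a.Bdd s s') {c c' : ActiveMode P K₀ → ℂ} {B B' : ℝ}
    (hc : SobBdd s c B) (hc' : SobBdd s c' B') (p : ActiveMode P K₀) :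
    a.act (fun p => c p - c' p) p = a.act c p - a.act c' p := by
  have h1 : (Hs.ofSeq s c).coeff = c := Hs.coeff_ofSeq hc
  have h1' : (Hs.ofSeq s c').coeff = c' := Hs.coeff_ofSeq hc'
  have h2 : (Hs.ofSeq s c - Hs.ofSeq s c').coeff = fun p => c p - c' p := by
    funext p
    rw [Hs.coeff_sub, h1, h1']
  have h3 : ((a.clm s s') (Hs.ofSeq s c - Hs.ofSeq s c')).coeff p =
      ((a.clm s s') (Hs.ofSeq s c)).coeff p - ((a.clm s s') (Hs.ofSeq s c')).coeff p := by
    rw [map_sub, Hs.coeff_sub]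
  rwa [h.rep_clm.apply, h.rep_clm.apply, h.rep_clm.apply, h2, h1, h1'] at h3

theorem sobBdd_idAdd {τ C K ε B : ℝ} {a : FOp P K₀} (hε : ε ∈ Icc (0 : ℝ) 1)
    {c : ActiveMode P K₀ → ℂ} (hc : SobBdd τ c B) (ha : SobBdd τ (a.act c) (C * K * B)) :
    SobBdd τ (FOp.idAdd ε a c) ((1 + C * K) * B) := by
  have h1 := hc.add (ha.smul (ε : ℂ))
  refine h1.mono ?_
  rw [Complex.norm_real, Real.norm_of_nonneg hε.1]
  have := mul_le_of_le_one_left ha.nonneg hε.2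
  linarith

/-- The right hand side of the equation for `w`, up to the factor `ε` and the spectral cut-off. -/
def rhs (ε : ℝ) (a r r₁ : FOp P K₀) (f u w : ActiveMode P K₀ → ℂ) : ActiveMode P K₀ → ℂ :=
  fun p => FOp.idAdd ε a.adj (r.act u) p + r₁.act w p + FOp.idAdd ε a.adj f p

theorem IsRealSeq.rhs {ε : ℝ} {a r r₁ : FOp P K₀} {f u w : ActiveMode P K₀ → ℂ} (ha : a.IsReal)
    (hr : r.IsReal) (hr₁ : r₁.IsReal) (hf : IsRealSeq f) (hu : IsRealSeq u) (hw : IsRealSeq w) :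
    IsRealSeq (rhs ε a r r₁ f u w) := by
  intro p
  simp only [Beam.rhs, map_add, (hr.act hu).idAdd ha.adj p, hr₁.act hw p, hf.idAdd ha.adj p]

/-- The bounds for the operators which enter the right hand side, for a given order `τ`. -/
structure RhsBounds (q γ ζ τ C : ℝ) (A R R₁ : Fam P K₀ σ) : Prop where
  C_nonneg : 0 ≤ C
  adj_bdd : ∀ z ∈ paramBox γ, ∀ u ∈ Metric.ball (0 : Hs P K₀ σ) q, ∀ c B,
    SobBdd (τ + ζ) c B → SobBdd (τ + ζ) ((A u z).adj.act c) (C * 1 * B)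
  adj_lip : ∀ ε ∈ Icc 0 γ, ∀ ω ∈ Icc (1 : ℝ) 2, ∀ ω' ∈ Icc (1 : ℝ) 2,
    ∀ u ∈ Metric.ball (0 : Hs P K₀ σ) q, ∀ v ∈ Metric.ball (0 : Hs P K₀ σ) q, ∀ c B,
      SobBdd (τ + ζ) c B → SobBdd (τ + ζ)
        (fun p => (A u (ω, ε)).adj.act c p - (A v (ω', ε)).adj.act c p)
        (C * (‖u - v‖ + |ω - ω'|) * B)
  adj_sub : ∀ z ∈ paramBox γ, ∀ u ∈ Metric.ball (0 : Hs P K₀ σ) q, ∀ c c' p,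
    (A u z).adj.act (fun p => c p - c' p) p = (A u z).adj.act c p - (A u z).adj.act c' p
  smooth : SmoothFam q γ ζ τ C R
  smooth₁ : SmoothFam q γ ζ τ C R₁

theorem FOp.adj_sub (a a' : FOp P K₀) : (a - a').adj = a.adj - a'.adj := by
  funext p p'
  simp [FOp.adj]

theorem SmoothFam.mono {q γ r τ K K' : ℝ} {R : Fam P K₀ σ} (h : SmoothFam q γ r τ K R)
    (hK : K ≤ K') : SmoothFam q γ r τ K' R := by
  refine ⟨h.bdd, fun z hz u hu => (h.norm_le z hz u hu).trans hK, ?_, h.c1, h.real⟩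
  intro ε hε ω hω ω' hω' u hu v hv
  refine (h.lip ε hε ω hω ω' hω' u hu v hv).trans ?_
  have := norm_nonneg (u - v)
  have := abs_nonneg (ω - ω')
  exact mul_le_mul_of_nonneg_right hK (by linarith)

/-- The decay class is stable under adjoints and acts on every Sobolev order, so `(Id + ε Q)^*`
preserves the `ζ` orders gained by the smoothing factors. -/
theorem exists_rhsBounds (h : Admissible β θ K₀) {q γ ζ τ τ₀ K : ℝ} {A R R₁ : Fam P K₀ σ}
    (hA : DecayFam q γ K τ₀ A) (hK : 0 ≤ K) (hτ₀ : τ₀ ≤ σ) (hR : ∃ K > 0, SmoothFam q γ ζ τ K R)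
    (hR₁ : ∃ K > 0, SmoothFam q γ ζ τ K R₁) :
    ∃ C > 0, RhsBounds q γ ζ τ C A R R₁ := by
  obtain ⟨C, hC, hact⟩ := DecayBdd.exists_act_le h P (τ + ζ)
  obtain ⟨K₂, hK₂, hR⟩ := hR
  obtain ⟨K₃, hK₃, hR₁⟩ := hR₁
  refine ⟨C * K + K₂ + K₃, by positivity, by positivity, ?_, ?_, ?_,
    hR.mono (by nlinarith), hR₁.mono (by nlinarith)⟩
  · intro z hz u hu c B hc
    refine (hact K _ hK (hA.bdd z hz u hu).adj c B hc).mono ?_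
    rw [mul_one]
    exact mul_le_mul_of_nonneg_right (by linarith) hc.nonneg
  · intro ε hε ω hω ω' hω' u hu v hv c B hc
    have e0 := sobNorm_nonneg τ₀ (u - v).coeff
    have e1 := (hA.lip ε hε ω hω ω' hω' u hu v hv).adj
    have e2 := hact _ _ (by positivity) e1 c B hc
    have e3 : (A u (ω, ε) - A v (ω', ε)).adj.act c =
        fun p => (A u (ω, ε)).adj.act c p - (A v (ω', ε)).adj.act c p := by
      funext p
      rw [FOp.adj_sub]
      exact act_sub_of_decayBdd h (hA.bdd _ ⟨hω, hε⟩ u hu).adj (hA.bdd _ ⟨hω', hε⟩ v hv).adj c p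
    rw [e3] at e2
    refine e2.mono ?_
    have e4 := (u - v).sobNorm_le hτ₀
    have e5 := hc.nonneg
    have e6 := abs_nonneg (ω - ω')
    rw [← mul_assoc]
    refine mul_le_mul_of_nonneg_right ?_ e5
    exact mul_le_mul (by linarith) (by linarith) (by positivity) (by positivity)
  · intro z hz u hu c c' p
    exact act_fun_sub_of_decayBdd h (hA.bdd z hz u hu).adj c c' p

section

variable {q γ ζ τ C ε : ℝ} {A R R₁ : Fam P K₀ σ}

theorem RhsBounds.sobBdd_rhs (h : RhsBounds q γ ζ τ C A R R₁) (hγ : γ ≤ 1) {ω : ℝ}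
    (hε : ε ∈ Icc 0 γ) (hω : ω ∈ Icc (1 : ℝ) 2) {x : Hs P K₀ σ}
    (hx : x ∈ Metric.ball (0 : Hs P K₀ σ) q) {f u w : ActiveMode P K₀ → ℂ} {Bf Bu Bw : ℝ}
    (hf : SobBdd (τ + ζ) f Bf) (hu : SobBdd τ u Bu) (hw : SobBdd τ w Bw) :
    SobBdd (τ + ζ) (rhs ε (A x (ω, ε)) (R x (ω, ε)) (R₁ x (ω, ε)) f u w)
      ((1 + C) ^ 2 * (Bu + Bw + Bf)) := by
  have hz : (ω, ε) ∈ paramBox γ := ⟨hω, hε⟩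
  have hε1 : ε ∈ Icc (0 : ℝ) 1 := ⟨hε.1, hε.2.trans hγ⟩
  have e1 := (h.smooth.bdd _ hz x hx).sobBdd_act hu (h.smooth.norm_le _ hz x hx)
  have e2 := (h.smooth₁.bdd _ hz x hx).sobBdd_act hw (h.smooth₁.norm_le _ hz x hx)
  have e3 := sobBdd_idAdd hε1 e1 (h.adj_bdd _ hz x hx _ _ e1)
  have e4 := sobBdd_idAdd hε1 hf (h.adj_bdd _ hz x hx _ _ hf)
  have e5 := (e3.add e2).add e4
  refine e5.mono ?_
  have := h.C_nonneg
  have := hf.nonneg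
  have := hu.nonneg
  have := hw.nonneg
  have f1 : 0 ≤ C * Bw := by positivity
  have f2 : 0 ≤ C * Bf := by positivity
  have f3 : 0 ≤ C * Bu := by positivity
  have f4 : 0 ≤ C * (C * Bw) := by positivity
  have f5 : 0 ≤ C * (C * Bf) := by positivity
  linarith

/-- Telescoping: the outer operator, the inner operator and the argument are changed one at a time.
The bound `B'` of `w'` does not enter the result; it serves only to split the action of the second
smoothing operator on `w - w'`. -/
theorem RhsBounds.sobBdd_rhs_sub (h : RhsBounds q γ ζ τ C A R R₁) (hγ : γ ≤ 1) {ω ω' : ℝ}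
    (hε : ε ∈ Icc 0 γ) (hω : ω ∈ Icc (1 : ℝ) 2) (hω' : ω' ∈ Icc (1 : ℝ) 2) {x x' : Hs P K₀ σ}
    (hx : x ∈ Metric.ball (0 : Hs P K₀ σ) q) (hx' : x' ∈ Metric.ball (0 : Hs P K₀ σ) q)
    {f u w u' w' : ActiveMode P K₀ → ℂ} {Bf Bu Bw Du Dw B' : ℝ}
    (hf : SobBdd (τ + ζ) f Bf) (hu : SobBdd τ u Bu) (hu' : SobBdd τ u' Bu) (hw : SobBdd τ w Bw)
    (hw' : SobBdd τ w' B')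
    (hdu : SobBdd τ (fun p => u p - u' p) Du) (hdw : SobBdd τ (fun p => w p - w' p) Dw) :
    SobBdd (τ + ζ) (fun p => rhs ε (A x (ω, ε)) (R x (ω, ε)) (R₁ x (ω, ε)) f u w p -
      rhs ε (A x' (ω', ε)) (R x' (ω', ε)) (R₁ x' (ω', ε)) f u' w' p)
      (2 * (1 + C) ^ 2 * ((‖x - x'‖ + |ω - ω'|) * (Bu + Bw + Bf) + Du + Dw)) := by
  have hz : (ω, ε) ∈ paramBox γ := ⟨hω, hε⟩
  have hz' : (ω', ε) ∈ paramBox γ := ⟨hω', hε⟩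
  have hε1 : ε ∈ Icc (0 : ℝ) 1 := ⟨hε.1, hε.2.trans hγ⟩
  set η := ‖x - x'‖ + |ω - ω'| with hη
  have hη0 : 0 ≤ η := by positivity
  set a := A x (ω, ε)
  set a' := A x' (ω', ε)
  set r := R x (ω, ε)
  set r' := R x' (ω', ε)
  set t := R₁ x (ω, ε)
  set t' := R₁ x' (ω', ε)
  have g1 := (h.smooth.bdd _ hz x hx).sobBdd_act_sub (h.smooth.bdd _ hz' x' hx') hu
    (h.smooth.lip ε hε ω hω ω' hω' x hx x' hx')
  have g2 := (h.smooth.bdd _ hz' x' hx').sobBdd_act hdu (h.smooth.norm_le _ hz' x' hx')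
  have g3 := (h.smooth₁.bdd _ hz x hx).sobBdd_act_sub (h.smooth₁.bdd _ hz' x' hx') hw
    (h.smooth₁.lip ε hε ω hω ω' hω' x hx x' hx')
  have g4 := (h.smooth₁.bdd _ hz' x' hx').sobBdd_act hdw (h.smooth₁.norm_le _ hz' x' hx')
  have g5 := (h.smooth.bdd _ hz' x' hx').sobBdd_act hu' (h.smooth.norm_le _ hz' x' hx')
  have g6 := g1.add g2
  have e6 : (fun p => r.act u p - r'.act u p + r'.act (fun p => u p - u' p) p) =
      fun p => r.act u p - r'.act u' p := by
    funext p
    rw [(h.smooth.bdd _ hz' x' hx').act_sub hu hu' p]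
    ring
  rw [e6] at g6
  have g7 := sobBdd_idAdd hε1 g6 (h.adj_bdd _ hz x hx _ _ g6)
  have g8 := (h.adj_lip ε hε ω hω ω' hω' x hx x' hx' _ _ g5).smul (ε : ℂ)
  have g9 := (h.adj_lip ε hε ω hω ω' hω' x hx x' hx' _ _ hf).smul (ε : ℂ)
  have g10 := ((g7.add g8).add (g3.add g4)).add g9
  have e10 : (fun p => FOp.idAdd ε a.adj (fun p => r.act u p - r'.act u' p) p +
      (ε : ℂ) * (a.adj.act (r'.act u') p - a'.adj.act (r'.act u') p) +
      (t.act w p - t'.act w p + t'.act (fun p => w p - w' p) p) +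
      (ε : ℂ) * (a.adj.act f p - a'.adj.act f p)) =
      fun p => rhs ε a r t f u w p - rhs ε a' r' t' f u' w' p := by
    funext p
    rw [(h.smooth₁.bdd _ hz' x' hx').act_sub hw hw' p]
    simp only [rhs, FOp.idAdd]
    rw [h.adj_sub _ hz x hx]
    ring
  rw [e10] at g10
  refine g10.mono ?_
  rw [Complex.norm_real, Real.norm_of_nonneg hε.1]
  have c0 := h.C_nonneg
  have b1 := hf.nonneg
  have b2 := hu.nonneg
  have b3 := hw.nonneg
  have b4 := hdu.nonneg
  have b5 := hdw.nonneg
  have i1 : ε * (C * η * (C * Bu)) ≤ C * η * (C * Bu) := mul_le_of_le_one_left (by positivity) hε1.2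
  have i2 : ε * (C * η * Bf) ≤ C * η * Bf := mul_le_of_le_one_left (by positivity) hε1.2
  have j1 : 0 ≤ C * (η * Bu) := by positivity
  have j2 : 0 ≤ C * (C * (η * Bu)) := by positivity
  have j3 : 0 ≤ C * (η * Bw) := by positivity
  have j4 : 0 ≤ C * (C * (η * Bw)) := by positivity
  have j5 : 0 ≤ C * (η * Bf) := by positivity
  have j6 : 0 ≤ C * (C * (η * Bf)) := by positivity
  have j7 : 0 ≤ C * Du := by positivity
  have j8 : 0 ≤ C * (C * Du) := by positivity
  have j9 : 0 ≤ C * Dw := by positivity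
  have j10 : 0 ≤ C * (C * Dw) := by positivity
  have j11 : 0 ≤ η * Bu := by positivity
  have j12 : 0 ≤ η * Bw := by positivity
  have j13 : 0 ≤ η * Bf := by positivity
  linarith

end

/-! Solution of the equation on the shells -/

theorem LowerBdd.eq_zero {m ω ε c : ℝ} {a : FOp P K₀} {T : Finset (ActiveMode P K₀)} (hc : 0 < c)
    (h : LowerBdd m ω ε a T c) {v : ActiveMode P K₀ → ℂ} (hv : ∀ p ∈ T, waveAct m ω ε a v p = 0)
    {p : ActiveMode P K₀} (hp : p ∈ T) : v p = 0 := by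
  by_contra hne
  have h1 := h v
  rw [pnorm_congr (c' := 0) fun p hp => hv p hp] at h1
  have h2 : pnorm 0 T (0 : ActiveMode P K₀ → ℂ) = 0 := by simp [pnorm]
  rw [h2] at h1
  have h3 := mul_pos hc (pnorm_pos (τ := 0) hp hne)
  linarith

/-- A lower bound forbids a kernel, and a square matrix without kernel is invertible. -/
theorem LowerBdd.det_ne_zero {m ω ε c : ℝ} {a : FOp P K₀} {T : Finset (ActiveMode P K₀)}
    [DecidableEq T] (hc : 0 < c) (h : LowerBdd m ω ε a T c) (hT : BlockClosed T)
    (ha : BlockDiag a) : (waveMatrix m ω ε a T).det ≠ 0 := by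
  classical
  intro hdet
  obtain ⟨v, hv, hMv⟩ := Matrix.exists_mulVec_eq_zero_iff.2 hdet
  obtain ⟨p, hp⟩ := Function.ne_iff.1 hv
  let vv : ActiveMode P K₀ → ℂ := fun p => if hp : p ∈ T then v ⟨p, hp⟩ else 0
  have hvv : (fun p : T => vv p.1) = v := by
    funext p
    simp [vv]
  have h1 : ∀ p ∈ T, waveAct m ω ε a vv p = 0 := by
    intro p hp
    have := waveMatrix_mulVec (m := m) (ω := ω) (ε := ε) (a := a) (T := T) (p := ⟨p, hp⟩)
      (fun p' hp' => ha.entry_eq_zero hT hp hp') vv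
    rw [← this, hvv, hMv]
    rfl
  have h2 := h.eq_zero hc h1 p.2
  rw [← hvv] at hp
  exact hp h2

open Classical in
/-- The solution of `(L_ω + ε a) x = g`, shell by shell. -/
def shellInv (h : Admissible β θ K₀) (m ω ε : ℝ) (a : FOp P K₀) (g : ActiveMode P K₀ → ℂ) :
    ActiveMode P K₀ → ℂ :=
  fun p => (waveMatrix m ω ε a (shell h P p.lev))⁻¹.mulVec (fun q => g q.1) ⟨p, mem_shell.2 rfl⟩

theorem waveAct_shellInv {h : Admissible β θ K₀} {m ω ε c : ℝ} {a : FOp P K₀}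
    (g : ActiveMode P K₀ → ℂ) (ha : BlockDiag a) (hc : 0 < c) {κ : ℕ}
    (hl : LowerBdd m ω ε a (shell h P κ) c) {p : ActiveMode P K₀} (hp : p ∈ shell h P κ) :
    waveAct m ω ε a (shellInv h m ω ε a g) p = g p := by
  classical
  have hT := blockClosed_shell (P := P) h κ
  have hdet := hl.det_ne_zero hc hT ha
  rw [← waveMatrix_mulVec (T := shell h P κ) (p := ⟨p, hp⟩)
    (fun p' hp' => ha.entry_eq_zero hT hp hp')]
  have h1 : (fun q : shell h P κ => shellInv h m ω ε a g q.1) =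
      (waveMatrix m ω ε a (shell h P κ))⁻¹.mulVec (fun q => g q.1) := by
    funext q
    -- The matrix in `shellInv` is indexed by the shell of the level of `q`; replacing `κ` by this
    -- level makes the index types agree.
    obtain ⟨q, hq⟩ := q
    obtain rfl := mem_shell.1 hq
    unfold shellInv
    congr!
  rw [h1, Matrix.mulVec_mulVec]
  have h2 := Matrix.mul_nonsing_inv (waveMatrix m ω ε a (shell h P κ)) (by
    rw [isUnit_iff_ne_zero]
    exact hdet)
  rw [show (waveMatrix m ω ε a (shell h P κ) * (waveMatrix m ω ε a (shell h P κ))⁻¹) = 1 from h2,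
    Matrix.one_mulVec]

theorem contDiffWithinAt_det {n : Type*} [Fintype n] [DecidableEq n] {M : ℝ → Matrix n n ℂ}
    {S : Set ℝ} {x : ℝ} (hM : ∀ i j, ContDiffWithinAt ℝ 1 (fun x => M x i j) S x) :
    ContDiffWithinAt ℝ 1 (fun x => (M x).det) S x := by
  simp only [Matrix.det_apply]
  refine ContDiffWithinAt.sum fun τ _ => ?_
  refine ContDiffWithinAt.const_smul _ ?_
  exact contDiffWithinAt_prod fun i _ => hM _ _

/-- By Cramer's rule the solution is a polynomial in the data divided by a determinant, which does
not vanish at the point considered. -/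
theorem contDiffWithinAt_inv_mulVec {n : Type*} [Fintype n] [DecidableEq n] {M : ℝ → Matrix n n ℂ}
    {g : ℝ → n → ℂ} {S : Set ℝ} {x : ℝ}
    (hM : ∀ i j, ContDiffWithinAt ℝ 1 (fun x => M x i j) S x)
    (hg : ∀ i, ContDiffWithinAt ℝ 1 (fun x => g x i) S x) (hdet : (M x).det ≠ 0) (i : n) :
    ContDiffWithinAt ℝ 1 (fun x => ((M x)⁻¹.mulVec (g x)) i) S x := by
  simp only [Matrix.mulVec, dotProduct, Matrix.inv_def, Ring.inverse_eq_inv', Matrix.smul_apply,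
    smul_eq_mul, Matrix.adjugate_apply]
  refine ContDiffWithinAt.sum fun j _ => ContDiffWithinAt.mul (ContDiffWithinAt.mul ?_ ?_) (hg j)
  · exact (contDiffWithinAt_det hM).inv hdet
  · refine contDiffWithinAt_det fun i' j' => ?_
    simp only [Matrix.updateRow_apply]
    split_ifs
    · exact contDiffWithinAt_const
    · exact hM _ _

theorem contDiff_waveSymbol (m : ℝ) (p : ActiveMode P K₀) :
    ContDiff ℝ 1 fun ω => (waveSymbol m ω p : ℂ) := by
  refine Complex.ofRealCLM.contDiff.comp ?_
  change ContDiff ℝ 1 fun ω : ℝ => -ω ^ 2 * (p.time : ℝ) ^ 2 + len p.space ^ 4 + m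
  fun_prop

theorem contDiffWithinAt_shellInv {h : Admissible β θ K₀} {m ε c : ℝ} {a : ℝ → FOp P K₀}
    {g : ℝ → ActiveMode P K₀ → ℂ} {S : Set ℝ} {ω : ℝ}
    (ha : ∀ p p', ContDiffWithinAt ℝ 1 (fun ω => a ω p p') S ω)
    (hg : ∀ p, ContDiffWithinAt ℝ 1 (fun ω => g ω p) S ω) (had : BlockDiag (a ω)) (hc : 0 < c)
    (p : ActiveMode P K₀) (hl : LowerBdd m ω ε (a ω) (shell h P p.lev) c) :
    ContDiffWithinAt ℝ 1 (fun ω => shellInv h m ω ε (a ω) (g ω) p) S ω := by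
  classical
  unfold shellInv
  refine contDiffWithinAt_inv_mulVec (fun i j => ?_) (fun i => hg _) ?_ _
  · simp only [waveMatrix, Matrix.of_apply]
    refine ContDiffWithinAt.add ?_ (contDiffWithinAt_const.mul (ha _ _))
    split_ifs
    · exact (contDiff_waveSymbol m _).contDiffWithinAt
    · exact contDiffWithinAt_const
  · exact hl.det_ne_zero hc (blockClosed_shell h _) had

/-! ### Cut-off solutions on one shell: bounds, differences and reality -/

/-- On the shell `κ`, the function `w` is `χ` times a solution `x` of `(L_ω + ε a) x = ε F`, with a
lower bound `c` for `L_ω + ε a` if `χ ≠ 0`. -/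
structure CutSol (h : Admissible β θ K₀) (m ω ε c χ : ℝ) (κ : ℕ) (a : FOp P K₀)
    (F w x : ActiveMode P K₀ → ℂ) : Prop where
  mem : χ ∈ Icc (0 : ℝ) 1
  eq : ∀ p ∈ shell h P κ, w p = (χ : ℂ) * x p
  solves : χ ≠ 0 → ∀ p ∈ shell h P κ, waveAct m ω ε a x p = (ε : ℂ) * F p
  lower : χ ≠ 0 → LowerBdd m ω ε a (shell h P κ) c

theorem LowerBdd.pnorm_le {m ω ε c : ℝ} {a : FOp P K₀} {T : Finset (ActiveMode P K₀)} (hc : 0 < c)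
    (h : LowerBdd m ω ε a T c) (v : ActiveMode P K₀ → ℂ) :
    pnorm 0 T v ≤ c⁻¹ * pnorm 0 T (waveAct m ω ε a v) := by
  rw [inv_mul_eq_div, le_div_iff₀ hc, mul_comm]
  exact h v

theorem pnorm_real_smul {τ r : ℝ} (hr : 0 ≤ r) (T : Finset (ActiveMode P K₀))
    (c : ActiveMode P K₀ → ℂ) : pnorm τ T (fun p => (r : ℂ) * c p) = r * pnorm τ T c := by
  rw [pnorm_smul, Complex.norm_real, Real.norm_of_nonneg hr]

section

variable {h : Admissible β θ K₀} {m ω ω' ε c χ χ' : ℝ} {κ : ℕ} {a a' : FOp P K₀}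
  {F F' w w' x x' : ActiveMode P K₀ → ℂ}

theorem CutSol.pnorm_sol_le (H : CutSol h m ω ε c χ κ a F w x) (hc : 0 < c) (hε : 0 ≤ ε)
    (hχ : χ ≠ 0) : pnorm 0 (shell h P κ) x ≤ c⁻¹ * ε * pnorm 0 (shell h P κ) F := by
  refine ((H.lower hχ).pnorm_le hc x).trans (le_of_eq ?_)
  rw [pnorm_congr (H.solves hχ), pnorm_real_smul hε, mul_assoc]

theorem CutSol.pnorm_eq (H : CutSol h m ω ε c χ κ a F w x) :
    pnorm 0 (shell h P κ) w = χ * pnorm 0 (shell h P κ) x := by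
  rw [pnorm_congr H.eq, pnorm_real_smul H.mem.1]

theorem CutSol.pnorm_le' (H : CutSol h m ω ε c χ κ a F w x) (hc : 0 < c) (hε : 0 ≤ ε) :
    pnorm 0 (shell h P κ) w ≤ χ * (c⁻¹ * ε * pnorm 0 (shell h P κ) F) := by
  rw [H.pnorm_eq]
  by_cases hχ : χ = 0
  · rw [hχ, zero_mul, zero_mul]
  · exact mul_le_mul_of_nonneg_left (H.pnorm_sol_le hc hε hχ) H.mem.1

theorem CutSol.pnorm_le (H : CutSol h m ω ε c χ κ a F w x) (hc : 0 < c) (hε : 0 ≤ ε) :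
    pnorm 0 (shell h P κ) w ≤ c⁻¹ * ε * pnorm 0 (shell h P κ) F := by
  have := pnorm_nonneg 0 (shell h P κ) F
  exact (H.pnorm_le' hc hε).trans (mul_le_of_le_one_left (by positivity) H.mem.2)

theorem waveAct_sub_of_closed {T : Finset (ActiveMode P K₀)} {p : ActiveMode P K₀}
    (ha : ∀ p' ∉ T, a p p' = 0) (v v' : ActiveMode P K₀ → ℂ) :
    waveAct m ω ε a (fun p => v p - v' p) p = waveAct m ω ε a v p - waveAct m ω ε a v' p := by
  rw [waveAct_eq_sum ha, waveAct_eq_sum ha, waveAct_eq_sum ha]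
  simp only [mul_sub, Finset.sum_sub_distrib]
  ring

/-- If both cut-offs are non-zero, both inverses are controlled and the resolvent identity applies.
If one vanishes, its solution has no bound, but then the other cut-off is at most `X` and the
corresponding `w` is small by itself. No lower bound is needed where a cut-off vanishes. -/
theorem CutSol.pnorm_sub_le (H : CutSol h m ω ε c χ κ a F w x)
    (H' : CutSol h m ω' ε c χ' κ a' F' w' x') (had : BlockDiag a) (hc : 0 < c) (hε : 0 ≤ ε)
    {X η : ℝ} (hη0 : 0 ≤ η)
    (hX : |χ - χ'| ≤ X)
    (hη : ∀ v, pnorm 0 (shell h P κ) (fun p => waveAct m ω' ε a' v p - waveAct m ω ε a v p) ≤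
      η * pnorm 0 (shell h P κ) v) :
    pnorm 0 (shell h P κ) (fun p => w p - w' p) ≤
      c⁻¹ * ε * X * pnorm 0 (shell h P κ) F +
        (c⁻¹ * ε * X + c⁻¹ * c⁻¹ * ε * η) * pnorm 0 (shell h P κ) F' +
        c⁻¹ * ε * pnorm 0 (shell h P κ) (fun p => F p - F' p) := by
  set T := shell h P κ
  have n1 := pnorm_nonneg 0 T F
  have n2 := pnorm_nonneg 0 T F'
  have n3 := pnorm_nonneg 0 T (fun p => F p - F' p)
  have hX0 : 0 ≤ X := (abs_nonneg _).trans hX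
  have hci : 0 < c⁻¹ := inv_pos.2 hc
  by_cases hχ : χ = 0
  · have h1 : χ' ≤ X := by
      rw [hχ, zero_sub, abs_neg] at hX
      exact (le_abs_self _).trans hX
    have h2 : pnorm 0 T w = 0 := by rw [H.pnorm_eq, hχ, zero_mul]
    have h3 := H'.pnorm_le' hc hε
    have h4 : χ' * (c⁻¹ * ε * pnorm 0 T F') ≤ X * (c⁻¹ * ε * pnorm 0 T F') :=
      mul_le_mul_of_nonneg_right h1 (by positivity)
    have h5 := Beam.pnorm_sub_le 0 T w w'
    have j1 : 0 ≤ c⁻¹ * ε * X * pnorm 0 T F := by positivity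
    have j2 : 0 ≤ c⁻¹ * c⁻¹ * ε * η * pnorm 0 T F' := by positivity
    have j3 : 0 ≤ c⁻¹ * ε * pnorm 0 T (fun p => F p - F' p) := by positivity
    linarith
  by_cases hχ' : χ' = 0
  · have h1 : χ ≤ X := by
      rw [hχ', sub_zero] at hX
      exact (le_abs_self _).trans hX
    have h2 : pnorm 0 T w' = 0 := by rw [H'.pnorm_eq, hχ', zero_mul]
    have h3 := H.pnorm_le' hc hε
    have h4 : χ * (c⁻¹ * ε * pnorm 0 T F) ≤ X * (c⁻¹ * ε * pnorm 0 T F) :=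
      mul_le_mul_of_nonneg_right h1 (by positivity)
    have h5 := Beam.pnorm_sub_le 0 T w w'
    have j1 : 0 ≤ c⁻¹ * ε * X * pnorm 0 T F' := by positivity
    have j2 : 0 ≤ c⁻¹ * c⁻¹ * ε * η * pnorm 0 T F' := by positivity
    have j3 : 0 ≤ c⁻¹ * ε * pnorm 0 T (fun p => F p - F' p) := by positivity
    linarith
  have hl := H.lower hχ
  have hx' := H'.pnorm_sol_le hc hε hχ'
  have hsub : ∀ p ∈ T, waveAct m ω ε a (fun p => x p - x' p) p =
      (ε : ℂ) * (F p - F' p) + (waveAct m ω' ε a' x' p - waveAct m ω ε a x' p) := by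
    intro p hp
    rw [waveAct_sub_of_closed fun p' hp' => had.entry_eq_zero (blockClosed_shell h κ) hp hp',
      H.solves hχ p hp, H'.solves hχ' p hp]
    ring
  have h1 : pnorm 0 T (fun p => x p - x' p) ≤
      c⁻¹ * (ε * pnorm 0 T (fun p => F p - F' p) + η * (c⁻¹ * ε * pnorm 0 T F')) := by
    refine (hl.pnorm_le hc _).trans (mul_le_mul_of_nonneg_left ?_ hci.le)
    rw [pnorm_congr hsub]
    refine (pnorm_add_le 0 T _ _).trans (add_le_add ?_ ?_)
    · rw [pnorm_real_smul hε]
    · exact (hη x').trans (mul_le_mul_of_nonneg_left hx' hη0)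
  have h2 : ∀ p ∈ T, w p - w' p = (χ : ℂ) * (x p - x' p) + ((χ - χ' : ℝ) : ℂ) * x' p := by
    intro p hp
    rw [H.eq p hp, H'.eq p hp]
    push_cast
    ring
  rw [pnorm_congr h2]
  refine (pnorm_add_le 0 T _ _).trans ?_
  rw [pnorm_real_smul H.mem.1, pnorm_smul, Complex.norm_real, Real.norm_eq_abs]
  have h3 := mul_le_of_le_one_left (pnorm_nonneg 0 T (fun p => x p - x' p)) H.mem.2
  have h4 := mul_le_mul hX hx' (pnorm_nonneg _ _ _) hX0
  have j1 : 0 ≤ c⁻¹ * ε * X * pnorm 0 T F := by positivity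
  linarith

theorem waveSymbol_neg (m ω : ℝ) (p : ActiveMode P K₀) :
    waveSymbol m ω (-p) = waveSymbol m ω p := by
  simp [waveSymbol, ActiveMode.time_neg, ActiveMode.space_neg, len_neg]

theorem waveAct_conj (ha : a.IsReal) (v : ActiveMode P K₀ → ℂ) (p : ActiveMode P K₀) :
    waveAct m ω ε a (fun p => (starRingEnd ℂ) (v (-p))) p =
      (starRingEnd ℂ) (waveAct m ω ε a v (-p)) := by
  simp only [waveAct, FOp.act, map_add, map_mul, Complex.conj_ofReal, waveSymbol_neg]
  congr 2
  rw [Complex.conj_tsum, ← (Equiv.neg (ActiveMode P K₀)).tsum_eq]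
  refine tsum_congr fun p' => ?_
  simp only [Equiv.neg_apply, neg_neg, map_mul]
  congr 1
  have := ha (-p) p'
  rw [neg_neg] at this
  exact this

/-- Uniqueness: for a real operator and a real source, the conjugate reflection of the solution
solves the same system, which has no kernel when the cut-off is non-zero. Shells are invariant under
reflection. -/
theorem CutSol.real (H : CutSol h m ω ε c χ κ a F w x) (hc : 0 < c) (had : BlockDiag a)
    (har : a.IsReal) (hF : IsRealSeq F) {p : ActiveMode P K₀} (hp : p ∈ shell h P κ) :
    w (-p) = (starRingEnd ℂ) (w p) := by
  have hneg : ∀ {p : ActiveMode P K₀}, p ∈ shell h P κ → -p ∈ shell h P κ := by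
    intro p hp
    rwa [mem_shell, lev_neg, ← mem_shell]
  rw [H.eq _ (hneg hp), H.eq _ hp, map_mul, Complex.conj_ofReal]
  by_cases hχ : χ = 0
  · simp [hχ]
  congr 1
  have h1 : ∀ p ∈ shell h P κ,
      waveAct m ω ε a (fun p => x p - (starRingEnd ℂ) (x (-p))) p = 0 := by
    intro p hp
    rw [waveAct_sub_of_closed fun p' hp' => had.entry_eq_zero (blockClosed_shell h κ) hp hp',
      waveAct_conj har, H.solves hχ p hp, H.solves hχ _ (hneg hp), map_mul, Complex.conj_ofReal,
      hF p, Complex.conj_conj, sub_self]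
  have h2 := (H.lower hχ).eq_zero hc h1 hp
  rw [sub_eq_zero.1 h2, Complex.conj_conj]

end

/-! Curves of finitely supported functions -/

theorem Hs.ofSeq_eq_sum {T : Finset (ActiveMode P K₀)} {c : ActiveMode P K₀ → ℂ}
    (hT : ∀ p ∉ T, c p = 0) : Hs.ofSeq s c = ∑ p ∈ T, c p • Hs.exp s p := by
  classical
  have h1 : ∀ q, (∑ p ∈ T, c p • Hs.exp s p).coeff q = ∑ p ∈ T, (c p • Hs.exp s p).coeff q := by
    intro q
    rw [← Hs.coeffL_apply, map_sum]
    rfl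
  refine Hs.ext fun q => ?_
  rw [h1, Hs.coeff_ofSeq (sobBdd_of_support hT)]
  simp only [Hs.coeff_smul, Hs.coeff_exp]
  by_cases hq : q ∈ T
  · rw [Finset.sum_eq_single q]
    · simp
    · intro p _ hp
      simp [hp.symm]
    · exact fun h => absurd hq h
  · rw [hT q hq, Finset.sum_eq_zero]
    intro p hp
    have : q ≠ p := fun e => hq (e ▸ hp)
    simp [this]

section

variable {T : Finset (ActiveMode P K₀)} {c : ℝ → ActiveMode P K₀ → ℂ}

theorem contDiffOn_ofSeq (hT : ∀ ω ∈ Icc (1 : ℝ) 2, ∀ p ∉ T, c ω p = 0)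
    (hc : ∀ p, ContDiffOn ℝ 1 (fun ω => c ω p) (Icc 1 2)) :
    ContDiffOn ℝ 1 (fun ω => (Hs.ofSeq s (c ω) : Hs P K₀ s)) (Icc 1 2) := by
  have h1 : ContDiffOn ℝ 1 (fun ω => ∑ p ∈ T, c ω p • Hs.exp s p) (Icc 1 2) :=
    ContDiffOn.sum fun p _ => (hc p).smul contDiffOn_const
  exact h1.congr fun ω hω => Hs.ofSeq_eq_sum (hT ω hω)

theorem Hs.incl_ofSeq (h : s' ≤ s) {c : ActiveMode P K₀ → ℂ} {B : ℝ} (hc : SobBdd s c B) :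
    Hs.incl h (Hs.ofSeq s c) = Hs.ofSeq s' c := by
  refine Hs.ext fun p => ?_
  rw [Hs.coeff_incl, Hs.coeff_ofSeq hc, Hs.coeff_ofSeq (hc.lower h)]

/-- A common finite support makes the curve `C¹` in every order at once, with constants depending on
the support. The uniform bound of the derivative comes from the Lipschitz constant in the lower
order. -/
theorem exists_hasC1Deriv (h : s' ≤ s) (hT : ∀ ω ∈ Icc (1 : ℝ) 2, ∀ p ∉ T, c ω p = 0)
    (hc : ∀ p, ContDiffOn ℝ 1 (fun ω => c ω p) (Icc 1 2)) {L : ℝ}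
    (hL : ∀ ω ∈ Icc (1 : ℝ) 2, ∀ ω' ∈ Icc (1 : ℝ) 2,
      SobBdd s' (fun p => c ω p - c ω' p) (L * |ω - ω'|)) :
    ∃ v', HasC1Deriv h (fun ω => Hs.ofSeq s (c ω)) v' ∧ ∀ ω ∈ Icc (1 : ℝ) 2, ‖v' ω‖ ≤ L := by
  have h1 := contDiffOn_ofSeq (s := s') hT hc
  have h2 : ∀ ω ∈ Icc (1 : ℝ) 2, Hs.incl h (Hs.ofSeq s (c ω)) = Hs.ofSeq s' (c ω) :=
    fun ω hω => Hs.incl_ofSeq h (sobBdd_of_support (hT ω hω))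
  refine ⟨derivWithin (fun ω => (Hs.ofSeq s' (c ω) : Hs P K₀ s')) (Icc 1 2),
    ⟨(contDiffOn_ofSeq hT hc).continuousOn, continuousOn_derivWithin_of_contDiffOn_one h1,
      fun ω hω => ?_⟩, fun ω hω => ?_⟩
  · exact (hasDerivWithinAt_of_contDiffOn_one h1 hω).congr h2 (h2 ω hω)
  · refine norm_le_of_hasDerivWithinAt_of_lip hω (hasDerivWithinAt_of_contDiffOn_one h1 hω) ?_
    intro x hx
    have h3 := hL x hx ω hω
    rw [Hs.norm_le_iff h3.nonneg]
    have h4 : (Hs.ofSeq s' (c x) - Hs.ofSeq s' (c ω) : Hs P K₀ s').coeff =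
        fun p => c x p - c ω p := by
      funext p
      rw [Hs.coeff_sub, Hs.coeff_ofSeq (sobBdd_of_support (hT x hx)),
        Hs.coeff_ofSeq (sobBdd_of_support (hT ω hω))]
    rw [h4]
    exact h3

variable {q γ ε : ℝ} {x : ℝ → Hs P K₀ σ}

theorem contDiffOn_act_of_decay (h : Admissible β θ K₀) {a : ℝ → FOp P K₀} {K : ℝ}
    (ha : ∀ ω ∈ Icc (1 : ℝ) 2, DecayBdd K (a ω))
    (hac : ∀ p p', ContDiffOn ℝ 1 (fun ω => a ω p p') (Icc 1 2))
    (hc : ∀ p, ContDiffOn ℝ 1 (fun ω => c ω p) (Icc 1 2)) (p : ActiveMode P K₀) :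
    ContDiffOn ℝ 1 (fun ω => (a ω).act (c ω) p) (Icc 1 2) := by
  have h1 : ContDiffOn ℝ 1 (fun ω => ∑ p' ∈ nearModes h P p, a ω p p' * c ω p') (Icc 1 2) :=
    ContDiffOn.sum fun p' _ => (hac p p').mul (hc p')
  exact h1.congr fun ω hω =>
    act_eq_sum (fun p' hp' => (ha ω hω).entry_eq_zero_of_notMem h hp') _

theorem contDiffOn_idAdd_of_decay (h : Admissible β θ K₀) {a : ℝ → FOp P K₀} {K : ℝ}
    (ha : ∀ ω ∈ Icc (1 : ℝ) 2, DecayBdd K (a ω))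
    (hac : ∀ p p', ContDiffOn ℝ 1 (fun ω => a ω p p') (Icc 1 2))
    (hc : ∀ p, ContDiffOn ℝ 1 (fun ω => c ω p) (Icc 1 2)) (p : ActiveMode P K₀) :
    ContDiffOn ℝ 1 (fun ω => FOp.idAdd ε (a ω) (c ω) p) (Icc 1 2) :=
  (hc p).add (contDiffOn_const.mul (contDiffOn_act_of_decay h ha hac hc p))

theorem contDiffOn_conj {g : ℝ → ℂ} {S : Set ℝ} (hg : ContDiffOn ℝ 1 g S) :
    ContDiffOn ℝ 1 (fun ω => (starRingEnd ℂ) (g ω)) S :=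
  (Complex.conjCLE.contDiff (n := 1)).comp_contDiffOn hg

theorem SmoothFam.contDiffOn_act {r τ K : ℝ} {R : Fam P K₀ σ} (hR : SmoothFam q γ r τ K R)
    (hε : ε ∈ Icc 0 γ) (hx : ContDiffOn ℝ 1 x (Icc 1 2))
    (hxB : ∀ ω ∈ Icc (1 : ℝ) 2, x ω ∈ Metric.ball (0 : Hs P K₀ σ) q)
    (hT : ∀ ω ∈ Icc (1 : ℝ) 2, ∀ p ∉ T, c ω p = 0)
    (hc : ∀ p, ContDiffOn ℝ 1 (fun ω => c ω p) (Icc 1 2)) (p : ActiveMode P K₀) :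
    ContDiffOn ℝ 1 (fun ω => (R (x ω) (ω, ε)).act (c ω) p) (Icc 1 2) := by
  have h1 : ∀ p', ContDiffOn ℝ 1 (fun ω => R (x ω) (ω, ε) p p') (Icc 1 2) := fun p' =>
    ((entryL τ (τ + r) p p').contDiff.comp_contDiffOn (hR.c1 ε hε x hx hxB)).congr
      fun ω hω => ((hR.bdd _ ⟨hω, hε⟩ _ (hxB ω hω)).entryL_clm p p').symm
  have h2 : ContDiffOn ℝ 1 (fun ω => ∑ p' ∈ T, R (x ω) (ω, ε) p p' * c ω p') (Icc 1 2) :=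
    ContDiffOn.sum fun p' _ => (h1 p').mul (hc p')
  refine h2.congr fun ω hω => tsum_eq_sum fun p' hp' => ?_
  rw [hT ω hω p' hp', mul_zero]

theorem contDiffOn_rhs (h : Admissible β θ K₀) {r τ K K' τ₀ : ℝ} {A R R₁ : Fam P K₀ σ}
    (hA : DecayFam q γ K' τ₀ A) (hR : SmoothFam q γ r τ K R) (hR₁ : SmoothFam q γ r τ K R₁)
    (hε : ε ∈ Icc 0 γ) (hx : ContDiffOn ℝ 1 x (Icc 1 2))
    (hxB : ∀ ω ∈ Icc (1 : ℝ) 2, x ω ∈ Metric.ball (0 : Hs P K₀ σ) q)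
    {T₁ : Finset (ActiveMode P K₀)} {c₁ : ℝ → ActiveMode P K₀ → ℂ}
    (hT : ∀ ω ∈ Icc (1 : ℝ) 2, ∀ p ∉ T, c ω p = 0)
    (hc : ∀ p, ContDiffOn ℝ 1 (fun ω => c ω p) (Icc 1 2))
    (hT₁ : ∀ ω ∈ Icc (1 : ℝ) 2, ∀ p ∉ T₁, c₁ ω p = 0)
    (hc₁ : ∀ p, ContDiffOn ℝ 1 (fun ω => c₁ ω p) (Icc 1 2)) (f : ActiveMode P K₀ → ℂ)
    (p : ActiveMode P K₀) :
    ContDiffOn ℝ 1 (fun ω => rhs ε (A (x ω) (ω, ε)) (R (x ω) (ω, ε)) (R₁ (x ω) (ω, ε)) f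
      (c ω) (c₁ ω) p) (Icc 1 2) := by
  have ha : ∀ ω ∈ Icc (1 : ℝ) 2, DecayBdd K' (A (x ω) (ω, ε)).adj :=
    fun ω hω => (hA.bdd _ ⟨hω, hε⟩ _ (hxB ω hω)).adj
  have hac : ∀ p p', ContDiffOn ℝ 1 (fun ω => (A (x ω) (ω, ε)).adj p p') (Icc 1 2) :=
    fun p p' => contDiffOn_conj (hA.c1 ε hε x hx hxB p' p)
  exact ((contDiffOn_idAdd_of_decay h ha hac
    (fun p => hR.contDiffOn_act hε hx hxB hT hc p) p).add
    (hR₁.contDiffOn_act hε hx hxB hT₁ hc₁ p)).add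
    (contDiffOn_idAdd_of_decay (c := fun _ => f) h ha hac (fun p => contDiffOn_const) p)

end

/-! Estimates on the low modes -/

/-- On the levels at least `k`, `weight ^ (-ζ)` is at most a constant times `2 ^ (-4 k ζ)`; the
square root of this is the decay of the increments. -/
theorem exists_tail_le (h : Admissible β θ K₀) (P : BlockPartition d ι β ρ θ) {ζ : ℝ}
    (hζ : 0 ≤ ζ) (hs : σ + ζ ≤ s) :
    ∃ C > 0, ∀ (k : ℕ) (c : ActiveMode P K₀ → ℂ) (B : ℝ), SobBdd s c B → (∀ p, p.lev < k → c p = 0) →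
      SobBdd σ c (C * (2 : ℝ) ^ (-2 * k * ζ) * B) := by
  set L := levConst θ K₀ ^ |ζ| with hL
  have hL1 : 1 ≤ levConst θ K₀ := one_le_levConst h
  have hL0 : 0 < L := Real.rpow_pos_of_pos (by linarith) _
  refine ⟨Real.sqrt L, Real.sqrt_pos.2 hL0, fun k c B hc hk T => ?_⟩
  have hB := hc.nonneg
  refine pnorm_le_sq (by positivity) ?_
  rw [mul_pow, mul_pow, Real.sq_sqrt hL0.le]
  have e1 : ((2 : ℝ) ^ (-2 * k * ζ)) ^ 2 = (2 : ℝ) ^ (-4 * k * ζ) := by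
    rw [← Real.rpow_natCast, ← Real.rpow_mul (by norm_num)]
    congr 1
    push_cast
    ring
  rw [e1]
  have h1 : ∀ p ∈ T, p.weight ^ σ * ‖c p‖ ^ 2 ≤
      L * (2 : ℝ) ^ (-4 * k * ζ) * (p.weight ^ s * ‖c p‖ ^ 2) := by
    intro p _
    by_cases hp : p.lev < k
    · rw [hk p hp]
      simp
    · push Not at hp
      rw [← mul_assoc]
      refine mul_le_mul_of_nonneg_right ?_ (sq_nonneg _)
      have h2 : p.weight ^ σ ≤ p.weight ^ (-ζ) * p.weight ^ s := by
        rw [← Real.rpow_add p.weight_pos]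
        exact Real.rpow_le_rpow_of_exponent_le p.one_le_weight (by linarith)
      have h3 := weight_rpow_le_lev h (-ζ) p
      rw [abs_neg] at h3
      have h4 : (2 : ℝ) ^ (4 * p.lev * -ζ) ≤ (2 : ℝ) ^ (-4 * k * ζ) := by
        refine Real.rpow_le_rpow_of_exponent_le (by norm_num) ?_
        have : (k : ℝ) * ζ ≤ p.lev * ζ := mul_le_mul_of_nonneg_right (by exact_mod_cast hp) hζ
        linarith
      refine h2.trans (mul_le_mul_of_nonneg_right ?_ (weight_rpow_nonneg p s))
      exact h3.trans (mul_le_mul_of_nonneg_left h4 hL0.le)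
  refine (Finset.sum_le_sum h1).trans ?_
  rw [← Finset.mul_sum, ← pnorm_sq]
  have := pow_le_pow_left₀ (pnorm_nonneg _ _ _) (hc T) 2
  exact mul_le_mul_of_nonneg_left this (by positivity)

theorem inv_gap {δ ζ : ℝ} (κ : ℕ) :
    (δ * (2 : ℝ) ^ (-2 * κ * ζ))⁻¹ = δ⁻¹ * (2 : ℝ) ^ (2 * κ * ζ) := by
  rw [mul_inv, ← Real.rpow_neg (by norm_num)]
  congr 2
  ring

/-- The inverse of the small divisor on shell `κ` is `δ⁻¹ 2 ^ (2 κ ζ)`, a loss of `ζ` orders, taken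
from the order `τ + ζ` of the source. -/
theorem exists_cut_le (h : Admissible β θ K₀) (P : BlockPartition d ι β ρ θ) (τ ζ : ℝ) :
    ∃ C > 0, ∀ (k : ℕ) (m δ ε ω B : ℝ) (χ : ℕ → ℝ) (a : FOp P K₀)
      (F w x : ActiveMode P K₀ → ℂ), 0 < δ → 0 ≤ ε →
      (∀ κ ≤ k, CutSol h m ω ε (δ * (2 : ℝ) ^ (-2 * κ * ζ)) (χ κ) κ a F w x) →
      (∀ p, k < p.lev → w p = 0) → SobBdd (τ + ζ) F B → SobBdd τ w (C * (ε / δ) * B) := by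
  obtain ⟨C, hC, hlow⟩ := pnorm_low_le h (P := P) (K₀ := K₀) τ ζ 0 0
  refine ⟨C, hC, fun k m δ ε ω B χ a F w x hδ hε H hw hF => ?_⟩
  have hsup : ∀ p ∉ low h P k, w p = 0 := fun p hp => hw p (by simpa using hp)
  refine (sobBdd_of_support hsup).mono ?_
  have h1 := hlow k w F F F (ε / δ) 0 0 (by positivity) le_rfl le_rfl fun κ hκ => by
    refine ((H κ hκ).pnorm_le (by positivity) hε).trans (le_of_eq ?_)
    rw [inv_gap]
    ring
  refine h1.trans ?_
  have h2 := mul_le_mul_of_nonneg_left (hF (low h P k)) (by positivity : 0 ≤ C * (ε / δ))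
  linarith

/-- The exponents add up to `2 κ (2 ζ + 2)` in two ways: one inverse and the variation of the
cut-off, or two inverses and the variation `2 ^ (4 κ)` of the operator. The difference of the
sources loses only `ζ`. -/
theorem exists_cut_sub_le (h : Admissible β θ K₀) (P : BlockPartition d ι β ρ θ) (τ ζ : ℝ) :
    ∃ C > 0, ∀ (k : ℕ) (m δ ε ω ω' B B' D X E : ℝ) (χ χ' : ℕ → ℝ) (a a' : FOp P K₀)
      (F F' w w' x x' : ActiveMode P K₀ → ℂ), 0 < δ → 0 ≤ ε → 0 ≤ X → 0 ≤ E → BlockDiag a →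
      (∀ κ ≤ k, CutSol h m ω ε (δ * (2 : ℝ) ^ (-2 * κ * ζ)) (χ κ) κ a F w x) →
      (∀ κ ≤ k, CutSol h m ω' ε (δ * (2 : ℝ) ^ (-2 * κ * ζ)) (χ' κ) κ a' F' w' x') →
      (∀ κ ≤ k, |χ κ - χ' κ| ≤ X * (2 : ℝ) ^ (2 * κ * (ζ + 2))) →
      (∀ κ ≤ k, ∀ v, pnorm 0 (shell h P κ) (fun p => waveAct m ω' ε a' v p - waveAct m ω ε a v p) ≤
        E * (2 : ℝ) ^ (4 * κ : ℝ) * pnorm 0 (shell h P κ) v) →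
      (∀ p, k < p.lev → w p = 0) → (∀ p, k < p.lev → w' p = 0) →
      SobBdd (τ + (2 * ζ + 2)) F B → SobBdd (τ + (2 * ζ + 2)) F' B' →
      SobBdd (τ + ζ) (fun p => F p - F' p) D →
      SobBdd τ (fun p => w p - w' p)
        (C * (ε / δ * X * B + (ε / δ * X + ε / δ / δ * E) * B' + ε / δ * D)) := by
  obtain ⟨C, hC, hlow⟩ := pnorm_low_le h (P := P) (K₀ := K₀) τ (2 * ζ + 2) (2 * ζ + 2) ζ
  refine ⟨C, hC, ?_⟩
  intro k m δ ε ω ω' B B' D X E χ χ' a a' F F' w w' x x' hδ hε hX0 hE0 had H H' hX hE hw hw' hF hF' hFF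
  have hsup : ∀ p ∉ low h P k, w p - w' p = 0 := fun p hp => by
    have hp' : k < p.lev := by simpa using hp
    rw [hw p hp', hw' p hp', sub_zero]
  refine (sobBdd_of_support hsup).mono ?_
  have h1 := hlow k (fun p => w p - w' p) F F' (fun p => F p - F' p) (ε / δ * X)
    (ε / δ * X + ε / δ / δ * E) (ε / δ) (by positivity) (by positivity) (by positivity)
    fun κ hκ => by
      refine ((H κ hκ).pnorm_sub_le (H' κ hκ) had (by positivity) hε (by positivity) (hX κ hκ)
        (hE κ hκ)).trans (le_of_eq ?_)
      rw [inv_gap]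
      have e1 : (2 : ℝ) ^ (2 * κ * (2 * ζ + 2)) =
          (2 : ℝ) ^ (2 * κ * ζ) * (2 : ℝ) ^ (2 * κ * (ζ + 2)) := by
        rw [← Real.rpow_add (by norm_num)]
        congr 1
        ring
      have e2 : (2 : ℝ) ^ (2 * κ * (ζ + 2)) = (2 : ℝ) ^ (2 * κ * ζ) * (2 : ℝ) ^ (4 * κ : ℝ) := by
        rw [← Real.rpow_add (by norm_num)]
        congr 1
        ring
      rw [e1, e2]
      ring
  refine h1.trans (mul_le_mul_of_nonneg_left ?_ hC.le)
  refine add_le_add (add_le_add ?_ ?_) ?_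
  · exact mul_le_mul_of_nonneg_left (hF _) (by positivity)
  · exact mul_le_mul_of_nonneg_left (hF' _) (by positivity)
  · exact mul_le_mul_of_nonneg_left (hFF _) (by positivity)

/-! The bounds of the scheme, with one constant -/

/-- The estimates of order `τ` used in the iteration, with the constant `M`. -/
structure OrderBounds (h : Admissible β θ K₀) (q γ ζ τ M : ℝ) (A R R₁ : Fam P K₀ σ) : Prop where
  act_le : ∀ z ∈ paramBox γ, ∀ u ∈ Metric.ball (0 : Hs P K₀ σ) q, ∀ c B,
    SobBdd τ c B → SobBdd τ ((A u z).act c) (M * B)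
  act_sub_le : ∀ ε ∈ Icc 0 γ, ∀ ω ∈ Icc (1 : ℝ) 2, ∀ ω' ∈ Icc (1 : ℝ) 2,
    ∀ u ∈ Metric.ball (0 : Hs P K₀ σ) q, ∀ v ∈ Metric.ball (0 : Hs P K₀ σ) q, ∀ c B,
      SobBdd τ c B → SobBdd τ
        (fun p => (A u (ω, ε)).act c p - (A v (ω', ε)).act c p) (M * (‖u - v‖ + |ω - ω'|) * B)
  rhs_le : ∀ ε ∈ Icc 0 γ, ∀ ω ∈ Icc (1 : ℝ) 2, ∀ x ∈ Metric.ball (0 : Hs P K₀ σ) q,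
    ∀ (f u w : ActiveMode P K₀ → ℂ) (Bf Bu Bw : ℝ), SobBdd (τ + ζ) f Bf → SobBdd τ u Bu →
      SobBdd τ w Bw → SobBdd (τ + ζ)
        (rhs ε (A x (ω, ε)) (R x (ω, ε)) (R₁ x (ω, ε)) f u w) (M * (Bu + Bw + Bf))
  rhs_sub_le : ∀ ε ∈ Icc 0 γ, ∀ ω ∈ Icc (1 : ℝ) 2, ∀ ω' ∈ Icc (1 : ℝ) 2,
    ∀ x ∈ Metric.ball (0 : Hs P K₀ σ) q, ∀ x' ∈ Metric.ball (0 : Hs P K₀ σ) q,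
    ∀ (f u w u' w' : ActiveMode P K₀ → ℂ) (Bf Bu Bw Du Dw : ℝ), SobBdd (τ + ζ) f Bf →
      SobBdd τ u Bu → SobBdd τ u' Bu → SobBdd τ w Bw → SobBdd τ w' Bw →
      SobBdd τ (fun p => u p - u' p) Du → SobBdd τ (fun p => w p - w' p) Dw →
      SobBdd (τ + ζ) (fun p => rhs ε (A x (ω, ε)) (R x (ω, ε)) (R₁ x (ω, ε)) f u w p -
        rhs ε (A x' (ω', ε)) (R x' (ω', ε)) (R₁ x' (ω', ε)) f u' w' p)
        (M * ((‖x - x'‖ + |ω - ω'|) * (Bu + Bw + Bf) + Du + Dw))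
  cut_le : ∀ (k : ℕ) (m δ ε ω B : ℝ) (χ : ℕ → ℝ) (a : FOp P K₀)
      (F w x : ActiveMode P K₀ → ℂ), 0 < δ → 0 ≤ ε →
      (∀ κ ≤ k, CutSol h m ω ε (δ * (2 : ℝ) ^ (-2 * κ * ζ)) (χ κ) κ a F w x) →
      (∀ p, k < p.lev → w p = 0) → SobBdd (τ + ζ) F B → SobBdd τ w (M * (ε / δ) * B)
  cut_sub_le : ∀ (k : ℕ) (m δ ε ω ω' B D X E : ℝ) (χ χ' : ℕ → ℝ) (a a' : FOp P K₀)
      (F F' w w' x x' : ActiveMode P K₀ → ℂ), 0 < δ → 0 ≤ ε → 0 ≤ X → 0 ≤ E → BlockDiag a →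
      (∀ κ ≤ k, CutSol h m ω ε (δ * (2 : ℝ) ^ (-2 * κ * ζ)) (χ κ) κ a F w x) →
      (∀ κ ≤ k, CutSol h m ω' ε (δ * (2 : ℝ) ^ (-2 * κ * ζ)) (χ' κ) κ a' F' w' x') →
      (∀ κ ≤ k, |χ κ - χ' κ| ≤ X * (2 : ℝ) ^ (2 * κ * (ζ + 2))) →
      (∀ κ ≤ k, ∀ v, pnorm 0 (shell h P κ) (fun p => waveAct m ω' ε a' v p - waveAct m ω ε a v p) ≤
        E * (2 : ℝ) ^ (4 * κ : ℝ) * pnorm 0 (shell h P κ) v) →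
      (∀ p, k < p.lev → w p = 0) → (∀ p, k < p.lev → w' p = 0) →
      SobBdd (τ + (2 * ζ + 2)) F B → SobBdd (τ + (2 * ζ + 2)) F' B →
      SobBdd (τ + ζ) (fun p => F p - F' p) D →
      SobBdd τ (fun p => w p - w' p)
        (M * (ε / δ * X * B + (ε / δ * X + ε / δ / δ * E) * B + ε / δ * D))

/-- Each estimate remains true for a larger constant; stating them for all large `M` lets the three
orders and the other requirements share one `M`. -/
theorem eventually_orderBounds (h : Admissible β θ K₀) {q γ ζ τ τ₀ K : ℝ} (hγ : γ ≤ 1)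
    {A R R₁ : Fam P K₀ σ} (hA : DecayFam q γ K τ₀ A) (hK : 0 ≤ K) (hτ₀ : τ₀ ≤ σ)
    (hR : ∃ K > 0, SmoothFam q γ ζ τ K R) (hR₁ : ∃ K > 0, SmoothFam q γ ζ τ K R₁) :
    ∀ᶠ M in atTop, OrderBounds h q γ ζ τ M A R R₁ := by
  obtain ⟨C₁, hC₁, hact⟩ := DecayBdd.exists_act_le h P τ
  obtain ⟨C₂, hC₂, hrhs⟩ := exists_rhsBounds h hA hK hτ₀ hR hR₁
  obtain ⟨C₃, hC₃, hcut⟩ := exists_cut_le h P τ ζ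
  obtain ⟨C₄, hC₄, hcut'⟩ := exists_cut_sub_le h P τ ζ
  filter_upwards [eventually_ge_atTop (C₁ * K), eventually_ge_atTop (2 * (1 + C₂) ^ 2),
    eventually_ge_atTop C₃, eventually_ge_atTop C₄] with M h1 h2 h3 h4
  have hM : 0 < M := hC₃.trans_le h3
  refine ⟨?_, ?_, ?_, ?_, ?_, ?_⟩
  · intro z hz u hu c B hc
    exact (hact K _ hK (hA.bdd z hz u hu) c B hc).mono
      (mul_le_mul_of_nonneg_right h1 hc.nonneg)
  · intro ε hε ω hω ω' hω' u hu v hv c B hc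
    have e0 := sobNorm_nonneg τ₀ (u - v).coeff
    have e2 := hact _ _ (by positivity) (hA.lip ε hε ω hω ω' hω' u hu v hv) c B hc
    have e3 : (A u (ω, ε) - A v (ω', ε)).act c =
        fun p => (A u (ω, ε)).act c p - (A v (ω', ε)).act c p := by
      funext p
      exact act_sub_of_decayBdd h (hA.bdd _ ⟨hω, hε⟩ u hu) (hA.bdd _ ⟨hω', hε⟩ v hv) c p
    rw [e3] at e2
    refine e2.mono (mul_le_mul_of_nonneg_right ?_ hc.nonneg)
    rw [← mul_assoc]
    exact mul_le_mul h1 (add_le_add_left ((u - v).sobNorm_le hτ₀) _) (by positivity) hM.le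
  · intro ε hε ω hω x hx f u w Bf Bu Bw hf hu hw
    have := hf.nonneg
    have := hu.nonneg
    have := hw.nonneg
    refine (hrhs.sobBdd_rhs hγ hε hω hx hf hu hw).mono ?_
    exact mul_le_mul_of_nonneg_right (by nlinarith) (by positivity)
  · intro ε hε ω hω ω' hω' x hx x' hx' f u w u' w' Bf Bu Bw Du Dw hf hu hu' hw hw' hdu hdw
    have := hf.nonneg
    have := hu.nonneg
    have := hw.nonneg
    have := hdu.nonneg
    have := hdw.nonneg
    refine (hrhs.sobBdd_rhs_sub hγ hε hω hω' hx hx' hf hu hu' hw hw' hdu hdw).mono ?_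
    exact mul_le_mul_of_nonneg_right h2 (by positivity)
  · intro k m δ ε ω B χ a F w x hδ hε H hw hF
    have := hF.nonneg
    refine (hcut k m δ ε ω B χ a F w x hδ hε H hw hF).mono ?_
    exact mul_le_mul_of_nonneg_right (mul_le_mul_of_nonneg_right h3 (by positivity)) hF.nonneg
  · intro k m δ ε ω ω' B D X E χ χ' a a' F F' w w' x x' hδ hε hX0 hE0 had H H' hX hE hw hw' hF hF' hD
    have := hF.nonneg
    have := hD.nonneg
    refine (hcut' k m δ ε ω ω' B B D X E χ χ' a a' F F' w w' x x' hδ hε hX0 hE0 had H H' hX hE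
      hw hw' hF hF' hD).mono ?_
    exact mul_le_mul_of_nonneg_right h4 (by positivity)

/-- The estimates used in the iteration, with the constant `M`. -/
structure SchemeBounds (h : Admissible β θ K₀) (q γ ζ s K τ₀ M : ℝ) (A VD R R₁ : Fam P K₀ σ)
    (f : ActiveMode P K₀ → ℂ) : Prop where
  one_le : 1 ≤ M
  high : OrderBounds h q γ ζ s M A R R₁
  mid : OrderBounds h q γ ζ (s - ζ - 2) M A R R₁
  base : OrderBounds h q γ ζ σ M A R R₁
  tail : ∀ (k : ℕ) (c : ActiveMode P K₀ → ℂ) (B : ℝ), SobBdd s c B →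
    (∀ p, p.lev < k → c p = 0) → SobBdd σ c (M * (2 : ℝ) ^ (-2 * k * ζ) * B)
  schur : schurConst h P * K ≤ M
  sq_K : K₀ ^ 2 ≤ M
  growth : (2 : ℝ) ^ (2 * ζ) ≤ M
  geom : (1 - (2 : ℝ) ^ (-2 * ζ))⁻¹ ≤ M
  f_bdd : SobBdd (s + ζ) f M
  K_nonneg : 0 ≤ K
  zeta_pos : 0 < ζ
  le_base : τ₀ ≤ σ
  base_le : σ + ζ + 2 ≤ s
  gamma_le : γ ≤ 1
  decayA : ∃ K > 0, DecayFam q γ K τ₀ A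
  block : BlockFam q γ K τ₀ VD
  smooth : ∃ K > 0, SmoothFam q γ ζ s K R
  smooth₁ : ∃ K > 0, SmoothFam q γ ζ s K R₁
  real : IsRealSeq f

/-- The order `s` serves for the sizes, `s - ζ - 2` for the Lipschitz bounds in `ω` and `σ` for the
increments; all are at least `σ`, where the smoothing families are controlled. -/
theorem exists_schemeBounds (h : Admissible β θ K₀) {q γ ζ s K τ₀ : ℝ} {A VD R R₁ : Fam P K₀ σ}
    (f : Hs P K₀ (s + ζ)) (hf : f.IsReal) (hγ : γ ≤ 1) (hζ : 0 < ζ) (hs : σ + ζ + 2 ≤ s)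
    (hA : ∃ K > 0, DecayFam q γ K τ₀ A) (hVD : BlockFam q γ K τ₀ VD) (hK : 0 ≤ K) (hτ₀ : τ₀ ≤ σ)
    (hR : ∀ τ, σ ≤ τ → ∃ K > 0, SmoothFam q γ ζ τ K R)
    (hR₁ : ∀ τ, σ ≤ τ → ∃ K > 0, SmoothFam q γ ζ τ K R₁) :
    ∃ M, SchemeBounds h q γ ζ s K τ₀ M A VD R R₁ f.coeff := by
  obtain ⟨K', hK', hA'⟩ := id hA
  have hb : ∀ τ, σ ≤ τ → ∀ᶠ M in atTop, OrderBounds h q γ ζ τ M A R R₁ := fun τ hτ =>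
    eventually_orderBounds h hγ hA' hK'.le hτ₀ (hR τ hτ) (hR₁ τ hτ)
  obtain ⟨C, hC, htail⟩ := exists_tail_le (σ := σ) (s := s) h P hζ.le (by linarith)
  obtain ⟨M, h1, h2, h3, h4, h5, h6, h7, h8, h9, h10⟩ :=
    ((eventually_ge_atTop 1).and <| (hb s (by linarith)).and <|
      (hb (s - ζ - 2) (by linarith)).and <| (hb σ le_rfl).and <| (eventually_ge_atTop C).and <|
      (eventually_ge_atTop (schurConst h P * K)).and <| (eventually_ge_atTop (K₀ ^ 2)).and <|
      (eventually_ge_atTop ((2 : ℝ) ^ (2 * ζ))).and <|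
      (eventually_ge_atTop (1 - (2 : ℝ) ^ (-2 * ζ))⁻¹).and
      (eventually_ge_atTop ‖f‖)).exists
  refine ⟨M, h1, h2, h3, h4, ?_, h6, h7, h8, h9, f.sobBdd.mono h10, hK, hζ, hτ₀, hs, hγ, hA, hVD,
    hR s (by linarith), hR₁ s (by linarith), hf⟩
  intro k c B hc hk
  refine (htail k c B hc hk).mono ?_
  have := hc.nonneg
  have : (0 : ℝ) ≤ (2 : ℝ) ^ (-2 * k * ζ) := by positivity
  gcongr

/-! The iteration for a fixed `ε` -/

/-- The resonant frequencies for a curve of functions, given by Fourier coefficients. -/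
def resSection (m ζ δ ε : ℝ) (VD : Fam P K₀ σ) (k : ℕ) (u : ℝ → ActiveMode P K₀ → ℂ) : Set ℝ :=
  {ω | (ω, ε) ∈ resonantSet m ζ δ VD k fun ω _ => Hs.ofSeq σ (u ω)}

/-- The width of the layer where the cut-off of step `k` varies. -/
def gap (ζ δ C₀ : ℝ) (k : ℕ) : ℝ := δ / (128 * C₀) * (2 : ℝ) ^ (-2 * k * (ζ + 2))

/-- The family of operators at the function with Fourier coefficients `u`. -/
def Fam.at (B : Fam P K₀ σ) (u : ActiveMode P K₀ → ℂ) (ω ε : ℝ) : FOp P K₀ :=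
  B (Hs.ofSeq σ u) (ω, ε)

/-- The right hand side at `(u, w)`. -/
def source (A R R₁ : Fam P K₀ σ) (f : ActiveMode P K₀ → ℂ) (ε ω : ℝ)
    (u w : ActiveMode P K₀ → ℂ) : ActiveMode P K₀ → ℂ :=
  rhs ε (A.at u ω ε) (R.at u ω ε) (R₁.at u ω ε) f u w

/-- The sequences `u_{k-1}`, `w_{k-1}` and `1 - ψ_k` of the iteration, for a fixed `ε`. -/
structure Chain (h : Admissible β θ K₀) (m δ ε ζ C₀ : ℝ) (A VD R R₁ : Fam P K₀ σ)
    (f : ActiveMode P K₀ → ℂ) (U W : ℕ → ℝ → ActiveMode P K₀ → ℂ) (χ : ℕ → ℝ → ℝ) : Prop where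
  U_zero : ∀ ω p, U 0 ω p = 0
  W_zero : ∀ ω p, W 0 ω p = 0
  cut : ∀ k ω, χ k ω = 1 - cutoff (resSection m ζ δ ε VD k (U k)) (gap ζ δ C₀ k) ω
  W_succ : ∀ k ω p, W (k + 1) ω p = if p.lev ≤ k then
    (χ p.lev ω : ℂ) * shellInv h m ω ε (VD.at (U k ω) ω ε)
      (fun p => (ε : ℂ) * source A R R₁ f ε ω (U k ω) (W k ω) p) p else 0
  U_succ : ∀ k ω, U (k + 1) ω = FOp.idAdd ε (A.at (U k ω) ω ε) (W (k + 1) ω)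

/-- The smallness of `δ`, in terms of the constants `M`, `b` and `C₀`. -/
structure Small (q γ K₀ M b C₀ δ ε : ℝ) : Prop where
  δ_pos : 0 < δ
  ε_nonneg : 0 ≤ ε
  ε_le : ε ≤ δ ^ 2
  δ_sq_le : δ ^ 2 ≤ γ
  b_eq : b = 7000 * (C₀ + 1) * M ^ 4
  small : δ * (1000 * M ^ 10 * b) ≤ 1
  small_q : δ * (3 * M * b) < q
  one_le_C : 1 ≤ C₀
  two_sq_le : 2 * K₀ ^ 2 ≤ C₀

/-- The regularity and the bounds of the functions of index `j`. -/
structure Good (ζ s M b δ ε : ℝ) (U W : ℕ → ℝ → ActiveMode P K₀ → ℂ) (j : ℕ) : Prop where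
  fin : ∃ T : Finset (ActiveMode P K₀), ∀ ω ∈ Icc (1 : ℝ) 2, ∀ p ∉ T, U j ω p = 0
  supp : ∀ ω p, j ≤ p.lev → W j ω p = 0
  realU : ∀ ω ∈ Icc (1 : ℝ) 2, IsRealSeq (U j ω)
  realW : ∀ ω ∈ Icc (1 : ℝ) 2, IsRealSeq (W j ω)
  c1U : ∀ p, ContDiffOn ℝ 1 (fun ω => U j ω p) (Icc 1 2)
  c1W : ∀ p, ContDiffOn ℝ 1 (fun ω => W j ω p) (Icc 1 2)
  bddU : ∀ ω ∈ Icc (1 : ℝ) 2, SobBdd s (U j ω) (3 * M * b * (ε / δ))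
  bddW : ∀ ω ∈ Icc (1 : ℝ) 2, SobBdd s (W j ω) (b * (ε / δ))
  lipU : ∀ ω ∈ Icc (1 : ℝ) 2, ∀ ω' ∈ Icc (1 : ℝ) 2,
    SobBdd (s - ζ - 2) (fun p => U j ω p - U j ω' p) (3 * M * b * (ε / δ / δ) * |ω - ω'|)
  lipW : ∀ ω ∈ Icc (1 : ℝ) 2, ∀ ω' ∈ Icc (1 : ℝ) 2,
    SobBdd (s - ζ - 2) (fun p => W j ω p - W j ω' p) (b * (ε / δ / δ) * |ω - ω'|)

/-- The bounds of the increments of index `j`. -/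
structure GoodInc (ζ σ M b δ ε : ℝ) (U W : ℕ → ℝ → ActiveMode P K₀ → ℂ) (j : ℕ) : Prop where
  incU : ∀ ω ∈ Icc (1 : ℝ) 2, SobBdd σ (fun p => U (j + 1) ω p - U j ω p)
    (6 * M ^ 2 * b * (ε / δ) * (2 : ℝ) ^ (-2 * j * ζ))
  incW : ∀ ω ∈ Icc (1 : ℝ) 2, SobBdd σ (fun p => W (j + 1) ω p - W j ω p)
    (2 * M * b * (ε / δ) * (2 : ℝ) ^ (-2 * j * ζ))

theorem norm_ofSeq_sub_le {τ : ℝ} {c c' : ActiveMode P K₀ → ℂ} {B B' D : ℝ} (hc : SobBdd τ c B)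
    (hc' : SobBdd τ c' B') (hD : SobBdd τ (fun p => c p - c' p) D) :
    ‖(Hs.ofSeq τ c - Hs.ofSeq τ c' : Hs P K₀ τ)‖ ≤ D := by
  rw [Hs.norm_le_iff hD.nonneg]
  have h4 : (Hs.ofSeq τ c - Hs.ofSeq τ c' : Hs P K₀ τ).coeff = fun p => c p - c' p := by
    funext p
    rw [Hs.coeff_sub, Hs.coeff_ofSeq hc, Hs.coeff_ofSeq hc']
  rwa [h4]

theorem norm_ofSeq_le {τ : ℝ} {c : ActiveMode P K₀ → ℂ} {B : ℝ} (hc : SobBdd τ c B) :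
    ‖(Hs.ofSeq τ c : Hs P K₀ τ)‖ ≤ B := by
  rwa [Hs.norm_le_iff hc.nonneg, Hs.coeff_ofSeq hc]

section

variable {q γ K₀ M b C₀ δ ε : ℝ}

theorem Small.one_le_b (S : Small q γ K₀ M b C₀ δ ε) (hM : 1 ≤ M) : 1 ≤ b := by
  rw [S.b_eq]
  have := S.one_le_C
  have : 1 ≤ M ^ 4 := one_le_pow₀ hM
  nlinarith

/-- The smallness of `δ` against a polynomial expression of `M` and `b`. -/
theorem Small.mul_le_one (S : Small q γ K₀ M b C₀ δ ε) (hM : 1 ≤ M) (c : ℝ) (i : ℕ) (hi : i ≤ 10)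
    (hc : c ≤ 1000) : δ * (c * M ^ i * b) ≤ 1 := by
  refine le_trans (mul_le_mul_of_nonneg_left ?_ S.δ_pos.le) S.small
  have hb := S.one_le_b hM
  have h1 : M ^ i ≤ M ^ 10 := pow_le_pow_right₀ hM hi
  have h2 : 0 ≤ M ^ i := by positivity
  exact mul_le_mul_of_nonneg_right (mul_le_mul hc h1 h2 (by norm_num)) (by linarith)

theorem Small.δ_le_one (S : Small q γ K₀ M b C₀ δ ε) (hM : 1 ≤ M) : δ ≤ 1 := by
  have h1 := S.mul_le_one hM 1 0 (by norm_num) (by norm_num)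
  have hb := S.one_le_b hM
  have := mul_le_mul_of_nonneg_left hb S.δ_pos.le
  linarith

theorem Small.ratio_nonneg (S : Small q γ K₀ M b C₀ δ ε) : 0 ≤ ε / δ :=
  div_nonneg S.ε_nonneg S.δ_pos.le

theorem Small.ratio_le (S : Small q γ K₀ M b C₀ δ ε) : ε / δ ≤ δ := by
  rw [div_le_iff₀ S.δ_pos]
  linarith [S.ε_le, sq δ]

theorem Small.ratio_div_nonneg (S : Small q γ K₀ M b C₀ δ ε) : 0 ≤ ε / δ / δ :=
  div_nonneg S.ratio_nonneg S.δ_pos.le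

theorem Small.ratio_div_le (S : Small q γ K₀ M b C₀ δ ε) : ε / δ / δ ≤ 1 := by
  rw [div_le_iff₀ S.δ_pos, one_mul]
  exact S.ratio_le

theorem Small.ε_le_δ (S : Small q γ K₀ M b C₀ δ ε) (hM : 1 ≤ M) : ε ≤ δ := by
  have := S.ε_le
  have := S.δ_le_one hM
  have := S.δ_pos
  nlinarith

theorem Small.mem (S : Small q γ K₀ M b C₀ δ ε) : ε ∈ Icc 0 γ := ⟨S.ε_nonneg, S.ε_le.trans S.δ_sq_le⟩

end

/-! ### First consequences of the induction hypotheses -/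

section

variable {h : Admissible β θ K₀} {q γ ζ K τ₀ M b C₀ m δ ε : ℝ} {A VD R R₁ : Fam P K₀ σ}
  {f : ActiveMode P K₀ → ℂ} {U W : ℕ → ℝ → ActiveMode P K₀ → ℂ} {χ : ℕ → ℝ → ℝ}
  {ω ω' : ℝ} {j k κ : ℕ}

theorem SchemeBounds.idAdd_le {τ : ℝ} (B : SchemeBounds h q γ ζ s K τ₀ M A VD R R₁ f)
    (O : OrderBounds h q γ ζ τ M A R R₁) (hε : ε ∈ Icc 0 γ) (hω : ω ∈ Icc (1 : ℝ) 2)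
    {x : Hs P K₀ σ} (hx : x ∈ Metric.ball (0 : Hs P K₀ σ) q) {c : ActiveMode P K₀ → ℂ} {D : ℝ}
    (hc : SobBdd τ c D) : SobBdd τ (FOp.idAdd ε (A x (ω, ε)) c) ((1 + M) * D) := by
  have h1 := O.act_le (ω, ε) ⟨hω, hε⟩ x hx c D hc
  have h2 := sobBdd_idAdd (C := M) (K := 1) ⟨hε.1, hε.2.trans B.gamma_le⟩ hc (by rwa [mul_one])
  rwa [mul_one] at h2

theorem SchemeBounds.idAdd_sub_le {τ : ℝ} (B : SchemeBounds h q γ ζ s K τ₀ M A VD R R₁ f)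
    (O : OrderBounds h q γ ζ τ M A R R₁) (hε : ε ∈ Icc 0 γ) (hω : ω ∈ Icc (1 : ℝ) 2)
    (hω' : ω' ∈ Icc (1 : ℝ) 2) {x x' : Hs P K₀ σ} (hx : x ∈ Metric.ball (0 : Hs P K₀ σ) q)
    (hx' : x' ∈ Metric.ball (0 : Hs P K₀ σ) q) {c c' : ActiveMode P K₀ → ℂ} {D E : ℝ}
    (hD : SobBdd τ (fun p => c p - c' p) D) (hc : SobBdd τ c' E) :
    SobBdd τ (fun p => FOp.idAdd ε (A x (ω, ε)) c p - FOp.idAdd ε (A x' (ω', ε)) c' p)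
      ((1 + M) * D + ε * (M * (‖x - x'‖ + |ω - ω'|) * E)) := by
  obtain ⟨K', hK', hA⟩ := B.decayA
  have h1 := B.idAdd_le O hε hω hx hD
  have h2 := (O.act_sub_le ε hε ω hω ω' hω' x hx x' hx' c' E hc).smul (ε : ℂ)
  rw [Complex.norm_real, Real.norm_of_nonneg hε.1] at h2
  have h3 := h1.add h2
  have e : (fun p => FOp.idAdd ε (A x (ω, ε)) (fun p => c p - c' p) p +
      (ε : ℂ) * ((A x (ω, ε)).act c' p - (A x' (ω', ε)).act c' p)) =
      fun p => FOp.idAdd ε (A x (ω, ε)) c p - FOp.idAdd ε (A x' (ω', ε)) c' p := by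
    funext p
    simp only [FOp.idAdd, act_fun_sub_of_decayBdd h (hA.bdd (ω, ε) ⟨hω, hε⟩ x hx)]
    ring
  rwa [e] at h3

theorem SchemeBounds.base_le_mid (B : SchemeBounds h q γ ζ s K τ₀ M A VD R R₁ f) :
    σ ≤ s - ζ - 2 := by
  linarith [B.base_le]

theorem SchemeBounds.base_le_high (B : SchemeBounds h q γ ζ s K τ₀ M A VD R R₁ f) : σ ≤ s := by
  linarith [B.base_le, B.zeta_pos]

/-- The hypotheses on the bounds and on the parameters, and the iteration. -/
structure Scheme (h : Admissible β θ K₀) (q γ ζ s K τ₀ M b C₀ m δ ε : ℝ) (A VD R R₁ : Fam P K₀ σ)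
    (f : ActiveMode P K₀ → ℂ) (U W : ℕ → ℝ → ActiveMode P K₀ → ℂ) (χ : ℕ → ℝ → ℝ) : Prop where
  bounds : SchemeBounds h q γ ζ s K τ₀ M A VD R R₁ f
  small : Small q γ K₀ M b C₀ δ ε
  chain : Chain h m δ ε ζ C₀ A VD R R₁ f U W χ

namespace Scheme

variable (H : Scheme h q γ ζ s K τ₀ M b C₀ m δ ε A VD R R₁ f U W χ)

include H

theorem mul_ratio_le_one (c : ℝ) (i : ℕ) (hi : i ≤ 10) (hc : c ≤ 1000) (hc0 : 0 ≤ c) :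
    c * M ^ i * b * (ε / δ) ≤ 1 := by
  have hM := H.bounds.one_le
  have h1 := H.small.mul_le_one hM c i hi hc
  have hb := H.small.one_le_b hM
  have h2 : c * M ^ i * b * (ε / δ) ≤ c * M ^ i * b * δ :=
    mul_le_mul_of_nonneg_left H.small.ratio_le (by positivity)
  linarith

theorem ball (hj : Good ζ s M b δ ε U W j) (hω : ω ∈ Icc (1 : ℝ) 2) :
    Hs.ofSeq σ (U j ω) ∈ Metric.ball (0 : Hs P K₀ σ) q := by
  refine mem_ball_of_norm_lt ?_
  have hM := H.bounds.one_le
  have hb := H.small.one_le_b hM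
  refine (norm_ofSeq_le ((hj.bddU ω hω).lower H.bounds.base_le_high)).trans_lt ?_
  have h2 : 3 * M * b * (ε / δ) ≤ 3 * M * b * δ :=
    mul_le_mul_of_nonneg_left H.small.ratio_le (by positivity)
  linarith [H.small.small_q]

theorem coeff (hj : Good ζ s M b δ ε U W j) (hω : ω ∈ Icc (1 : ℝ) 2) :
    (Hs.ofSeq σ (U j ω)).coeff = U j ω :=
  Hs.coeff_ofSeq ((hj.bddU ω hω).lower H.bounds.base_le_high)

theorem isReal (hj : Good ζ s M b δ ε U W j) (hω : ω ∈ Icc (1 : ℝ) 2) :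
    (Hs.ofSeq σ (U j ω)).IsReal := by
  rw [Hs.IsReal, H.coeff hj hω]
  exact hj.realU ω hω

theorem norm_sub_le (hj : Good ζ s M b δ ε U W j) (hω : ω ∈ Icc (1 : ℝ) 2)
    (hω' : ω' ∈ Icc (1 : ℝ) 2) :
    ‖(Hs.ofSeq σ (U j ω) - Hs.ofSeq σ (U j ω') : Hs P K₀ σ)‖ ≤
      3 * M * b * (ε / δ / δ) * |ω - ω'| :=
  norm_ofSeq_sub_le ((hj.bddU ω hω).lower H.bounds.base_le_high)
    ((hj.bddU ω' hω').lower H.bounds.base_le_high)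
    ((hj.lipU ω hω ω' hω').lower H.bounds.base_le_mid)

theorem norm_inc_le (hj : Good ζ s M b δ ε U W j) (hj' : Good ζ s M b δ ε U W (j + 1))
    (hi : GoodInc ζ σ M b δ ε U W j) (hω : ω ∈ Icc (1 : ℝ) 2) :
    ‖(Hs.ofSeq σ (U (j + 1) ω) - Hs.ofSeq σ (U j ω) : Hs P K₀ σ)‖ ≤
      6 * M ^ 2 * b * (ε / δ) * (2 : ℝ) ^ (-2 * j * ζ) :=
  norm_ofSeq_sub_le ((hj'.bddU ω hω).lower H.bounds.base_le_high)
    ((hj.bddU ω hω).lower H.bounds.base_le_high) (hi.incU ω hω)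

/-- The increments form a geometric series of ratio `2 ^ (-2 ζ) < 1`, whose sum is at most `M`. The
factor `2 ^ (-2 κ ζ)` has the same rate as the small divisor on shell `κ`. -/
theorem norm_telescope_le (hg : ∀ j ≤ k, Good ζ s M b δ ε U W j)
    (hi : ∀ j < k, GoodInc ζ σ M b δ ε U W j) (hκ : κ ≤ k) (hω : ω ∈ Icc (1 : ℝ) 2) :
    ‖(Hs.ofSeq σ (U k ω) - Hs.ofSeq σ (U κ ω) : Hs P K₀ σ)‖ ≤
      6 * M ^ 3 * b * (ε / δ) * (2 : ℝ) ^ (-2 * κ * ζ) := by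
  have hM := H.bounds.one_le
  have hb := H.small.one_le_b hM
  have hr := H.small.ratio_nonneg
  have hζ := H.bounds.zeta_pos
  set r : ℝ := (2 : ℝ) ^ (-2 * ζ) with hr'
  have hr0 : 0 < r := by positivity
  have hr1 : r < 1 := Real.rpow_lt_one_of_one_lt_of_neg (by norm_num) (by linarith)
  have e1 : ∀ j : ℕ, (2 : ℝ) ^ (-2 * j * ζ) = r ^ j := by
    intro j
    rw [hr', ← Real.rpow_natCast, ← Real.rpow_mul (by norm_num)]
    congr 1
    ring
  obtain ⟨i, rfl⟩ := Nat.exists_eq_add_of_le hκ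
  have h1 : ∀ n ≤ i, ‖(Hs.ofSeq σ (U (κ + n) ω) - Hs.ofSeq σ (U κ ω) : Hs P K₀ σ)‖ ≤
      6 * M ^ 2 * b * (ε / δ) * r ^ κ * ∑ l ∈ Finset.range n, r ^ l := by
    intro n
    induction n with
    | zero => simp
    | succ n ih =>
      intro hn
      have h2 := ih (by omega)
      have h3 := H.norm_inc_le (hg (κ + n) (by omega)) (hg (κ + n + 1) (by omega))
        (hi (κ + n) (by omega)) hω
      rw [e1, pow_add] at h3
      rw [Finset.sum_range_succ, mul_add]
      have h4 := norm_add_le (Hs.ofSeq σ (U (κ + n + 1) ω) - Hs.ofSeq σ (U (κ + n) ω))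
        (Hs.ofSeq σ (U (κ + n) ω) - Hs.ofSeq σ (U κ ω) : Hs P K₀ σ)
      rw [sub_add_sub_cancel] at h4
      have h5 : κ + (n + 1) = κ + n + 1 := by ring
      rw [h5]
      linarith
  refine (h1 i le_rfl).trans ?_
  have h2 : ∑ l ∈ Finset.range i, r ^ l ≤ M := by
    have h3 := (summable_geometric_of_lt_one hr0.le hr1).sum_le_tsum (Finset.range i)
      (fun l _ => by positivity)
    rw [tsum_geometric_of_lt_one hr0.le hr1] at h3
    exact h3.trans H.bounds.geom
  rw [e1]
  have h4 := mul_le_mul_of_nonneg_left h2 (by positivity : 0 ≤ 6 * M ^ 2 * b * (ε / δ) * r ^ κ)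
  refine h4.trans (le_of_eq ?_)
  ring

end Scheme

end

/-! ### Persistence of the small divisor bounds and estimates of the next `w` -/

section

variable {h : Admissible β θ K₀} {q γ ζ K τ₀ M b C₀ m δ ε : ℝ} {A VD R R₁ : Fam P K₀ σ}
  {f : ActiveMode P K₀ → ℂ} {U W : ℕ → ℝ → ActiveMode P K₀ → ℂ} {χ : ℕ → ℝ → ℝ}
  {ω ω' : ℝ} {j k κ : ℕ}

theorem size_pow_le_of_mem_shell {p : ActiveMode P K₀} (hp : p ∈ shell h P κ) :
    P.size p.space ^ 4 ≤ 16 * (2 : ℝ) ^ (4 * κ : ℝ) := by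
  have h1 := size_lt_two_pow p
  rw [mem_shell.1 hp] at h1
  have h2 := pow_le_pow_left₀ (by linarith [one_le_size P p.space]) h1.le 4
  refine h2.trans (le_of_eq ?_)
  have h3 : (2 : ℝ) ^ (4 * κ : ℝ) = (2 : ℝ) ^ (4 * κ) := by
    rw [← Real.rpow_natCast]
    push_cast
    rfl
  rw [h3, ← pow_mul, add_mul, pow_add]
  ring

/-- On shell `κ` the fourth power of the block size is at most `16 * 2 ^ (4 κ)`. The change of the
potential keeps its factor `ε`. -/
theorem SchemeBounds.pnorm_waveAct_sub_le (B : SchemeBounds h q γ ζ s K τ₀ M A VD R R₁ f)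
    (hε : ε ∈ Icc 0 γ) (hω : ω ∈ Icc (1 : ℝ) 2) (hω' : ω' ∈ Icc (1 : ℝ) 2) {x x' : Hs P K₀ σ}
    (hx : x ∈ Metric.ball (0 : Hs P K₀ σ) q) (hx' : x' ∈ Metric.ball (0 : Hs P K₀ σ) q)
    (v : ActiveMode P K₀ → ℂ) :
    pnorm 0 (shell h P κ)
        (fun p => waveAct m ω' ε (VD x' (ω', ε)) v p - waveAct m ω ε (VD x (ω, ε)) v p) ≤
      (64 * K₀ ^ 2 * (2 : ℝ) ^ (4 * κ : ℝ) * |ω' - ω| + ε * (M * (‖x' - x‖ + |ω' - ω|))) *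
        pnorm 0 (shell h P κ) v := by
  have hV := B.block
  have e0 := sobNorm_nonneg τ₀ (x' - x).coeff
  have hK := B.K_nonneg
  have h1 := Beam.pnorm_waveAct_sub_le h (m := m) (R := 16 * (2 : ℝ) ^ (4 * κ : ℝ))
    (η := K * (sobNorm τ₀ (x' - x).coeff + |ω' - ω|)) (blockClosed_shell (P := P) h κ)
    (hV.diag (ω, ε) ⟨hω, hε⟩ x hx) (hV.diag (ω', ε) ⟨hω', hε⟩ x' hx') (by positivity)
    (hV.decay.lip ε hε ω' hω' ω hω x' hx' x hx) hε.1 hω hω'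
    (fun p hp => size_pow_le_of_mem_shell hp) (by positivity) v
  refine h1.trans (mul_le_mul_of_nonneg_right ?_ (pnorm_nonneg _ _ _))
  refine add_le_add (le_of_eq (by ring)) (mul_le_mul_of_nonneg_left ?_ hε.1)
  rw [← mul_assoc]
  exact mul_le_mul B.schur (add_le_add_left ((x' - x).sobNorm_le B.le_base) _) (by positivity)
    (by linarith [B.one_le])

theorem gap_pos (S : Small q γ K₀ M b C₀ δ ε) (ζ : ℝ) (κ : ℕ) : 0 < gap ζ δ C₀ κ := by
  have := S.δ_pos
  have := S.one_le_C
  unfold gap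
  positivity

theorem eight_div_gap {δ C₀ : ℝ} (hδ : 0 < δ) (hC : 0 < C₀) (ζ : ℝ) (k : ℕ) :
    8 / gap ζ δ C₀ k = 1024 * C₀ / δ * (2 : ℝ) ^ (2 * k * (ζ + 2)) := by
  have e2 : (2 : ℝ) ^ (-2 * k * (ζ + 2)) = ((2 : ℝ) ^ (2 * k * (ζ + 2)))⁻¹ := by
    rw [← Real.rpow_neg (by norm_num)]
    congr 1
    ring
  rw [gap, e2]
  have : (0 : ℝ) < (2 : ℝ) ^ (2 * k * (ζ + 2)) := by positivity
  field_simp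
  ring

namespace Scheme

variable (H : Scheme h q γ ζ s K τ₀ M b C₀ m δ ε A VD R R₁ f U W χ)

include H

/-- At a nearby non-resonant `y` the function of step `κ` gives the bound `2 δ 2 ^ (-2 κ ζ)`.
Passing to `ω` and to the function of step `k` costs at most a quarter of `δ 2 ^ (-2 κ ζ)` for the
symbol and a quarter for the potential. This is why the cut-off of shell `κ` never has to be
updated. -/
theorem lower (hg : ∀ j ≤ k, Good ζ s M b δ ε U W j) (hi : ∀ j < k, GoodInc ζ σ M b δ ε U W j)
    (hκ : κ ≤ k) (hω : ω ∈ Icc (1 : ℝ) 2)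
    (hn : NearCompl (resSection m ζ δ ε VD κ (U κ)) (gap ζ δ C₀ κ) ω) :
    LowerBdd m ω ε (VD.at (U k ω) ω ε) (shell h P κ) (δ * (2 : ℝ) ^ (-2 * κ * ζ)) := by
  obtain ⟨y, hy, hyO, hlt⟩ := hn
  have hM := H.bounds.one_le
  have hb := H.small.one_le_b hM
  have hε := H.small.mem
  have hδ := H.small.δ_pos
  have hC := H.small.one_le_C
  have hζ := H.bounds.zeta_pos
  have hV := H.bounds.block
  have hr := H.small.ratio_nonneg
  have hx := H.ball (hg κ hκ) hy
  have hx' := H.ball (hg k le_rfl) hω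
  set x := Hs.ofSeq σ (U κ y)
  set g : ℝ := (2 : ℝ) ^ (-2 * κ * ζ) with hgdef
  have hg0 : 0 < g := by positivity
  have h1 : LowerBdd m y ε (VD x (y, ε)) (shell h P κ) (2 * (δ * g)) := by
    refine lowerBdd_of_isEig (blockClosed_shell h κ) (hV.diag (y, ε) ⟨hy, hε⟩ x hx)
      (hV.selfAdj (y, ε) ⟨hy, hε⟩ x hx (H.isReal (hg κ hκ) hy)) ?_
    rintro α μ ⟨p, hp, hpα⟩ hμ
    by_contra hlt'
    push Not at hlt'
    refine hyO ⟨hy, ⟨hε.1, H.small.ε_le⟩, α, ?_, ?_, μ, hμ, by linarith⟩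
    · rw [← size_of_block hpα, ← mem_shell.1 hp]
      exact two_pow_lev_le p
    · rw [← size_of_block hpα, ← mem_shell.1 hp]
      exact size_lt_two_pow p
  have h2 := h1.perturb (H.bounds.pnorm_waveAct_sub_le (m := m) (κ := κ) hε hy hω hx hx')
  refine LowerBdd.mono h2 ?_
  -- The symbol moves at the rate `2 ^ (4 κ)` on this shell. The layer has been given the exponent
  -- `ζ + 2` so that the total motion is the small divisor divided by `128 C₀`; then `2 K₀² ≤ C₀`
  -- suffices.
  have hgap : (2 : ℝ) ^ (4 * κ : ℝ) * gap ζ δ C₀ κ = δ * g / (128 * C₀) := by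
    rw [gap, hgdef]
    have : (2 : ℝ) ^ (-2 * κ * ζ) = (2 : ℝ) ^ (4 * κ : ℝ) * (2 : ℝ) ^ (-2 * κ * (ζ + 2)) := by
      rw [← Real.rpow_add (by norm_num)]
      congr 1
      ring
    rw [this]
    ring
  have h3 : 64 * K₀ ^ 2 * (2 : ℝ) ^ (4 * κ : ℝ) * |ω - y| ≤ δ * g / 4 := by
    have i1 : 64 * K₀ ^ 2 * ((2 : ℝ) ^ (4 * κ : ℝ) * |ω - y|) ≤
        64 * K₀ ^ 2 * ((2 : ℝ) ^ (4 * κ : ℝ) * gap ζ δ C₀ κ) := by gcongr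
    rw [hgap] at i1
    have i2 : 64 * K₀ ^ 2 * (δ * g / (128 * C₀)) ≤ δ * g / 4 := by
      have i3 := H.small.two_sq_le
      rw [mul_div_assoc', div_le_iff₀ (by positivity)]
      have := mul_le_mul_of_nonneg_left i3 (by positivity : 0 ≤ 32 * (δ * g))
      linarith
    linarith
  have h4 : |ω - y| ≤ δ * g := by
    refine hlt.le.trans ?_
    have i1 : 1 ≤ (2 : ℝ) ^ (4 * κ : ℝ) := Real.one_le_rpow (by norm_num) (by positivity)
    have i2 := le_mul_of_one_le_left (gap_pos H.small ζ κ).le i1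
    rw [hgap] at i2
    exact i2.trans (div_le_self (by positivity) (by linarith))
  have h5 : ‖(Hs.ofSeq σ (U k ω) - x : Hs P K₀ σ)‖ ≤
      6 * M ^ 3 * b * (ε / δ) * g + 3 * M * b * (ε / δ / δ) * |ω - y| := by
    have i1 := H.norm_telescope_le hg hi hκ hω
    have i2 := H.norm_sub_le (hg κ hκ) hω hy
    have i3 := norm_add_le (Hs.ofSeq σ (U k ω) - Hs.ofSeq σ (U κ ω) : Hs P K₀ σ)
      (Hs.ofSeq σ (U κ ω) - Hs.ofSeq σ (U κ y))
    rw [sub_add_sub_cancel] at i3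
    exact i3.trans (add_le_add i1 i2)
  have h6 : 3 * M * b * (ε / δ / δ) * |ω - y| ≤ 3 * M * b * (δ * g) := by
    have := H.small.ratio_div_le
    have := H.small.ratio_div_nonneg
    calc 3 * M * b * (ε / δ / δ) * |ω - y| ≤ 3 * M * b * 1 * (δ * g) := by gcongr
      _ = _ := by ring
  have h7 : 6 * M ^ 3 * b * (ε / δ) * g ≤ 6 * M ^ 3 * b * (δ * g) := by
    have := H.small.ratio_le
    calc 6 * M ^ 3 * b * (ε / δ) * g ≤ 6 * M ^ 3 * b * δ * g := by gcongr
      _ = _ := by ring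
  have h8 : ε * (M * (‖(Hs.ofSeq σ (U k ω) - x : Hs P K₀ σ)‖ + |ω - y|)) ≤ δ * g / 4 := by
    have i1 : ‖(Hs.ofSeq σ (U k ω) - x : Hs P K₀ σ)‖ + |ω - y| ≤
        10 * M ^ 3 * b * (δ * g) := by
      have i2 : M ≤ M ^ 3 := le_self_pow₀ hM (by norm_num)
      have i3 : 1 ≤ M ^ 3 * b := by
        have : 1 ≤ M ^ 3 := one_le_pow₀ hM
        nlinarith
      have i4 : 3 * M * b * (δ * g) ≤ 3 * M ^ 3 * b * (δ * g) := by gcongr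
      have i5 := mul_le_mul_of_nonneg_right i3 (by positivity : 0 ≤ δ * g)
      linarith
    have i2 : ε * (M * (‖(Hs.ofSeq σ (U k ω) - x : Hs P K₀ σ)‖ + |ω - y|)) ≤
        δ * (M * (10 * M ^ 3 * b * (δ * g))) := by
      have := H.small.ε_le_δ hM
      have := H.small.ε_nonneg
      gcongr
    have i3 := H.small.mul_le_one hM 40 4 (by norm_num) (by norm_num)
    have i4 := mul_le_mul_of_nonneg_right i3 (by positivity : 0 ≤ δ * g)
    refine i2.trans ?_
    linarith
  linarith [mul_pos hδ hg0]

/-- The solution of the uncut equation at step `k`. -/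
theorem cutSol (hg : ∀ j ≤ k, Good ζ s M b δ ε U W j) (hi : ∀ j < k, GoodInc ζ σ M b δ ε U W j)
    (hκ : κ ≤ k) (hω : ω ∈ Icc (1 : ℝ) 2) :
    CutSol h m ω ε (δ * (2 : ℝ) ^ (-2 * κ * ζ)) (χ κ ω) κ (VD.at (U k ω) ω ε)
      (source A R R₁ f ε ω (U k ω) (W k ω)) (W (k + 1) ω)
      (shellInv h m ω ε (VD.at (U k ω) ω ε)
        (fun p => (ε : ℂ) * source A R R₁ f ε ω (U k ω) (W k ω) p)) := by
  have hδ := H.small.δ_pos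
  have hgap := gap_pos H.small ζ κ
  have hcut := H.chain.cut κ ω
  have hmem := cutoff_mem (resSection m ζ δ ε VD κ (U κ)) hgap ω
  have hlow : χ κ ω ≠ 0 →
      LowerBdd m ω ε (VD.at (U k ω) ω ε) (shell h P κ) (δ * (2 : ℝ) ^ (-2 * κ * ζ)) := by
    intro hχ
    refine H.lower hg hi hκ hω ?_
    -- The cut-off already vanishes at distance `7 / 8` of the width, so a non-zero value places `ω`
    -- within the full width used for the lower bound.
    by_contra hn
    refine hχ ?_
    rw [hcut, cutoff_eq_one hgap, sub_self]
    rintro ⟨y, hy, hyO, hlt⟩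
    exact hn ⟨y, hy, hyO, by linarith⟩
  refine ⟨?_, ?_, ?_, hlow⟩
  · rw [hcut]
    exact ⟨by linarith [hmem.2], by linarith [hmem.1]⟩
  · intro p hp
    have hp' := mem_shell.1 hp
    rw [H.chain.W_succ, if_pos (by omega), hp']
  · intro hχ p hp
    exact waveAct_shellInv _ (H.bounds.block.diag (ω, ε) ⟨hω, H.small.mem⟩ _
      (H.ball (hg k le_rfl) hω)) (by positivity) (hlow hχ) hp

theorem supp_succ (ω : ℝ) (p : ActiveMode P K₀) (hp : k < p.lev) : W (k + 1) ω p = 0 := by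
  rw [H.chain.W_succ, if_neg (by omega)]

/-- Since `ε / δ ≤ δ` and `δ` is small against `b`, the induction bounds are at most `1`. The result
does not contain `b`, and so the size of the iterates does not grow with the step. -/
theorem source_le (hj : Good ζ s M b δ ε U W k) (hω : ω ∈ Icc (1 : ℝ) 2) :
    SobBdd (s + ζ) (source A R R₁ f ε ω (U k ω) (W k ω)) (3 * M ^ 2) := by
  have hM := H.bounds.one_le
  have h1 := H.mul_ratio_le_one 3 1 (by norm_num) (by norm_num) (by norm_num)
  have h2 := H.mul_ratio_le_one 1 0 (by norm_num) (by norm_num) (by norm_num)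
  rw [pow_one] at h1
  rw [pow_zero, one_mul, one_mul] at h2
  refine (H.bounds.high.rhs_le ε H.small.mem ω hω _ (H.ball hj hω) f _ _ _ _ _ H.bounds.f_bdd
    ((hj.bddU ω hω).mono h1) ((hj.bddW ω hω).mono h2)).mono ?_
  nlinarith

theorem abs_cut_sub_le (κ : ℕ) (ω ω' : ℝ) :
    |χ κ ω - χ κ ω'| ≤ 1024 * C₀ / δ * |ω - ω'| * (2 : ℝ) ^ (2 * κ * (ζ + 2)) := by
  have hδ := H.small.δ_pos
  have hC := H.small.one_le_C
  rw [H.chain.cut, H.chain.cut]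
  have h1 := abs_cutoff_sub_le (resSection m ζ δ ε VD κ (U κ)) (gap_pos H.small ζ κ) ω' ω
  have e1 : ∀ x y : ℝ, 1 - x - (1 - y) = y - x := fun x y => by ring
  rw [e1, abs_sub_comm ω ω']
  rw [eight_div_gap hδ (by linarith)] at h1
  exact h1.trans (le_of_eq (by ring))

theorem source_lip (hj : Good ζ s M b δ ε U W k) (hω : ω ∈ Icc (1 : ℝ) 2)
    (hω' : ω' ∈ Icc (1 : ℝ) 2) :
    SobBdd (s - ζ - 2 + ζ) (fun p => source A R R₁ f ε ω (U k ω) (W k ω) p -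
      source A R R₁ f ε ω' (U k ω') (W k ω') p) (20 * M ^ 3 * b * |ω - ω'|) := by
  have hM := H.bounds.one_le
  have hb := H.small.one_le_b hM
  have hζ := H.bounds.zeta_pos
  have h1 := H.mul_ratio_le_one 3 1 (by norm_num) (by norm_num) (by norm_num)
  have h2 := H.mul_ratio_le_one 1 0 (by norm_num) (by norm_num) (by norm_num)
  rw [pow_one] at h1
  rw [pow_zero, one_mul, one_mul] at h2
  have hle : s - ζ - 2 ≤ s := by linarith
  have hr := H.small.ratio_div_le
  have hr0 := H.small.ratio_div_nonneg
  have h3 := H.bounds.mid.rhs_sub_le ε H.small.mem ω hω ω' hω' _ (H.ball hj hω) _ (H.ball hj hω')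
    f _ _ _ _ _ _ _ _ _ (H.bounds.f_bdd.lower (by linarith))
    (((hj.bddU ω hω).mono h1).lower hle) (((hj.bddU ω' hω').mono h1).lower hle)
    (((hj.bddW ω hω).mono h2).lower hle) (((hj.bddW ω' hω').mono h2).lower hle)
    (hj.lipU ω hω ω' hω') (hj.lipW ω hω ω' hω')
  refine h3.mono ?_
  have h4 := H.norm_sub_le hj hω hω'
  have t := abs_nonneg (ω - ω')
  set t' := |ω - ω'|
  have h5 : 3 * M * b * (ε / δ / δ) * t' ≤ 3 * M * b * t' := by
    have := mul_le_mul_of_nonneg_left hr (by positivity : 0 ≤ 3 * M * b * t')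
    linarith
  have h6 : b * (ε / δ / δ) * t' ≤ b * t' := by
    have := mul_le_mul_of_nonneg_left hr (by positivity : 0 ≤ b * t')
    linarith
  have h7 : (‖(Hs.ofSeq σ (U k ω) - Hs.ofSeq σ (U k ω') : Hs P K₀ σ)‖ + t') * (1 + 1 + M) ≤
      (3 * M * b * t' + t') * (3 * M) := by
    have : 1 + 1 + M ≤ 3 * M := by linarith
    gcongr
    linarith
  have h8 : (3 * M * b * t' + t') * (3 * M) + 3 * M * b * t' + b * t' ≤ 20 * M ^ 2 * b * t' := by
    have i1 : 1 ≤ M * b := by nlinarith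
    have i2 : 3 * M * b + 1 ≤ 4 * M * b := by linarith
    have i3 : M ≤ M ^ 2 := le_self_pow₀ hM (by norm_num)
    have i4 : 1 ≤ M ^ 2 := one_le_pow₀ hM
    have i5 : M * (b * t') ≤ M ^ 2 * (b * t') := by gcongr
    have i6 : 1 * (b * t') ≤ M ^ 2 * (b * t') := by gcongr
    have i7 := mul_le_mul_of_nonneg_right i2 (by positivity : 0 ≤ t' * (3 * M))
    have i8 : 0 ≤ M ^ 2 * (b * t') := by positivity
    linarith
  have h9 : M * (20 * M ^ 2 * b * t') = 20 * M ^ 3 * b * t' := by ring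
  rw [← h9]
  refine mul_le_mul_of_nonneg_left ?_ (by linarith)
  linarith

theorem bddW_succ (hg : ∀ j ≤ k, Good ζ s M b δ ε U W j)
    (hi : ∀ j < k, GoodInc ζ σ M b δ ε U W j) (hω : ω ∈ Icc (1 : ℝ) 2) :
    SobBdd s (W (k + 1) ω) (b * (ε / δ)) := by
  have hM := H.bounds.one_le
  have hr := H.small.ratio_nonneg
  have hC := H.small.one_le_C
  refine (H.bounds.high.cut_le k m δ ε ω _ _ _ _ _ _ H.small.δ_pos H.small.ε_nonneg
    (fun κ hκ => H.cutSol hg hi hκ hω) (fun p hp => H.supp_succ ω p hp)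
    (H.source_le (hg k le_rfl) hω)).mono ?_
  have h1 : 3 * M ^ 3 ≤ b := by
    rw [H.small.b_eq]
    have : M ^ 3 ≤ M ^ 4 := pow_le_pow_right₀ hM (by norm_num)
    have : 0 ≤ M ^ 3 := by positivity
    nlinarith
  have := mul_le_mul_of_nonneg_right h1 hr
  linarith

/-- The main contributions come from the cut-off and from the symbol and do not involve the previous
Lipschitz constants. The latter enter only with a factor `δ`, so the same `b` is reproduced. -/
theorem lipW_succ (hg : ∀ j ≤ k, Good ζ s M b δ ε U W j)
    (hi : ∀ j < k, GoodInc ζ σ M b δ ε U W j) (hω : ω ∈ Icc (1 : ℝ) 2)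
    (hω' : ω' ∈ Icc (1 : ℝ) 2) :
    SobBdd (s - ζ - 2) (fun p => W (k + 1) ω p - W (k + 1) ω' p)
      (b * (ε / δ / δ) * |ω - ω'|) := by
  have hM := H.bounds.one_le
  have hb := H.small.one_le_b hM
  have hδ := H.small.δ_pos
  have hC := H.small.one_le_C
  have hε := H.small.mem
  have hr0 := H.small.ratio_div_nonneg
  have hk := hg k le_rfl
  have t := abs_nonneg (ω - ω')
  set t' := |ω - ω'| with ht'
  have hord : s - ζ - 2 + (2 * ζ + 2) = s + ζ := by ring
  have hE : ∀ κ ≤ k, ∀ v, pnorm 0 (shell h P κ) (fun p =>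
      waveAct m ω' ε (VD.at (U k ω') ω' ε) v p - waveAct m ω ε (VD.at (U k ω) ω ε) v p) ≤
        65 * M * t' * (2 : ℝ) ^ (4 * κ : ℝ) * pnorm 0 (shell h P κ) v := by
    intro κ hκ v
    refine (H.bounds.pnorm_waveAct_sub_le hε hω hω' (H.ball hk hω) (H.ball hk hω') v).trans ?_
    refine mul_le_mul_of_nonneg_right ?_ (pnorm_nonneg _ _ _)
    rw [abs_sub_comm ω' ω, ← ht']
    have i0 : 1 ≤ (2 : ℝ) ^ (4 * κ : ℝ) := Real.one_le_rpow (by norm_num) (by positivity)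
    have i1 : ‖(Hs.ofSeq σ (U k ω') - Hs.ofSeq σ (U k ω) : Hs P K₀ σ)‖ ≤ 3 * M * b * t' := by
      have i2 := H.norm_sub_le hk hω' hω
      rw [abs_sub_comm ω' ω, ← ht'] at i2
      have := mul_le_mul_of_nonneg_left H.small.ratio_div_le (by positivity : 0 ≤ 3 * M * b * t')
      linarith
    have i2 : ‖(Hs.ofSeq σ (U k ω') - Hs.ofSeq σ (U k ω) : Hs P K₀ σ)‖ + t' ≤ 4 * M * b * t' := by
      have : 1 ≤ M * b := by nlinarith
      have := mul_le_mul_of_nonneg_right this t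
      linarith
    have i3 : ε * (M * (‖(Hs.ofSeq σ (U k ω') - Hs.ofSeq σ (U k ω) : Hs P K₀ σ)‖ + t')) ≤
        δ * (M * (4 * M * b * t')) := by
      have := H.small.ε_le_δ hM
      have := H.small.ε_nonneg
      gcongr
    have i4 := mul_le_mul_of_nonneg_right (H.small.mul_le_one hM 4 2 (by norm_num) (by norm_num)) t
    have i5 : 64 * K₀ ^ 2 * (2 : ℝ) ^ (4 * κ : ℝ) * t' ≤ 64 * M * (2 : ℝ) ^ (4 * κ : ℝ) * t' := by
      have := H.bounds.sq_K
      gcongr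
    have i6 : 1 * t' ≤ M * (2 : ℝ) ^ (4 * κ : ℝ) * t' := by
      refine mul_le_mul_of_nonneg_right ?_ t
      nlinarith
    linarith
  have h1 := H.bounds.mid.cut_sub_le k m δ ε ω ω' (3 * M ^ 2) (20 * M ^ 3 * b * t')
    (1024 * C₀ / δ * t') (65 * M * t') (fun κ => χ κ ω) (fun κ => χ κ ω') _ _ _ _ _ _ _ _ hδ
    hε.1 (by positivity) (by positivity)
    (H.bounds.block.diag (ω, ε) ⟨hω, hε⟩ _ (H.ball hk hω))
    (fun κ hκ => H.cutSol hg hi hκ hω) (fun κ hκ => H.cutSol hg hi hκ hω')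
    (fun κ _ => H.abs_cut_sub_le κ ω ω') hE (fun p hp => H.supp_succ ω p hp)
    (fun p hp => H.supp_succ ω' p hp) (by rw [hord]; exact H.source_le hk hω)
    (by rw [hord]; exact H.source_le hk hω') (H.source_lip hk hω hω')
  refine h1.mono ?_
  have e1 : ε / δ * (1024 * C₀ / δ * t') = ε / δ / δ * t' * (1024 * C₀) := by ring
  have e2 : ε / δ * (20 * M ^ 3 * b * t') = ε / δ / δ * t' * (δ * (20 * M ^ 3 * b)) := by
    field_simp
  have e3 : ε / δ / δ * (65 * M * t') = ε / δ / δ * t' * (65 * M) := by ring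
  rw [e1, e2, e3]
  have i1 := H.small.mul_le_one hM 20 3 (by norm_num) (by norm_num)
  -- This inequality dictates `b = 7000 (C₀ + 1) M ^ 4`: the two cut-off terms give `6144 C₀ M ^ 3`,
  -- the operator gives `195 M ^ 4`, and the last term is at most `M`.
  have i2 : M * (1024 * C₀ * (3 * M ^ 2) + (1024 * C₀ + 65 * M) * (3 * M ^ 2) +
      δ * (20 * M ^ 3 * b)) ≤ b := by
    rw [H.small.b_eq] at i1 ⊢
    have j1 : M ^ 3 ≤ M ^ 4 := pow_le_pow_right₀ hM (by norm_num)
    have j2 : M ≤ M ^ 4 := le_self_pow₀ hM (by norm_num)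
    have j3 := mul_le_mul_of_nonneg_left j1 (by positivity : 0 ≤ C₀)
    have j4 : M * (δ * (20 * M ^ 3 * (7000 * (C₀ + 1) * M ^ 4))) ≤ M * 1 := by gcongr
    have j5 : 0 ≤ C₀ * M ^ 4 := by positivity
    have j6 : M * (1024 * C₀ * (3 * M ^ 2) + (1024 * C₀ + 65 * M) * (3 * M ^ 2)) =
      6144 * (C₀ * M ^ 3) + 195 * M ^ 4 := by ring
    rw [mul_add, j6]
    linarith
  have i3 := mul_le_mul_of_nonneg_right i2 (by positivity : 0 ≤ ε / δ / δ * t')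
  refine le_trans (le_of_eq ?_) (i3.trans (le_of_eq ?_)) <;> ring

end Scheme

end

/-! ### Estimates of the next `u`, increments and regularity -/

section

variable {h : Admissible β θ K₀} {q γ ζ K τ₀ M b C₀ m δ ε : ℝ} {A VD R R₁ : Fam P K₀ σ}
  {f : ActiveMode P K₀ → ℂ} {U W : ℕ → ℝ → ActiveMode P K₀ → ℂ} {χ : ℕ → ℝ → ℝ}
  {ω ω' : ℝ} {j k κ : ℕ}

theorem SobBdd.of_norm_le {τ D : ℝ} {c c' : ActiveMode P K₀ → ℂ} (hc : SobBdd τ c' D)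
    (hle : ∀ p, ‖c p‖ ≤ ‖c' p‖) : SobBdd τ c D :=
  fun T => (pnorm_le_of_norm_le fun p _ => hle p).trans (hc T)

theorem CutSol.congr {c y : ℝ} {a : FOp P K₀} {F w w' x : ActiveMode P K₀ → ℂ}
    (H : CutSol h m ω ε c y κ a F w x) (hw : ∀ p ∈ shell h P κ, w' p = w p) :
    CutSol h m ω ε c y κ a F w' x :=
  ⟨H.mem, fun p hp => (hw p hp).trans (H.eq p hp), H.solves, H.lower⟩

/-- Columns are finite as well as rows, since the adjoint satisfies the same decay bound. The set
`T'` depends on `T` only, not on the operator, hence is uniform in `ω`. -/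
theorem exists_act_support (h : Admissible β θ K₀) (T : Finset (ActiveMode P K₀)) :
    ∃ T' : Finset (ActiveMode P K₀), ∀ (K : ℝ) (a : FOp P K₀), DecayBdd K a →
      ∀ c : ActiveMode P K₀ → ℂ, (∀ p ∉ T, c p = 0) → ∀ p ∉ T', a.act c p = 0 := by
  classical
  refine ⟨T.biUnion fun p' => nearModes h P p', fun K a ha c hc p hp => ?_⟩
  have h1 : ∀ p', a p p' * c p' = 0 := by
    intro p'
    by_cases hp' : p' ∈ T
    · have h2 : p ∉ nearModes h P p' := fun e => hp (Finset.mem_biUnion.2 ⟨p', hp', e⟩)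
      have h3 := ha.adj.entry_eq_zero_of_notMem h h2
      rw [FOp.adj, map_eq_zero] at h3
      rw [h3, zero_mul]
    · rw [hc p' hp', mul_zero]
  rw [FOp.act, tsum_congr h1, tsum_zero]

theorem Good.contDiffOn_point (hj : Good ζ s M b δ ε U W j) :
    ContDiffOn ℝ 1 (fun ω => (Hs.ofSeq σ (U j ω) : Hs P K₀ σ)) (Icc 1 2) := by
  obtain ⟨T, hT⟩ := hj.fin
  exact contDiffOn_ofSeq hT hj.c1U

theorem Good.eq_zero_of_notMem_low (hj : Good ζ s M b δ ε U W j) (ω : ℝ) (p : ActiveMode P K₀) (hp : p ∉ low h P j) :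
    W j ω p = 0 := by
  refine hj.supp ω p ?_
  simp at hp
  exact hp.le

namespace Scheme

variable (H : Scheme h q γ ζ s K τ₀ M b C₀ m δ ε A VD R R₁ f U W χ)

include H

theorem bddU_succ (hg : ∀ j ≤ k, Good ζ s M b δ ε U W j)
    (hi : ∀ j < k, GoodInc ζ σ M b δ ε U W j) (hω : ω ∈ Icc (1 : ℝ) 2) :
    SobBdd s (U (k + 1) ω) (3 * M * b * (ε / δ)) := by
  have hM := H.bounds.one_le
  rw [H.chain.U_succ]
  have h1 := H.bddW_succ hg hi hω
  refine (H.bounds.idAdd_le H.bounds.high H.small.mem hω (H.ball (hg k le_rfl) hω) h1).mono ?_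
  have := mul_le_mul_of_nonneg_right (by linarith : 1 + M ≤ 3 * M) h1.nonneg
  linarith

theorem lipU_succ (hg : ∀ j ≤ k, Good ζ s M b δ ε U W j)
    (hi : ∀ j < k, GoodInc ζ σ M b δ ε U W j) (hω : ω ∈ Icc (1 : ℝ) 2)
    (hω' : ω' ∈ Icc (1 : ℝ) 2) :
    SobBdd (s - ζ - 2) (fun p => U (k + 1) ω p - U (k + 1) ω' p)
      (3 * M * b * (ε / δ / δ) * |ω - ω'|) := by
  have hM := H.bounds.one_le
  have hb := H.small.one_le_b hM
  have hδ := H.small.δ_pos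
  have hr0 := H.small.ratio_div_nonneg
  have hk := hg k le_rfl
  have h1 := H.bounds.idAdd_sub_le H.bounds.mid H.small.mem hω hω' (H.ball hk hω) (H.ball hk hω')
    (H.lipW_succ hg hi hω hω')
    ((H.bddW_succ hg hi hω').lower (by linarith [H.bounds.zeta_pos] : s - ζ - 2 ≤ s))
  rw [H.chain.U_succ, H.chain.U_succ]
  refine h1.mono ?_
  have h2 := H.norm_sub_le hk hω hω'
  have t := abs_nonneg (ω - ω')
  set t' := |ω - ω'| with ht'
  have i1 : ‖(Hs.ofSeq σ (U k ω) - Hs.ofSeq σ (U k ω') : Hs P K₀ σ)‖ + t' ≤ 4 * M * b * t' := by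
    have := mul_le_mul_of_nonneg_left H.small.ratio_div_le (by positivity : 0 ≤ 3 * M * b * t')
    have : 1 ≤ M * b := by nlinarith
    have := mul_le_mul_of_nonneg_right this t
    linarith
  have hr := H.small.ratio_nonneg
  have i2 : ε * (M * (‖(Hs.ofSeq σ (U k ω) - Hs.ofSeq σ (U k ω') : Hs P K₀ σ)‖ + t') *
      (b * (ε / δ))) ≤ δ * (M * (4 * M * b * t') * (b * (ε / δ))) := by
    have := H.small.ε_le_δ hM
    have := H.small.ε_nonneg
    gcongr
  have e1 : δ * (M * (4 * M * b * t') * (b * (ε / δ))) =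
      δ * (4 * M ^ 2 * b) * (b * (ε / δ / δ) * t') * δ := by
    field_simp
  have i3 : δ * (4 * M ^ 2 * b) * (b * (ε / δ / δ) * t') * δ ≤
      1 * (b * (ε / δ / δ) * t') * 1 := by
    have := H.small.mul_le_one hM 4 2 (by norm_num) (by norm_num)
    have := H.small.δ_le_one hM
    gcongr
  have i4 := mul_le_mul_of_nonneg_right hM (by positivity : 0 ≤ b * (ε / δ / δ) * t')
  linarith

/-- The part of the new function on shell `k`, which the previous one did not have, is small only
through its size in the higher order `s`. -/
theorem tail_succ (hg : ∀ j ≤ k, Good ζ s M b δ ε U W j)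
    (hi : ∀ j < k, GoodInc ζ σ M b δ ε U W j) (hω : ω ∈ Icc (1 : ℝ) 2) :
    SobBdd σ (fun p => if p.lev < k then 0 else W (k + 1) ω p)
      (M * (2 : ℝ) ^ (-2 * k * ζ) * (b * (ε / δ))) := by
  refine H.bounds.tail k _ _ ((H.bddW_succ hg hi hω).of_norm_le fun p => ?_) fun p hp => if_pos hp
  split_ifs
  · simp
  · exact le_rfl

theorem growth_le (j : ℕ) :
    (2 : ℝ) ^ (-2 * j * ζ) ≤ M * (2 : ℝ) ^ (-2 * (j + 1 : ℕ) * ζ) := by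
  have e : (2 : ℝ) ^ (-2 * j * ζ) = (2 : ℝ) ^ (2 * ζ) * (2 : ℝ) ^ (-2 * (j + 1 : ℕ) * ζ) := by
    rw [← Real.rpow_add (by norm_num)]
    congr 1
    push_cast
    ring
  rw [e]
  exact mul_le_mul_of_nonneg_right H.bounds.growth (by positivity)

/-- On the old shells two consecutive iterates solve the same system with functions differing by the
previous increment. Inversion and the factor `ε` yield `ε / δ`, and the smallness of `δ` absorbs all
the constants, including the loss from `2 ^ (-2 j ζ)` to `2 ^ (-2 (j + 1) ζ)`. -/
theorem low_succ (hg : ∀ i ≤ j + 1, Good ζ s M b δ ε U W i)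
    (hi : ∀ i < j + 1, GoodInc ζ σ M b δ ε U W i) (hω : ω ∈ Icc (1 : ℝ) 2) :
    SobBdd σ (fun p => (if p.lev < j + 1 then W (j + 1 + 1) ω p else 0) - W (j + 1) ω p)
      (ε / δ * (2 : ℝ) ^ (-2 * (j + 1 : ℕ) * ζ)) := by
  have hM := H.bounds.one_le
  have hb := H.small.one_le_b hM
  have hδ := H.small.δ_pos
  have hε := H.small.mem
  have hr := H.small.ratio_nonneg
  have hζ := H.bounds.zeta_pos
  have hk := hg (j + 1) le_rfl
  have hj := hg j (Nat.le_succ j)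
  have hij := hi j (Nat.lt_succ_self j)
  have hg' : ∀ i ≤ j, Good ζ s M b δ ε U W i := fun i h => hg i (by omega)
  have hi' : ∀ i < j, GoodInc ζ σ M b δ ε U W i := fun i h => hi i (by omega)
  set g : ℝ := (2 : ℝ) ^ (-2 * j * ζ) with hgdef
  have hg0 : 0 < g := by positivity
  have hX := H.norm_inc_le hj hk hij hω
  set N := ‖(Hs.ofSeq σ (U (j + 1) ω) - Hs.ofSeq σ (U j ω) : Hs P K₀ σ)‖ with hN
  have hN0 : 0 ≤ N := norm_nonneg _
  have h1 := H.mul_ratio_le_one 3 1 (by norm_num) (by norm_num) (by norm_num)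
  have h2 := H.mul_ratio_le_one 1 0 (by norm_num) (by norm_num) (by norm_num)
  rw [pow_one] at h1
  rw [pow_zero, one_mul, one_mul] at h2
  have hle := H.bounds.base_le_high
  have hF := H.bounds.base.rhs_sub_le ε hε ω hω ω hω _ (H.ball hk hω) _ (H.ball hj hω)
    f _ _ _ _ _ _ _ _ _ (H.bounds.f_bdd.lower (by linarith))
    (((hk.bddU ω hω).mono h1).lower hle) (((hj.bddU ω hω).mono h1).lower hle)
    (((hk.bddW ω hω).mono h2).lower hle) (((hj.bddW ω hω).mono h2).lower hle)
    (hij.incU ω hω) (hij.incW ω hω)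
  rw [sub_self, abs_zero, add_zero, ← hN] at hF
  have hE : ∀ κ ≤ j, ∀ v, pnorm 0 (shell h P κ) (fun p =>
      waveAct m ω ε (VD.at (U j ω) ω ε) v p - waveAct m ω ε (VD.at (U (j + 1) ω) ω ε) v p) ≤
        ε * (M * N) * (2 : ℝ) ^ (4 * κ : ℝ) * pnorm 0 (shell h P κ) v := by
    intro κ _ v
    refine (H.bounds.pnorm_waveAct_sub_le hε hω hω (H.ball hk hω) (H.ball hj hω) v).trans ?_
    refine mul_le_mul_of_nonneg_right ?_ (pnorm_nonneg _ _ _)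
    rw [sub_self, abs_zero, mul_zero, zero_add, add_zero, norm_sub_rev, ← hN]
    exact le_mul_of_one_le_right (mul_nonneg hε.1 (by positivity))
      (Real.one_le_rpow (by norm_num) (by positivity))
  have hord : σ + (2 * ζ + 2) ≤ s + ζ := by linarith [H.bounds.base_le]
  -- Both iterates carry the same cut-offs at the same `ω`, hence `X = 0`, and only the potential
  -- varies.
  have h3 := H.bounds.base.cut_sub_le j m δ ε ω ω (3 * M ^ 2) _
    0 (ε * (M * N)) (fun κ => χ κ ω) (fun κ => χ κ ω) _ _ _ _
    (fun p => if p.lev < j + 1 then W (j + 1 + 1) ω p else 0) (W (j + 1) ω) _ _ hδ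
    hε.1 le_rfl (mul_nonneg hε.1 (by positivity))
    (H.bounds.block.diag (ω, ε) ⟨hω, hε⟩ _ (H.ball hk hω))
    (fun κ hκ => (H.cutSol hg hi (by omega) hω).congr fun p hp => by
      have := mem_shell.1 hp
      exact if_pos (by omega))
    (fun κ hκ => H.cutSol hg' hi' hκ hω)
    (fun κ _ => by rw [sub_self, abs_zero, zero_mul]) hE (fun p hp => if_neg (by omega))
    (fun p hp => H.supp_succ ω p hp) ((H.source_le hk hω).lower hord)
    ((H.source_le hj hω).lower hord) hF
  refine h3.mono ?_
  set e := ε / δ with he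
  have hed : e ≤ δ := H.small.ratio_le
  have e1 : e / δ * (ε * (M * N)) = e * (e * (M * N)) := by
    rw [he]
    field_simp
  rw [mul_zero, zero_mul, zero_add, zero_add, e1]
  have i1 : N ≤ 6 * M ^ 2 * b * (e * g) := hX.trans (le_of_eq (by ring))
  have hM3 : (1 + 1 + M) ≤ 3 * M := by linarith
  have i2 : N * (1 + 1 + M) ≤ 6 * M ^ 2 * b * (e * g) * (3 * M) := by gcongr
  have i3 : e * (M * N) ≤ 1 * (M * (6 * M ^ 2 * b * (e * g))) := by
    have : e ≤ 1 := hed.trans (H.small.δ_le_one hM)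
    gcongr
  have i4 : M * (e * (e * (M * N)) * (3 * M ^ 2) + e * (M * (N * (1 + 1 + M) +
      6 * M ^ 2 * b * e * g + 2 * M * b * e * g))) ≤
      M * (e * (1 * (M * (6 * M ^ 2 * b * (e * g)))) * (3 * M ^ 2) +
        e * (M * (6 * M ^ 2 * b * (e * g) * (3 * M) +
      6 * M ^ 2 * b * e * g + 2 * M * b * e * g))) := by gcongr
  refine i4.trans ?_
  have p1 : M ^ 5 ≤ M ^ 6 := pow_le_pow_right₀ hM (by norm_num)
  have p2 : M ^ 4 ≤ M ^ 6 := pow_le_pow_right₀ hM (by norm_num)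
  have p3 : M ^ 3 ≤ M ^ 6 := pow_le_pow_right₀ hM (by norm_num)
  have i5 : (18 * M ^ 6 + 18 * M ^ 5 + 6 * M ^ 4 + 2 * M ^ 3) * (b * (e * g) * e) ≤
      44 * M ^ 6 * (b * (e * g) * e) :=
    mul_le_mul_of_nonneg_right (by linarith) (by positivity)
  have i6 : 44 * M ^ 6 * (b * (e * g) * e) ≤
      44 * M ^ 6 * (b * (e * (M * (2 : ℝ) ^ (-2 * (j + 1 : ℕ) * ζ))) * δ) := by
    have := H.growth_le j
    gcongr
  have i7 := mul_le_mul_of_nonneg_right (H.small.mul_le_one hM 44 7 (by norm_num) (by norm_num))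
    (by positivity : 0 ≤ e * (2 : ℝ) ^ (-2 * (j + 1 : ℕ) * ζ))
  refine le_trans (le_of_eq ?_) (i5.trans (i6.trans (le_trans (le_of_eq ?_) (i7.trans
    (le_of_eq ?_))))) <;> ring

theorem incW_succ (hg : ∀ j ≤ k, Good ζ s M b δ ε U W j)
    (hi : ∀ j < k, GoodInc ζ σ M b δ ε U W j) (hω : ω ∈ Icc (1 : ℝ) 2) :
    SobBdd σ (fun p => W (k + 1) ω p - W k ω p)
      (2 * M * b * (ε / δ) * (2 : ℝ) ^ (-2 * k * ζ)) := by
  have hM := H.bounds.one_le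
  have hb := H.small.one_le_b hM
  have hr := H.small.ratio_nonneg
  have h1 := H.tail_succ hg hi hω
  cases k with
  | zero =>
    simp only [H.chain.W_zero, sub_zero]
    simp only [Nat.not_lt_zero, if_false] at h1
    refine h1.mono ?_
    have := h1.nonneg
    linarith
  | succ j =>
    have h2 := h1.add (H.low_succ hg hi hω)
    have e : (fun p : ActiveMode P K₀ => (if p.lev < j + 1 then 0 else W (j + 1 + 1) ω p) +
        ((if p.lev < j + 1 then W (j + 1 + 1) ω p else 0) - W (j + 1) ω p)) =
        fun p => W (j + 1 + 1) ω p - W (j + 1) ω p := by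
      funext p
      split_ifs <;> ring
    rw [e] at h2
    refine h2.mono ?_
    have i1 : 1 ≤ M * b := by nlinarith
    have := mul_le_mul_of_nonneg_right i1
      (by positivity : 0 ≤ ε / δ * (2 : ℝ) ^ (-2 * (j + 1 : ℕ) * ζ))
    linarith

/-- Apply `Id + ε Q` to the increment of `w` and add the change of `Q`. The latter carries `ε` and
the previous increment of `u`, so the index shift costs only a factor `M`, absorbed by `δ`. -/
theorem incU_succ (hg : ∀ j ≤ k, Good ζ s M b δ ε U W j)
    (hi : ∀ j < k, GoodInc ζ σ M b δ ε U W j) (hω : ω ∈ Icc (1 : ℝ) 2) :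
    SobBdd σ (fun p => U (k + 1) ω p - U k ω p)
      (6 * M ^ 2 * b * (ε / δ) * (2 : ℝ) ^ (-2 * k * ζ)) := by
  have hM := H.bounds.one_le
  have hb := H.small.one_le_b hM
  have hr := H.small.ratio_nonneg
  have h1 := H.incW_succ hg hi hω
  have hk := hg k le_rfl
  cases k with
  | zero =>
    simp only [H.chain.W_zero, sub_zero] at h1
    simp only [H.chain.U_zero, sub_zero, H.chain.U_succ]
    refine (H.bounds.idAdd_le H.bounds.base H.small.mem hω (H.ball hk hω) h1).mono ?_
    have := mul_le_mul_of_nonneg_right (by linarith : 1 + M ≤ 3 * M) h1.nonneg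
    linarith
  | succ j =>
    have hj := hg j (Nat.le_succ j)
    have hij := hi j (Nat.lt_succ_self j)
    have h2 := H.bounds.idAdd_sub_le H.bounds.base H.small.mem hω hω (H.ball hk hω)
      (H.ball hj hω) h1 ((hk.bddW ω hω).lower H.bounds.base_le_high)
    have e2 : FOp.idAdd ε (A (Hs.ofSeq σ (U (j + 1) ω)) (ω, ε)) (W (j + 1 + 1) ω) =
        U (j + 1 + 1) ω := (H.chain.U_succ (j + 1) ω).symm
    have e1 : FOp.idAdd ε (A (Hs.ofSeq σ (U j ω)) (ω, ε)) (W (j + 1) ω) = U (j + 1) ω :=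
      (H.chain.U_succ j ω).symm
    rw [e1, e2, sub_self, abs_zero, add_zero] at h2
    refine h2.mono ?_
    have hX := H.norm_inc_le hj hk hij hω
    set N := ‖(Hs.ofSeq σ (U (j + 1) ω) - Hs.ofSeq σ (U j ω) : Hs P K₀ σ)‖ with hN
    set e := ε / δ with he
    set g : ℝ := (2 : ℝ) ^ (-2 * (j + 1 : ℕ) * ζ) with hgdef
    have hg0 : 0 < g := by positivity
    have i0 := H.mul_ratio_le_one 1 0 (by norm_num) (by norm_num) (by norm_num)
    rw [pow_zero, one_mul, one_mul] at i0
    have i1 : N ≤ 6 * M ^ 2 * b * e * (M * g) := by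
      refine hX.trans ?_
      have := H.growth_le j
      gcongr
    have i2 : ε * (M * N * (b * e)) ≤ δ * (M * (6 * M ^ 2 * b * e * (M * g)) * 1) := by
      have := H.small.ε_le_δ hM
      have := H.small.δ_pos
      gcongr
    have i3 := mul_le_mul_of_nonneg_right (H.small.mul_le_one hM 6 4 (by norm_num) (by norm_num))
      (by positivity : 0 ≤ e * g)
    have i4 : 1 * (e * g) ≤ M ^ 2 * b * (e * g) := by
      refine mul_le_mul_of_nonneg_right ?_ (by positivity)
      have : 1 ≤ M ^ 2 := one_le_pow₀ hM
      nlinarith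
    have i5 : M * (b * (e * g)) ≤ M ^ 2 * (b * (e * g)) := by
      have : M ≤ M ^ 2 := le_self_pow₀ hM (by norm_num)
      gcongr
    have i6 : 0 ≤ M ^ 2 * (b * (e * g)) := by positivity
    linarith

/-- On the active levels this is uniqueness for the real linear system; on the others both
coefficients vanish. -/
theorem realW_succ (hg : ∀ j ≤ k, Good ζ s M b δ ε U W j)
    (hi : ∀ j < k, GoodInc ζ σ M b δ ε U W j) (hω : ω ∈ Icc (1 : ℝ) 2) :
    IsRealSeq (W (k + 1) ω) := by
  obtain ⟨K₁, -, hA⟩ := H.bounds.decayA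
  obtain ⟨K₂, -, hR⟩ := H.bounds.smooth
  obtain ⟨K₃, -, hR₁⟩ := H.bounds.smooth₁
  have hk := hg k le_rfl
  have hz : (ω, ε) ∈ paramBox γ := ⟨hω, H.small.mem⟩
  have hx := H.ball hk hω
  have hxr := H.isReal hk hω
  intro p
  by_cases hp : p.lev ≤ k
  · refine (H.cutSol hg hi hp hω).real (mul_pos H.small.δ_pos (by positivity))
      (H.bounds.block.diag _ hz _ hx) (H.bounds.block.decay.real _ hz _ hx hxr) ?_
      (mem_shell.2 rfl)
    exact IsRealSeq.rhs (hA.real _ hz _ hx hxr) (hR.real _ hz _ hx hxr) (hR₁.real _ hz _ hx hxr)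
      H.bounds.real (hk.realU ω hω) (hk.realW ω hω)
  · push Not at hp
    rw [H.supp_succ ω p hp, H.supp_succ ω (-p) (by rwa [lev_neg]), map_zero]

theorem realU_succ (hg : ∀ j ≤ k, Good ζ s M b δ ε U W j)
    (hi : ∀ j < k, GoodInc ζ σ M b δ ε U W j) (hω : ω ∈ Icc (1 : ℝ) 2) :
    IsRealSeq (U (k + 1) ω) := by
  obtain ⟨K₁, -, hA⟩ := H.bounds.decayA
  have hk := hg k le_rfl
  rw [H.chain.U_succ]
  exact (H.realW_succ hg hi hω).idAdd (hA.real _ ⟨hω, H.small.mem⟩ _ (H.ball hk hω)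
    (H.isReal hk hω))

/-- The solution is `C¹` only where the lower bound holds, that is within the full width of the
non-resonant set. Away from it the factor `1 - cutoff` vanishes identically, so the product is `C¹`
everywhere. -/
theorem c1W_succ (hg : ∀ j ≤ k, Good ζ s M b δ ε U W j)
    (hi : ∀ j < k, GoodInc ζ σ M b δ ε U W j) (p : ActiveMode P K₀) :
    ContDiffOn ℝ 1 (fun ω => W (k + 1) ω p) (Icc 1 2) := by
  obtain ⟨K₁, -, hA⟩ := H.bounds.decayA
  obtain ⟨K₂, -, hR⟩ := H.bounds.smooth
  obtain ⟨K₃, -, hR₁⟩ := H.bounds.smooth₁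
  have hk := hg k le_rfl
  have hε := H.small.mem
  by_cases hp : p.lev ≤ k
  · have hx := hk.contDiffOn_point (σ := σ)
    have hxB : ∀ ω ∈ Icc (1 : ℝ) 2, Hs.ofSeq σ (U k ω) ∈ Metric.ball (0 : Hs P K₀ σ) q :=
      fun ω hω => H.ball hk hω
    obtain ⟨T, hT⟩ := hk.fin
    have h0 : ∀ p, ContDiffOn ℝ 1 (fun ω => source A R R₁ f ε ω (U k ω) (W k ω) p) (Icc 1 2) :=
      contDiffOn_rhs h hA (hR.mono (le_max_left K₂ K₃))
        (hR₁.mono (le_max_right K₂ K₃)) hε hx hxB hT hk.c1U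
        (fun ω _ p hp => hk.eq_zero_of_notMem_low (h := h) ω p hp) hk.c1W f
    have h1 := contDiffOn_cutoff_mul (O := resSection m ζ δ ε VD p.lev (U p.lev))
      (gap_pos H.small ζ p.lev) (f := fun ω => shellInv h m ω ε (VD.at (U k ω) ω ε)
        (fun p => (ε : ℂ) * source A R R₁ f ε ω (U k ω) (W k ω) p) p) fun ω hω hn => by
      refine contDiffWithinAt_shellInv (c := δ * (2 : ℝ) ^ (-2 * p.lev * ζ))
        (fun p p' => H.bounds.block.decay.c1 ε hε _ hx hxB p p' ω hω)
        (fun p => contDiffWithinAt_const.mul (h0 p ω hω))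
        (H.bounds.block.diag (ω, ε) ⟨hω, hε⟩ _ (hxB ω hω))
        (mul_pos H.small.δ_pos (by positivity)) p (H.lower hg hi hp hω hn)
    refine h1.congr fun ω hω => ?_
    rw [H.chain.W_succ, if_pos hp, H.chain.cut]
  · push Not at hp
    exact contDiffOn_const.congr fun ω _ => H.supp_succ ω p hp

theorem c1U_succ (hg : ∀ j ≤ k, Good ζ s M b δ ε U W j)
    (hi : ∀ j < k, GoodInc ζ σ M b δ ε U W j) (p : ActiveMode P K₀) :
    ContDiffOn ℝ 1 (fun ω => U (k + 1) ω p) (Icc 1 2) := by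
  obtain ⟨K₁, -, hA⟩ := H.bounds.decayA
  have hk := hg k le_rfl
  have hε := H.small.mem
  have hxB : ∀ ω ∈ Icc (1 : ℝ) 2, Hs.ofSeq σ (U k ω) ∈ Metric.ball (0 : Hs P K₀ σ) q :=
    fun ω hω => H.ball hk hω
  simp only [H.chain.U_succ]
  exact contDiffOn_idAdd_of_decay h (fun ω hω => hA.bdd (ω, ε) ⟨hω, hε⟩ _ (hxB ω hω))
    (fun p p' => hA.c1 ε hε _ (hk.contDiffOn_point) hxB p p') (H.c1W_succ hg hi) p

/-- `W (k + 1)` lives on the levels at most `k`, and `Q` enlarges this support to a finite set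
independent of `ω`. -/
theorem fin_succ (hg : ∀ j ≤ k, Good ζ s M b δ ε U W j) :
    ∃ T : Finset (ActiveMode P K₀), ∀ ω ∈ Icc (1 : ℝ) 2, ∀ p ∉ T, U (k + 1) ω p = 0 := by
  classical
  obtain ⟨K₁, -, hA⟩ := H.bounds.decayA
  obtain ⟨T, hT⟩ := exists_act_support (K₀ := K₀) h (low h P k)
  refine ⟨low h P k ∪ T, fun ω hω p hp => ?_⟩
  rw [Finset.mem_union, not_or] at hp
  have h1 : ∀ p ∉ low h P k, W (k + 1) ω p = 0 := fun p hp =>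
    H.supp_succ ω p (by simpa using hp)
  have h2 : (A.at (U k ω) ω ε).act (W (k + 1) ω) p = 0 :=
    hT K₁ _ (hA.bdd (ω, ε) ⟨hω, H.small.mem⟩ _ (H.ball (hg k le_rfl) hω)) _ h1 p hp.2
  rw [H.chain.U_succ, FOp.idAdd, h1 p hp.1, h2, mul_zero, add_zero]

theorem good_zero : Good ζ s M b δ ε U W 0 := by
  have hM := H.bounds.one_le
  have hb := H.small.one_le_b hM
  have hr := H.small.ratio_nonneg
  have hr' := H.small.ratio_div_nonneg
  have eU : ∀ ω, U 0 ω = 0 := fun ω => funext (H.chain.U_zero ω)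
  have eW : ∀ ω, W 0 ω = 0 := fun ω => funext (H.chain.W_zero ω)
  have z : ∀ τ, SobBdd τ (fun _ : ActiveMode P K₀ => (0 : ℂ)) 0 := fun τ => sobBdd_zero τ
  refine ⟨⟨∅, fun ω _ p _ => H.chain.U_zero ω p⟩, fun ω p _ => H.chain.W_zero ω p,
    fun ω _ p => ?_, fun ω _ p => ?_, fun p => ?_, fun p => ?_, fun ω _ => ?_, fun ω _ => ?_,
    fun ω _ ω' _ => ?_, fun ω _ ω' _ => ?_⟩
  · rw [eU]
    simp
  · rw [eW]
    simp
  · exact contDiffOn_const.congr fun ω _ => H.chain.U_zero ω p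
  · exact contDiffOn_const.congr fun ω _ => H.chain.W_zero ω p
  · rw [eU]
    exact (sobBdd_zero s).mono (by positivity)
  · rw [eW]
    exact (sobBdd_zero s).mono (by positivity)
  · simp only [H.chain.U_zero, sub_zero]
    exact (z _).mono (by positivity)
  · simp only [H.chain.W_zero, sub_zero]
    exact (z _).mono (by positivity)

/-- Bounds and increments are proved together for all earlier indices, because the lower bound on
shell `κ` compares the current function with that of step `κ` through every increment in between. -/
theorem good_and_inc (k : ℕ) :
    (∀ j ≤ k, Good ζ s M b δ ε U W j) ∧ ∀ j < k, GoodInc ζ σ M b δ ε U W j := by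
  induction k with
  | zero =>
    refine ⟨fun j hj => ?_, fun j hj => absurd hj (Nat.not_lt_zero j)⟩
    obtain rfl := Nat.le_zero.1 hj
    exact H.good_zero
  | succ k ih =>
    obtain ⟨hg, hi⟩ := ih
    refine ⟨fun j hj => ?_, fun j hj => ?_⟩
    · rcases Nat.lt_or_ge k j with h1 | h1
      · obtain rfl : j = k + 1 := by omega
        exact ⟨H.fin_succ hg, fun ω p hp => H.supp_succ ω p (by omega),
          fun ω hω => H.realU_succ hg hi hω, fun ω hω => H.realW_succ hg hi hω,
          H.c1U_succ hg hi, H.c1W_succ hg hi, fun ω hω => H.bddU_succ hg hi hω,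
          fun ω hω => H.bddW_succ hg hi hω, fun ω hω ω' hω' => H.lipU_succ hg hi hω hω',
          fun ω hω ω' hω' => H.lipW_succ hg hi hω hω'⟩
      · exact hg j h1
    · rcases Nat.lt_or_ge j k with h1 | h1
      · exact hi j h1
      · obtain rfl : j = k := by omega
        exact ⟨fun ω hω => H.incU_succ hg hi hω, fun ω hω => H.incW_succ hg hi hω⟩

end Scheme

end

/-! Existence of the iteration -/

/-- The state of the iteration: the last functions `u`, `w` and the cut-offs `1 - ψ_κ`. -/
structure Iterate (P : BlockPartition d ι β ρ θ) (K₀ : ℝ) where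
  u : ℝ → ActiveMode P K₀ → ℂ
  w : ℝ → ActiveMode P K₀ → ℂ
  χ : ℕ → ℝ → ℝ

/-- The cut-offs after one more step. -/
def Iterate.nextCut (m δ ε ζ C₀ : ℝ) (VD : Fam P K₀ σ) (k : ℕ) (S : Iterate P K₀) : ℕ → ℝ → ℝ :=
  Function.update S.χ k fun ω => 1 - cutoff (resSection m ζ δ ε VD k S.u) (gap ζ δ C₀ k) ω

/-- The function `w` after one more step. -/
def Iterate.nextW (h : Admissible β θ K₀) (m δ ε ζ C₀ : ℝ) (A VD R R₁ : Fam P K₀ σ)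
    (f : ActiveMode P K₀ → ℂ) (k : ℕ) (S : Iterate P K₀) : ℝ → ActiveMode P K₀ → ℂ :=
  fun ω p => if p.lev ≤ k then
    (S.nextCut m δ ε ζ C₀ VD k p.lev ω : ℂ) * shellInv h m ω ε (VD.at (S.u ω) ω ε)
      (fun p => (ε : ℂ) * source A R R₁ f ε ω (S.u ω) (S.w ω) p) p else 0

/-- The iteration. -/
def iterate (h : Admissible β θ K₀) (m δ ε ζ C₀ : ℝ) (A VD R R₁ : Fam P K₀ σ)
    (f : ActiveMode P K₀ → ℂ) : ℕ → Iterate P K₀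
  | 0 => ⟨fun _ _ => 0, fun _ _ => 0, fun _ _ => 0⟩
  | k + 1 =>
    { u := fun ω => FOp.idAdd ε (A.at ((iterate h m δ ε ζ C₀ A VD R R₁ f k).u ω) ω ε)
        ((iterate h m δ ε ζ C₀ A VD R R₁ f k).nextW h m δ ε ζ C₀ A VD R R₁ f k ω)
      w := (iterate h m δ ε ζ C₀ A VD R R₁ f k).nextW h m δ ε ζ C₀ A VD R R₁ f k
      χ := (iterate h m δ ε ζ C₀ A VD R R₁ f k).nextCut m δ ε ζ C₀ VD k }

/-- Each step needs the cut-offs of all earlier steps, so the recursion carries them in its state.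
Step `k` alters only the entry `k`, and stored cut-offs therefore stay equal to those of their own
step. -/
theorem exists_chain (h : Admissible β θ K₀) (m δ ε ζ C₀ : ℝ) (A VD R R₁ : Fam P K₀ σ)
    (f : ActiveMode P K₀ → ℂ) : ∃ U W χ, Chain h m δ ε ζ C₀ A VD R R₁ f U W χ := by
  set S := iterate h m δ ε ζ C₀ A VD R R₁ f
  have h0 : ∀ k, (S (k + 1)).χ = (S k).nextCut m δ ε ζ C₀ VD k := fun k => rfl
  have h1 : ∀ k κ, κ < k → (S k).χ κ = (S (κ + 1)).χ κ := by
    intro k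
    induction k with
    | zero => exact fun κ hκ => absurd hκ (Nat.not_lt_zero κ)
    | succ k ih =>
      intro κ hκ
      rcases Nat.lt_succ_iff_lt_or_eq.1 hκ with h2 | rfl
      · rw [h0, Iterate.nextCut, Function.update_of_ne h2.ne, ih κ h2]
      · rfl
  refine ⟨fun k => (S k).u, fun k => (S k).w, fun k => (S (k + 1)).χ k, fun ω p => rfl,
    fun ω p => rfl, fun k ω => ?_, fun k ω p => ?_, fun k ω => rfl⟩
  · rw [h0, Iterate.nextCut, Function.update_self]
  · have h2 : (S (k + 1)).w ω p = (S k).nextW h m δ ε ζ C₀ A VD R R₁ f k ω p := rfl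
    rw [h2, Iterate.nextW]
    split_ifs with hp
    · rw [← h0, h1 (k + 1) p.lev (by omega)]
    · rfl

/-! Sums of families -/

/-- The weak norms of the separate families have orders increasing with `j`; all are replaced by
that of index `N`. -/
theorem exists_decayFam_total {σ₀ q γ : ℝ} {N : ℕ} {A : ℕ → Fam P K₀ σ}
    (hA : ∀ j ≤ N, ∃ χ ≤ 0, MemSigma σ₀ χ j q γ (A j))
    (hσ : σ₀ + 2 * N + ((d : ℝ) + 1) / 2 ≤ σ) :
    ∃ K > 0, DecayFam q γ K (σ₀ + 2 * N + ((d : ℝ) + 1) / 2) (Fam.total N A) := by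
  have h1 : ∀ j, ∃ K > 0, j ≤ N → DecayFam q γ K (σ₀ + 2 * N + ((d : ℝ) + 1) / 2) (A j) := by
    intro j
    by_cases hj : j ≤ N
    · obtain ⟨χ, hχ, hmem⟩ := hA j hj
      have hjN : (j : ℝ) ≤ N := by exact_mod_cast hj
      obtain ⟨K, hK, hd⟩ := hmem.exists_decayFam hχ (by linarith)
      exact ⟨K, hK, fun _ => hd.mono le_rfl hK.le (by linarith) hσ⟩
    · exact ⟨1, one_pos, fun h => absurd h hj⟩
  choose K hK hd using h1
  exact ⟨∑ j ∈ Finset.range (N + 1), K j, Finset.sum_pos (fun j _ => hK j) (by simp),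
    DecayFam.total fun j hj => hd j hj⟩

theorem blockFam_total {q γ K τ₀ : ℝ} {N : ℕ} {A : ℕ → Fam P K₀ σ}
    (hA : DecayFam q γ K τ₀ (Fam.total N A)) (hsa : ∀ j ≤ N, (A j).SelfAdj q γ)
    (hd : ∀ j ≤ N, ∀ z ∈ paramBox γ, ∀ u ∈ Metric.ball (0 : Hs P K₀ σ) q, ∀ p p',
      p.block ≠ p'.block → A j u z p p' = 0) : BlockFam q γ K τ₀ (Fam.total N A) := by
  have he : ∀ u z p p', Fam.total N A u z p p' =
      ∑ j ∈ Finset.range (N + 1), A j u z p p' := by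
    intro u z p p'
    rw [Fam.total, Finset.sum_apply, Finset.sum_apply]
  refine ⟨hA, fun z hz u hu hur => ?_, fun z hz u hu p p' hp => ?_⟩
  · funext p p'
    rw [FOp.adj, he, he, map_sum]
    refine Finset.sum_congr rfl fun j hj => ?_
    exact congrFun (congrFun (hsa j (Finset.mem_range_succ_iff.1 hj) z hz u hu hur) p) p'
  · rw [he]
    exact Finset.sum_eq_zero fun j hj => hd j (Finset.mem_range_succ_iff.1 hj) z hz u hu p p' hp

/-! Properties of the iterates -/

theorem CutSol.waveAct_eq {h : Admissible β θ K₀} {m ω ε c : ℝ} {κ : ℕ} {a : FOp P K₀}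
    {F w x : ActiveMode P K₀ → ℂ} (H : CutSol h m ω ε c 1 κ a F w x) (had : BlockDiag a)
    {p : ActiveMode P K₀} (hp : p ∈ shell h P κ) : waveAct m ω ε a w p = (ε : ℂ) * F p := by
  have h1 : ∀ p' ∉ shell h P κ, a p p' = 0 := fun p' hp' =>
    had.entry_eq_zero (blockClosed_shell h κ) hp hp'
  rw [← H.solves one_ne_zero p hp, waveAct_eq_sum h1, waveAct_eq_sum h1, H.eq p hp]
  have h2 : ∀ p' ∈ shell h P κ, a p p' * w p' = a p p' * x p' := fun p' hp' => by
    rw [H.eq p' hp', Complex.ofReal_one, one_mul]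
  rw [Finset.sum_congr rfl h2, Complex.ofReal_one, one_mul]

theorem abs_derivWithin_cutoff_le (O : Set ℝ) {D : ℝ} (hD : 0 < D) {ω : ℝ}
    (hω : ω ∈ Icc (1 : ℝ) 2) : |derivWithin (cutoff O D) (Icc 1 2) ω| ≤ 8 / D := by
  rw [(hasDerivAt_cutoff O D ω).hasDerivWithinAt.derivWithin (uniqueDiffOn_interval ω hω)]
  exact abs_deriv_cutoff_le O hD ω

/-- The distance is to the complement in the whole line, which contains the part of `[1, 2]` outside
`O` that the cut-off looks at. -/
theorem cutoff_eq_one_of_infDist {O : Set ℝ} {D x : ℝ} (hD : 0 < D)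
    (h : D ≤ Metric.infDist x Oᶜ) : cutoff O D x = 1 := by
  refine cutoff_eq_one hD ?_
  rintro ⟨y, -, hyO, hlt⟩
  have h1 := Metric.infDist_le_dist_of_mem (x := x) (show y ∈ Oᶜ from hyO)
  rw [Real.dist_eq] at h1
  linarith

namespace Scheme

variable {h : Admissible β θ K₀} {q γ ζ K τ₀ M b C₀ m δ ε : ℝ} {A VD R R₁ : Fam P K₀ σ}
  {f : ActiveMode P K₀ → ℂ} {U W : ℕ → ℝ → ActiveMode P K₀ → ℂ} {χ : ℕ → ℝ → ℝ} {ω : ℝ}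

theorem good (H : Scheme h q γ ζ s K τ₀ M b C₀ m δ ε A VD R R₁ f U W χ) (k : ℕ) :
    Good ζ s M b δ ε U W k := (H.good_and_inc k).1 k le_rfl

theorem goodInc (H : Scheme h q γ ζ s K τ₀ M b C₀ m δ ε A VD R R₁ f U W χ) (k : ℕ) :
    GoodInc ζ σ M b δ ε U W k := (H.good_and_inc (k + 1)).2 k (Nat.lt_succ_self k)

/-- The truncated equation outside the resonant sets. -/
theorem waveAct_eq (H : Scheme h q γ ζ s K τ₀ M b C₀ m δ ε A VD R R₁ f U W χ) {k : ℕ}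
    (hω : ω ∈ Icc (1 : ℝ) 2) (hO : ∀ κ ≤ k, ω ∉ resSection m ζ δ ε VD κ (U κ)) :
    waveAct m ω ε (VD.at (U k ω) ω ε) (W (k + 1) ω) =
      fun p => (ε : ℂ) * lowBlocks k (source A R R₁ f ε ω (U k ω) (W k ω)) p := by
  obtain ⟨hg, hi⟩ := H.good_and_inc k
  have had : BlockDiag (VD.at (U k ω) ω ε) :=
    H.bounds.block.diag (ω, ε) ⟨hω, H.small.mem⟩ _ (H.ball (H.good k) hω)
  funext p
  by_cases hp : p.lev ≤ k
  · have h1 := H.cutSol hg hi hp hω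
    have hgap := gap_pos H.small ζ p.lev
    have h2 : χ p.lev ω = 1 := by
      rw [H.chain.cut, cutoff_eq_zero hgap, sub_zero]
      refine ⟨ω, hω, hO p.lev hp, ?_⟩
      rw [sub_self, abs_zero]
      positivity
    rw [h2] at h1
    rw [h1.waveAct_eq had (mem_shell.2 rfl), lowBlocks, if_pos ((lev_le_iff p k).1 hp)]
  · have h1 : ∀ p' ∉ shell h P p.lev, VD.at (U k ω) ω ε p p' = 0 := fun p' hp' =>
      had.entry_eq_zero (blockClosed_shell h p.lev) (mem_shell.2 rfl) hp'
    rw [waveAct_eq_sum h1, lowBlocks, if_neg fun e => hp ((lev_le_iff p k).2 e),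
      H.supp_succ ω p (by omega), Finset.sum_eq_zero]
    · simp
    · intro p' hp'
      have := mem_shell.1 hp'
      rw [H.supp_succ ω p' (by omega), mul_zero]

end Scheme


end Beam

end

/-! ### Choice of the constants and proof of the proposition -/

open Beam

theorem proposition5p2p1
    {d : ℕ} (hd : 0 < d) {ι : Type*} {β ρ θ : ℝ} (hβ : 0 < β) (hβ' : β < 1 / 10)
    (hρ : 0 < ρ) (hρβ : ρ < β) (hθ : 0 < θ) (P : BlockPartition d ι β ρ θ)
    {K₀ m : ℝ} (hK₀ : 0 < K₀) (hm : 0 < m)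
    {σ₀ σ s ζ q γ : ℝ} {N : ℕ} (hσ₀ : (d : ℝ) / 2 + 1 < σ₀) (hζ : 0 < ζ) (hq : 0 < q)
    (hγ : 0 < γ) (hγ' : γ ≤ 1)
    (hσ : σ₀ + 2 * (N + 1) + ((d : ℝ) + 1) / 2 + ζ ≤ σ)
    (hN : ζ + 2 ≤ (N + 1) * (1 + ρ / 2)) (hs : σ + ζ + 2 ≤ s)
    (V Rt : Fam P K₀ σ) (hV : MemSigma σ₀ 0 0 q γ V) (hVsa : V.SelfAdj q γ)
    (hRt : MemR σ₀ ζ 0 0 q γ Rt)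
    (Qj VDj : ℕ → Fam P K₀ σ) (R₁ : Fam P K₀ σ)
    (hdiag : IsDiagonalization m σ₀ ζ N q γ V Qj VDj R₁)
    (f : Hs P K₀ (s + ζ)) (hf : f.IsReal) :
    ∃ γ₀ ∈ Ioc 0 γ, ∃ C₀ > 0, EigenvalueConstant m q γ₀ C₀ hζ (Fam.total N VDj) ∧
    ∃ δ₀ ∈ Ioc 0 (Real.sqrt γ₀), ∃ C₁ > 0, ∃ B₁ > 0, ∃ B₂ > 0, ∀ δ ∈ Ioc 0 δ₀,
    ∃ (G O : ℕ → Set (ℝ × ℝ)) (ψ : ℕ → ℝ → ℝ → ℝ) (u w : ℕ → ℝ → ℝ → Hs P K₀ s), ∀ k : ℕ,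
      -- the sets `O_k` and `G_k`
      O k = resonantSet m ζ δ (Fam.total N VDj) k
        (fun ω ε => Hs.incl (index_base hζ hs) (prev u k ω ε)) ∧
      G k = innerSet ζ δ C₀ k (O k) ∧
      -- the cut-offs
      (∀ ε ∈ Icc 0 (δ ^ 2),
        (∀ ω ∈ Icc (1 : ℝ) 2, ψ k ω ε ∈ Icc (0 : ℝ) 1) ∧
        closure {ω | ω ∈ Icc (1 : ℝ) 2 ∧ ψ k ω ε ≠ 0} ⊆ {ω | (ω, ε) ∈ O k} ∧
        (∀ ω, (ω, ε) ∈ G k → ψ k ω ε = 1) ∧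
        ContDiffOn ℝ 1 (fun ω => ψ k ω ε) (Icc 1 2) ∧
        ∀ ω ∈ Icc (1 : ℝ) 2, |derivWithin (fun x => ψ k x ε) (Icc 1 2) ω| ≤
          C₁ / δ * (2 : ℝ) ^ (2 * k * (ζ + 2))) ∧
      -- regularity and bounds of `w_k` and of `u_k`
      (∀ ε ∈ Icc 0 (δ ^ 2),
        (∃ w' : ℝ → Hs P K₀ (s - ζ - 2),
          HasC1Deriv (index_drop hζ) (fun ω => w k ω ε) w' ∧
          ∀ ω ∈ Icc (1 : ℝ) 2, ‖w k ω ε‖ + δ * ‖w' ω‖ ≤ B₁ * (ε / δ)) ∧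
        (∃ u' : ℝ → Hs P K₀ (s - ζ - 2),
          HasC1Deriv (index_drop hζ) (fun ω => u k ω ε) u' ∧
          ∀ ω ∈ Icc (1 : ℝ) 2, ‖u k ω ε‖ + δ * ‖u' ω‖ ≤ B₂ * (ε / δ))) ∧
      (∀ ω ∈ Icc (1 : ℝ) 2, ∀ ε ∈ Icc 0 (δ ^ 2),
        (w k ω ε).IsReal ∧ (u k ω ε).IsReal ∧
        ‖Hs.incl (index_base hζ hs) (u k ω ε)‖ < q ∧
        -- decay of the increments
        ‖Hs.incl (index_base hζ hs) (w k ω ε - prev w k ω ε)‖ ≤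
          B₂ * (ε / δ) * (2 : ℝ) ^ (-2 * k * ζ) ∧
        ‖Hs.incl (index_base hζ hs) (u k ω ε - prev u k ω ε)‖ ≤
          2 * B₂ * (ε / δ) * (2 : ℝ) ^ (-2 * k * ζ) ∧
        -- `u_k` in terms of `w_k`
        (u k ω ε).coeff = FOp.idAdd ε
          (Fam.total N Qj (Hs.incl (index_base hζ hs) (prev u k ω ε)) (ω, ε)) (w k ω ε).coeff ∧
        -- the truncated equation outside the resonant sets
        ((∀ k' ≤ k, (ω, ε) ∉ O k') →
          waveAct m ω ε (Fam.total N VDj (Hs.incl (index_base hζ hs) (prev u k ω ε)) (ω, ε))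
              (w k ω ε).coeff =
            fun p =>
              (ε : ℂ) * lowBlocks k (FOp.idAdd ε
                (Fam.total N Qj (Hs.incl (index_base hζ hs) (prev u k ω ε)) (ω, ε)).adj
                ((Rt (Hs.incl (index_base hζ hs) (prev u k ω ε)) (ω, ε)).act
                  (prev u k ω ε).coeff)) p +
              (ε : ℂ) * lowBlocks k
                ((R₁ (Hs.incl (index_base hζ hs) (prev u k ω ε)) (ω, ε)).act
                  (prev w k ω ε).coeff) p +
              (ε : ℂ) * lowBlocks k (FOp.idAdd ε
                (Fam.total N Qj (Hs.incl (index_base hζ hs) (prev u k ω ε)) (ω, ε)).adj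
                f.coeff) p)) := by
  have hAd : Admissible β θ K₀ := ⟨hβ.le, by linarith, hθ.le, hK₀⟩
  have hd0 : (0 : ℝ) ≤ d := Nat.cast_nonneg d
  have hN0 : (0 : ℝ) ≤ N := Nat.cast_nonneg N
  have hχ : ∀ j : ℕ, -(j : ℝ) * (1 + ρ / 2) ≤ 0 := fun j => by
    have : 0 ≤ (j : ℝ) * (1 + ρ / 2) := by positivity
    linarith
  have hσN : σ₀ + 2 * N + ((d : ℝ) + 1) / 2 ≤ σ := by linarith
  obtain ⟨K, hK, hVDd⟩ := exists_decayFam_total (A := VDj)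
    (fun j hj => ⟨_, hχ j, (hdiag.memVD j hj).mem⟩) hσN
  have hQd := exists_decayFam_total (A := Qj) (fun j hj => ⟨_, hχ j, (hdiag.memQ j hj).1⟩) hσN
  have hblock := blockFam_total hVDd hdiag.selfAdjVD fun j hj => (hdiag.memVD j hj).diag
  set Q := Fam.total N Qj
  set VD := Fam.total N VDj
  obtain ⟨M, hM⟩ := exists_schemeBounds hAd f hf hγ' hζ hs hQd hblock hK.le hσN
    (fun τ hτ => hRt.exists_smoothFam (by push_cast; linarith))
    (fun τ hτ => hdiag.memR.exists_smoothFam (by push_cast; linarith))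
  have hM1 := hM.one_le
  set κ₀ := schurConst hAd P * (K * (q + 1))
  have hκ₀ : 0 < κ₀ := mul_pos (schurConst_pos hAd P) (by positivity)
  -- The summands serve for `C₀ ≥ 1`, for the variation of the symbol, and for that of the
  -- potential.
  set C₀ := 1 + 2 * K₀ ^ 2 + κ₀ with hC₀
  have hC₀1 : 1 ≤ C₀ := by
    have : 0 ≤ 2 * K₀ ^ 2 := by positivity
    linarith
  set b := 7000 * (C₀ + 1) * M ^ 4 with hb
  have hb0 : 0 < b := by positivity
  -- The second bound keeps the contribution of the potential to the slope of the eigenvalues below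
  -- `(K₀²)⁻¹`, half of the least main term.
  set γ₀ := min γ ((K₀ ^ 2)⁻¹ / κ₀)
  have hγ₀ : 0 < γ₀ := lt_min hγ (by positivity)
  have hγ₀γ : γ₀ ≤ γ := min_le_left _ _
  refine ⟨γ₀, ⟨hγ₀, hγ₀γ⟩, C₀, by linarith, hblock.eigenvalueConstant hAd hζ hK.le (by linarith)
    hγ₀γ (hγ₀γ.trans hγ') hq ?_ (by linarith [hC₀]), ?_⟩
  · have : γ₀ ≤ (K₀ ^ 2)⁻¹ / κ₀ := min_le_right _ _
    rwa [le_div_iff₀ hκ₀] at this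
  -- In this order: `δ² ≤ γ₀`, the contraction and all absorptions of constants, and the stay of the
  -- iterates in the ball of radius `q`.
  set δ₀ := min (Real.sqrt γ₀) (min (1 / (1000 * M ^ 10 * b)) (q / (6 * M * b)))
  have hδ₀ : 0 < δ₀ := lt_min (Real.sqrt_pos.2 hγ₀) (lt_min (by positivity) (by positivity))
  -- `1024 C₀ / δ` is `8` over the width of the layer; `2 b` adds the bounds of `w` and of `δ` times
  -- its derivative; `6 M² b` bounds the increments and dominates twice the bound `3 M b` of `u`.
  refine ⟨δ₀, ⟨hδ₀, min_le_left _ _⟩, 1024 * C₀, by positivity, 2 * b, by positivity,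
    6 * M ^ 2 * b, by positivity, fun δ hδ => ?_⟩
  choose U W χ hchain using fun ε => exists_chain hAd m δ ε ζ C₀ Q VD Rt R₁ f.coeff
  have hδγ : δ ^ 2 ≤ γ := by
    have h1 : δ ≤ Real.sqrt γ₀ := hδ.2.trans (min_le_left _ _)
    have h2 := pow_le_pow_left₀ hδ.1.le h1 2
    rw [Real.sq_sqrt hγ₀.le] at h2
    linarith
  have hδ1 : δ * (1000 * M ^ 10 * b) ≤ 1 := by
    have h1 : δ ≤ 1 / (1000 * M ^ 10 * b) :=
      hδ.2.trans ((min_le_right _ _).trans (min_le_left _ _))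
    rwa [le_div_iff₀ (by positivity)] at h1
  have hδq : δ * (3 * M * b) < q := by
    have h1 : δ ≤ q / (6 * M * b) := hδ.2.trans ((min_le_right _ _).trans (min_le_right _ _))
    rw [le_div_iff₀ (by positivity)] at h1
    have : 0 < δ * (3 * M * b) := mul_pos hδ.1 (by positivity)
    linarith
  have hH : ∀ ε ∈ Icc 0 (δ ^ 2), Scheme hAd q γ ζ s K (σ₀ + 2 * N + ((d : ℝ) + 1) / 2) M b C₀ m δ ε
      Q VD Rt R₁ f.coeff (U ε) (W ε) (χ ε) := fun ε hε =>
    ⟨hM, ⟨hδ.1, hε.1, hε.2, hδγ, hb, hδ1, hδq, hC₀1, by linarith [hC₀]⟩, hchain ε⟩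
  -- The chain is indexed with a shift by one: its entry `0` is the zero function of index `-1`, so
  -- `prev u k` is the entry `k`.
  let u : ℕ → ℝ → ℝ → Hs P K₀ s := fun k ω ε => Hs.ofSeq s (U ε (k + 1) ω)
  let w : ℕ → ℝ → ℝ → Hs P K₀ s := fun k ω ε => Hs.ofSeq s (W ε (k + 1) ω)
  have hprev : ∀ k ω ε, prev u k ω ε = Hs.ofSeq s (U ε k ω) := by
    intro k ω ε
    cases k with
    | zero =>
      refine Hs.ext fun p => ?_
      rw [show U ε 0 ω = 0 from funext ((hchain ε).U_zero ω), Hs.coeff_ofSeq (sobBdd_zero s)]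
      exact Hs.coeff_zero p
    | succ k => rfl
  have hprevw : ∀ k ω ε, prev w k ω ε = Hs.ofSeq s (W ε k ω) := by
    intro k ω ε
    cases k with
    | zero =>
      refine Hs.ext fun p => ?_
      rw [show W ε 0 ω = 0 from funext ((hchain ε).W_zero ω), Hs.coeff_ofSeq (sobBdd_zero s)]
      exact Hs.coeff_zero p
    | succ k => rfl
  have hincl : ∀ k, ∀ ε ∈ Icc 0 (δ ^ 2), ∀ ω ∈ Icc (1 : ℝ) 2,
      Hs.incl (index_base hζ hs) (prev u k ω ε) = Hs.ofSeq σ (U ε k ω) := by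
    intro k ε hε ω hω
    rw [hprev, Hs.incl_ofSeq _ (((hH ε hε).good k).bddU ω hω)]
  let O : ℕ → Set (ℝ × ℝ) := fun k => resonantSet m ζ δ VD k
    (fun ω ε => Hs.incl (index_base hζ hs) (prev u k ω ε))
  have hO : ∀ k, ∀ ε ∈ Icc 0 (δ ^ 2),
      {ω | (ω, ε) ∈ O k} = resSection m ζ δ ε VD k (U ε k) := by
    intro k ε hε
    ext ω
    refine and_congr_right fun hω => ?_
    simp only [hincl k ε hε ω hω]
  refine ⟨fun k => innerSet ζ δ C₀ k (O k), O,
    fun k ω ε => cutoff (resSection m ζ δ ε VD k (U ε k)) (gap ζ δ C₀ k) ω, u, w,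
    fun k => ⟨rfl, rfl, fun ε hε => ?_, fun ε hε => ?_, fun ω hω ε hε => ?_⟩⟩
  · have hgap := gap_pos (hH ε hε).small ζ k
    refine ⟨fun ω _ => cutoff_mem _ hgap ω, ?_, fun ω hω => ?_,
      (contDiff_cutoff _ _).contDiffOn, fun ω hω => ?_⟩
    · rw [hO k ε hε]
      exact closure_support_cutoff_subset hgap
    · refine cutoff_eq_one_of_infDist hgap ?_
      rw [← hO k ε hε]
      exact hω.2.2
    · rw [← eight_div_gap hδ.1 (by linarith)]
      exact abs_derivWithin_cutoff_le _ hgap hω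
  · have H := hH ε hε
    have hg := H.good (k + 1)
    obtain ⟨T, hT⟩ := hg.fin
    have hr : δ * (ε / δ / δ) = ε / δ := mul_div_cancel₀ _ hδ.1.ne'
    obtain ⟨w', hw', hw'b⟩ := exists_hasC1Deriv (index_drop hζ)
      (fun ω _ p hp => hg.eq_zero_of_notMem_low (h := hAd) ω p hp) hg.c1W hg.lipW
    obtain ⟨u', hu', hu'b⟩ := exists_hasC1Deriv (index_drop hζ) hT hg.c1U hg.lipU
    refine ⟨⟨w', hw', fun ω hω => ?_⟩, ⟨u', hu', fun ω hω => ?_⟩⟩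
    · have h1 := norm_ofSeq_le (hg.bddW ω hω)
      have h2 := mul_le_mul_of_nonneg_left (hw'b ω hω) hδ.1.le
      have h3 : δ * (b * (ε / δ / δ)) = b * (ε / δ) := by rw [mul_left_comm, hr]
      linarith
    · have h1 := norm_ofSeq_le (hg.bddU ω hω)
      have h2 := mul_le_mul_of_nonneg_left (hu'b ω hω) hδ.1.le
      have h3 : δ * (3 * M * b * (ε / δ / δ)) = 3 * M * b * (ε / δ) := by rw [mul_left_comm, hr]
      have h4 : M * (b * (ε / δ)) ≤ M ^ 2 * (b * (ε / δ)) :=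
        mul_le_mul_of_nonneg_right (le_self_pow₀ hM1 (by norm_num))
          (mul_nonneg hb0.le H.small.ratio_nonneg)
      linarith
  · have H := hH ε hε
    have hg := H.good k
    have hg' := H.good (k + 1)
    have hi := H.goodInc k
    have hcU : (u k ω ε).coeff = U ε (k + 1) ω := Hs.coeff_ofSeq (hg'.bddU ω hω)
    have hcW : (w k ω ε).coeff = W ε (k + 1) ω := Hs.coeff_ofSeq (hg'.bddW ω hω)
    have hle := index_base hζ hs
    have hr := H.small.ratio_nonneg
    have hg0 : 0 < (2 : ℝ) ^ (-2 * k * ζ) := by positivity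
    refine ⟨?_, ?_, ?_, ?_, ?_, ?_, fun hres => ?_⟩
    · rw [Hs.IsReal, hcW]
      exact hg'.realW ω hω
    · rw [Hs.IsReal, hcU]
      exact hg'.realU ω hω
    · rw [show u k ω ε = Hs.ofSeq s (U ε (k + 1) ω) from rfl, Hs.incl_ofSeq _ (hg'.bddU ω hω)]
      exact mem_ball_zero_iff.1 (H.ball hg' hω)
    · rw [hprevw, show w k ω ε = Hs.ofSeq s (W ε (k + 1) ω) from rfl, Hs.incl_sub,
        Hs.incl_ofSeq _ (hg'.bddW ω hω), Hs.incl_ofSeq _ (hg.bddW ω hω)]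
      refine (norm_ofSeq_sub_le ((hg'.bddW ω hω).lower hle) ((hg.bddW ω hω).lower hle)
        (hi.incW ω hω)).trans ?_
      have h1 : 2 * M ≤ 6 * M ^ 2 := by nlinarith
      gcongr
    · rw [hprev, show u k ω ε = Hs.ofSeq s (U ε (k + 1) ω) from rfl, Hs.incl_sub,
        Hs.incl_ofSeq _ (hg'.bddU ω hω), Hs.incl_ofSeq _ (hg.bddU ω hω)]
      refine (norm_ofSeq_sub_le ((hg'.bddU ω hω).lower hle) ((hg.bddU ω hω).lower hle)
        (hi.incU ω hω)).trans ?_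
      have h1 : 0 ≤ 6 * M ^ 2 * b * (ε / δ) * (2 : ℝ) ^ (-2 * k * ζ) := by positivity
      linarith
    · rw [hcU, hcW, hincl k ε hε ω hω]
      exact H.chain.U_succ k ω
    · have h1 : ∀ κ ≤ k, ω ∉ resSection m ζ δ ε VD κ (U ε κ) := by
        intro κ hκ
        rw [← hO κ ε hε]
        exact hres κ hκ
      have h2 := H.waveAct_eq hω h1
      have hcu : (prev u k ω ε).coeff = U ε k ω := by
        rw [hprev, Hs.coeff_ofSeq (hg.bddU ω hω)]
      have hcw : (prev w k ω ε).coeff = W ε k ω := by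
        rw [hprevw, Hs.coeff_ofSeq (hg.bddW ω hω)]
      rw [hincl k ε hε ω hω, hcW, hcu, hcw]
      refine h2.trans (funext fun p => ?_)
      simp only [lowBlocks, source, rhs, Fam.at]
      split_ifs
      · ring
      · simp
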